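/- **Setting.** Let $\mathcal H$ be a complex Hilbert space, $X$ a standard Borel space with a $\sigma$-finite measure $dx$ and a measurable map $t:X\to\mathbb R_+$ such that the image of $dx$ under $t$ is absolutely continuous with respect to Lebesgue measure, and let $\{\mathcal E(x)\}_{x\in X}$ be a measurable field of separable Hilbert spaces. Let $\mathcal X$ be the space of finite chains $\varkappa=\{x_1,\dots,x_n\}\subset X$, $t(x_1)<\dots<t(x_n)$, with $d\varkappa=\prod_{x\in\varkappa}dx$; put $\mathcal E^\otimes(\varkappa)=\bigotimes_{x\in\varkappa}\mathcal E(x)$, $X^t=\{x:t(x)<t\}$, $\mathcal X^t=\{\varkappa\in\mathcal X:\varkappa\subset X^t\}$, $\varkappa^t=\varkappa\cap X^t$. For $\xi>0$ let $\mathcal G(\xi)$ be the Hilbert space of measurable $a$ with $a(\varkappa)\in\mathcal H\otimes\mathcal E^\otimes(\varkappa)$ and $\|a\|^2(\xi)=\int\xi^{|\varkappa|}\|a(\varkappa)\|^2d\varkappa<\infty$; $\mathcal G=\mathcal G(1)$. An operator is *$\zeta$-bounded* if it is continuous $\mathcal G(\xi^+)\to\mathcal G(\xi_-)$ for all $\xi_->0$,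 $\xi^+\ge\zeta^2\xi_-$. A table is $\boldsymbol\varkappa=\begin{pmatrix}\varkappa_0^-&\varkappa_+^-\\ \varkappa_0^0&\varkappa_+^0\end{pmatrix}$ with entries in $\mathcal X$; $\boldsymbol\varkappa^*$ is obtained by exchanging $\varkappa_0^-$ and $\varkappa_+^0$. Unions, differences, inclusions of tables and $\boldsymbol\varkappa^t$ are entrywise. For a table $\boldsymbol\vartheta$ put $\vartheta_{\rm in}=\vartheta_0^-\sqcup\vartheta_0^0$ and $\vartheta_{\rm out}=\vartheta_0^0\sqcup\vartheta_+^0$. Consider measurable operator-valued functions $$T(\boldsymbol\varkappa):\mathcal H\otimes\mathcal E^\otimes(\varkappa_0^-)\otimes\mathcal E^\otimes(\varkappa_0^0)\to\mathcal H\otimes\mathcal E^\otimes(\varkappa_0^0)\otimes\mathcal E^\otimes(\varkappa_+^0),$$ identified if equal for almost all $\boldsymbol\varkappa$, with $T^*(\boldsymbol\varkappa)=T(\boldsymbol\varkappa^*)^*$ and $$[\epsilon(T)a](\varkappa)=\sum_{\varkappa_0^0\sqcup\varkappa_+^0=\varkappa}\iint T(\boldsymbol\varkappa)\,a(\varkappa_0^0\sqcup\varkappa_0^-)\,d\varkappa_0^-\,d\varkappa_+^-.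 \tag{2.1}$$ A weight is a triangular matrix function $\zeta(x)=\begin{bmatrix}1&\zeta_0^-&\zeta_+^-\\0&\zeta_0^0&\zeta_+^0\\0&0&1\end{bmatrix}(x)$ with nonnegative entries; it is integrable if $\zeta_+^-\in L^1$, $\zeta_0^-,\zeta_+^0\in L^2$, $\zeta_0^0\in L^\infty$. Put $\zeta_\nu^\mu(\varkappa)=\prod_{x\in\varkappa}\zeta^\mu_\nu(x)$, $\zeta(\boldsymbol\varkappa)=\prod_{\mu\in\{-,0\},\,\nu\in\{0,+\}}\zeta^\mu_\nu(\varkappa^\mu_\nu)$, $\zeta^*=\mathbf g\,\zeta^{\mathrm T}\mathbf g$ with $\mathbf g=\begin{bmatrix}0&0&1\\0&1&0\\1&0&0\end{bmatrix}$, and $$\|T\|(\zeta)=\operatorname{ess\,sup}_{\boldsymbol\varkappa}\ \|T(\boldsymbol\varkappa)\|/\zeta(\boldsymbol\varkappa).\tag{2.3}$$ $T$ is relatively bounded if $\|T\|(\zeta)<\infty$ for some integrable weight $\zeta$; $\mathcal U$ is the space of relatively bounded functions. **Theorem 2.** (1) If $\zeta$ is an integrable weight and $\|T\|(\zeta)<\infty$,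 then for every number $r>\operatorname{ess\,sup}_x\zeta_0^0(x)$ the operators $U=\epsilon(T)$ and $U^*=\epsilon(T^*)$ are defined by absolutely convergent integrals on every $\mathcal G(\xi)$, $\xi>0$, are $r$-bounded and formally conjugated in $\mathcal G$ ($\langle c|Ua\rangle=\langle U^*c|a\rangle$ for $a\in\mathcal G(\xi^+)$, $c\in\mathcal G(1/\xi_-)$, $\xi_->0$, $\xi^+\ge r^2\xi_-$), and $U^*U=\epsilon(T^*\cdot T)$ is $r^2$-bounded, where $$(S\cdot T)(\boldsymbol\varkappa)=\sum_{\vartheta_0^-\subseteq\varkappa_0^-,\ \vartheta_+^0\subseteq\varkappa_+^0}\ \sum_{\substack{\sigma\cup\rho=\varkappa_+^-\\ \sigma\cap\rho=\vartheta_+^-}}S\begin{pmatrix}\vartheta_0^-\sqcup\vartheta_+^-&\varkappa_+^-\setminus\sigma\\ \varkappa_0^0\sqcup\vartheta_+^0&\varkappa_+^0\setminus\vartheta_+^0\end{pmatrix}T\begin{pmatrix}\varkappa_0^-\setminus\vartheta_0^-&\varkappa_+^-\setminus\rho\\ \varkappa_0^0\sqcup\vartheta_0^-&\vartheta_+^-\sqcup\vartheta_+^0\end{pmatrix}.\tag{2.5}$$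 (2) With the product (2.5), the involution $T\mapsto T^*$ and the unit $I(\boldsymbol\varkappa)$ (the identity if $\varkappa_0^-=\varkappa_+^-=\varkappa_+^0=\emptyset$, zero otherwise), $\mathcal U$ is a unital $*$-algebra. It is the directed union, over the integrable weights $\zeta$, of the spaces $\{\|T\|(\zeta)<\infty\}$ normed by $\|\cdot\|(\zeta)$, with $\|T^*\|(\zeta)=\|T\|(\zeta^*)$ and $\|T^*\cdot T\|(\xi)\le[\|T\|(\zeta)]^2$ if $\xi^\mu_\nu\ge(\zeta^*\zeta)^\mu_\nu$ almost everywhere; and $\epsilon$ is a unital $*$-representation of $\mathcal U$: it is linear, $\epsilon(S\cdot T)=\epsilon(S)\epsilon(T)$, $\epsilon(T^*)=\epsilon(T)^*$, $\epsilon(I)=\hat I$, on every $\mathcal G(\xi)$, $\xi>0$. (3) Let $B(\boldsymbol\vartheta)=\epsilon(L(\boldsymbol\vartheta))$, an operator from $\mathcal G\otimes\mathcal E^\otimes(\vartheta_{\rm in})$ to $\mathcal G\otimes\mathcal E^\otimes(\vartheta_{\rm out})$ (in the Fock scale), with a jointly measurable $L(\boldsymbol\vartheta,\boldsymbol\varkappa)$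 such that $\|L(\boldsymbol\vartheta,\boldsymbol\varkappa)\|\le c\,\lambda(\boldsymbol\vartheta)\,\xi(\boldsymbol\varkappa)$ for almost all $(\boldsymbol\vartheta,\boldsymbol\varkappa)$, where $c\ge0$, $\xi$ is an integrable weight and $\lambda$ is a weight integrable on every $X^t$. For such operator-valued functions $B$ of tables put $$[\Lambda_{[0,t)}(B)a](\varkappa)=\sum_{\vartheta_0^0\sqcup\vartheta_+^0\subseteq\varkappa^t}\int_{\mathcal X^t}\!\int_{\mathcal X^t}[B(\boldsymbol\vartheta)\,\dot a(\vartheta_0^-\sqcup\vartheta_0^0)](\varkappa\setminus\vartheta_0^0\setminus\vartheta_+^0)\,d\vartheta_0^-\,d\vartheta_+^-,\qquad[\dot a(\vartheta)](\varkappa)=a(\vartheta\sqcup\varkappa).$$ Then the integrals converge absolutely and $\Lambda_{[0,t)}(B)=\epsilon(T^t)=:U^t$ on every $\mathcal G(\xi')$, $\xi'>0$, where $$T^t(\boldsymbol\varkappa)=N_{[0,t)}(L)(\boldsymbol\varkappa)=\sum_{\boldsymbol\vartheta\subseteq\boldsymbol\varkappa^t}L(\boldsymbol\vartheta,\boldsymbol\varkappa\setminus\boldsymbol\vartheta)$$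 is relatively bounded and $\|T^t\|(\zeta)\le c$ whenever $\zeta^\mu_\nu(x)\ge\xi^\mu_\nu(x)+\lambda^\mu_\nu(x)$ for almost all $x$ with $t(x)<t$ and $\zeta^\mu_\nu(x)\ge\xi^\mu_\nu(x)$ for almost all $x$ with $t(x)\ge t$. (4) In the situation of (3), let $\mathbf x^\mu_\nu$ ($\mu\in\{-,0\}$, $\nu\in\{0,+\}$) be the table whose only nonempty entry is $\{x\}$ at the place $(\mu,\nu)$, let $T^{s]}(\boldsymbol\varkappa)$ be the sum defining $T^t(\boldsymbol\varkappa)$ with $t(y)\le s$ instead of $t(y)<t$ for the points $y$ of $\boldsymbol\vartheta$ (so $T^{s]}(\boldsymbol\varkappa)=T^t(\boldsymbol\varkappa)$ if $t>s$ and no point of $\boldsymbol\varkappa$ has its time in $(s,t)$), and let $\mathbf U(x)$, $\mathbf G(x)$, $\mathbf D(x)$ be the upper triangular $3\times3$ matrices, with indices in the order $-,0,+$ and with entries acting between $\mathcal G$ and $\mathcal G\otimes\mathcal E(x)$, given by $$U^\mu_\nu(x)=\epsilon\big(\boldsymbol\varkappa\mapsto T^{t(x)}(\boldsymbol\varkappa\sqcup\mathbf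 x^\mu_\nu)\big),\quad G^\mu_\nu(x)=\epsilon\big(\boldsymbol\varkappa\mapsto T^{t(x)]}(\boldsymbol\varkappa\sqcup\mathbf x^\mu_\nu)\big),\quad D^\mu_\nu(x)=\Lambda_{[0,t(x))}\big(\boldsymbol\vartheta\mapsto B(\mathbf x^\mu_\nu\sqcup\boldsymbol\vartheta)\big)$$ for $\mu\in\{-,0\}$, $\nu\in\{0,+\}$, and by $U^-_-=U^+_+=G^-_-=G^+_+=U^{t(x)}$, $D^-_-=D^+_+=0$. For a matrix $\mathbf P$ of operators let $(\mathbf P^\star)^\mu_\nu=(P^{\bar\nu}_{\bar\mu})^*$, where $\bar\mp=\pm$, $\bar0=0$ (i.e. $\mathbf P^\star=\mathbf g\mathbf P^*\mathbf g$), the conjugated operators being given by $\epsilon(T)^*=\epsilon(T^*)$. Then for almost all $x$ the entries of $\mathbf U(x)$ and $\mathbf G(x)$ are bounded in the Fock scale, with formal conjugates given by $\epsilon(T)^*=\epsilon(T^*)$, and $\mathbf D(x)=\mathbf G(x)-\mathbf U(x)$. On every $\mathcal G(\xi')$, $\xi'>0$, for all $t$, with $\mathbf D^\star=\mathbf G^\star-\mathbf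 U^\star$, $$U^t-U^0=\Lambda^t(\mathbf D),\qquad U^{t*}-U^{0*}=\Lambda^t(\mathbf D^\star),$$ $$U^{t*}U^t-U^{0*}U^0=\Lambda^t(\mathbf U^\star\mathbf D+\mathbf D^\star\mathbf U+\mathbf D^\star\mathbf D)=\Lambda^t(\mathbf G^\star\mathbf G-\mathbf U^\star\mathbf U),$$ that is, $d(U^*U)=d\Lambda(\mathbf G^\star\mathbf G-\mathbf U^\star\mathbf U)$, with usual products of triangular matrices, where the integrals converge absolutely and $$[\Lambda^t(\mathbf D)a](\varkappa)=\sum_{x\in\varkappa^t}[D^0_0(x)\dot a(x)+D^0_+(x)a](\varkappa\setminus x)+\int_{X^t}[D^-_0(x)\dot a(x)+D^-_+(x)a](\varkappa)\,dx.$$ -/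

import Mathlib

open MeasureTheory
open scoped ENNReal NNReal

/-! ### The space of chains

A chain is a finite subset of `X` (the points of which have different times).  The sigma-algebra
on finite subsets is the quotient one: a set of finite subsets is measurable iff for every `n` its
preimage under `(x₁, …, xₙ) ↦ {x₁, …, xₙ}` is measurable.  (It takes precedence over the
sigma-algebra of Mathlib on `Finset X`, which does not see the sigma-algebra of `X`.) -/

instance (priority := 2000) chainMeasurableSpace {X : Type*} [MeasurableSpace X] [DecidableEq X] :
    MeasurableSpace (Finset X) :=
  ⨅ n : ℕ, MeasurableSpace.map (fun v : Fin n → X => Finset.univ.image v) inferInstance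

/-- The space of quantum noise: a measure `dx` on `X`, a time `t : X → ℝ₊` with respect to which
`dx` is absolutely continuous, and a measurable field `x ↦ E(x)` of separable Hilbert spaces, given
in coordinates of a measurable orthonormal frame as `E(x) = ℓ²{n | n < dim x}`. -/
structure Noise (X : Type*) [MeasurableSpace X] where
  vol : Measure X
  sigmaFinite : SigmaFinite vol
  time : X → ℝ≥0
  measurable_time : Measurable time
  absCont : vol.map (fun x => (time x : ℝ)) ≪ volume
  dim : X → ℕ∞
  measurable_dim : Measurable dim

/-- A table `ϰ = (ϰ₀⁻, ϰ₊⁻; ϰ₀⁰, ϰ₊⁰)` of four finite subsets: `m0 = ϰ₀⁻`, `mp = ϰ₊⁻`,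
`oo = ϰ₀⁰`, `op = ϰ₊⁰`. -/
@[ext] structure Table (X : Type*) where
  m0 : Finset X
  mp : Finset X
  oo : Finset X
  op : Finset X

namespace Table

variable {X : Type*} [DecidableEq X]

/-- The points on the input side, `ϰ₀⁰ ⊔ ϰ₀⁻`. -/
def dom (ϰ : Table X) : Finset X := ϰ.oo ∪ ϰ.m0

/-- The points on the output side, `ϰ₀⁰ ⊔ ϰ₊⁰`. -/
def cod (ϰ : Table X) : Finset X := ϰ.oo ∪ ϰ.op

/-- The conjugate table `ϰ*`. -/
def conj (ϰ : Table X) : Table X := ⟨ϰ.op, ϰ.mp, ϰ.oo, ϰ.m0⟩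

/-- The union of tables, taken entrywise. -/
def union (θ ϰ : Table X) : Table X :=
  ⟨θ.m0 ∪ ϰ.m0, θ.mp ∪ ϰ.mp, θ.oo ∪ ϰ.oo, θ.op ∪ ϰ.op⟩

/-- The difference of tables, taken entrywise. -/
def diff (ϰ θ : Table X) : Table X :=
  ⟨ϰ.m0 \ θ.m0, ϰ.mp \ θ.mp, ϰ.oo \ θ.oo, ϰ.op \ θ.op⟩

/-- The table of four empty sets. -/
def empty : Table X := ⟨∅, ∅, ∅, ∅⟩

/-- A table, seen as a quadruple. -/
def toProd (ϰ : Table X) : (Finset X × Finset X) × (Finset X × Finset X) :=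
  ((ϰ.m0, ϰ.mp), (ϰ.oo, ϰ.op))

/-- A quadruple, seen as a table. -/
def ofProd (p : (Finset X × Finset X) × (Finset X × Finset X)) : Table X :=
  ⟨p.1.1, p.1.2, p.2.1, p.2.2⟩

instance [MeasurableSpace X] : MeasurableSpace (Table X) :=
  MeasurableSpace.comap toProd inferInstance

end Table

/-- The indices `-`, `0`, `+` of triangular matrices. -/
inductive Ind
  | minus
  | zero
  | plus

/-- The reflection of indices `- ↔ +`. -/
def Ind.refl : Ind → Ind
  | .minus => .plus
  | .zero => .zero
  | .plus => .minus

/-- The points carried by an index at `x`: the component of index `0` is `E(x)`, those of index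
`-` and `+` are one-dimensional. -/
def Ind.pts {X : Type*} (x : X) : Ind → Finset X
  | .zero => {x}
  | .minus => ∅
  | .plus => ∅

/-- The elementary tables at `x`: the entry `(μ, ν)` is `{x}`, where `μ ∈ {-, 0}` is the upper and
`ν ∈ {0, +}` the lower index, and all other entries are empty.  (Empty for other `μ`, `ν`.) -/
def Table.elem {X : Type*} (x : X) : Ind → Ind → Table X
  | .minus, .zero => ⟨{x}, ∅, ∅, ∅⟩
  | .minus, .plus => ⟨∅, {x}, ∅, ∅⟩
  | .zero, .zero => ⟨∅, ∅, {x}, ∅⟩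
  | .zero, .plus => ⟨∅, ∅, ∅, {x}⟩
  | _, _ => ⟨∅, ∅, ∅, ∅⟩

/-! ### Weights: triangular matrix functions `ζ(x)` -/

/-- The four nontrivial entries of a triangular matrix function with
`ζ₋⁻ = 1 = ζ₊⁺`: `m0 = ζ₀⁻`, `mp = ζ₊⁻`, `oo = ζ₀⁰`, `op = ζ₊⁰`. -/
structure Weight (X : Type*) where
  m0 : X → ℝ≥0
  mp : X → ℝ≥0
  oo : X → ℝ≥0
  op : X → ℝ≥0

/-- The matrix `g` of the indefinite metric. -/
def gMatrix : Matrix (Fin 3) (Fin 3) ℝ≥0 := !![0, 0, 1; 0, 1, 0; 1, 0, 0]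

namespace Weight

variable {X : Type*}

/-- The matrix `ζ(x)`, rows and columns in the order `-, 0, +`. -/
def matrix (ζ : Weight X) (x : X) : Matrix (Fin 3) (Fin 3) ℝ≥0 :=
  !![1, ζ.m0 x, ζ.mp x; 0, ζ.oo x, ζ.op x; 0, 0, 1]

/-- The weight `ζ*`. -/
def conj (ζ : Weight X) : Weight X := ⟨ζ.op, ζ.mp, ζ.oo, ζ.m0⟩

theorem matrix_conj (ζ : Weight X) (x : X) :
    ζ.conj.matrix x = gMatrix * (ζ.matrix x).transpose * gMatrix := by
  ext i j
  fin_cases i <;> fin_cases j <;>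
    simp only [Matrix.mul_apply, Fin.sum_univ_three, Matrix.transpose_apply] <;>
    simp [matrix, conj, gMatrix]

/-- The product `∏_{μ ≤ ν} ζ^μ_ν(ϰ^μ_ν)` with `ζ(ϰ) = ∏_{x ∈ ϰ} ζ(x)`. -/
def prod (ζ : Weight X) (ϰ : Table X) : ℝ≥0 :=
  (∏ x ∈ ϰ.m0, ζ.m0 x) * (∏ x ∈ ϰ.mp, ζ.mp x) * (∏ x ∈ ϰ.oo, ζ.oo x) * (∏ x ∈ ϰ.op, ζ.op x)

/-- Integrability: `ζ₊⁻ ∈ L¹`, `ζ₀⁻, ζ₊⁰ ∈ L²`, `ζ₀⁰ ∈ L^∞`. -/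
structure Integrable [MeasurableSpace X] (ζ : Weight X) (μ : Measure X) : Prop where
  m0 : MemLp (fun x => (ζ.m0 x : ℝ)) 2 μ
  mp : MemLp (fun x => (ζ.mp x : ℝ)) 1 μ
  oo : MemLp (fun x => (ζ.oo x : ℝ)) ∞ μ
  op : MemLp (fun x => (ζ.op x : ℝ)) 2 μ

end Weight

noncomputable section

namespace Noise

variable {X : Type*} [MeasurableSpace X] [DecidableEq X] (N : Noise X)

/-! ### Measures on chains and tables -/

/-- The measure `dϰ = ∏ dx` on chains, over `t(x₁) < ⋯ < t(xₙ)`, `n = 0, 1, …`. -/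
def chainMeasure : Measure (Finset X) :=
  Measure.sum fun n : ℕ =>
    Measure.map (fun v : Fin n → X => Finset.univ.image v)
      ((Measure.pi fun _ : Fin n => N.vol).restrict {v | StrictMono fun i => N.time (v i)})

/-- The measure `dϰ₀⁻ dϰ₊⁻ dϰ₀⁰ dϰ₊⁰` on tables. -/
def tableMeasure : Measure (Table X) :=
  Measure.map Table.ofProd
    ((N.chainMeasure.prod N.chainMeasure).prod (N.chainMeasure.prod N.chainMeasure))

/-- The points of `A` with time in `I`; `ϰ^t = ϰ ∩ X^t` is the case `I = [0, t)`. -/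
def cut (I : Set ℝ≥0) (A : Finset X) : Finset X :=
  letI : DecidablePred fun x => N.time x ∈ I := Classical.decPred _
  A.filter fun x => N.time x ∈ I

/-- `X^t`, the points before `t`. -/
def before (t : ℝ≥0) : Set X := {x | N.time x < t}

/-- The chains in `X^t`. -/
def chainsBefore (t : ℝ≥0) : Set (Finset X) := {ϰ | ∀ x ∈ ϰ, N.time x < t}

/-! ### Tensor products `H ⊗ E^⊗(A)` -/

/-- The labels of the product orthonormal basis of `E^⊗(A) = ⊗_{x ∈ A} E(x)`. -/
def Lab (A : Finset X) : Type _ := (x : A) → {n : ℕ // (n : ℕ∞) < N.dim x}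

variable (H : Type*) [NormedAddCommGroup H] [InnerProductSpace ℂ H]

/-- The Hilbert tensor product `H ⊗ E^⊗(A)`, in coordinates of the product basis of `E^⊗(A)`. -/
abbrev Ten (A : Finset X) : Type _ := lp (fun _ : N.Lab A => H) 2

variable {N H}

/-- The identification of `H ⊗ E^⊗(A)` and `H ⊗ E^⊗(B)` for equal sets `A = B` (it is
applied to sets that are equal for almost all chains; the value `0` elsewhere is arbitrary). -/
def tenCast (A B : Finset X) : N.Ten H A →L[ℂ] N.Ten H B :=
  if h : A = B then by subst h; exact ContinuousLinearMap.id ℂ _ else 0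

/-- The operator `T : H ⊗ E^⊗(A) → H ⊗ E^⊗(B)` as an operator
`H ⊗ E^⊗(A') → H ⊗ E^⊗(B')` for `A = A'`, `B = B'`. -/
def opCast {A B : Finset X} (A' B' : Finset X) (T : N.Ten H A →L[ℂ] N.Ten H B) :
    N.Ten H A' →L[ℂ] N.Ten H B' :=
  (tenCast B B').comp (T.comp (tenCast A' A))

/-- The coordinate in `H` of a vector of `H ⊗ E^⊗(A)` at the basis vector `⊗_{x ∈ A} e_{f(x)}`
(zero if `f(x) ≥ dim x` for some `x ∈ A`). -/
def coord (f : X → ℕ) (A : Finset X) (v : N.Ten H A) : H :=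
  letI := Classical.propDecidable (∀ x : A, (f x : ℕ∞) < N.dim x)
  if h : ∀ x : A, (f x : ℕ∞) < N.dim x then v (fun x => ⟨f x, h x⟩) else 0

/-- The vector `h ⊗ ⊗_{x ∈ A} e_{f(x)}` of `H ⊗ E^⊗(A)` (zero if `f(x) ≥ dim x` for some
`x ∈ A`). -/
def basisVec (f : X → ℕ) (A : Finset X) (h : H) : N.Ten H A :=
  letI := Classical.propDecidable (∀ x : A, (f x : ℕ∞) < N.dim x)
  letI := Classical.decEq (N.Lab A)
  if hf : ∀ x : A, (f x : ℕ∞) < N.dim x then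
    lp.single 2 (fun x => ⟨f x, hf x⟩ : N.Lab A) h else 0

/-! ### The Fock scale -/

variable (N H)

/-- Sections `ϰ ↦ a(ϰ) ∈ H ⊗ E^⊗(A ⊔ ϰ)`, representing the elements of the spaces `G(ξ) ⊗ E^⊗(A)`;
for `A = ∅` they represent the elements of `G(ξ) = H ⊗ F(ξ)`. -/
abbrev Vec (A : Finset X) : Type _ := ∀ ϰ : Finset X, N.Ten H (A ∪ ϰ)

variable {N H}
variable {A B C : Finset X}

/-- Equality of sections almost everywhere. -/
def AEq (a b : N.Vec H A) : Prop := ∀ᵐ ϰ ∂N.chainMeasure, a ϰ = b ϰ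

/-- Measurability of a section, by coordinates in the measurable product frames. -/
def MeasVec (a : N.Vec H A) : Prop :=
  ∀ f : X → ℕ, Measurable f →
    AEStronglyMeasurable (fun ϰ => coord f (A ∪ ϰ) (a ϰ)) N.chainMeasure

/-- The squared norm `‖a‖²(ξ) = ∫ ξ^{|ϰ|} ‖a(ϰ)‖² dϰ`. -/
def sqNorm (ξ : ℝ≥0) (a : N.Vec H A) : ℝ≥0∞ :=
  ∫⁻ ϰ, (ξ : ℝ≥0∞) ^ ϰ.card * ‖a ϰ‖ₑ ^ 2 ∂N.chainMeasure

/-- The norm `‖a‖(ξ)`. -/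
def scaleNorm (ξ : ℝ≥0) (a : N.Vec H A) : ℝ≥0∞ := sqNorm ξ a ^ (1 / 2 : ℝ)

/-- `a ∈ G(ξ) ⊗ E^⊗(A)`. -/
def MemG (ξ : ℝ≥0) (a : N.Vec H A) : Prop := MeasVec a ∧ sqNorm ξ a < ∞

/-- The scalar product `⟨c | a⟩ = ∫ ⟨c(ϰ) | a(ϰ)⟩ dϰ`. -/
def pairing (c a : N.Vec H A) : ℂ := ∫ ϰ, inner ℂ (c ϰ) (a ϰ) ∂N.chainMeasure

/-- `U` is a `(ξ⁺, ξ₋)`-continuous (linear) operator `G(ξ⁺) ⊗ E^⊗(A) → G(ξ₋) ⊗ E^⊗(B)`. -/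
structure ScaleContinuous (ξp ξm : ℝ≥0) (U : N.Vec H A → N.Vec H B) : Prop where
  maps : ∀ a, MemG ξp a → MemG ξm (U a)
  map_add : ∀ a b, MemG ξp a → MemG ξp b → AEq (U (a + b)) (U a + U b)
  map_smul : ∀ (z : ℂ) (a), MemG ξp a → AEq (U (z • a)) (z • U a)
  bound : ∃ K : ℝ≥0, ∀ a, MemG ξp a → scaleNorm ξm (U a) ≤ K * scaleNorm ξp a

/-- `U` is `r`-bounded: `(ξ⁺, ξ₋)`-continuous for all `ξ₋ > 0` and `ξ⁺ ≥ r² ξ₋`. -/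
def ScaleBounded (r : ℝ≥0) (U : N.Vec H A → N.Vec H B) : Prop :=
  ∀ ξp ξm : ℝ≥0, 0 < ξm → r ^ 2 * ξm ≤ ξp → ScaleContinuous ξp ξm U

/-- `V` is the formally conjugated operator of the `r`-bounded operator `U`:
`⟨c | U a⟩ = ⟨V c | a⟩` for `a ∈ G(ξ⁺)`, `c ∈ G(1/ξ₋)`, whenever `ξ₋ > 0` and `ξ⁺ ≥ r² ξ₋`. -/
def FormalAdjoint (r : ℝ≥0) (U : N.Vec H A → N.Vec H B) (V : N.Vec H B → N.Vec H A) : Prop :=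
  ∀ ξp ξm : ℝ≥0, 0 < ξm → r ^ 2 * ξm ≤ ξp →
    ∀ a c, MemG ξp a → MemG ξm⁻¹ c → pairing c (U a) = pairing (V c) a

/-! ### Operator-valued functions of tables -/

variable (N H)

/-- Operator-valued functions `T(ϰ)` from `H ⊗ E^⊗(A) ⊗ E^⊗(ϰ₀⁰ ⊔ ϰ₀⁻)` to
`H ⊗ E^⊗(B) ⊗ E^⊗(ϰ₀⁰ ⊔ ϰ₊⁰)`; for `A = B = ∅` those acting from
`H ⊗ E^⊗(ϰ₀⁰ ⊔ ϰ₀⁻)` to `H ⊗ E^⊗(ϰ₀⁰ ⊔ ϰ₊⁰)`. -/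
abbrev OpFn (A B : Finset X) : Type _ :=
  ∀ ϰ : Table X, N.Ten H (A ∪ ϰ.dom) →L[ℂ] N.Ten H (B ∪ ϰ.cod)

/-- Functions `L(θ, ϰ)`, whose values `L(θ)` are operator-valued functions. -/
abbrev OpFamily : Type _ := ∀ θ : Table X, N.OpFn H θ.dom θ.cod

variable {N H}

/-- Equality of operator-valued functions for almost all tables. -/
def OpAEq (S T : N.OpFn H A B) : Prop := ∀ᵐ ϰ ∂N.tableMeasure, S ϰ = T ϰ

/-- The relative norm `‖T‖(ζ) = ess sup ‖T(ϰ)‖ / ∏ ζ^μ_ν(ϰ^μ_ν)` (with `0 / 0 = 0` and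
`c / 0 = ∞` for `c > 0`). -/
def relNorm (ζ : Weight X) (T : N.OpFn H A B) : ℝ≥0∞ :=
  essSup (fun ϰ => ‖T ϰ‖ₑ / (ζ.prod ϰ : ℝ≥0∞)) N.tableMeasure

/-- The conjugate function `T*(ϰ) = T(ϰ*)*`. -/
def star [CompleteSpace H] (T : N.OpFn H A B) : N.OpFn H B A :=
  fun ϰ => ContinuousLinearMap.adjoint (T ϰ.conj)

/-- Strong measurability of the coordinates of `T(ϰ)` and of `T(ϰ)*`. -/
def MeasOp [CompleteSpace H] (T : N.OpFn H A B) : Prop :=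
  ∀ f g : X → ℕ, Measurable f → Measurable g → ∀ h : H,
    StronglyMeasurable (fun ϰ : Table X =>
      coord g (B ∪ ϰ.cod) (T ϰ (basisVec f (A ∪ ϰ.dom) h))) ∧
    StronglyMeasurable (fun ϰ : Table X =>
      coord f (A ∪ ϰ.dom) (ContinuousLinearMap.adjoint (T ϰ) (basisVec g (B ∪ ϰ.cod) h)))

/-- Joint strong measurability of the coordinates of `L(θ, ϰ)` and of `L(θ, ϰ)*`. -/
def MeasFamily [CompleteSpace H] (L : N.OpFamily H) : Prop :=
  ∀ f g : X → ℕ, Measurable f → Measurable g → ∀ h : H,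
    StronglyMeasurable (fun p : Table X × Table X =>
      coord g (p.1.cod ∪ p.2.cod) (L p.1 p.2 (basisVec f (p.1.dom ∪ p.2.dom) h))) ∧
    StronglyMeasurable (fun p : Table X × Table X =>
      coord f (p.1.dom ∪ p.2.dom)
        (ContinuousLinearMap.adjoint (L p.1 p.2) (basisVec g (p.1.cod ∪ p.2.cod) h)))

/-- Relatively bounded operator-valued functions. -/
def RelBounded [CompleteSpace H] (T : N.OpFn H A B) : Prop :=
  MeasOp T ∧ ∃ ζ : Weight X, ζ.Integrable N.vol ∧ relNorm ζ T < ∞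

/-- The unit `I(ϰ) = I ⊗ 1^⊗(ϰ)`: the identity of `H ⊗ E^⊗(A ⊔ ϰ₀⁰)` if
`ϰ₀⁻ = ϰ₊⁻ = ϰ₊⁰ = ∅`, and zero otherwise. -/
def one : N.OpFn H A A := fun ϰ =>
  if ϰ.m0 = ∅ ∧ ϰ.mp = ∅ ∧ ϰ.op = ∅ then tenCast _ _ else 0

/-- The product `S · T`.  The first two sums are over `θ₀⁻ ⊆ ϰ₀⁻` and `θ₊⁰ ⊆ ϰ₊⁰`, the last one is
over the pairs `p = (σ, ρ)` with `σ ∪ ρ = ϰ₊⁻`, where `θ₊⁻ = σ ∩ ρ`. -/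
def mul (S : N.OpFn H B C) (T : N.OpFn H A B) : N.OpFn H A C := fun ϰ =>
  ∑ θm0 ∈ ϰ.m0.powerset, ∑ θop ∈ ϰ.op.powerset,
    ∑ p ∈ (ϰ.mp.powerset ×ˢ ϰ.mp.powerset).filter (fun p => p.1 ∪ p.2 = ϰ.mp),
      (tenCast _ (C ∪ ϰ.cod)).comp
        ((S ⟨θm0 ∪ (p.1 ∩ p.2), ϰ.mp \ p.1, ϰ.oo ∪ θop, ϰ.op \ θop⟩).comp
          (opCast (A ∪ ϰ.dom) _ (T ⟨ϰ.m0 \ θm0, ϰ.mp \ p.2, ϰ.oo ∪ θm0, (p.1 ∩ p.2) ∪ θop⟩)))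

/-- A set of operator-valued functions is a unital `*`-algebra for the unit `one`, the product `mul`
and the involution `star`, functions that agree almost everywhere being identified. -/
structure UnitalStarAlgebra [CompleteSpace H] (𝓤 : Set (N.OpFn H A A)) : Prop where
  one_mem : one ∈ 𝓤
  zero_mem : 0 ∈ 𝓤
  add_mem : ∀ S ∈ 𝓤, ∀ T ∈ 𝓤, S + T ∈ 𝓤
  smul_mem : ∀ (z : ℂ), ∀ T ∈ 𝓤, z • T ∈ 𝓤
  mul_mem : ∀ S ∈ 𝓤, ∀ T ∈ 𝓤, mul S T ∈ 𝓤
  star_mem : ∀ T ∈ 𝓤, star T ∈ 𝓤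
  mul_congr : ∀ S ∈ 𝓤, ∀ S' ∈ 𝓤, ∀ T ∈ 𝓤, ∀ T' ∈ 𝓤,
    OpAEq S S' → OpAEq T T' → OpAEq (mul S T) (mul S' T')
  star_congr : ∀ T ∈ 𝓤, ∀ T' ∈ 𝓤, OpAEq T T' → OpAEq (star T) (star T')
  mul_assoc : ∀ R ∈ 𝓤, ∀ S ∈ 𝓤, ∀ T ∈ 𝓤, OpAEq (mul (mul R S) T) (mul R (mul S T))
  one_mul : ∀ T ∈ 𝓤, OpAEq (mul one T) T
  mul_one : ∀ T ∈ 𝓤, OpAEq (mul T one) T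
  mul_add : ∀ R ∈ 𝓤, ∀ S ∈ 𝓤, ∀ T ∈ 𝓤, OpAEq (mul R (S + T)) (mul R S + mul R T)
  add_mul : ∀ R ∈ 𝓤, ∀ S ∈ 𝓤, ∀ T ∈ 𝓤, OpAEq (mul (R + S) T) (mul R T + mul S T)
  smul_mul : ∀ (z : ℂ), ∀ S ∈ 𝓤, ∀ T ∈ 𝓤, OpAEq (mul (z • S) T) (z • mul S T)
  mul_smul : ∀ (z : ℂ), ∀ S ∈ 𝓤, ∀ T ∈ 𝓤, OpAEq (mul S (z • T)) (z • mul S T)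
  star_star : ∀ T ∈ 𝓤, OpAEq (star (star T)) T
  star_add : ∀ S ∈ 𝓤, ∀ T ∈ 𝓤, OpAEq (star (S + T)) (star S + star T)
  star_smul : ∀ (z : ℂ), ∀ T ∈ 𝓤, OpAEq (star (z • T)) ((starRingEnd ℂ z) • star T)
  star_mul : ∀ S ∈ 𝓤, ∀ T ∈ 𝓤, OpAEq (star (mul S T)) (mul (star T) (star S))

/-! ### The Fock representation -/

/-- The integrand `T(ϰ) a(ϰ₀⁰ ⊔ ϰ₀⁻)` of the Fock representation, for `ϰ = ϰ₀⁰ ⊔ ϰ₊⁰`, as a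
function of `p = (ϰ₀⁻, ϰ₊⁻)`. -/
def fockIntegrand (T : N.OpFn H A B) (a : N.Vec H A) (ϰ ϰoo : Finset X)
    (p : Finset X × Finset X) : N.Ten H (B ∪ ϰ) :=
  tenCast _ _ (T ⟨p.1, p.2, ϰoo, ϰ \ ϰoo⟩ (a (ϰoo ∪ p.1)))

/-- The Fock representation
`[ε(T)a](ϰ) = ∑_{ϰ₀⁰ ⊔ ϰ₊⁰ = ϰ} ∬ T(ϰ) a(ϰ₀⁰ ⊔ ϰ₀⁻) dϰ₀⁻ dϰ₊⁻`. -/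
def fock (T : N.OpFn H A B) (a : N.Vec H A) : N.Vec H B := fun ϰ =>
  ∑ ϰoo ∈ ϰ.powerset, ∫ p, fockIntegrand T a ϰ ϰoo p ∂(N.chainMeasure.prod N.chainMeasure)

/-- Absolute convergence of the integrals in `[ε(T)a](ϰ)` for almost all `ϰ`. -/
def FockConverges (T : N.OpFn H A B) (a : N.Vec H A) : Prop :=
  ∀ᵐ ϰ ∂N.chainMeasure, ∀ ϰoo ∈ ϰ.powerset,
    MeasureTheory.Integrable (fockIntegrand T a ϰ ϰoo) (N.chainMeasure.prod N.chainMeasure)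

/-! ### Quantum stochastic integrals -/

/-- The multiple point derivative `ȧ(θ) ∈ G ⊗ E^⊗(A ⊔ θ)`, `[ȧ(θ)](ϰ) = a(θ ⊔ ϰ)`, as a section
over `D = A ⊔ θ`. -/
def pointDeriv (a : N.Vec H A) (θ D : Finset X) : N.Vec H D := fun ϰ =>
  tenCast _ _ (a (θ ∪ ϰ))

variable (N H)

/-- Functions `B(θ)` with values in operators
`G ⊗ E^⊗(θ₀⁰ ⊔ θ₀⁻) → G ⊗ E^⊗(θ₀⁰ ⊔ θ₊⁰)`. -/
abbrev OpIntegrand : Type _ := ∀ θ : Table X, N.Vec H θ.dom → N.Vec H θ.cod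

variable {N H}

/-- The integrand `[B(σ ⊔ θ) ȧ(θ₀⁻ ⊔ θ₀⁰)](ϰ \ θ₀⁰ \ θ₊⁰)` of a multiple integral as a function of
`p = (θ₀⁻, θ₊⁻)`. -/
def multIntegrand (F : N.OpIntegrand H) (σ : Table X) (a : N.Vec H A) (ϰ θoo θop : Finset X)
    (p : Finset X × Finset X) : N.Ten H (B ∪ ϰ) :=
  tenCast _ _ (F (σ.union ⟨p.1, p.2, θoo, θop⟩)
    (pointDeriv a (θoo ∪ p.1) (σ.union ⟨p.1, p.2, θoo, θop⟩).dom) ((ϰ \ θoo) \ θop))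

/-- The multiple integral `Λ_{[0,t)}(Ḃ(σ))` of `Ḃ(σ, θ) = B(σ ⊔ θ)` for a fixed table `σ`, acting
from `G ⊗ E^⊗(A)` to `G ⊗ E^⊗(B)` with `A = σ₀⁰ ⊔ σ₀⁻`, `B = σ₀⁰ ⊔ σ₊⁰`, as
`[Λ_{[0,t)}(B)a](ϰ) = ∑_{θ₀⁰ ⊔ θ₊⁰ ⊆ ϰ^t} ∬ [B(θ) ȧ(θ₀⁻ ⊔ θ₀⁰)](ϰ \ θ₀⁰ \ θ₊⁰) dθ₀⁻ dθ₊⁻`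
with the integrals over the chains in `X^t`.  For `σ = ∅` it is `Λ_{[0,t)}(B)`. -/
def multInt (t : ℝ≥0) (F : N.OpIntegrand H) (σ : Table X) (a : N.Vec H A) : N.Vec H B := fun ϰ =>
  ∑ θoo ∈ (N.cut (Set.Iio t) ϰ).powerset, ∑ θop ∈ (N.cut (Set.Iio t) ϰ \ θoo).powerset,
    ∫ p in N.chainsBefore t ×ˢ N.chainsBefore t, multIntegrand F σ a ϰ θoo θop p
      ∂(N.chainMeasure.prod N.chainMeasure)

/-- Absolute convergence of the integrals in `[Λ_{[0,t)}(Ḃ(σ))a](ϰ)` for almost all `ϰ`. -/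
def MultConverges (B : Finset X) (t : ℝ≥0) (F : N.OpIntegrand H) (σ : Table X) (a : N.Vec H A) :
    Prop :=
  ∀ᵐ ϰ ∂N.chainMeasure, ∀ θoo ∈ (N.cut (Set.Iio t) ϰ).powerset,
    ∀ θop ∈ (N.cut (Set.Iio t) ϰ \ θoo).powerset,
      MeasureTheory.IntegrableOn (multIntegrand (B := B) F σ a ϰ θoo θop)
        (N.chainsBefore t ×ˢ N.chainsBefore t) (N.chainMeasure.prod N.chainMeasure)

/-- The sum `N(L)(ϰ) = ∑_{θ ⊆ ϰ ∩ t⁻¹(I)} L(θ, ϰ \ θ)` over all subtables of points with times in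
`I`; `N_{[0,t)}` is the case `I = [0, t)`. -/
def multSum (I : Set ℝ≥0) (L : N.OpFamily H) : N.OpFn H ∅ ∅ := fun ϰ =>
  ∑ m0 ∈ (N.cut I ϰ.m0).powerset, ∑ mp ∈ (N.cut I ϰ.mp).powerset,
    ∑ oo ∈ (N.cut I ϰ.oo).powerset, ∑ op ∈ (N.cut I ϰ.op).powerset,
      opCast (∅ ∪ ϰ.dom) (∅ ∪ ϰ.cod) (L ⟨m0, mp, oo, op⟩ (ϰ.diff ⟨m0, mp, oo, op⟩))

/-! ### Matrices of operators at a point -/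

variable (N H)

/-- Matrices `[D^μ_ν]` at `x`, `μ, ν ∈ {-, 0, +}`, with entries acting from `G ⊗ E_ν(x)` to
`G ⊗ E_μ(x)`, where `E_- = E_+ = ℂ` and `E_0(x) = E(x)`.  The upper index `μ` is written first. -/
abbrev OpMatrix (x : X) : Type _ := ∀ μ ν : Ind, N.Vec H (ν.pts x) → N.Vec H (μ.pts x)

variable {N H}

/-- The product of matrices. -/
def matMul {x : X} (P Q : N.OpMatrix H x) : N.OpMatrix H x := fun μ ν a =>
  P μ .minus (Q .minus ν a) + P μ .zero (Q .zero ν a) + P μ .plus (Q .plus ν a)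

/-- The conjugation `P ↦ g P g` with the matrix `g` of the indefinite metric, which interchanges
the indices `-` and `+`. -/
def gConj {x : X} (P : N.OpMatrix H x) : N.OpMatrix H x := fun μ ν a =>
  fun ϰ => tenCast _ _ (P μ.refl ν.refl (fun ϰ' => tenCast _ _ (a ϰ')) ϰ)

/-- The function `Ṫ(x^μ_ν)`, `ϰ ↦ T(ϰ ⊔ x^μ_ν)`. -/
def dotOp (T : N.OpFn H ∅ ∅) (x : X) (μ ν : Ind) : N.OpFn H (ν.pts x) (μ.pts x) := fun ϰ =>
  opCast _ _ (T ((Table.elem x μ ν).union ϰ))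

/-- The triangular matrix with the entries `Ṫ(x^μ_ν)` for `μ ≠ +`, `ν ≠ -`, and with the entry
`T'` at `(-, -)` and `(+, +)`. -/
def triMatrix (T T' : N.OpFn H ∅ ∅) (x : X) (μ ν : Ind) : N.OpFn H (ν.pts x) (μ.pts x) :=
  match μ, ν with
  | .minus, .minus => T'
  | .minus, .zero => dotOp T x .minus .zero
  | .minus, .plus => dotOp T x .minus .plus
  | .zero, .minus => 0
  | .zero, .zero => dotOp T x .zero .zero
  | .zero, .plus => dotOp T x .zero .plus
  | .plus, .minus => 0
  | .plus, .zero => 0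
  | .plus, .plus => T'

/-- The matrix `𝐔(x)`: `U = ε(T^{t(x)})` on the diagonal and `U^μ_ν(x) = ε(Ṫ^{t(x)}(x^μ_ν))`,
where `T^t = N_{[0,t)}(L)`. -/
def matU (L : N.OpFamily H) (x : X) : N.OpMatrix H x := fun μ ν =>
  fock (triMatrix (multSum (Set.Iio (N.time x)) L) (multSum (Set.Iio (N.time x)) L) x μ ν)

/-- The matrix `𝐆(x)`: `U = ε(T^{t(x)})` on the diagonal and `G^μ_ν(x) = ε(Ṫ^{t(x)]}(x^μ_ν))`,
where `T^{s]} = N_{[0,s]}(L)`. -/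
def matG (L : N.OpFamily H) (x : X) : N.OpMatrix H x := fun μ ν =>
  fock (triMatrix (multSum (Set.Iic (N.time x)) L) (multSum (Set.Iio (N.time x)) L) x μ ν)

/-- The Hermitian conjugate matrix `𝐔(x)*`, whose entry `(μ, ν)` is the operator conjugated to the
entry `(ν, μ)` of `𝐔(x)`. -/
def matUadj [CompleteSpace H] (L : N.OpFamily H) (x : X) : N.OpMatrix H x := fun μ ν =>
  fock (star
    (triMatrix (multSum (Set.Iio (N.time x)) L) (multSum (Set.Iio (N.time x)) L) x ν μ))

/-- The Hermitian conjugate matrix `𝐆(x)*`. -/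
def matGadj [CompleteSpace H] (L : N.OpFamily H) (x : X) : N.OpMatrix H x := fun μ ν =>
  fock (star
    (triMatrix (multSum (Set.Iic (N.time x)) L) (multSum (Set.Iio (N.time x)) L) x ν μ))

/-- The pseudo-Hermitian conjugate matrix `𝐔⋆(x) = g 𝐔(x)* g`. -/
def matUstar [CompleteSpace H] (L : N.OpFamily H) (x : X) : N.OpMatrix H x := gConj (matUadj L x)

/-- The pseudo-Hermitian conjugate matrix `𝐆⋆(x) = g 𝐆(x)* g`. -/
def matGstar [CompleteSpace H] (L : N.OpFamily H) (x : X) : N.OpMatrix H x := gConj (matGadj L x)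

/-- The matrix `𝐃(x)` of the derivatives `D^μ_ν(x) = Λ_{[0,t(x))}(Ḃ(x^μ_ν))` of the process
`Λ_{[0,t)}(B)`, with zeros elsewhere. -/
def matD (F : N.OpIntegrand H) (x : X) : N.OpMatrix H x := fun μ ν =>
  match μ, ν with
  | .minus, .zero => multInt (N.time x) F (Table.elem x .minus .zero)
  | .minus, .plus => multInt (N.time x) F (Table.elem x .minus .plus)
  | .zero, .zero => multInt (N.time x) F (Table.elem x .zero .zero)
  | .zero, .plus => multInt (N.time x) F (Table.elem x .zero .plus)
  | _, _ => 0

/-- The single integral `Λ^t(𝐃) = ∑ Λ^ν_μ(t, D^μ_ν)` over `μ ∈ {-, 0}`, `ν ∈ {0, +}`. -/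
def singleInt (t : ℝ≥0) (D : ∀ x, N.OpMatrix H x) (a : N.Vec H ∅) : N.Vec H ∅ := fun ϰ =>
  (∑ x ∈ N.cut (Set.Iio t) ϰ,
    tenCast _ _ (D x .zero .zero (pointDeriv a {x} {x}) (ϰ.erase x))) +
  (∑ x ∈ N.cut (Set.Iio t) ϰ, tenCast _ _ (D x .zero .plus a (ϰ.erase x))) +
  (∫ x in N.before t, D x .minus .zero (pointDeriv a {x} {x}) ϰ ∂N.vol) +
  (∫ x in N.before t, D x .minus .plus a ϰ ∂N.vol)

/-- Absolute convergence of the integrals in `[Λ^t(𝐃)a](ϰ)` for almost all `ϰ`. -/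
def SingleConverges (t : ℝ≥0) (D : ∀ x, N.OpMatrix H x) (a : N.Vec H ∅) : Prop :=
  ∀ᵐ ϰ ∂N.chainMeasure,
    MeasureTheory.IntegrableOn (ε := N.Ten H (∅ ∪ ϰ))
      (fun x => D x .minus .zero (pointDeriv a {x} {x}) ϰ) (N.before t) N.vol ∧
    MeasureTheory.IntegrableOn (ε := N.Ten H (∅ ∪ ϰ))
      (fun x => D x .minus .plus a ϰ) (N.before t) N.vol

end Noise

end

set_option linter.unusedSectionVars false

open Finset (card_eq_one card_eq_zero card_pos card_singleton card_univ coe_image disjoint_left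
  disjoint_of_subset_left disjoint_union_left empty_subset empty_union erase_eq insert_erase
  insert_sdiff_insert insert_sdiff_of_notMem insert_union inter_eq_left mem_biUnion mem_coe
  mem_filter mem_image mem_image_of_mem mem_insert mem_map mem_powerset mem_product mem_range
  mem_sdiff mem_sigma mem_singleton mem_union mem_union_left mem_union_right mem_univ mul_sum
  notMem_erase powerset_mono prod_congr prod_const prod_empty prod_mul_distrib prod_pow
  prod_singleton sdiff_empty sdiff_eq_empty_iff_subset sdiff_insert_of_notMem sdiff_subset
  sdiff_subset_sdiff single_le_sum singleton_product singleton_union smul_sum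
  stronglyMeasurable_fun_sum subset_union_left sum_add_distrib sum_biUnion sum_bij' sum_comm
  sum_comm' sum_congr sum_eq_single sum_eq_zero sum_filter sum_image sum_insert sum_le_sum sum_map
  sum_mul sum_powerset_insert sum_product sum_sigma' sum_singleton sum_subset sum_union
  union_assoc union_comm union_empty union_eq_empty union_insert union_sdiff_left
  union_sdiff_of_subset union_subset union_subset_union union_union_union_comm univ)
open Set (Iic Iio indicator_of_mem indicator_of_notMem mem_Iic mem_Iio mem_iInter mem_iUnion
  mem_inter_iff mem_ofPred_eq mem_preimage)
open Filter (Eventually EventuallyEq atTop eventually_all eventually_congr)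
open MeasureTheory.Measure (QuasiMeasurePreserving ae_ae_of_ae_prod dirac dirac_prod map_apply
  measurePreserving_swap pi prod_restrict quasiMeasurePreserving_fst quasiMeasurePreserving_snd
  restrict_le_self)
open ContinuousLinearMap (adjoint adjoint_adjoint adjoint_comp adjoint_inner_left le_opENorm
  opNorm_le_bound)
open ENNReal (coe_le_coe coe_lt_top coe_toNNReal mul_lt_top rpow_natCast)

/-! Notation for the measures on chains, pairs of chains and tables, and for the types. -/

notation:max "ν[" N "]" => Noise.chainMeasure N
notation:max "ν²[" N "]" => Measure.prod (Noise.chainMeasure N) (Noise.chainMeasure N)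
notation:max "τ[" N "]" => Noise.tableMeasure N
notation:max "C²[" X "]" => Finset X × Finset X
notation:max "C⁴[" X "]" => (Finset X × Finset X) × (Finset X × Finset X)
notation:max "Op[" X "," K "]" => Table X → K →L[ℂ] K

/-! ### Measurable structure of the space of finite chains -/

section ChainMeasurable

variable {X : Type*} [MeasurableSpace X]

/-- Countably many measurable functions suffice to interpolate all functions on finite sets. -/
theorem exists_interpolating [StandardBorelSpace X] :
    ∃ F : ℕ → X → ℕ, (∀ n, Measurable (F n)) ∧
      ∀ (A : Finset X) (g : X → ℕ), ∃ n, ∀ x ∈ A, F n x = g x := by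
  classical
  obtain ⟨f, hf, hinj⟩ := MeasurableSpace.measurable_injection_nat_bool_of_countablySeparated X
  have hne : Nonempty (Σ N : ℕ, ((Fin N → Bool) → ℕ)) := ⟨⟨0, fun _ => 0⟩⟩
  obtain ⟨e, he⟩ := exists_surjective_nat (Σ N : ℕ, ((Fin N → Bool) → ℕ))
  refine ⟨fun n x => (e n).2 fun i => f x i, fun n => ?_, fun A g => ?_⟩
  · exact (measurable_of_countable (e n).2).comp
      (measurable_pi_lambda _ fun i => (measurable_pi_apply _).comp hf)
  · have hsep : ∀ x y : X, ∃ k, x ≠ y → f x k ≠ f y k := fun x y => by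
      by_cases h : x = y
      · exact ⟨0, fun h' => absurd h h'⟩
      · obtain ⟨k, hk⟩ := Function.ne_iff.mp (hinj.ne h)
        exact ⟨k, fun _ => hk⟩
    choose k hk using hsep
    set N := (A ×ˢ A).sup (fun p => k p.1 p.2) + 1 with hN
    have hNlt : ∀ x ∈ A, ∀ y ∈ A, k x y < N := fun x hx y hy =>
      Nat.lt_succ_of_le (Finset.le_sup (f := fun p : X × X => k p.1 p.2)
        (Finset.mk_mem_product hx hy))
    have hA : ∀ x ∈ A, ∀ y ∈ A, (fun i : Fin N => f x i) = (fun i : Fin N => f y i) → x = y := by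
      intro x hx y hy h
      by_contra hxy
      exact hk x y hxy (congrFun h ⟨k x y, hNlt x hx y hy⟩)
    obtain ⟨n, hn⟩ := he ⟨N, fun b => if h : ∃ x ∈ A, (fun i : Fin N => f x i) = b
      then g h.choose else 0⟩
    refine ⟨n, fun x hx => ?_⟩
    have hex : ∃ y ∈ A, (fun i : Fin N => f y i) = fun i : Fin N => f x i := ⟨x, hx, rfl⟩
    change (e n).2 (fun i : Fin (e n).1 => f x i) = g x
    rw [hn]
    change (if h : ∃ y ∈ A, (fun i : Fin N => f y i) = (fun i : Fin N => f x i)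
      then g h.choose else 0) = g x
    rw [dif_pos hex, hA _ hex.choose_spec.1 _ hx hex.choose_spec.2]

/-- A countable family of measurable functions interpolating all functions on finite sets. -/
noncomputable def interp [StandardBorelSpace X] : ℕ → X → ℕ := exists_interpolating.choose

theorem measurable_interp [StandardBorelSpace X] (n : ℕ) : Measurable (interp (X := X) n) :=
  exists_interpolating.choose_spec.1 n

theorem exists_interp_eq [StandardBorelSpace X] (A : Finset X) (g : X → ℕ) :
    ∃ n, ∀ x ∈ A, interp n x = g x :=
  exists_interpolating.choose_spec.2 A g

variable [DecidableEq X]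

theorem measurable_image_univ (n : ℕ) :
    Measurable fun v : Fin n → X => univ.image v := by
  intro S hS
  exact (MeasurableSpace.measurableSet_iInf.mp hS n)

theorem measurable_chain_iff {Z : Type*} [MeasurableSpace Z] {g : Finset X → Z} :
    Measurable g ↔ ∀ n : ℕ, Measurable fun v : Fin n → X => g (univ.image v) := by
  constructor
  · exact fun h n => h.comp (measurable_image_univ n)
  · intro h S hS
    exact MeasurableSpace.measurableSet_iInf.mpr fun n => h n hS

theorem measurableSet_chain_iff {S : Set (Finset X)} :
    MeasurableSet S ↔
      ∀ n : ℕ, MeasurableSet {v : Fin n → X | univ.image v ∈ S} :=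
  MeasurableSpace.measurableSet_iInf

theorem measurableSet_avoid {E : Set X} (hE : MeasurableSet E) :
    MeasurableSet {A : Finset X | ∀ x ∈ A, x ∉ E} := by
  refine measurableSet_chain_iff.mpr fun n => ?_
  have : {v : Fin n → X | univ.image v ∈ {A : Finset X | ∀ x ∈ A, x ∉ E}} =
      ⋂ i, {v | v i ∉ E} := by
    ext v; simp
  rw [this]
  exact MeasurableSet.iInter fun i => hE.compl.preimage (measurable_pi_apply i)

/-- The sets of chains that avoid a measurable set generate the sigma-algebra. -/
theorem chainMeasurableSpace_eq [StandardBorelSpace X] :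
    (chainMeasurableSpace : MeasurableSpace (Finset X)) =
      MeasurableSpace.generateFrom
        {S | ∃ E : Set X, MeasurableSet E ∧ S = {A : Finset X | ∀ x ∈ A, x ∉ E}} := by
  refine le_antisymm (fun W hW => ?_) (MeasurableSpace.generateFrom_le ?_)
  swap
  · rintro S ⟨E, hE, rfl⟩
    exact measurableSet_avoid hE
  rcases isEmpty_or_nonempty X with hX | hX
  · have : W = ∅ ∨ W = Set.univ := by
      by_cases h : ∅ ∈ W
      · exact Or.inr (Set.eq_univ_of_forall fun A => by rwa [Finset.eq_empty_of_isEmpty A])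
      · exact Or.inl (Set.eq_empty_of_forall_notMem fun A => by
          rwa [Finset.eq_empty_of_isEmpty A])
    rcases this with rfl | rfl
    · exact @MeasurableSet.empty _ (_)
    · exact @MeasurableSet.univ _ (_)
  let G : MeasurableSpace (Finset X) := MeasurableSpace.generateFrom
        {S | ∃ E : Set X, MeasurableSet E ∧ S = {A : Finset X | ∀ x ∈ A, x ∉ E}}
  have hG : ∀ E : Set X, MeasurableSet E →
      MeasurableSet[G] {A : Finset X | ∀ x ∈ A, x ∉ E} := fun E hE =>
    MeasurableSpace.measurableSet_generateFrom ⟨E, hE, rfl⟩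
  have hsep : @MeasurableSpace.CountablySeparated (Finset X) G := by
    refine ⟨⟨Set.range fun n => {A : Finset X | ∀ x ∈ A, x ∉ {x | interp n x = 1}},
      Set.countable_range _, ?_, ?_⟩⟩
    · rintro _ ⟨n, rfl⟩
      exact hG _ (measurable_interp n (measurableSet_singleton 1))
    · intro A _ B _ h
      have key : ∀ A B : Finset X, (∀ n, (∀ x ∈ A, interp n x ≠ 1) → ∀ x ∈ B, interp n x ≠ 1) →
          B ⊆ A := by
        intro A B h x hx
        by_contra hxA
        obtain ⟨n, hn⟩ := exists_interp_eq (A ∪ B) fun y => if y = x then 1 else 0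
        refine h n (fun y hy => ?_) x hx ?_
        · rw [hn y (mem_union_left _ hy), if_neg (fun e : y = x => hxA (e ▸ hy))]; simp
        · rw [hn x (mem_union_right _ hx), if_pos rfl]
      refine Finset.Subset.antisymm (key _ _ fun n => ?_) (key _ _ fun n => ?_)
      · exact (h _ ⟨n, rfl⟩).2
      · exact (h _ ⟨n, rfl⟩).1
  let f : ℕ × (ℕ → X) → Finset X := fun p => (Finset.range p.1).image p.2
  have hf : @Measurable _ _ _ G f := by
    refine @measurable_generateFrom _ _ _ _ _ ?_
    rintro _ ⟨E, hE, rfl⟩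
    have : f ⁻¹' {A : Finset X | ∀ x ∈ A, x ∉ E} =
        ⋂ i : ℕ, ({p | p.1 ≤ i} ∪ {p | p.2 i ∉ E}) := by
      ext p
      simp only [f, mem_preimage, mem_ofPred_eq, mem_image, mem_range,
        mem_iInter, Set.mem_union]
      constructor
      · intro h i
        by_cases hi : p.1 ≤ i
        · exact Or.inl hi
        · exact Or.inr (h _ ⟨i, not_le.mp hi, rfl⟩)
      · rintro h x ⟨i, hi, rfl⟩
        exact (h i).resolve_left (not_le.mpr hi)
    rw [this]
    exact MeasurableSet.iInter fun i =>
      (measurableSet_le measurable_fst measurable_const).union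
        (hE.compl.preimage ((measurable_pi_apply i).comp measurable_snd))
  have hsurj : Function.Surjective f := by
    intro A
    refine ⟨(A.card, fun i => if h : i < A.card then (A.equivFin.symm ⟨i, h⟩ : X)
      else Classical.arbitrary X), ?_⟩
    ext x
    simp only [f, mem_image, mem_range]
    constructor
    · rintro ⟨i, hi, rfl⟩
      rw [dif_pos hi]; exact (A.equivFin.symm ⟨i, hi⟩).2
    · intro hx
      refine ⟨A.equivFin ⟨x, hx⟩, (A.equivFin ⟨x, hx⟩).2, ?_⟩
      rw [dif_pos (A.equivFin ⟨x, hx⟩).2]; simp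
  refine (@Measurable.measurableSet_preimage_iff_of_surjective _ _ _ _ G hsep f hf hsurj W).mp ?_
  have : f ⁻¹' W = ⋃ n : ℕ, ({p | p.1 = n} ∩
      (fun p : ℕ × (ℕ → X) => fun i : Fin n => p.2 i) ⁻¹'
        {v : Fin n → X | univ.image v ∈ W}) := by
    ext p
    have himg : ∀ n, univ.image (fun i : Fin n => p.2 i) = (Finset.range n).image p.2 := by
      intro n; ext x
      simp only [mem_image, mem_univ, true_and, mem_range]
      exact ⟨fun ⟨i, hi⟩ => ⟨i, i.2, hi⟩, fun ⟨i, hi, h⟩ => ⟨⟨i, hi⟩, h⟩⟩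
    simp only [f, mem_preimage, mem_iUnion, mem_inter_iff, mem_ofPred_eq, himg]
    exact ⟨fun h => ⟨_, rfl, h⟩, fun ⟨n, hn, h⟩ => hn ▸ h⟩
  rw [this]
  refine MeasurableSet.iUnion fun n => ?_
  refine (measurable_fst (measurableSet_singleton n)).inter ?_
  exact (measurable_pi_lambda _ fun i => (measurable_pi_apply _).comp measurable_snd)
    (measurableSet_chain_iff.mp hW n)

variable [StandardBorelSpace X] {Y : Type*} [MeasurableSpace Y]

theorem measurable_to_chain {g : Y → Finset X}
    (h : ∀ E : Set X, MeasurableSet E → MeasurableSet {y | ∀ x ∈ g y, x ∉ E}) :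
    Measurable g := by
  rw [chainMeasurableSpace_eq]
  refine measurable_generateFrom ?_
  rintro _ ⟨E, hE, rfl⟩
  exact h E hE

theorem Measurable.chain_avoid {g : Y → Finset X} (hg : Measurable g) {E : Set X}
    (hE : MeasurableSet E) : MeasurableSet {y | ∀ x ∈ g y, x ∉ E} :=
  hg (measurableSet_avoid hE)

theorem Measurable.chain_union {f g : Y → Finset X} (hf : Measurable f) (hg : Measurable g) :
    Measurable fun y => f y ∪ g y := by
  refine measurable_to_chain fun E hE => ?_
  have : {y | ∀ x ∈ f y ∪ g y, x ∉ E} = {y | ∀ x ∈ f y, x ∉ E} ∩ {y | ∀ x ∈ g y, x ∉ E} := by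
    ext y; simp only [mem_union, mem_ofPred_eq, mem_inter_iff]
    exact ⟨fun h => ⟨fun x hx => h x (Or.inl hx), fun x hx => h x (Or.inr hx)⟩,
      fun h x hx => hx.elim (h.1 x) (h.2 x)⟩
  rw [this]
  exact (hf.chain_avoid hE).inter (hg.chain_avoid hE)

theorem measurable_chain_singleton : Measurable fun x : X => ({x} : Finset X) := by
  refine measurable_to_chain fun E hE => ?_
  convert hE.compl using 1
  ext x; simp

theorem Measurable.chain_filter {f : Y → Finset X} (hf : Measurable f) (p : X → Prop)
    [DecidablePred p] (hp : MeasurableSet {x | p x}) : Measurable fun y => (f y).filter p := by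
  refine measurable_to_chain fun E hE => ?_
  have : {y | ∀ x ∈ (f y).filter p, x ∉ E} = {y | ∀ x ∈ f y, x ∉ E ∩ {x | p x}} := by
    ext y; simp only [mem_filter, mem_ofPred_eq, mem_inter_iff, not_and]
    exact ⟨fun h x hx hxE hpx => h x ⟨hx, hpx⟩ hxE, fun h x hx hxE => h x hx.1 hxE hx.2⟩
  rw [this]
  exact hf.chain_avoid (hE.inter hp)

/-- The part of a chain selected by the `n`-th interpolating function. -/
noncomputable def splitPart (n : ℕ) (A : Finset X) : Finset X :=
  A.filter fun x => interp n x = 1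

theorem splitPart_subset (n : ℕ) (A : Finset X) : splitPart n A ⊆ A := Finset.filter_subset _ _

theorem measurableSet_interp_eq (n k : ℕ) : MeasurableSet {x : X | interp n x = k} :=
  measurable_interp n (measurableSet_singleton k)

theorem measurable_splitPart (n : ℕ) : Measurable (splitPart (X := X) n) :=
  measurable_id.chain_filter _ (measurableSet_interp_eq n 1)

theorem sdiff_splitPart (n : ℕ) (A : Finset X) :
    A \ splitPart n A = A.filter fun x => ¬ interp n x = 1 := by
  ext x; simp [splitPart]; tauto

theorem measurable_sdiff_splitPart (n : ℕ) :
    Measurable fun A : Finset X => A \ splitPart n A := by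
  simp_rw [sdiff_splitPart]
  exact measurable_id.chain_filter _ (measurableSet_interp_eq n 1).compl

theorem exists_splitPart_eq {A θ : Finset X} (h : θ ⊆ A) : ∃ n, splitPart n A = θ := by
  obtain ⟨n, hn⟩ := exists_interp_eq A fun x => if x ∈ θ then 1 else 0
  refine ⟨n, ?_⟩
  ext x
  simp only [splitPart, mem_filter]
  constructor
  · rintro ⟨hx, h1⟩
    by_contra hxθ
    rw [hn x hx, if_neg hxθ] at h1; simp at h1
  · intro hx
    exact ⟨h hx, by rw [hn x (h hx), if_pos hx]⟩

/-- Chains on which the `n`-th selection does not coincide with an earlier one. -/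
def freshSplit (n : ℕ) : Set (Finset X) := {A | ∀ m < n, splitPart m A ≠ splitPart n A}

theorem measurableSet_agree {α : Type*} [MeasurableSpace α] [MeasurableEq α] {f g : X → α}
    (hf : Measurable f) (hg : Measurable g) :
    MeasurableSet {A : Finset X | ∀ x ∈ A, f x = g x} := by
  have := measurableSet_avoid (measurableSet_eq_fun hf hg).compl
  simpa using this

theorem measurableSet_freshSplit (n : ℕ) : MeasurableSet (freshSplit (X := X) n) := by
  have : freshSplit (X := X) n =
      ⋂ m, ⋂ _ : m < n, {A | ∀ x ∈ A, (interp m x = 1 ↔ interp n x = 1)}ᶜ := by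
    ext A
    simp only [freshSplit, splitPart, mem_ofPred_eq, mem_iInter, Set.mem_compl_iff]
    refine forall₂_congr fun m _ => not_congr ?_
    exact Finset.filter_inj'
  rw [this]
  refine MeasurableSet.iInter fun m => MeasurableSet.iInter fun _ => MeasurableSet.compl ?_
  have hm : Measurable fun x : X => decide (interp m x = 1) :=
    (measurable_of_countable fun k : ℕ => decide (k = 1)).comp (measurable_interp m)
  have hn : Measurable fun x : X => decide (interp n x = 1) :=
    (measurable_of_countable fun k : ℕ => decide (k = 1)).comp (measurable_interp n)
  have := measurableSet_agree hm hn
  simpa only [decide_eq_decide] using this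

theorem measurableSet_chain_subset :
    MeasurableSet {p : C²[X] | p.1 ⊆ p.2} := by
  have : {p : C²[X] | p.1 ⊆ p.2} =
      ⋂ n, ({p | ∀ x ∈ p.2, x ∉ {x | interp n x = 1}}ᶜ ∪
        {p | ∀ x ∈ p.1, x ∉ {x | interp n x = 1}}) := by
    ext p
    simp only [mem_ofPred_eq, mem_iInter, Set.mem_union, Set.mem_compl_iff]
    constructor
    · intro h n
      by_cases hn : ∀ x ∈ p.2, ¬ interp n x = 1
      · exact Or.inr fun x hx => hn x (h hx)
      · exact Or.inl hn
    · intro h x hx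
      by_contra hx2
      obtain ⟨n, hn⟩ := exists_interp_eq (p.1 ∪ p.2) fun y => if y = x then 1 else 0
      refine ((h n).resolve_left (not_not.mpr fun y hy => ?_)) x hx ?_
      · rw [hn y (mem_union_right _ hy), if_neg (fun e : y = x => hx2 (e ▸ hy))]; simp
      · rw [hn x (mem_union_left _ hx), if_pos rfl]
  rw [this]
  exact MeasurableSet.iInter fun n =>
    (measurable_snd.chain_avoid (measurableSet_interp_eq n 1)).compl.union
      (measurable_fst.chain_avoid (measurableSet_interp_eq n 1))

instance : MeasurableSingletonClass (Finset X) := ⟨fun A => by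
  have h1 : Measurable fun B : Finset X => (A, B) := measurable_prodMk_left
  have h2 : Measurable fun B : Finset X => (B, A) := measurable_prodMk_right
  convert (h1 measurableSet_chain_subset).inter (h2 measurableSet_chain_subset) using 1
  ext B
  simp only [Set.mem_singleton_iff, mem_inter_iff, mem_preimage, mem_ofPred_eq]
  exact ⟨fun h => h ▸ ⟨subset_rfl, subset_rfl⟩, fun h => Finset.Subset.antisymm h.2 h.1⟩⟩

theorem measurable_chain_prod {g : X → ℝ≥0∞} (hg : Measurable g) :
    Measurable fun A : Finset X => ∏ x ∈ A, g x := by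
  classical
  refine measurable_chain_iff.mpr fun n => ?_
  have : (fun v : Fin n → X => ∏ x ∈ univ.image v, g x) =
      fun v => ∏ i : Fin n, if ∀ j < i, v j ≠ v i then g (v i) else 1 := by
    ext v
    rw [← Finset.prod_filter]
    symm
    refine Finset.prod_bij (fun i _ => v i) (fun i _ => mem_image_of_mem _ (mem_univ _))
      ?_ ?_ (fun _ _ => rfl)
    · intro i hi j hj hij
      simp only [mem_filter, mem_univ, true_and] at hi hj
      by_contra hne
      rcases lt_or_gt_of_ne hne with h | h
      · exact hj i h hij
      · exact hi j h hij.symm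
    · intro x hx
      obtain ⟨i, hi⟩ : ∃ i, v i = x := by simpa using hx
      let s := univ.filter fun i => v i = x
      have hs : s.Nonempty := ⟨i, by simp [s, hi]⟩
      refine ⟨s.min' hs, ?_, ?_⟩
      · simp only [mem_filter, mem_univ, true_and]
        intro j hj hvj
        have h1 : v (s.min' hs) = x := (mem_filter.mp (s.min'_mem hs)).2
        exact absurd (s.min'_le j (by simp [s, hvj, h1])) (not_le.mpr hj)
      · exact (mem_filter.mp (s.min'_mem hs)).2
  rw [this]
  refine Finset.measurable_prod _ fun i _ => ?_
  refine Measurable.ite ?_ (hg.comp (measurable_pi_apply i)) measurable_const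
  simp only [Set.ofPred_forall]
  exact MeasurableSet.iInter fun j => MeasurableSet.iInter fun _ =>
    (measurableSet_eq_fun (measurable_pi_apply j) (measurable_pi_apply i)).compl

end ChainMeasurable

/-! ### The sum-integral formula on the space of chains -/

namespace Noise

section SumIntegral

variable {X : Type*} [MeasurableSpace X] [DecidableEq X] (N : Noise X)

instance : SigmaFinite N.vol := N.sigmaFinite

theorem vol_time_eq (c : ℝ≥0) : ∀ᵐ x ∂N.vol, N.time x ≠ c := by
  have hm : Measurable fun x => (N.time x : ℝ) := measurable_coe_nnreal_real.comp N.measurable_time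
  have h : ∀ᵐ s ∂(N.vol.map fun x => (N.time x : ℝ)), s ≠ (c : ℝ) :=
    N.absCont.ae_le (Measure.ae_ne _ _)
  filter_upwards [ae_of_ae_map hm.aemeasurable h] with x hx
  exact_mod_cast hx

instance sfinite_chainMeasure : SFinite ν[N] := by
  unfold chainMeasure; infer_instance

theorem ae_pi_time_injective {ι : Type*} [Fintype ι] :
    ∀ᵐ v ∂(pi fun _ : ι => N.vol), Function.Injective fun i => N.time (v i) := by
  classical
  have key : ∀ i j : ι, i ≠ j →
      ∀ᵐ v ∂(pi fun _ : ι => N.vol), N.time (v i) ≠ N.time (v j) := by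
    intro i j hij
    have e := measurePreserving_piEquivPiSubtypeProd (fun _ : ι => N.vol) (fun k => k = i)
    refine e.quasiMeasurePreserving.ae
      (p := fun q => N.time (q.1 ⟨i, rfl⟩) ≠ N.time (q.2 ⟨j, hij.symm⟩)) ?_
    refine (Measure.ae_prod_iff_ae_ae ?_).2 (Eventually.of_forall fun u => ?_)
    · refine (measurableSet_eq_fun ?_ ?_).compl
      · exact N.measurable_time.comp ((measurable_pi_apply _).comp measurable_fst)
      · exact N.measurable_time.comp ((measurable_pi_apply _).comp measurable_snd)
    · filter_upwards [(Measure.tendsto_eval_ae_ae (μ := fun _ : {k // ¬ k = i} => N.vol)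
        (i := ⟨j, hij.symm⟩)).eventually (N.vol_time_eq (N.time (u ⟨i, rfl⟩)))] with w hw
      exact fun h => hw h.symm
  have : ∀ᵐ v ∂(pi fun _ : ι => N.vol), ∀ i j : ι, i ≠ j →
      N.time (v i) ≠ N.time (v j) := by
    refine eventually_all.2 fun i => eventually_all.2 fun j => ?_
    by_cases hij : i = j
    · exact Eventually.of_forall fun v h => absurd hij h
    · filter_upwards [key i j hij] with v hv _ using hv
  filter_upwards [this] with v hv i j h
  by_contra hij
  exact hv i j hij h

theorem measurableSet_strictMono_time {n : ℕ} (π : Equiv.Perm (Fin n)) :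
    MeasurableSet {v : Fin n → X | StrictMono fun i => N.time (v (π i))} := by
  have : {v : Fin n → X | StrictMono fun i => N.time (v (π i))} =
      ⋂ i, ⋂ j, ⋂ _ : i < j, {v | N.time (v (π i)) < N.time (v (π j))} := by
    ext v; simp [StrictMono]
  rw [this]
  exact MeasurableSet.iInter fun i => MeasurableSet.iInter fun j => MeasurableSet.iInter fun _ =>
    measurableSet_lt (N.measurable_time.comp (measurable_pi_apply _))
      (N.measurable_time.comp (measurable_pi_apply _))

theorem measurable_image_univ' {ι : Type*} [Fintype ι] [StandardBorelSpace X] :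
    Measurable fun v : ι → X => univ.image v := by
  refine measurable_to_chain fun E hE => ?_
  have : {v : ι → X | ∀ x ∈ univ.image v, x ∉ E} = ⋂ i, {v | v i ∉ E} := by ext v; simp
  rw [this]
  exact MeasurableSet.iInter fun i => hE.compl.preimage (measurable_pi_apply i)

theorem lintegral_pi_image_equiv {ι κ : Type*} [Fintype ι] [Fintype κ] (e : ι ≃ κ)
    (g : Finset X → ℝ≥0∞) :
    ∫⁻ v, g (univ.image v) ∂(pi fun _ : κ => N.vol) =
      ∫⁻ v, g (univ.image v) ∂(pi fun _ : ι => N.vol) := by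
  have h := measurePreserving_piCongrLeft (α := fun _ : κ => X) (fun _ : κ => N.vol) e
  rw [← h.lintegral_comp_emb (MeasurableEquiv.measurableEmbedding _)]
  congr with v
  congr 1
  ext x
  simp only [mem_image, mem_univ, true_and]
  constructor
  · rintro ⟨k, rfl⟩
    refine ⟨e.symm k, ?_⟩
    conv_rhs => rw [← e.apply_symm_apply k]
    exact (MeasurableEquiv.piCongrLeft_apply_apply (β := fun _ : κ => X) e v (e.symm k)).symm
  · rintro ⟨i, rfl⟩
    exact ⟨e i, MeasurableEquiv.piCongrLeft_apply_apply (β := fun _ : κ => X) e v i⟩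

theorem lintegral_strictMono_perm {n : ℕ} (π : Equiv.Perm (Fin n)) (g : Finset X → ℝ≥0∞) :
    ∫⁻ v in {v : Fin n → X | StrictMono fun i => N.time (v (π i))}, g (univ.image v)
        ∂(pi fun _ : Fin n => N.vol) =
      ∫⁻ v in {v : Fin n → X | StrictMono fun i => N.time (v i)}, g (univ.image v)
        ∂(pi fun _ : Fin n => N.vol) := by
  have h := measurePreserving_piCongrLeft (α := fun _ : Fin n => X) (fun _ => N.vol) π
  rw [← h.setLIntegral_comp_preimage_emb (MeasurableEquiv.measurableEmbedding _)]
  have hap : ∀ (v : Fin n → X) i,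
      MeasurableEquiv.piCongrLeft (fun _ : Fin n => X) π v (π i) = v i := fun v i =>
    MeasurableEquiv.piCongrLeft_apply_apply (β := fun _ : Fin n => X) π v i
  have hs : (MeasurableEquiv.piCongrLeft (fun _ : Fin n => X) π) ⁻¹'
      {v : Fin n → X | StrictMono fun i => N.time (v (π i))} =
      {v : Fin n → X | StrictMono fun i => N.time (v i)} := by
    ext v
    simp only [mem_preimage, mem_ofPred_eq, hap]
  rw [hs]
  congr with v
  congr 1
  ext x
  simp only [mem_image, mem_univ, true_and]
  constructor
  · rintro ⟨k, rfl⟩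
    exact ⟨π.symm k, by rw [← hap v (π.symm k), π.apply_symm_apply]⟩
  · rintro ⟨i, rfl⟩
    exact ⟨π i, hap v i⟩

theorem lintegral_strictMono [StandardBorelSpace X] {n : ℕ} {g : Finset X → ℝ≥0∞}
    (hg : Measurable g) :
    ∫⁻ v in {v : Fin n → X | StrictMono fun i => N.time (v i)}, g (univ.image v)
        ∂(pi fun _ : Fin n => N.vol) =
      (n.factorial : ℝ≥0∞)⁻¹ * ∫⁻ v, g (univ.image v)
        ∂(pi fun _ : Fin n => N.vol) := by
  classical
  have hsum : ∫⁻ v, g (univ.image v) ∂(pi fun _ : Fin n => N.vol) =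
      ∑ π : Equiv.Perm (Fin n), ∫⁻ v in {v : Fin n → X | StrictMono fun i => N.time (v (π i))},
        g (univ.image v) ∂(pi fun _ : Fin n => N.vol) := by
    simp_rw [← lintegral_indicator (N.measurableSet_strictMono_time _)]
    rw [← lintegral_finsetSum univ (f := fun (π : Equiv.Perm (Fin n)) (v : Fin n → X) =>
        {v : Fin n → X | StrictMono fun i => N.time (v (π i))}.indicator
          (fun v => g (univ.image v)) v) fun π _ =>
      (hg.comp (measurable_image_univ n)).indicator (N.measurableSet_strictMono_time π)]
    refine lintegral_congr_ae ?_
    filter_upwards [N.ae_pi_time_injective] with v hv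
    set π₀ := Tuple.sort fun i => N.time (v i)
    have h0 : StrictMono fun i => N.time (v (π₀ i)) :=
      (Tuple.monotone_sort fun i => N.time (v i)).strictMono_of_injective
        (hv.comp π₀.injective)
    rw [sum_eq_single π₀]
    · rw [indicator_of_mem]; exact h0
    · intro π _ hne
      refine indicator_of_notMem (fun h => hne ?_) _
      have := Tuple.unique_monotone (f := fun i => N.time (v i)) (σ := π) (τ := π₀)
        (StrictMono.monotone h) h0.monotone
      ext i
      exact congrArg Fin.val (hv (congrFun this i))
    · simp
  rw [hsum, sum_congr rfl fun π _ => N.lintegral_strictMono_perm π g, Finset.sum_const,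
    card_univ, Fintype.card_perm, Fintype.card_fin, nsmul_eq_mul, ← mul_assoc,
    ENNReal.inv_mul_cancel (by simp [Nat.factorial_ne_zero]) (by simp), one_mul]

/-- The integral over chains as a sum of integrals over tuples. -/
theorem lintegral_chain [StandardBorelSpace X] {g : Finset X → ℝ≥0∞} (hg : Measurable g) :
    ∫⁻ A, g A ∂ν[N] = ∑' n : ℕ, (n.factorial : ℝ≥0∞)⁻¹ *
      ∫⁻ v, g (univ.image v) ∂(pi fun _ : Fin n => N.vol) := by
  unfold chainMeasure
  rw [lintegral_sum_measure]
  congr with n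
  rw [lintegral_map hg (measurable_image_univ n), N.lintegral_strictMono hg]

theorem sum_powerset_image {ι M : Type*} [Fintype ι] [DecidableEq ι] [AddCommMonoid M] {v : ι → X}
    (hv : Function.Injective v) (f : Finset X → Finset X → M) :
    ∑ θ ∈ (univ.image v).powerset, f θ (univ.image v \ θ) =
      ∑ J ∈ (univ : Finset ι).powerset, f (J.image v) (Jᶜ.image v) := by
  rw [Finset.powerset_image, sum_image]
  · refine sum_congr rfl fun J _ => ?_
    rw [← Finset.image_sdiff _ _ hv, Finset.compl_eq_univ_sdiff]
  · intro J _ J' _ h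
    exact Finset.image_injective hv h

theorem lintegral_pi_split [StandardBorelSpace X] {n : ℕ} (J : Finset (Fin n))
    {f : Finset X → Finset X → ℝ≥0∞} (hf : Measurable (Function.uncurry f)) :
    ∫⁻ v, f (J.image v) (Jᶜ.image v) ∂(pi fun _ : Fin n => N.vol) =
      ∫⁻ u, ∫⁻ w, f (univ.image u) (univ.image w)
        ∂(pi fun _ : Fin (n - J.card) => N.vol)
        ∂(pi fun _ : Fin J.card => N.vol) := by
  obtain ⟨p, hp, hJ⟩ : ∃ (p : Fin n → Prop) (_ : DecidablePred p), ∀ i, i ∈ J ↔ p i :=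
    ⟨(· ∈ J), inferInstance, fun _ => Iff.rfl⟩
  have h := measurePreserving_piEquivPiSubtypeProd (fun _ : Fin n => N.vol) p
  have h1 : ∫⁻ v, f (J.image v) (Jᶜ.image v) ∂(pi fun _ : Fin n => N.vol) =
      ∫⁻ q : ({i // p i} → X) × ({i // ¬ p i} → X),
        f (univ.image q.1) (univ.image q.2)
        ∂((pi fun _ => N.vol).prod (pi fun _ => N.vol)) := by
    rw [← h.lintegral_comp_emb (MeasurableEquiv.measurableEmbedding _)]
    congr with v
    congr 1
    · ext x
      simp only [mem_image, mem_univ, true_and, Subtype.exists, hJ]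
      exact ⟨fun ⟨i, hi, h⟩ => ⟨i, hi, h⟩, fun ⟨i, hi, h⟩ => ⟨i, hi, h⟩⟩
    · ext x
      simp only [mem_image, mem_univ, true_and, Subtype.exists, Finset.mem_compl, hJ]
      exact ⟨fun ⟨i, hi, h⟩ => ⟨i, hi, h⟩, fun ⟨i, hi, h⟩ => ⟨i, hi, h⟩⟩
  have hm : Measurable fun q : ({i // p i} → X) × ({i // ¬ p i} → X) =>
      f (univ.image q.1) (univ.image q.2) :=
    hf.comp ((measurable_image_univ'.comp measurable_fst).prodMk
      (measurable_image_univ'.comp measurable_snd))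
  rw [h1, lintegral_prod _ hm.aemeasurable]
  have e1 : Fin J.card ≃ {i // p i} := by
    refine (Fintype.equivFinOfCardEq ?_).symm
    rw [Fintype.card_subtype]; congr 1; ext i; simp [hJ]
  have e2 : Fin (n - J.card) ≃ {i // ¬ p i} := by
    refine (Fintype.equivFinOfCardEq ?_).symm
    rw [Fintype.card_subtype_compl, Fintype.card_subtype, Fintype.card_fin]
    congr 2; ext i; simp [hJ]
  simp only
  rw [N.lintegral_pi_image_equiv e1 (fun A => ∫⁻ w : {i // ¬ p i} → X,
      f A (univ.image w) ∂(pi fun _ => N.vol))]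
  congr with u
  exact N.lintegral_pi_image_equiv e2 (fun B => f (univ.image u) B)

/-- The sum-integral formula. -/
theorem lintegral_sum_powerset [StandardBorelSpace X]
    {f : Finset X → Finset X → ℝ≥0∞} (hf : Measurable (Function.uncurry f))
    (hs : Measurable fun A => ∑ θ ∈ A.powerset, f θ (A \ θ)) :
    ∫⁻ A, ∑ θ ∈ A.powerset, f θ (A \ θ) ∂ν[N] =
      ∫⁻ A, ∫⁻ B, f A B ∂ν[N] ∂ν[N] := by
  classical
  let I : ℕ → ℕ → ℝ≥0∞ := fun k l => ∫⁻ u, ∫⁻ w, f (univ.image u) (univ.image w)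
        ∂(pi fun _ : Fin l => N.vol) ∂(pi fun _ : Fin k => N.vol)
  have hL : ∀ n : ℕ, ∫⁻ v, ∑ θ ∈ (univ.image v).powerset,
      f θ (univ.image v \ θ) ∂(pi fun _ : Fin n => N.vol) =
      ∑ k ∈ Finset.range (n + 1), (n.choose k : ℝ≥0∞) * I k (n - k) := by
    intro n
    have : ∫⁻ v, ∑ θ ∈ (univ.image v).powerset,
        f θ (univ.image v \ θ) ∂(pi fun _ : Fin n => N.vol) =
        ∫⁻ v, ∑ J ∈ (univ : Finset (Fin n)).powerset, f (J.image v) (Jᶜ.image v)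
          ∂(pi fun _ : Fin n => N.vol) := by
      refine lintegral_congr_ae ?_
      filter_upwards [N.ae_pi_time_injective] with v hv
      exact sum_powerset_image (fun i j h => hv (congrArg N.time h)) f
    rw [this, lintegral_finsetSum']
    · rw [sum_congr rfl fun J _ => N.lintegral_pi_split J hf,
        Finset.sum_powerset_apply_card (fun k => I k (n - k))]
      simp [nsmul_eq_mul]
    · intro J _
      have hi : ∀ J : Finset (Fin n), Measurable fun v : Fin n → X => J.image v := by
        intro J
        refine measurable_to_chain fun E hE => ?_
        have : {v : Fin n → X | ∀ x ∈ J.image v, x ∉ E} = ⋂ i ∈ J, {v | v i ∉ E} := by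
          ext v; simp
        rw [this]
        exact MeasurableSet.iInter fun i => MeasurableSet.iInter fun _ =>
          hE.compl.preimage (measurable_pi_apply i)
      exact (hf.comp ((hi J).prodMk (hi Jᶜ))).aemeasurable
  have hR : ∫⁻ A, ∫⁻ B, f A B ∂ν[N] ∂ν[N] =
      ∑' k : ℕ, ∑' l : ℕ, (k.factorial : ℝ≥0∞)⁻¹ * ((l.factorial : ℝ≥0∞)⁻¹ * I k l) := by
    rw [N.lintegral_chain (g := fun A => ∫⁻ B, f A B ∂ν[N]) hf.lintegral_prod_right']
    congr with k
    rw [ENNReal.tsum_mul_left]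
    congr 1
    have : ∀ u : Fin k → X, ∫⁻ B, f (univ.image u) B ∂ν[N] =
        ∑' l : ℕ, (l.factorial : ℝ≥0∞)⁻¹ * ∫⁻ w, f (univ.image u) (univ.image w)
          ∂(pi fun _ : Fin l => N.vol) := fun u =>
      N.lintegral_chain (hf.comp measurable_prodMk_left)
    change ∫⁻ u, ∫⁻ B, f (univ.image u) B ∂ν[N]
      ∂(pi fun _ : Fin k => N.vol) = _
    have hm : ∀ l : ℕ, Measurable fun u : Fin k → X =>
        ∫⁻ w, f (univ.image u) (univ.image w)
          ∂(pi fun _ : Fin l => N.vol) := fun l => by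
      refine Measurable.lintegral_prod_right' (f := fun q : (Fin k → X) × (Fin l → X) =>
        f (univ.image q.1) (univ.image q.2)) ?_
      exact hf.comp (((measurable_image_univ k).comp measurable_fst).prodMk
        ((measurable_image_univ l).comp measurable_snd))
    simp_rw [this]
    rw [lintegral_tsum fun l => ((hm l).const_mul _).aemeasurable]
    congr with l
    rw [lintegral_const_mul _ (hm l)]
  rw [N.lintegral_chain hs, hR, ← ENNReal.tsum_prod,
    ← Finset.HasAntidiagonal.sigmaAntidiagonalEquivProd.tsum_eq, ENNReal.tsum_sigma']
  congr with n
  rw [hL, tsum_fintype, mul_sum, Finset.univ_eq_attach]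
  simp only [Finset.HasAntidiagonal.sigmaAntidiagonalEquivProd_apply]
  rw [
    Finset.sum_attach (Finset.HasAntidiagonal.antidiagonal n) (fun q => (q.1.factorial : ℝ≥0∞)⁻¹ *
      ((q.2.factorial : ℝ≥0∞)⁻¹ * I q.1 q.2)),
    Finset.Nat.sum_antidiagonal_eq_sum_range_succ (fun k l => (k.factorial : ℝ≥0∞)⁻¹ *
      ((l.factorial : ℝ≥0∞)⁻¹ * I k l))]
  refine sum_congr rfl fun k hk => ?_
  have hk' : k ≤ n := Nat.lt_succ_iff.mp (mem_range.mp hk)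
  rw [← mul_assoc, ← mul_assoc]
  congr 1
  rw [← Nat.choose_mul_factorial_mul_factorial hk']
  have h1 : ((n.choose k : ℕ) : ℝ≥0∞) ≠ 0 := by
    exact_mod_cast (Nat.choose_pos hk').ne'
  push_cast
  rw [ENNReal.mul_inv (Or.inr (by simp)) (Or.inr (by simp [Nat.factorial_ne_zero])),
    ENNReal.mul_inv (Or.inr (by simp)) (Or.inr (by simp [Nat.factorial_ne_zero])),
    mul_comm, ← mul_assoc, ← mul_assoc, ENNReal.mul_inv_cancel h1 (by simp), one_mul]

end SumIntegral

end Noise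

/-! ### Finite correspondences that unfold one measure into another -/

namespace Noise

section Unfold

variable {α β α' β' γ : Type*} [MeasurableSpace α] [MeasurableSpace β] [MeasurableSpace α']
  [MeasurableSpace β'] [MeasurableSpace γ]

/-- A finite-set-valued map that is enumerated by countably many measurable maps on measurable
sets. -/
def FinRep (R : α → Finset β) : Prop :=
  ∃ (φ : ℕ → α → β) (M : ℕ → Set α), (∀ n, Measurable (φ n)) ∧ (∀ n, MeasurableSet (M n)) ∧
    ∀ a, ∃ s : Finset ℕ, (∀ n, n ∈ s ↔ a ∈ M n) ∧ Set.InjOn (fun n => φ n a) s ∧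
      ∀ b, b ∈ R a ↔ ∃ n ∈ s, φ n a = b

theorem FinRep.stronglyMeasurable_sum {R : α → Finset β} (hR : FinRep R) {E : Type*}
    [TopologicalSpace E] [TopologicalSpace.PseudoMetrizableSpace E] [AddCommMonoid E]
    [ContinuousAdd E] {f : β → E} (hf : StronglyMeasurable f) :
    StronglyMeasurable fun a => ∑ b ∈ R a, f b := by
  classical
  obtain ⟨φ, M, hφ, hM, h⟩ := hR
  have hpart : ∀ K : ℕ, StronglyMeasurable fun a =>
      ∑ n ∈ Finset.range K, (M n).indicator (fun a => f (φ n a)) a := fun K =>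
    stronglyMeasurable_fun_sum _ fun n _ =>
      (hf.comp_measurable (hφ n)).indicator (hM n)
  refine stronglyMeasurable_of_tendsto atTop hpart (tendsto_pi_nhds.mpr fun a => ?_)
  obtain ⟨s, hs, hinj, hb⟩ := h a
  refine tendsto_const_nhds.congr' ?_
  filter_upwards [Filter.eventually_ge_atTop (s.sup id + 1)] with K hK
  have hsub : s ⊆ Finset.range K := fun n hn =>
    mem_range.mpr (lt_of_lt_of_le (Nat.lt_succ_of_le (Finset.le_sup (f := id) hn)) hK)
  have hRa : R a = s.image fun n => φ n a := by
    ext b; rw [hb, mem_image]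
  rw [hRa, sum_image hinj, ← sum_subset hsub]
  · exact sum_congr rfl fun n hn => by rw [indicator_of_mem ((hs n).mp hn)]
  · intro n _ hn
    exact indicator_of_notMem (fun h' => hn ((hs n).mpr h')) _

theorem FinRep.measurable_sum {R : α → Finset β} (hR : FinRep R) {f : β → ℝ≥0∞}
    (hf : Measurable f) : Measurable fun a => ∑ b ∈ R a, f b :=
  (hR.stronglyMeasurable_sum hf.stronglyMeasurable).measurable

theorem FinRep.id : FinRep fun a : α => ({a} : Finset α) := by
  refine ⟨fun _ a => a, fun n => if n = 0 then Set.univ else ∅, fun _ => measurable_id,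
    fun n => by by_cases h : n = 0 <;> simp [h], fun a => ⟨{0}, fun n => ?_, by simp, by simp [eq_comm]⟩⟩
  by_cases h : n = 0 <;> simp [h]

theorem FinRep.prod {R : α → Finset β} {R' : α' → Finset β'} (h : FinRep R) (h' : FinRep R') :
    FinRep fun q : α × α' => R q.1 ×ˢ R' q.2 := by
  classical
  obtain ⟨φ, M, hφ, hM, h⟩ := h
  obtain ⟨φ', M', hφ', hM', h'⟩ := h'
  refine ⟨fun n q => (φ n.unpair.1 q.1, φ' n.unpair.2 q.2),
    fun n => (M n.unpair.1) ×ˢ (M' n.unpair.2), fun n => ?_, fun n => (hM _).prod (hM' _),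
    fun q => ?_⟩
  · exact ((hφ _).comp measurable_fst).prodMk ((hφ' _).comp measurable_snd)
  obtain ⟨s, hs, hi, hb⟩ := h q.1
  obtain ⟨s', hs', hi', hb'⟩ := h' q.2
  refine ⟨(s ×ˢ s').image fun p => Nat.pair p.1 p.2, fun n => ?_, ?_, fun b => ?_⟩
  · rw [mem_image, Set.mem_prod, ← hs, ← hs']
    constructor
    · rintro ⟨p, hp, rfl⟩
      simpa using hp
    · intro hn
      exact ⟨n.unpair, by simpa using hn, by simp⟩
  · intro n hn m hm hnm
    simp only [coe_image, Set.mem_image, mem_coe, mem_product] at hn hm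
    obtain ⟨p, hp, rfl⟩ := hn
    obtain ⟨p', hp', rfl⟩ := hm
    simp only [Nat.unpair_pair, Prod.mk.injEq] at hnm
    rw [hi hp.1 hp'.1 hnm.1, hi' hp.2 hp'.2 hnm.2]
  · rw [mem_product, hb, hb']
    constructor
    · rintro ⟨⟨n, hn, h1⟩, ⟨m, hm, h2⟩⟩
      refine ⟨Nat.pair n m, mem_image.mpr ⟨(n, m), by simp [hn, hm], rfl⟩, ?_⟩
      simp [h1, h2]
    · rintro ⟨k, hk, rfl⟩
      obtain ⟨p, hp, rfl⟩ := mem_image.mp hk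
      rw [mem_product] at hp
      exact ⟨⟨p.1, hp.1, by simp⟩, ⟨p.2, hp.2, by simp⟩⟩

theorem FinRep.map {R : α → Finset β} (h : FinRep R) (e : β ≃ᵐ γ) :
    FinRep fun a => (R a).map e.toEquiv.toEmbedding := by
  obtain ⟨φ, M, hφ, hM, h⟩ := h
  refine ⟨fun n a => e (φ n a), M, fun n => e.measurable.comp (hφ n), hM, fun a => ?_⟩
  obtain ⟨s, hs, hi, hb⟩ := h a
  refine ⟨s, hs, fun n hn m hm h => hi hn hm (e.injective h), fun b => ?_⟩
  simp only [mem_map, hb]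
  constructor
  · rintro ⟨c, ⟨n, hn, rfl⟩, rfl⟩; exact ⟨n, hn, rfl⟩
  · rintro ⟨n, hn, rfl⟩; exact ⟨_, ⟨n, hn, rfl⟩, rfl⟩

theorem FinRep.comp {R : α → Finset β} (h : FinRep R) {g : γ → α} (hg : Measurable g) :
    FinRep fun c => R (g c) := by
  obtain ⟨φ, M, hφ, hM, h⟩ := h
  exact ⟨fun n c => φ n (g c), fun n => g ⁻¹' M n, fun n => (hφ n).comp hg, fun n => hg (hM n),
    fun c => h (g c)⟩

/-- Integration over `μ'` is summation over `R` followed by integration over `μ`. -/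
structure Unfold (μ : Measure α) (μ' : Measure β) (R : α → Finset β) : Prop where
  rep : FinRep R
  lint : ∀ f : β → ℝ≥0∞, Measurable f → ∫⁻ a, ∑ b ∈ R a, f b ∂μ = ∫⁻ b, f b ∂μ'

namespace Unfold

variable {μ : Measure α} {μ' : Measure β} {R : α → Finset β}

theorem ae (h : Unfold μ μ' R) {P : β → Prop} (hP : ∀ᵐ b ∂μ', P b) : ∀ᵐ a ∂μ, ∀ b ∈ R a, P b := by
  classical
  set S := toMeasurable μ' {b | ¬ P b} with hS
  have hSm : MeasurableSet S := measurableSet_toMeasurable _ _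
  have h0 : μ' S = 0 := by rw [hS, measure_toMeasurable]; exact hP
  have h1 : ∫⁻ a, ∑ b ∈ R a, S.indicator 1 b ∂μ = 0 := by
    rw [h.lint _ (measurable_one.indicator hSm), lintegral_indicator_one hSm, h0]
  rw [lintegral_eq_zero_iff (h.rep.measurable_sum (measurable_one.indicator hSm))] at h1
  filter_upwards [h1] with a ha b hb
  by_contra hPb
  have h2 := (Finset.sum_eq_zero_iff.mp ha) b hb
  rw [indicator_of_mem (subset_toMeasurable _ _ hPb)] at h2
  exact one_ne_zero h2

theorem aestronglyMeasurable_sum (h : Unfold μ μ' R) {E : Type*}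
    [TopologicalSpace E] [TopologicalSpace.PseudoMetrizableSpace E] [AddCommMonoid E]
    [ContinuousAdd E] {f : β → E} (hf : AEStronglyMeasurable f μ') :
    AEStronglyMeasurable (fun a => ∑ b ∈ R a, f b) μ := by
  refine ⟨_, h.rep.stronglyMeasurable_sum hf.stronglyMeasurable_mk, ?_⟩
  filter_upwards [h.ae hf.ae_eq_mk] with a ha
  exact sum_congr rfl ha

theorem lintegral (h : Unfold μ μ' R) {f : β → ℝ≥0∞} (hf : AEMeasurable f μ') :
    ∫⁻ a, ∑ b ∈ R a, f b ∂μ = ∫⁻ b, f b ∂μ' := by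
  rw [lintegral_congr_ae hf.ae_eq_mk, ← h.lint _ hf.measurable_mk]
  refine lintegral_congr_ae ?_
  filter_upwards [h.ae hf.ae_eq_mk] with a ha
  exact sum_congr rfl ha

/-- The correspondence as a kernel. -/
noncomputable def kernel (h : Unfold μ μ' R) : ProbabilityTheory.Kernel α β where
  toFun a := ∑ b ∈ R a, dirac b
  measurable' := by
    refine Measure.measurable_of_measurable_coe _ fun s hs => ?_
    have : (fun a => (∑ b ∈ R a, dirac b) s) = fun a => ∑ b ∈ R a, s.indicator 1 b := by
      ext a
      rw [Measure.finsetSum_apply]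
      exact sum_congr rfl fun b _ => Measure.dirac_apply' b hs
    rw [this]
    exact h.rep.measurable_sum (measurable_one.indicator hs)

theorem kernel_apply (h : Unfold μ μ' R) (a : α) :
    h.kernel a = ∑ b ∈ R a, dirac b := rfl

theorem bind_kernel (h : Unfold μ μ' R) : μ.bind h.kernel = μ' := by
  ext s hs
  rw [Measure.bind_apply hs h.kernel.aemeasurable, ← lintegral_indicator_one hs,
    ← h.lint _ (measurable_one.indicator hs)]
  refine lintegral_congr fun a => ?_
  rw [kernel_apply, Measure.finsetSum_apply]
  exact sum_congr rfl fun b _ => Measure.dirac_apply' b hs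

variable {E : Type*} [NormedAddCommGroup E]

theorem integrable (h : Unfold μ μ' R) {f : β → E} (hf : Integrable f μ') :
    Integrable (fun a => ∑ b ∈ R a, f b) μ := by
  refine ⟨h.aestronglyMeasurable_sum hf.1, ?_⟩
  have : ∫⁻ a, ‖∑ b ∈ R a, f b‖ₑ ∂μ ≤ ∫⁻ b, ‖f b‖ₑ ∂μ' := by
    rw [← h.lintegral hf.1.enorm]
    exact lintegral_mono fun a => enorm_sum_le _ _
  exact lt_of_le_of_lt this hf.2

theorem integral (h : Unfold μ μ' R) [NormedSpace ℝ E] [CompleteSpace E] {f : β → E}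
    (hf : Integrable f μ') : ∫ a, ∑ b ∈ R a, f b ∂μ = ∫ b, f b ∂μ' := by
  wlog hsm : StronglyMeasurable f generalizing f
  · have hmk := hf.1.ae_eq_mk
    rw [integral_congr_ae hmk, ← this (hf.congr hmk) hf.1.stronglyMeasurable_mk]
    refine integral_congr_ae ?_
    filter_upwards [h.ae hmk] with a ha
    exact sum_congr rfl ha
  have hf' : Integrable f ((h.kernel.comp (ProbabilityTheory.Kernel.const Unit μ)) ()) := by
    rw [← Measure.comp_eq_comp_const_apply, h.bind_kernel]; exact hf
  have := ProbabilityTheory.Kernel.integral_comp hf'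
  rw [← Measure.comp_eq_comp_const_apply, h.bind_kernel] at this
  rw [this, ProbabilityTheory.Kernel.const_apply]
  refine integral_congr_ae (Eventually.of_forall fun a => ?_)
  simp only [kernel_apply]
  rw [integral_finsetSum_measure]
  · exact sum_congr rfl fun b _ => (integral_dirac' f b hsm).symm
  · intro b _
    exact ⟨hsm.aestronglyMeasurable, by simp [HasFiniteIntegral, lintegral_dirac' _ hsm.enorm]⟩

theorem id (μ : Measure α) : Unfold μ μ fun a => {a} where
  rep := FinRep.id
  lint f _ := by simp

theorem prod {ν : Measure α'} {ν' : Measure β'} {R' : α' → Finset β'} [SFinite μ] [SFinite μ']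
    [SFinite ν] [SFinite ν'] (h : Unfold μ μ' R) (h' : Unfold ν ν' R') :
    Unfold (μ.prod ν) (μ'.prod ν') fun q => R q.1 ×ˢ R' q.2 where
  rep := h.rep.prod h'.rep
  lint f hf := by
    rw [lintegral_prod _ ((h.rep.prod h'.rep).measurable_sum hf).aemeasurable,
      lintegral_prod _ hf.aemeasurable, ← h.lint _ hf.lintegral_prod_right']
    refine lintegral_congr fun a => ?_
    simp_rw [sum_product]
    rw [lintegral_finsetSum (R a) (f := fun b y => ∑ b' ∈ R' y, f (b, b'))
      fun b _ => h'.rep.measurable_sum (hf.comp measurable_prodMk_left)]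
    exact sum_congr rfl fun b _ => h'.lint _ (hf.comp measurable_prodMk_left)

theorem map (h : Unfold μ μ' R) {ρ : Measure γ} (e : β ≃ᵐ γ) (he : MeasurePreserving e μ' ρ) :
    Unfold μ ρ fun a => (R a).map e.toEquiv.toEmbedding where
  rep := h.rep.map e
  lint f hf := by
    simp only [sum_map]
    rw [← he.lintegral_comp hf, ← h.lint (fun b => f (e b)) (hf.comp e.measurable)]
    rfl

theorem comp (h : Unfold μ μ' R) {ρ : Measure γ} {g : γ → α} (hg : MeasurePreserving g ρ μ) :
    Unfold ρ μ' fun c => R (g c) where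
  rep := h.rep.comp hg.measurable
  lint f hf := by
    rw [← h.lint f hf, ← hg.lintegral_comp (h.rep.measurable_sum hf)]

end Unfold

end Unfold

section Chains

variable {X : Type*} [MeasurableSpace X] [DecidableEq X] (N : Noise X)

/-- The ordered decompositions of a chain into two parts. -/
def splits (A : Finset X) : Finset C²[X] :=
  A.powerset.image fun θ => (θ, A \ θ)

theorem sum_splits {M : Type*} [AddCommMonoid M] (A : Finset X) (f : C²[X] → M) :
    ∑ q ∈ splits A, f q = ∑ θ ∈ A.powerset, f (θ, A \ θ) :=
  sum_image fun _ _ _ _ h => (Prod.mk.inj h).1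

theorem mem_splits {A θ : Finset X} (h : θ ⊆ A) : (θ, A \ θ) ∈ splits A :=
  mem_image_of_mem _ (mem_powerset.mpr h)

theorem union_of_mem_splits {A : Finset X} {q : C²[X]} (h : q ∈ splits A) :
    q.1 ∪ q.2 = A := by
  obtain ⟨θ, hθ, rfl⟩ := mem_image.mp h
  exact union_sdiff_of_subset (mem_powerset.mp hθ)

variable [StandardBorelSpace X]

theorem finRep_splits : FinRep (splits (X := X)) := by
  refine ⟨fun n A => (splitPart n A, A \ splitPart n A), freshSplit,
    fun n => (measurable_splitPart n).prodMk (measurable_sdiff_splitPart n),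
    measurableSet_freshSplit, fun A => ?_⟩
  classical
  have hex : ∀ θ : Finset X, ∃ n, θ ⊆ A → splitPart n A = θ := fun θ => by
    by_cases h : θ ⊆ A
    · obtain ⟨n, hn⟩ := exists_splitPart_eq h
      exact ⟨n, fun _ => hn⟩
    · exact ⟨0, fun h' => absurd h' h⟩
  let c : Finset X → ℕ := fun θ => Nat.find (hex θ)
  have hc : ∀ θ, θ ⊆ A → splitPart (c θ) A = θ := fun θ h => Nat.find_spec (hex θ) h
  refine ⟨A.powerset.image c, fun n => ?_, ?_, fun b => ?_⟩
  · simp only [mem_image, mem_powerset]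
    constructor
    · rintro ⟨θ, hθ, rfl⟩ m hm h
      exact Nat.find_min (hex θ) hm fun _ => h.trans (hc θ hθ)
    · intro hn
      refine ⟨splitPart n A, splitPart_subset n A, ?_⟩
      have h1 : c (splitPart n A) ≤ n := Nat.find_min' (hex _) fun _ => rfl
      rcases h1.lt_or_eq with h2 | h2
      · exact absurd (hc _ (splitPart_subset n A)) (hn _ h2)
      · exact h2
  · intro n hn m hm h
    simp only [coe_image, Set.mem_image, mem_coe, mem_powerset] at hn hm
    obtain ⟨θ, hθ, rfl⟩ := hn
    obtain ⟨θ', hθ', rfl⟩ := hm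
    have h' := (Prod.mk.inj h).1
    rw [hc θ hθ, hc θ' hθ'] at h'
    rw [h']
  · simp only [splits, mem_image, mem_powerset]
    constructor
    · rintro ⟨θ, hθ, rfl⟩
      exact ⟨c θ, ⟨θ, hθ, rfl⟩, by rw [hc θ hθ]⟩
    · rintro ⟨n, ⟨θ, hθ, rfl⟩, rfl⟩
      exact ⟨θ, hθ, by rw [hc θ hθ]⟩

theorem unfold_splits : Unfold ν[N] ν²[N] splits where
  rep := finRep_splits
  lint f hf := by
    have h := N.lintegral_sum_powerset (f := fun A B => f (A, B)) hf (by
      simpa only [sum_splits] using finRep_splits.measurable_sum hf)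
    simp_rw [sum_splits]
    rw [h, lintegral_prod _ hf.aemeasurable]

theorem ae_powerset {P : Finset X → Finset X → Prop}
    (h : ∀ᵐ q ∂ν²[N], P q.1 q.2) :
    ∀ᵐ A ∂ν[N], ∀ θ ⊆ A, P θ (A \ θ) := by
  filter_upwards [N.unfold_splits.ae h] with A hA θ hθ
  exact hA _ (mem_splits hθ)

theorem measurable_chain_union₂ :
    Measurable fun q : C²[X] => q.1 ∪ q.2 :=
  measurable_fst.chain_union measurable_snd

theorem quasiMeasurePreserving_union :
    QuasiMeasurePreserving (fun q : C²[X] => q.1 ∪ q.2) ν²[N] ν[N] := by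
  refine ⟨measurable_chain_union₂, Measure.AbsolutelyContinuous.mk fun S hS h0 => ?_⟩
  rw [map_apply measurable_chain_union₂ hS,
    ← lintegral_indicator_one (measurable_chain_union₂ hS),
    ← N.unfold_splits.lint _ (measurable_one.indicator (measurable_chain_union₂ hS))]
  refine (lintegral_eq_zero_iff (finRep_splits.measurable_sum
    (measurable_one.indicator (measurable_chain_union₂ hS)))).mpr ?_
  have : ∀ᵐ A ∂ν[N], A ∉ S := measure_eq_zero_iff_ae_notMem.mp h0
  filter_upwards [this] with A hA
  refine sum_eq_zero fun q hq => indicator_of_notMem ?_ _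
  rw [mem_preimage, union_of_mem_splits hq]
  exact hA

theorem ae_chain_of_ae {P : X → Prop} (h : ∀ᵐ x ∂N.vol, P x) :
    ∀ᵐ A ∂ν[N], ∀ x ∈ A, P x := by
  set E := toMeasurable N.vol {x | ¬ P x}
  have hE : MeasurableSet E := measurableSet_toMeasurable _ _
  have h0 : ∀ᵐ x ∂N.vol, x ∉ E := by
    rw [← measure_eq_zero_iff_ae_notMem, measure_toMeasurable]; exact h
  have : ∀ᵐ A ∂ν[N], ∀ x ∈ A, x ∉ E := by
    unfold chainMeasure
    refine (Measure.ae_sum_iff' (measurableSet_avoid hE)).mpr fun n => ?_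
    refine (ae_map_iff (measurable_image_univ n).aemeasurable (measurableSet_avoid hE)).mpr ?_
    refine ae_restrict_of_ae ?_
    have : ∀ᵐ v ∂(pi fun _ : Fin n => N.vol), ∀ i, v i ∉ E :=
      eventually_all.2 fun i =>
        (Measure.tendsto_eval_ae_ae (μ := fun _ : Fin n => N.vol) (i := i)).eventually h0
    filter_upwards [this] with v hv x hx
    obtain ⟨i, _, rfl⟩ := mem_image.mp hx
    exact hv i
  filter_upwards [this] with A hA x hx
  by_contra hP
  exact hA x hx (subset_toMeasurable _ _ hP)

theorem measurableSet_chain_disjoint :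
    MeasurableSet {q : C²[X] | Disjoint q.1 q.2} := by
  have : {q : C²[X] | Disjoint q.1 q.2} =
      ⋃ n, ({q | ∀ x ∈ q.1, x ∉ {x | interp n x = 1}} ∩
        {q | ∀ x ∈ q.2, x ∉ {x | interp n x = 1}ᶜ}) := by
    ext q
    simp only [mem_ofPred_eq, mem_iUnion, mem_inter_iff, Set.mem_compl_iff, not_not]
    constructor
    · intro h
      obtain ⟨n, hn⟩ := exists_interp_eq (q.1 ∪ q.2) fun y => if y ∈ q.2 then 1 else 0
      refine ⟨n, fun x hx => ?_, fun x hx => ?_⟩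
      · rw [hn x (mem_union_left _ hx), if_neg (disjoint_left.mp h hx)]; simp
      · rw [hn x (mem_union_right _ hx), if_pos hx]
    · rintro ⟨n, h1, h2⟩
      exact disjoint_left.mpr fun x hx hx' => h1 x hx (h2 x hx')
  rw [this]
  exact MeasurableSet.iUnion fun n =>
    (measurable_fst.chain_avoid (measurableSet_interp_eq n 1)).inter
      (measurable_snd.chain_avoid (measurableSet_interp_eq n 1).compl)

/-- The times of the points of a chain. -/
noncomputable def times (A : Finset X) : Finset ℝ≥0 := A.image N.time

theorem measurable_times : Measurable N.times := by
  refine measurable_to_chain fun E hE => ?_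
  simpa [times] using measurableSet_avoid (N.measurable_time hE)

theorem ae_times_disjoint :
    ∀ᵐ q ∂ν²[N], Disjoint (N.times q.1) (N.times q.2) := by
  refine (Measure.ae_prod_iff_ae_ae ?_).2 (Eventually.of_forall fun A => ?_)
  · exact ((N.measurable_times.comp measurable_fst).prodMk
      (N.measurable_times.comp measurable_snd)) measurableSet_chain_disjoint
  · have : ∀ᵐ y ∂N.vol, ∀ x ∈ A, N.time y ≠ N.time x :=
      (Filter.eventually_all_finset A).2 fun x _ => N.vol_time_eq _
    filter_upwards [N.ae_chain_of_ae this] with B hB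
    simp only [times, disjoint_left, mem_image]
    rintro _ ⟨x, hx, rfl⟩ ⟨y, hy, h⟩
    exact hB y hy x hx h

theorem ae_time_injOn : ∀ᵐ A : Finset X ∂ν[N], Set.InjOn N.time (A : Set X) := by
  filter_upwards [N.ae_powerset (P := fun θ κ => Disjoint (N.times θ) (N.times κ))
    N.ae_times_disjoint] with A hA x hx y hy h
  by_contra hxy
  refine disjoint_left.mp (hA {x} (by simpa using hx))
    (mem_image_of_mem _ (Finset.mem_singleton_self x)) (h ▸ ?_)
  exact mem_image_of_mem _ (mem_sdiff.mpr ⟨hy, by simpa using Ne.symm hxy⟩)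

theorem disjoint_of_times {A B : Finset X} (h : Disjoint (N.times A) (N.times B)) :
    Disjoint A B :=
  disjoint_left.mpr fun _ hx hx' => disjoint_left.mp h
    (mem_image_of_mem _ hx) (mem_image_of_mem _ hx')

theorem measurable_card_eq (n : ℕ) : MeasurableSet {A : Finset X | A.card = n} := by
  have h := measurable_chain_prod (X := X) (g := fun _ => 2) measurable_const
  convert h (measurableSet_singleton (2 ^ n)) using 1
  ext A
  simp only [prod_const, mem_preimage, Set.mem_singleton_iff, mem_ofPred_eq]
  constructor
  · rintro rfl; rfl
  · intro h
    have h' : ((2 ^ A.card : ℕ) : ℝ≥0∞) = ((2 ^ n : ℕ) : ℝ≥0∞) := by push_cast; exact h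
    exact Nat.pow_right_injective le_rfl (by exact_mod_cast h')

/-- On chains of one point the measure of chains is the measure of points. -/
theorem chainMeasure_restrict_card_one :
    ν[N].restrict {A | A.card = 1} = N.vol.map fun x => ({x} : Finset X) := by
  ext S hS
  have hS1 : MeasurableSet (S ∩ {A | A.card = 1}) := hS.inter (measurable_card_eq 1)
  rw [Measure.restrict_apply hS, map_apply measurable_chain_singleton hS,
    ← lintegral_indicator_one hS1, N.lintegral_chain (measurable_one.indicator hS1),
    tsum_eq_single 1]
  · have h := measurePreserving_funUnique N.vol (Fin 1)
    rw [← lintegral_indicator_one (measurable_chain_singleton hS),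
      ← h.lintegral_comp_emb (MeasurableEquiv.measurableEmbedding _)]
    simp only [Nat.factorial_one, Nat.cast_one, inv_one, one_mul]
    refine lintegral_congr fun v => ?_
    have : univ.image v = {MeasurableEquiv.funUnique (Fin 1) X v} := by
      ext x; simp
    rw [this]
    by_cases hx : ({MeasurableEquiv.funUnique (Fin 1) X v} : Finset X) ∈ S
    · rw [indicator_of_mem (Set.mem_inter hx (card_singleton _)),
        indicator_of_mem (mem_preimage.mpr hx)]
      rfl
    · rw [indicator_of_notMem fun h => hx h.1,
        indicator_of_notMem fun h => hx (mem_preimage.mp h)]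
  · intro n hn
    rw [lintegral_eq_zero_of_ae_eq_zero, mul_zero]
    filter_upwards [N.ae_pi_time_injective] with v hv
    refine indicator_of_notMem (fun h => hn ?_) _
    have h2 : (univ.image v).card = 1 := h.2
    rwa [Finset.card_image_of_injective _ (fun i j h => hv (congrArg N.time h)),
      card_univ, Fintype.card_fin] at h2

theorem chainMeasure_restrict_empty : ν[N].restrict {∅} = dirac (∅ : Finset X) := by
  ext S hS
  have hS1 : MeasurableSet (S ∩ {(∅ : Finset X)}) := hS.inter (measurableSet_singleton _)
  rw [Measure.restrict_apply hS, ← lintegral_indicator_one hS1,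
    N.lintegral_chain (measurable_one.indicator hS1), tsum_eq_single 0]
  · have hc : ∀ v : Fin 0 → X, univ.image v = ∅ := fun v => by simp
    simp_rw [hc]
    rw [lintegral_const]
    have : (pi fun _ : Fin 0 => N.vol) Set.univ = 1 := by
      simp
    rw [this, Measure.dirac_apply' _ hS]
    by_cases h : (∅ : Finset X) ∈ S <;> simp [h]
  · intro n hn
    have hc : ∀ v : Fin n → X, (S ∩ {(∅ : Finset X)}).indicator (1 : Finset X → ℝ≥0∞)
        (univ.image v) = 0 := by
      intro v
      refine indicator_of_notMem (fun h => ?_) _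
      have h2 : univ.image v = ∅ := h.2
      rw [Finset.image_eq_empty] at h2
      have := congrArg Finset.card h2
      simp at this
      exact hn this
    simp_rw [hc]
    simp

theorem lintegral_pi_prod {n : ℕ} {g : X → ℝ≥0∞} (hg : Measurable g) :
    ∫⁻ v, ∏ i, g (v i) ∂(pi fun _ : Fin n => N.vol) = (∫⁻ x, g x ∂N.vol) ^ n := by
  induction n with
  | zero => simp
  | succ n ih =>
    have h := measurePreserving_piFinSuccAbove (fun _ : Fin (n + 1) => N.vol) 0
    have h1 : ∫⁻ v, ∏ i, g (v i) ∂(pi fun _ : Fin (n + 1) => N.vol) =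
        ∫⁻ q : X × (Fin n → X), g q.1 * ∏ i, g (q.2 i)
          ∂(N.vol.prod (pi fun _ : Fin n => N.vol)) := by
      rw [← h.lintegral_comp_emb (MeasurableEquiv.measurableEmbedding _)]
      refine lintegral_congr fun v => ?_
      rw [Fin.prod_univ_succ]
      rfl
    have hm : Measurable fun v : Fin n → X => ∏ i, g (v i) :=
      Finset.measurable_fun_prod _ fun i _ => hg.comp (measurable_pi_apply i)
    rw [h1, lintegral_prod_mul hg.aemeasurable hm.aemeasurable, ih, pow_succ, mul_comm]

theorem lintegral_chain_prod_lt_top {g : X → ℝ≥0∞} (hg : Measurable g)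
    (hfin : ∫⁻ x, g x ∂N.vol < ∞) : ∫⁻ A, ∏ x ∈ A, g x ∂ν[N] < ∞ := by
  have h1 : ∀ n : ℕ, ∫⁻ v, ∏ x ∈ univ.image v, g x
      ∂(pi fun _ : Fin n => N.vol) = (∫⁻ x, g x ∂N.vol) ^ n := by
    intro n
    rw [← N.lintegral_pi_prod hg]
    refine lintegral_congr_ae ?_
    filter_upwards [N.ae_pi_time_injective] with v hv
    exact Finset.prod_image fun i _ j _ h => hv (congrArg N.time h)
  rw [N.lintegral_chain (measurable_chain_prod hg)]
  simp_rw [h1]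
  lift (∫⁻ x, g x ∂N.vol) to ℝ≥0 using hfin.ne with c
  have h2 : ∀ n : ℕ, ((n.factorial : ℝ≥0∞)⁻¹ * (c : ℝ≥0∞) ^ n) =
      (((n.factorial : ℝ≥0)⁻¹ * c ^ n : ℝ≥0) : ℝ≥0∞) := by
    intro n
    push_cast
    rw [ENNReal.coe_inv (by exact_mod_cast n.factorial_ne_zero)]
    simp
  simp_rw [h2]
  refine lt_top_iff_ne_top.mpr (ENNReal.tsum_coe_ne_top_iff_summable.mpr ?_)
  rw [← NNReal.summable_coe]
  convert Real.summable_pow_div_factorial (c : ℝ) using 2 with n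
  push_cast
  rw [div_eq_inv_mul]

end Chains

end Noise

/-! ### Rearrangements of product measures -/

theorem MeasureTheory.MeasurePreserving.integral_comp_of_aestronglyMeasurable {α β E : Type*}
    [MeasurableSpace α] [MeasurableSpace β] [NormedAddCommGroup E] [NormedSpace ℝ E]
    {μ : Measure α} {ν : Measure β} {g : α → β} (hg : MeasurePreserving g μ ν) {f : β → E}
    (hf : AEStronglyMeasurable f ν) : ∫ x, f (g x) ∂μ = ∫ y, f y ∂ν := by
  rw [← hg.map_eq] at hf ⊢
  exact (integral_map hg.measurable.aemeasurable hf).symm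

theorem MeasureTheory.measurePreserving_prodProdProdComm {α β γ δ : Type*} [MeasurableSpace α]
    [MeasurableSpace β] [MeasurableSpace γ] [MeasurableSpace δ] (μ₁ : Measure α) (μ₂ : Measure β)
    (μ₃ : Measure γ) (μ₄ : Measure δ) [SFinite μ₁] [SFinite μ₂] [SFinite μ₃] [SFinite μ₄] :
    MeasurePreserving (fun q : (α × β) × (γ × δ) => ((q.1.1, q.2.1), (q.1.2, q.2.2)))
      ((μ₁.prod μ₂).prod (μ₃.prod μ₄)) ((μ₁.prod μ₃).prod (μ₂.prod μ₄)) := by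
  have h1 := measurePreserving_prodAssoc μ₁ μ₂ (μ₃.prod μ₄)
  have h2 := (measurePreserving_prodAssoc μ₂ μ₃ μ₄).symm MeasurableEquiv.prodAssoc
  have h3 : MeasurePreserving (Prod.map Prod.swap id : (β × γ) × δ → (γ × β) × δ)
      ((μ₂.prod μ₃).prod μ₄) ((μ₃.prod μ₂).prod μ₄) :=
    measurePreserving_swap.prod (MeasurePreserving.id _)
  have h4 := measurePreserving_prodAssoc μ₃ μ₂ μ₄
  have h5 := (measurePreserving_prodAssoc μ₁ μ₃ (μ₂.prod μ₄)).symm MeasurableEquiv.prodAssoc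
  exact h5.comp (((MeasurePreserving.id μ₁).prod (h4.comp (h3.comp h2))).comp h1)

/-! ### Tables, weights and the norm estimate -/

theorem ENNReal.sum_mul_sq_le {ι : Type*} (s : Finset ι) (f g : ι → ℝ≥0∞) :
    (∑ i ∈ s, f i * g i) ^ 2 ≤ (∑ i ∈ s, f i ^ 2) * ∑ i ∈ s, g i ^ 2 := by
  have h := ENNReal.inner_le_Lp_mul_Lq s f g Real.HolderConjugate.two_two
  calc (∑ i ∈ s, f i * g i) ^ 2
      ≤ ((∑ i ∈ s, f i ^ (2 : ℝ)) ^ (1 / (2 : ℝ)) * (∑ i ∈ s, g i ^ (2 : ℝ)) ^ (1 / (2 : ℝ))) ^ 2 :=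
        pow_le_pow_left₀ zero_le h 2
    _ = _ := by
        rw [mul_pow, ← rpow_natCast, ← rpow_natCast, ← ENNReal.rpow_mul,
          ← ENNReal.rpow_mul]
        norm_num

theorem MeasureTheory.lintegral_mul_sq_le {α : Type*} [MeasurableSpace α] (μ : Measure α)
    {f g : α → ℝ≥0∞} (hf : AEMeasurable f μ) (hg : AEMeasurable g μ) :
    (∫⁻ a, f a * g a ∂μ) ^ 2 ≤ (∫⁻ a, f a ^ 2 ∂μ) * ∫⁻ a, g a ^ 2 ∂μ := by
  have h := ENNReal.lintegral_mul_le_Lp_mul_Lq μ Real.HolderConjugate.two_two hf hg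
  calc (∫⁻ a, f a * g a ∂μ) ^ 2
      ≤ ((∫⁻ a, f a ^ (2 : ℝ) ∂μ) ^ (1 / (2 : ℝ)) *
          (∫⁻ a, g a ^ (2 : ℝ) ∂μ) ^ (1 / (2 : ℝ))) ^ 2 := pow_le_pow_left₀ zero_le h 2
    _ = _ := by
        rw [mul_pow, ← rpow_natCast, ← rpow_natCast, ← ENNReal.rpow_mul,
          ← ENNReal.rpow_mul]
        norm_num

section

variable {X : Type*} [MeasurableSpace X] [DecidableEq X]

namespace Table

theorem measurable_toProd : Measurable (toProd (X := X)) := fun _ hs => ⟨_, hs, rfl⟩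

theorem measurable_ofProd : Measurable (ofProd (X := X)) := by
  rintro _ ⟨S, hS, rfl⟩
  exact hS

/-- Tables as quadruples of chains. -/
def equivProd : C⁴[X] ≃ᵐ Table X where
  toFun := ofProd
  invFun := toProd
  left_inv _ := rfl
  right_inv _ := rfl
  measurable_toFun := measurable_ofProd
  measurable_invFun := measurable_toProd

variable {Y : Type*} [MeasurableSpace Y]

theorem measurable_mk {f g h k : Y → Finset X} (hf : Measurable f) (hg : Measurable g)
    (hh : Measurable h) (hk : Measurable k) :
    Measurable fun y => (⟨f y, g y, h y, k y⟩ : Table X) :=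
  measurable_ofProd.comp ((hf.prodMk hg).prodMk (hh.prodMk hk))

theorem measurable_m0 : Measurable fun ϰ : Table X => ϰ.m0 :=
  measurable_fst.comp (measurable_fst.comp measurable_toProd)

theorem measurable_mp : Measurable fun ϰ : Table X => ϰ.mp :=
  measurable_snd.comp (measurable_fst.comp measurable_toProd)

theorem measurable_oo : Measurable fun ϰ : Table X => ϰ.oo :=
  measurable_fst.comp (measurable_snd.comp measurable_toProd)

theorem measurable_op : Measurable fun ϰ : Table X => ϰ.op :=
  measurable_snd.comp (measurable_snd.comp measurable_toProd)

theorem measurable_conj : Measurable (conj (X := X)) :=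
  measurable_mk measurable_op measurable_mp measurable_oo measurable_m0

theorem measurable_dom [StandardBorelSpace X] : Measurable (dom (X := X)) :=
  measurable_oo.chain_union measurable_m0

theorem measurable_cod [StandardBorelSpace X] : Measurable (cod (X := X)) :=
  measurable_oo.chain_union measurable_op

theorem measurable_union [StandardBorelSpace X] {f g : Y → Table X} (hf : Measurable f)
    (hg : Measurable g) : Measurable fun y => (f y).union (g y) :=
  measurable_mk ((measurable_m0.comp hf).chain_union (measurable_m0.comp hg))
    ((measurable_mp.comp hf).chain_union (measurable_mp.comp hg))
    ((measurable_oo.comp hf).chain_union (measurable_oo.comp hg))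
    ((measurable_op.comp hf).chain_union (measurable_op.comp hg))

end Table

namespace Noise

variable (N : Noise X)

theorem measurePreserving_equivProd :
    MeasurePreserving (Table.equivProd (X := X)) (ν²[N].prod ν²[N])
      τ[N] :=
  ⟨Table.equivProd.measurable, rfl⟩

instance sfinite_tableMeasure : SFinite τ[N] := by
  unfold tableMeasure; infer_instance

theorem ae_table_iff {P : Table X → Prop} :
    (∀ᵐ ϰ ∂τ[N], P ϰ) ↔
      ∀ᵐ q ∂ν²[N].prod ν²[N],
        P (Table.ofProd q) :=
  (MeasurableEmbedding.ae_map_iff (Table.equivProd (X := X)).measurableEmbedding)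

theorem qmp_m0 : QuasiMeasurePreserving (fun ϰ : Table X => ϰ.m0) τ[N] ν[N] :=
  (QuasiMeasurePreserving.fst quasiMeasurePreserving_fst).comp
    (N.measurePreserving_equivProd.symm Table.equivProd).quasiMeasurePreserving

theorem qmp_mp : QuasiMeasurePreserving (fun ϰ : Table X => ϰ.mp) τ[N] ν[N] :=
  (QuasiMeasurePreserving.snd quasiMeasurePreserving_fst).comp
    (N.measurePreserving_equivProd.symm Table.equivProd).quasiMeasurePreserving

theorem qmp_oo : QuasiMeasurePreserving (fun ϰ : Table X => ϰ.oo) τ[N] ν[N] :=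
  (QuasiMeasurePreserving.fst quasiMeasurePreserving_snd).comp
    (N.measurePreserving_equivProd.symm Table.equivProd).quasiMeasurePreserving

theorem qmp_op : QuasiMeasurePreserving (fun ϰ : Table X => ϰ.op) τ[N] ν[N] :=
  (QuasiMeasurePreserving.snd quasiMeasurePreserving_snd).comp
    (N.measurePreserving_equivProd.symm Table.equivProd).quasiMeasurePreserving

theorem measurePreserving_conj :
    MeasurePreserving (Table.conj (X := X)) τ[N] τ[N] := by
  let ν := ν[N]
  have hc := measurePreserving_prodProdProdComm ν ν ν ν
  have hs := measurePreserving_swap (μ := ν) (ν := ν)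
  have h1 := (MeasurePreserving.id (ν.prod ν)).prod hs
  have h2 := hs.prod (MeasurePreserving.id (ν.prod ν))
  exact (N.measurePreserving_equivProd.comp (h1.comp (hc.comp (h2.comp (hc.comp h1))))).comp
    (N.measurePreserving_equivProd.symm Table.equivProd)

end Noise

end

section

variable {X : Type*} [MeasurableSpace X] [DecidableEq X]

namespace Weight

/-- Measurability of the entries of a weight. -/
structure Meas (ζ : Weight X) : Prop where
  m0 : Measurable ζ.m0
  mp : Measurable ζ.mp
  oo : Measurable ζ.oo
  op : Measurable ζ.op

/-- The entrywise order of weights at a point. -/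
def LeAt (ζ ζ' : Weight X) (x : X) : Prop :=
  ζ.m0 x ≤ ζ'.m0 x ∧ ζ.mp x ≤ ζ'.mp x ∧ ζ.oo x ≤ ζ'.oo x ∧ ζ.op x ≤ ζ'.op x

theorem coe_prod (ζ : Weight X) (ϰ : Table X) : (ζ.prod ϰ : ℝ≥0∞) =
    (∏ x ∈ ϰ.m0, (ζ.m0 x : ℝ≥0∞)) * (∏ x ∈ ϰ.mp, (ζ.mp x : ℝ≥0∞)) *
      (∏ x ∈ ϰ.oo, (ζ.oo x : ℝ≥0∞)) * ∏ x ∈ ϰ.op, (ζ.op x : ℝ≥0∞) := by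
  simp [prod]

theorem Meas.measurable_prod [StandardBorelSpace X] {ζ : Weight X} (h : ζ.Meas) :
    Measurable fun ϰ => (ζ.prod ϰ : ℝ≥0∞) := by
  simp_rw [coe_prod]
  exact ((((measurable_chain_prod h.m0.coe_nnreal_ennreal).comp Table.measurable_m0).mul
    ((measurable_chain_prod h.mp.coe_nnreal_ennreal).comp Table.measurable_mp)).mul
    ((measurable_chain_prod h.oo.coe_nnreal_ennreal).comp Table.measurable_oo)).mul
    ((measurable_chain_prod h.op.coe_nnreal_ennreal).comp Table.measurable_op)

theorem Integrable.exists_meas {ζ : Weight X} {μ : Measure X} (h : ζ.Integrable μ) :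
    ∃ ζ' : Weight X, ζ'.Meas ∧ ζ'.Integrable μ ∧ ∀ᵐ x ∂μ, ζ.LeAt ζ' x ∧ ζ'.LeAt ζ x := by
  have key : ∀ {f : X → ℝ≥0}, AEStronglyMeasurable (fun x => (f x : ℝ)) μ →
      ∃ g : X → ℝ≥0, Measurable g ∧ f =ᵐ[μ] g := by
    intro f hf
    have : AEMeasurable f μ := by simpa using hf.aemeasurable.real_toNNReal
    exact ⟨this.mk f, this.measurable_mk, this.ae_eq_mk⟩
  obtain ⟨a, ha, ha'⟩ := key h.m0.1
  obtain ⟨b, hb, hb'⟩ := key h.mp.1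
  obtain ⟨c, hc, hc'⟩ := key h.oo.1
  obtain ⟨d, hd, hd'⟩ := key h.op.1
  have hq : ∀ {f g : X → ℝ≥0}, f =ᵐ[μ] g → (fun x => (f x : ℝ)) =ᵐ[μ] fun x => (g x : ℝ) :=
    fun h => h.mono fun x hx => by simp [hx]
  refine ⟨⟨a, b, c, d⟩, ⟨ha, hb, hc, hd⟩, ⟨h.m0.ae_eq (hq ha'), h.mp.ae_eq (hq hb'),
    h.oo.ae_eq (hq hc'), h.op.ae_eq (hq hd')⟩, ?_⟩
  filter_upwards [ha', hb', hc', hd'] with x h1 h2 h3 h4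
  simp [LeAt, h1, h2, h3, h4]

theorem prod_le_prod {ζ ζ' : Weight X} {ϰ : Table X}
    (h : ∀ x ∈ ϰ.m0 ∪ ϰ.mp ∪ ϰ.oo ∪ ϰ.op, ζ.LeAt ζ' x) : ζ.prod ϰ ≤ ζ'.prod ϰ := by
  have hm : ∀ {A : Finset X} {f g : X → ℝ≥0}, (∀ x ∈ A, f x ≤ g x) →
      ∏ x ∈ A, f x ≤ ∏ x ∈ A, g x := fun h => Finset.prod_le_prod' h
  unfold prod
  refine mul_le_mul' (mul_le_mul' (mul_le_mul' ?_ ?_) ?_) ?_ <;> refine hm fun x hx => ?_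
  · exact (h x (by simp [hx])).1
  · exact (h x (by simp [hx])).2.1
  · exact (h x (by simp [hx])).2.2.1
  · exact (h x (by simp [hx])).2.2.2

end Weight

namespace Noise

variable (N : Noise X) [StandardBorelSpace X]

theorem ae_table_of_ae {P : X → Prop} (h : ∀ᵐ x ∂N.vol, P x) :
    ∀ᵐ ϰ ∂τ[N], ∀ x ∈ ϰ.m0 ∪ ϰ.mp ∪ ϰ.oo ∪ ϰ.op, P x := by
  have h := N.ae_chain_of_ae h
  filter_upwards [N.qmp_m0.ae h, N.qmp_mp.ae h, N.qmp_oo.ae h, N.qmp_op.ae h] with ϰ h1 h2 h3 h4 x hx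
  simp only [mem_union] at hx
  rcases hx with ((hx | hx) | hx) | hx
  exacts [h1 x hx, h2 x hx, h3 x hx, h4 x hx]

theorem ae_prod_le {ζ ζ' : Weight X} (h : ∀ᵐ x ∂N.vol, ζ.LeAt ζ' x) :
    ∀ᵐ ϰ ∂τ[N], ζ.prod ϰ ≤ ζ'.prod ϰ := by
  filter_upwards [N.ae_table_of_ae h] with ϰ hϰ using Weight.prod_le_prod hϰ

/-- The positive counterpart of the Fock representation. -/
noncomputable def efock (w : Table X → ℝ≥0∞) (α : Finset X → ℝ≥0∞) (ϰ : Finset X) : ℝ≥0∞ :=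
  ∑ σ ∈ ϰ.powerset, ∫⁻ p, w ⟨p.1, p.2, σ, ϰ \ σ⟩ * α (σ ∪ p.1) ∂ν²[N]

variable {N}

theorem measurable_dom₂ : Measurable fun q : C⁴[X] =>
    q.1.1 ∪ q.2.1 :=
  (measurable_fst.comp measurable_fst).chain_union (measurable_fst.comp measurable_snd)

theorem measurable_efock {w : Table X → ℝ≥0∞} (hw : Measurable w) {α : Finset X → ℝ≥0∞}
    (hα : Measurable α) : Measurable (N.efock w α) := by
  have h1 : Measurable fun q : C⁴[X] =>
      w ⟨q.2.1, q.2.2, q.1.1, q.1.2⟩ * α (q.1.1 ∪ q.2.1) :=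
    (hw.comp (Table.measurable_mk (measurable_fst.comp measurable_snd)
      (measurable_snd.comp measurable_snd) (measurable_fst.comp measurable_fst)
      (measurable_snd.comp measurable_fst))).mul (hα.comp measurable_dom₂)
  have h2 := finRep_splits.measurable_sum
    (h1.lintegral_prod_right' (ν := ν²[N]))
  simp only [sum_splits] at h2
  exact h2

/-- The values of an almost everywhere valid relation in the Fock representation. -/
theorem ae_fock {P : Table X → Prop} (h : ∀ᵐ ϰ ∂τ[N], P ϰ) :
    ∀ᵐ ϰ ∂ν[N], ∀ σ ⊆ ϰ, ∀ᵐ p ∂ν²[N],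
      P ⟨p.1, p.2, σ, ϰ \ σ⟩ := by
  have h1 : ∀ᵐ q : C⁴[X] ∂ν²[N].prod ν²[N],
      P ⟨q.1.1, q.1.2, q.2.1, q.2.2⟩ := N.ae_table_iff.mp h
  have h2 : ∀ᵐ q : C⁴[X] ∂ν²[N].prod ν²[N],
      P ⟨q.2.1, q.2.2, q.1.1, q.1.2⟩ :=
    (measurePreserving_swap (μ := ν²[N])
      (ν := ν²[N])).quasiMeasurePreserving.ae h1
  have h3 : ∀ᵐ q : C²[X] ∂ν²[N],
      ∀ᵐ p : C²[X] ∂ν²[N],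
        P ⟨p.1, p.2, q.1, q.2⟩ := ae_ae_of_ae_prod h2
  filter_upwards [N.unfold_splits.ae h3] with ϰ hϰ σ hσ using hϰ _ (mem_splits hσ)

theorem ae_dom_of_ae {P : Finset X → Prop} (h : ∀ᵐ A ∂ν[N], P A) :
    ∀ᵐ ϰ ∂τ[N], P ϰ.dom := by
  have h1 := N.quasiMeasurePreserving_union.ae h
  rw [ae_table_iff]
  have h2 : QuasiMeasurePreserving
      (fun q : C⁴[X] => (q.2.1, q.1.1)) (ν²[N].prod ν²[N]) ν²[N] :=
    (QuasiMeasurePreserving.prodMap quasiMeasurePreserving_fst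
      quasiMeasurePreserving_fst).comp
      measurePreserving_swap.quasiMeasurePreserving
  exact h2.ae h1

theorem efock_mono_ae {w w' : Table X → ℝ≥0∞} {α α' : Finset X → ℝ≥0∞}
    (hw : ∀ᵐ ϰ ∂τ[N], w ϰ ≤ w' ϰ) (hα : ∀ᵐ A ∂ν[N], α A ≤ α' A) :
    ∀ᵐ ϰ ∂ν[N], N.efock w α ϰ ≤ N.efock w' α' ϰ := by
  filter_upwards [ae_fock hw, ae_fock (ae_dom_of_ae hα)] with ϰ h1 h2
  refine sum_le_sum fun σ hσ => lintegral_mono_ae ?_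
  filter_upwards [h1 σ (mem_powerset.mp hσ), h2 σ (mem_powerset.mp hσ)] with p h3 h4
  exact mul_le_mul' h3 h4

theorem measurable_pow_card (c : ℝ≥0∞) : Measurable fun A : Finset X => c ^ A.card := by
  simpa using measurable_chain_prod (X := X) (g := fun _ => c) measurable_const

theorem sum_powerset_pow (c d : ℝ≥0∞) (A : Finset X) :
    ∑ σ ∈ A.powerset, c ^ σ.card * d ^ (A \ σ).card = (c + d) ^ A.card := by
  have := Finset.prod_add (fun _ : X => c) (fun _ => d) A
  simpa using this.symm

variable (N) in
theorem lintegral_chain_union_pow (s κ : ℝ≥0∞) {g : Finset X → ℝ≥0∞} (hg : Measurable g) :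
    ∫⁻ σ, s ^ σ.card * ∫⁻ ρ, κ ^ ρ.card * g (σ ∪ ρ) ∂ν[N] ∂ν[N] =
      ∫⁻ ϰ, (s + κ) ^ ϰ.card * g ϰ ∂ν[N] := by
  have hm : Measurable fun q : C²[X] =>
      s ^ q.1.card * (κ ^ q.2.card * g (q.1 ∪ q.2)) :=
    ((measurable_pow_card s).comp measurable_fst).mul
      (((measurable_pow_card κ).comp measurable_snd).mul (hg.comp measurable_chain_union₂))
  have h := N.unfold_splits.lint _ hm
  rw [lintegral_prod _ hm.aemeasurable] at h
  have h1 : ∀ σ : Finset X, s ^ σ.card * ∫⁻ ρ, κ ^ ρ.card * g (σ ∪ ρ) ∂ν[N] =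
      ∫⁻ ρ, s ^ σ.card * (κ ^ ρ.card * g (σ ∪ ρ)) ∂ν[N] := fun σ =>
    (lintegral_const_mul _ ((measurable_pow_card κ).mul
      (hg.comp (measurable_chain_union₂.comp measurable_prodMk_left)))).symm
  simp_rw [h1]
  rw [← h]
  refine lintegral_congr fun ϰ => ?_
  rw [sum_splits, ← sum_powerset_pow, sum_mul]
  refine sum_congr rfl fun σ hσ => ?_
  rw [union_sdiff_of_subset (mem_powerset.mp hσ), mul_assoc]

theorem efock_weight_le {ζ : Weight X} (hζ : ζ.Meas) {α : Finset X → ℝ≥0∞} (hα : Measurable α)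
    {z : ℝ≥0} {ϰ : Finset X} (hz : ∀ x ∈ ϰ, ζ.oo x ≤ z) :
    N.efock (fun ϰ => (ζ.prod ϰ : ℝ≥0∞)) α ϰ ≤
      (∫⁻ A, ∏ x ∈ A, (ζ.mp x : ℝ≥0∞) ∂ν[N]) *
        ∑ σ ∈ ϰ.powerset, (z : ℝ≥0∞) ^ σ.card * ((∏ x ∈ ϰ \ σ, (ζ.op x : ℝ≥0∞)) *
          ∫⁻ ρ, (∏ x ∈ ρ, (ζ.m0 x : ℝ≥0∞)) * α (σ ∪ ρ) ∂ν[N]) := by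
  unfold efock
  rw [mul_sum]
  refine sum_le_sum fun σ hσ => ?_
  have h1 : ∀ p : C²[X],
      (ζ.prod ⟨p.1, p.2, σ, ϰ \ σ⟩ : ℝ≥0∞) * α (σ ∪ p.1) =
      ((∏ x ∈ σ, (ζ.oo x : ℝ≥0∞)) * (∏ x ∈ ϰ \ σ, (ζ.op x : ℝ≥0∞))) *
        (((∏ x ∈ p.1, (ζ.m0 x : ℝ≥0∞)) * α (σ ∪ p.1)) * ∏ x ∈ p.2, (ζ.mp x : ℝ≥0∞)) := by
    intro p; rw [Weight.coe_prod]; ring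
  have hm1 : Measurable fun ρ : Finset X => (∏ x ∈ ρ, (ζ.m0 x : ℝ≥0∞)) * α (σ ∪ ρ) :=
    (measurable_chain_prod hζ.m0.coe_nnreal_ennreal).mul
      (hα.comp (measurable_chain_union₂.comp measurable_prodMk_left))
  have hm2 : Measurable fun ρ : Finset X => ∏ x ∈ ρ, (ζ.mp x : ℝ≥0∞) :=
    measurable_chain_prod hζ.mp.coe_nnreal_ennreal
  have h3 : Measurable fun p : C²[X] =>
      ((∏ x ∈ p.1, (ζ.m0 x : ℝ≥0∞)) * α (σ ∪ p.1)) * ∏ x ∈ p.2, (ζ.mp x : ℝ≥0∞) :=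
    (hm1.comp measurable_fst).mul (hm2.comp measurable_snd)
  simp_rw [h1]
  rw [lintegral_const_mul _ h3, lintegral_prod_mul hm1.aemeasurable hm2.aemeasurable]
  have h2 : ∏ x ∈ σ, (ζ.oo x : ℝ≥0∞) ≤ (z : ℝ≥0∞) ^ σ.card :=
    Finset.prod_le_pow_card _ _ _ fun x hx =>
      coe_le_coe.mpr (hz x (mem_powerset.mp hσ hx))
  calc _ = (∏ x ∈ σ, (ζ.oo x : ℝ≥0∞)) * ((∫⁻ A, ∏ x ∈ A, (ζ.mp x : ℝ≥0∞) ∂ν[N]) *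
        ((∏ x ∈ ϰ \ σ, (ζ.op x : ℝ≥0∞)) *
          ∫⁻ ρ, (∏ x ∈ ρ, (ζ.m0 x : ℝ≥0∞)) * α (σ ∪ ρ) ∂ν[N])) := by ring
    _ ≤ (z : ℝ≥0∞) ^ σ.card * _ := mul_le_mul' h2 le_rfl
    _ = _ := by ring

/-- The norm estimate for the Fock representation. -/
theorem efock_sq_le {ζ : Weight X} (hζ : ζ.Meas) (hint : ζ.Integrable N.vol) {z : ℝ≥0}
    (hz : ∀ᵐ x ∂N.vol, ζ.oo x ≤ z) {ξm δ κ : ℝ≥0} (hδ : δ ≠ 0) (hκ : κ ≠ 0) :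
    ∃ K : ℝ≥0, ∀ α : Finset X → ℝ≥0∞, Measurable α →
      ∫⁻ ϰ, (ξm : ℝ≥0∞) ^ ϰ.card * N.efock (fun ϰ => (ζ.prod ϰ : ℝ≥0∞)) α ϰ ^ 2 ∂ν[N] ≤
        K * ∫⁻ ϰ, ((ξm * (1 + δ ^ 2) * z ^ 2 + κ ^ 2 : ℝ≥0) : ℝ≥0∞) ^ ϰ.card * α ϰ ^ 2 ∂ν[N] := by
  have hsq : ∀ (c : ℝ≥0) {g : X → ℝ≥0}, Measurable g → MemLp (fun x => (g x : ℝ)) 2 N.vol →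
      ∫⁻ A, ∏ x ∈ A, ((c * g x ^ 2 : ℝ≥0) : ℝ≥0∞) ∂ν[N] < ∞ := by
    intro c g hg h
    refine N.lintegral_chain_prod_lt_top (hg.pow_const 2 |>.const_mul c).coe_nnreal_ennreal ?_
    simp only [ENNReal.coe_mul]
    rw [lintegral_const_mul _ (hg.pow_const 2).coe_nnreal_ennreal]
    refine mul_lt_top coe_lt_top ?_
    have := h.2
    rw [eLpNorm_lt_top_iff_lintegral_rpow_enorm_lt_top (by simp) (by simp)] at this
    convert this using 2
    ext x
    simp
  set E := ∫⁻ A, ∏ x ∈ A, (ζ.mp x : ℝ≥0∞) ∂ν[N] with hE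
  have hEfin : E < ∞ := by
    refine N.lintegral_chain_prod_lt_top hζ.mp.coe_nnreal_ennreal ?_
    have := hint.mp.2
    rw [eLpNorm_one_eq_lintegral_enorm] at this
    convert this using 2
    ext x
    simp
  set C3 := ∫⁻ A, ∏ x ∈ A, (((κ ^ 2)⁻¹ * ζ.m0 x ^ 2 : ℝ≥0) : ℝ≥0∞) ∂ν[N] with hC3
  set C4 := ∫⁻ A, ∏ x ∈ A, ((ξm * (1 + δ ^ 2) * (δ ^ 2)⁻¹ * ζ.op x ^ 2 : ℝ≥0) : ℝ≥0∞) ∂ν[N] with hC4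
  let w : ℝ≥0∞ := ((ξm * (1 + δ ^ 2) * z ^ 2 : ℝ≥0) : ℝ≥0∞)
  let d : ℝ≥0∞ := ((1 + δ ^ 2 : ℝ≥0) : ℝ≥0∞)
  let D : Finset X → ℝ≥0∞ := fun A => ∏ x ∈ A, ((δ⁻¹ * ζ.op x : ℝ≥0) : ℝ≥0∞)
  let G : Finset X → ℝ≥0∞ := fun A =>
    ∏ x ∈ A, ((ξm * (1 + δ ^ 2) * (δ ^ 2)⁻¹ * ζ.op x ^ 2 : ℝ≥0) : ℝ≥0∞)
  have hK : E ^ 2 * C3 * C4 ≠ ∞ :=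
    ENNReal.mul_ne_top (ENNReal.mul_ne_top (ENNReal.pow_ne_top hEfin.ne)
      (hsq _ hζ.m0 hint.m0).ne) (hsq _ hζ.op hint.op).ne
  refine ⟨(E ^ 2 * C3 * C4).toNNReal, fun α hα => ?_⟩
  rw [coe_toNNReal hK]
  let γ : Finset X → ℝ≥0∞ := fun σ =>
    ∫⁻ ρ, ((κ ^ 2 : ℝ≥0) : ℝ≥0∞) ^ ρ.card * α (σ ∪ ρ) ^ 2 ∂ν[N]
  have hγ : Measurable γ := by
    refine Measurable.lintegral_prod_right' (f := fun q : C²[X] =>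
      ((κ ^ 2 : ℝ≥0) : ℝ≥0∞) ^ q.2.card * α (q.1 ∪ q.2) ^ 2) ?_
    exact ((measurable_pow_card _).comp measurable_snd).mul
      ((hα.comp measurable_chain_union₂).pow_const 2)
  let β : Finset X → ℝ≥0∞ := fun σ =>
    ∫⁻ ρ, (∏ x ∈ ρ, (ζ.m0 x : ℝ≥0∞)) * α (σ ∪ ρ) ∂ν[N]
  have hβγ : ∀ σ, β σ ^ 2 ≤ C3 * γ σ := by
    intro σ
    have h1 : ∀ ρ : Finset X, (∏ x ∈ ρ, (ζ.m0 x : ℝ≥0∞)) * α (σ ∪ ρ) =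
        (∏ x ∈ ρ, ((κ⁻¹ * ζ.m0 x : ℝ≥0) : ℝ≥0∞)) * ((κ : ℝ≥0∞) ^ ρ.card * α (σ ∪ ρ)) := by
      intro ρ
      rw [← mul_assoc, ← prod_const, ← prod_mul_distrib]
      congr 1
      refine prod_congr rfl fun x _ => ?_
      rw [← ENNReal.coe_mul]
      congr 1
      field_simp
    have hm1 : Measurable fun ρ : Finset X => ∏ x ∈ ρ, ((κ⁻¹ * ζ.m0 x : ℝ≥0) : ℝ≥0∞) :=
      measurable_chain_prod (hζ.m0.const_mul _).coe_nnreal_ennreal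
    have hm2 : Measurable fun ρ : Finset X => (κ : ℝ≥0∞) ^ ρ.card * α (σ ∪ ρ) :=
      (measurable_pow_card _).mul (hα.comp (measurable_chain_union₂.comp measurable_prodMk_left))
    calc β σ ^ 2 = (∫⁻ ρ, (∏ x ∈ ρ, ((κ⁻¹ * ζ.m0 x : ℝ≥0) : ℝ≥0∞)) *
          ((κ : ℝ≥0∞) ^ ρ.card * α (σ ∪ ρ)) ∂ν[N]) ^ 2 := by
            simp only [β]; simp_rw [h1]
      _ ≤ _ := lintegral_mul_sq_le _ hm1.aemeasurable hm2.aemeasurable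
      _ = C3 * γ σ := by
        congr 1
        · refine lintegral_congr fun ρ => ?_
          rw [← prod_pow]
          refine prod_congr rfl fun x _ => ?_
          rw [← ENNReal.coe_pow, mul_pow, inv_pow]
        · refine lintegral_congr fun ρ => ?_
          rw [mul_pow, ← pow_mul, mul_comm ρ.card 2, pow_mul]
          push_cast
          ring
  have hpt : ∀ᵐ ϰ ∂ν[N], (ξm : ℝ≥0∞) ^ ϰ.card *
      N.efock (fun ϰ => (ζ.prod ϰ : ℝ≥0∞)) α ϰ ^ 2 ≤ E ^ 2 * C3 * ∑ σ ∈ ϰ.powerset,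
        w ^ σ.card * γ σ *
          G (ϰ \ σ) := by
    filter_upwards [N.ae_chain_of_ae hz] with ϰ hϰ
    have h1 := efock_weight_le (N := N) hζ hα hϰ
    have h2 : (∑ σ ∈ ϰ.powerset, (z : ℝ≥0∞) ^ σ.card *
        ((∏ x ∈ ϰ \ σ, (ζ.op x : ℝ≥0∞)) * β σ)) ^ 2 ≤
        d ^ ϰ.card * ∑ σ ∈ ϰ.powerset,
          ((z : ℝ≥0∞) ^ σ.card * (D (ϰ \ σ) * β σ)) ^ 2 := by
      have h3 : ∀ σ ∈ ϰ.powerset, (z : ℝ≥0∞) ^ σ.card *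
          ((∏ x ∈ ϰ \ σ, (ζ.op x : ℝ≥0∞)) * β σ) = (δ : ℝ≥0∞) ^ (ϰ \ σ).card *
          ((z : ℝ≥0∞) ^ σ.card *
            (D (ϰ \ σ) * β σ)) := by
        intro σ _
        have : ∏ x ∈ ϰ \ σ, (ζ.op x : ℝ≥0∞) = (δ : ℝ≥0∞) ^ (ϰ \ σ).card *
            D (ϰ \ σ) := by
          rw [← prod_const, ← prod_mul_distrib]
          refine prod_congr rfl fun x _ => ?_
          rw [← ENNReal.coe_mul]
          congr 1
          field_simp
        rw [this]; ring
      rw [sum_congr rfl h3]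
      refine (ENNReal.sum_mul_sq_le _ _ _).trans (le_of_eq ?_)
      congr 1
      have := sum_powerset_pow 1 ((δ : ℝ≥0∞) ^ 2) ϰ
      simp only [one_pow, one_mul] at this
      simp only [d]
      push_cast
      rw [← this]
      refine sum_congr rfl fun σ _ => ?_
      rw [← pow_mul, ← pow_mul, mul_comm]
    calc (ξm : ℝ≥0∞) ^ ϰ.card * N.efock (fun ϰ => (ζ.prod ϰ : ℝ≥0∞)) α ϰ ^ 2
        ≤ (ξm : ℝ≥0∞) ^ ϰ.card * (E * ∑ σ ∈ ϰ.powerset, (z : ℝ≥0∞) ^ σ.card *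
          ((∏ x ∈ ϰ \ σ, (ζ.op x : ℝ≥0∞)) * β σ)) ^ 2 :=
          mul_le_mul' le_rfl (pow_le_pow_left₀ zero_le h1 2)
      _ ≤ (ξm : ℝ≥0∞) ^ ϰ.card * (E ^ 2 * (d ^ ϰ.card *
          ∑ σ ∈ ϰ.powerset, ((z : ℝ≥0∞) ^ σ.card *
            (D (ϰ \ σ) * β σ)) ^ 2)) := by
          rw [mul_pow]
          exact mul_le_mul' le_rfl (mul_le_mul' le_rfl h2)
      _ = E ^ 2 * ∑ σ ∈ ϰ.powerset, ((ξm : ℝ≥0∞) * d) ^ ϰ.card *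
            ((z : ℝ≥0∞) ^ σ.card *
            (D (ϰ \ σ) * β σ)) ^ 2 := by
          rw [← mul_sum, mul_pow]; ring
      _ ≤ E ^ 2 * ∑ σ ∈ ϰ.powerset, C3 * (w ^ σ.card *
          γ σ * G (ϰ \ σ)) := by
          refine mul_le_mul' le_rfl (sum_le_sum fun σ hσ => ?_)
          have hc : ϰ.card = σ.card + (ϰ \ σ).card := by
            rw [add_comm, Finset.card_sdiff_add_card_eq_card (mem_powerset.mp hσ)]
          have hp : G (ϰ \ σ) =
              ((ξm : ℝ≥0∞) * d) ^ (ϰ \ σ).card *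
                D (ϰ \ σ) ^ 2 := by
            rw [← prod_const, ← prod_pow, ← prod_mul_distrib]
            refine prod_congr rfl fun x _ => ?_
            rw [← ENNReal.coe_mul, ← ENNReal.coe_pow, ← ENNReal.coe_mul]
            congr 1
            rw [mul_pow, inv_pow]; ring
          rw [hp, hc]
          calc _ = (((ξm : ℝ≥0∞) * d) ^ σ.card *
                ((z : ℝ≥0∞) ^ 2) ^ σ.card *
                ((((ξm : ℝ≥0∞) * d) ^ (ϰ \ σ).card *
                D (ϰ \ σ) ^ 2))) * β σ ^ 2 := by
                rw [pow_add]
                ring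
            _ ≤ _ * (C3 * γ σ) := mul_le_mul' le_rfl (hβγ σ)
            _ = _ := by
                rw [← mul_pow]
                simp only [w, d]
                push_cast
                ring
      _ = _ := by rw [← mul_sum, ← mul_assoc]
  have hpw : ∀ c : ℝ≥0∞, Measurable fun A : Finset X => c ^ A.card := measurable_pow_card
  have hmop : Measurable fun A : Finset X =>
      G A :=
    measurable_chain_prod ((hζ.op.pow_const 2).const_mul _).coe_nnreal_ennreal
  have hf1 : Measurable fun σ : Finset X =>
      w ^ σ.card * γ σ := (hpw _).mul hγ
  have hmf : Measurable fun q : C²[X] =>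
      w ^ q.1.card * γ q.1 *
        G q.2 :=
    (hf1.comp measurable_fst).mul (hmop.comp measurable_snd)
  calc ∫⁻ ϰ, (ξm : ℝ≥0∞) ^ ϰ.card * N.efock (fun ϰ => (ζ.prod ϰ : ℝ≥0∞)) α ϰ ^ 2 ∂ν[N]
      ≤ ∫⁻ ϰ, E ^ 2 * C3 * ∑ σ ∈ ϰ.powerset,
        w ^ σ.card * γ σ *
          G (ϰ \ σ) ∂ν[N] := lintegral_mono_ae hpt
    _ = E ^ 2 * C3 * ((∫⁻ σ, w ^ σ.card * γ σ ∂ν[N]) * C4) := by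
        have h := N.unfold_splits.lint _ hmf
        have hs := finRep_splits.measurable_sum hmf
        simp_rw [sum_splits] at h hs
        rw [lintegral_const_mul _ hs]
        congr 1
        refine h.trans ?_
        exact lintegral_prod_mul hf1.aemeasurable hmop.aemeasurable
    _ = E ^ 2 * C3 * C4 * ∫⁻ σ, w ^ σ.card * γ σ ∂ν[N] := by ring
    _ = _ := by
        congr 1
        rw [N.lintegral_chain_union_pow _ _ (hα.pow_const 2)]
        push_cast
        rfl

end Noise

end

/-! ### Strongly measurable operator functions -/

section OpMeas

variable {Y Z : Type*} [MeasurableSpace Y] [MeasurableSpace Z]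
variable {K : Type*} [NormedAddCommGroup K] [InnerProductSpace ℂ K]

theorem StronglyMeasurable.clm_apply_of_forall {T : Y → K →L[ℂ] K}
    (hT : ∀ v, StronglyMeasurable fun y => T y v) {a : Y → K} (ha : StronglyMeasurable a) :
    StronglyMeasurable fun y => T y (a y) := by
  have hs : ∀ s : SimpleFunc Y K, StronglyMeasurable fun y => T y (s y) := by
    intro s
    have h : (fun y => T y (s y)) = fun y =>
        ∑ v ∈ s.range, (s ⁻¹' {v}).indicator (fun y => T y v) y := by
      funext y
      rw [sum_eq_single (s y)]
      · simp
      · intro v _ hv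
        simp [Set.indicator, hv.symm]
      · intro h
        exact absurd (s.mem_range_self y) h
    rw [h]
    exact stronglyMeasurable_fun_sum _ fun v _ => (hT v).indicator (s.measurableSet_fiber v)
  refine stronglyMeasurable_of_tendsto atTop (fun n => hs (ha.approx n)) ?_
  rw [tendsto_pi_nhds]
  intro y
  exact ((T y).continuous.tendsto _).comp (ha.tendsto_approx y)

theorem AEStronglyMeasurable.clm_apply_of_forall {T : Y → K →L[ℂ] K} {μ : Measure Y}
    (hT : ∀ v, StronglyMeasurable fun y => T y v) {a : Y → K} (ha : AEStronglyMeasurable a μ) :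
    AEStronglyMeasurable (fun y => T y (a y)) μ :=
  ⟨_, StronglyMeasurable.clm_apply_of_forall hT ha.stronglyMeasurable_mk,
    ha.ae_eq_mk.mono fun y hy => by simp only [hy]⟩

variable [CompleteSpace K]

/-- Strong measurability of an operator-valued function and of its adjoint. -/
structure OpMeas (T : Y → K →L[ℂ] K) : Prop where
  app : ∀ v, StronglyMeasurable fun y => T y v
  adj : ∀ v, StronglyMeasurable fun y => adjoint (T y) v

notation "OpMeas₂" L:max => OpMeas fun q => L (Prod.fst q) (Prod.snd q)

namespace OpMeas

variable {S T : Y → K →L[ℂ] K}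

theorem adjoint (hT : OpMeas T) : OpMeas fun y => adjoint (T y) :=
  ⟨hT.adj, by simpa using hT.app⟩

theorem comp_measurable (hT : OpMeas T) {g : Z → Y} (hg : Measurable g) :
    OpMeas fun z => T (g z) :=
  ⟨fun v => (hT.app v).comp_measurable hg, fun v => (hT.adj v).comp_measurable hg⟩

theorem const (S : K →L[ℂ] K) : OpMeas fun _ : Y => S :=
  ⟨fun _ => stronglyMeasurable_const, fun _ => stronglyMeasurable_const⟩

theorem add (hS : OpMeas S) (hT : OpMeas T) : OpMeas fun y => S y + T y :=
  ⟨fun v => (hS.app v).add (hT.app v), fun v => by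
    simp only [map_add]
    exact (hS.adj v).add (hT.adj v)⟩

theorem sub (hS : OpMeas S) (hT : OpMeas T) : OpMeas fun y => S y - T y :=
  ⟨fun v => (hS.app v).sub (hT.app v), fun v => by
    simp only [map_sub]
    exact (hS.adj v).sub (hT.adj v)⟩

theorem smul (hT : OpMeas T) (z : ℂ) : OpMeas fun y => z • T y :=
  ⟨fun v => (hT.app v).const_smul z, fun v => by
    simp only [map_smulₛₗ]
    exact (hT.adj v).const_smul _⟩

theorem comp (hS : OpMeas S) (hT : OpMeas T) : OpMeas fun y => (S y).comp (T y) :=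
  ⟨fun v => StronglyMeasurable.clm_apply_of_forall hS.app (hT.app v), fun v => by
    simp only [adjoint_comp]
    exact StronglyMeasurable.clm_apply_of_forall hT.adj (hS.adj v)⟩

theorem indicator (hT : OpMeas T) {s : Set Y} (hs : MeasurableSet s) :
    OpMeas (s.indicator T) := by
  classical
  refine ⟨fun v => ?_, fun v => ?_⟩
  · have : (fun y => s.indicator T y v) = s.indicator fun y => T y v := by
      funext y; by_cases h : y ∈ s <;> simp [h]
    rw [this]
    exact (hT.app v).indicator hs
  · have : (fun y => ContinuousLinearMap.adjoint (s.indicator T y) v) =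
        s.indicator fun y => ContinuousLinearMap.adjoint (T y) v := by
      funext y; by_cases h : y ∈ s <;> simp [h]
    rw [this]
    exact (hT.adj v).indicator hs

theorem sum_finRep {R : Z → Finset Y} (hR : Noise.FinRep R) (hT : OpMeas T) :
    OpMeas fun z => ∑ y ∈ R z, T y :=
  ⟨fun v => by
    simp only [sum_apply]
    exact hR.stronglyMeasurable_sum (hT.app v), fun v => by
    simp only [map_sum, sum_apply]
    exact hR.stronglyMeasurable_sum (hT.adj v)⟩

end OpMeas

end OpMeas

/-! ### The Fock representation, in coordinates -/

section

variable {X : Type*} [MeasurableSpace X] [DecidableEq X] (N : Noise X)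
variable {K : Type*} [NormedAddCommGroup K] [InnerProductSpace ℂ K]

namespace Weight.Integrable

theorem exists_oo_le {ζ : Weight X} {μ : Measure X} (h : ζ.Integrable μ) :
    ∃ z : ℝ≥0, ∀ᵐ x ∂μ, ζ.oo x ≤ z := by
  have h1 := h.oo.2
  rw [eLpNorm_exponent_top] at h1
  refine ⟨(eLpNormEssSup (fun x => (ζ.oo x : ℝ)) μ).toNNReal, ?_⟩
  filter_upwards [ae_le_eLpNormEssSup (f := fun x => (ζ.oo x : ℝ)) (μ := μ)] with x hx
  rw [← coe_le_coe, coe_toNNReal h1.ne]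
  simpa using hx

end Weight.Integrable

namespace Noise

/-- The Fock representation of operator-valued functions with values in a fixed space. -/
noncomputable def nfock (T : Op[X,K]) (a : Finset X → K) (ϰ : Finset X) : K :=
  ∑ σ ∈ ϰ.powerset, ∫ p, T ⟨p.1, p.2, σ, ϰ \ σ⟩ (a (σ ∪ p.1)) ∂ν²[N]

/-- Absolute convergence of the integrals in the Fock representation. -/
def NConv (T : Op[X,K]) (a : Finset X → K) (ϰ : Finset X) : Prop :=
  ∀ σ ⊆ ϰ, Integrable (fun p : C²[X] => T ⟨p.1, p.2, σ, ϰ \ σ⟩ (a (σ ∪ p.1))) ν²[N]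

/-- The squared norm in the Fock scale. -/
noncomputable def nsq (ξ : ℝ≥0) (a : Finset X → K) : ℝ≥0∞ :=
  ∫⁻ ϰ, (ξ : ℝ≥0∞) ^ ϰ.card * ‖a ϰ‖ₑ ^ 2 ∂ν[N]

/-- Elements of the Fock scale. -/
def InG (ξ : ℝ≥0) (a : Finset X → K) : Prop :=
  AEStronglyMeasurable a ν[N] ∧ N.nsq ξ a < ∞

/-- `‖T(ϰ)‖ ≤ c ζ(ϰ)` for almost all tables. -/
def Bdd (c : ℝ≥0) (ζ : Weight X) (T : Op[X,K]) : Prop :=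
  ∀ᵐ ϰ ∂τ[N], ‖T ϰ‖ₑ ≤ c * ζ.prod ϰ

variable [StandardBorelSpace X]
variable {N}

theorem nsq_congr {ξ : ℝ≥0} {a b : Finset X → K} (h : a =ᵐ[ν[N]] b) :
    N.nsq ξ a = N.nsq ξ b :=
  lintegral_congr_ae (h.mono fun ϰ hϰ => by simp only [hϰ])

theorem InG.congr {ξ : ℝ≥0} {a b : Finset X → K} (h : N.InG ξ a) (hab : a =ᵐ[ν[N]] b) :
    N.InG ξ b := ⟨h.1.congr hab, nsq_congr hab ▸ h.2⟩

theorem InG.exists_sm {ξ : ℝ≥0} {a : Finset X → K} (h : N.InG ξ a) :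
    ∃ b, StronglyMeasurable b ∧ a =ᵐ[ν[N]] b ∧ N.InG ξ b :=
  ⟨_, h.1.stronglyMeasurable_mk, h.1.ae_eq_mk, h.congr h.1.ae_eq_mk⟩

theorem Bdd.exists_meas {c : ℝ≥0} {ζ : Weight X} (hζ : ζ.Integrable N.vol)
    {T : Op[X,K]} (hT : N.Bdd c ζ T) :
    ∃ ζ' : Weight X, ζ'.Meas ∧ ζ'.Integrable N.vol ∧ N.Bdd c ζ' T ∧
      ∀ᵐ x ∂N.vol, ζ.LeAt ζ' x ∧ ζ'.LeAt ζ x := by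
  obtain ⟨ζ', h1, h2, h3⟩ := hζ.exists_meas
  refine ⟨ζ', h1, h2, ?_, h3⟩
  filter_upwards [hT, N.ae_prod_le (h3.mono fun x hx => hx.1)] with ϰ h4 h5
  exact h4.trans (mul_le_mul' le_rfl (coe_le_coe.mpr h5))

theorem efock_const_mul (c : ℝ≥0) (w : Table X → ℝ≥0∞) (α : Finset X → ℝ≥0∞) (ϰ : Finset X) :
    N.efock (fun ϰ => c * w ϰ) α ϰ = c * N.efock w α ϰ := by
  simp only [efock, mul_assoc, mul_sum]
  exact sum_congr rfl fun σ _ => lintegral_const_mul' _ _ ENNReal.coe_ne_top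

theorem Weight.Meas.measurable_bound {ζ : Weight X} (h : ζ.Meas) (c : ℝ≥0) :
    Measurable fun ϰ : Table X => (c : ℝ≥0∞) * ζ.prod ϰ := h.measurable_prod.const_mul _

/-- The positive Fock representation maps `G(ξ⁺)` to `G(ξ₋)`. -/
theorem efock_bound {ζ : Weight X} (hζ : ζ.Meas) (hint : ζ.Integrable N.vol) {z r : ℝ≥0}
    (hz : ∀ᵐ x ∂N.vol, ζ.oo x ≤ z) (hr : z < r) (c : ℝ≥0) {ξp ξm : ℝ≥0} (hξ : 0 < ξm)
    (hξp : r ^ 2 * ξm ≤ ξp) :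
    ∃ C : ℝ≥0, ∀ α : Finset X → ℝ≥0∞, Measurable α →
      ∫⁻ ϰ, (ξm : ℝ≥0∞) ^ ϰ.card * N.efock (fun ϰ => c * ζ.prod ϰ) α ϰ ^ 2 ∂ν[N] ≤
        C * ∫⁻ ϰ, (ξp : ℝ≥0∞) ^ ϰ.card * α ϰ ^ 2 ∂ν[N] := by
  have hd : 0 < r ^ 2 - z ^ 2 := tsub_pos_of_lt (pow_lt_pow_left₀ hr zero_le two_ne_zero)
  set d := r ^ 2 - z ^ 2 with hd'
  have hrz : r ^ 2 = z ^ 2 + d := by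
    rw [hd', add_tsub_cancel_of_le (pow_le_pow_left₀ zero_le hr.le 2)]
  have hδ : NNReal.sqrt (d / (2 * (z ^ 2 + 1))) ≠ 0 := by
    rw [Ne, NNReal.sqrt_eq_zero]; positivity
  have hκ : NNReal.sqrt (ξm * d / 2) ≠ 0 := by
    rw [Ne, NNReal.sqrt_eq_zero]; positivity
  obtain ⟨C, hC⟩ := efock_sq_le hζ hint hz (ξm := ξm) hδ hκ
  refine ⟨c ^ 2 * C, fun α hα => ?_⟩
  have h1 : ξm * (1 + NNReal.sqrt (d / (2 * (z ^ 2 + 1))) ^ 2) * z ^ 2 +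
      NNReal.sqrt (ξm * d / 2) ^ 2 ≤ ξp := by
    rw [NNReal.sq_sqrt, NNReal.sq_sqrt]
    refine le_trans ?_ hξp
    have h2 : d / (2 * (z ^ 2 + 1)) * z ^ 2 ≤ d / 2 := by
      have : d / (2 * (z ^ 2 + 1)) * z ^ 2 = d / 2 * (z ^ 2 / (z ^ 2 + 1)) := by
        field_simp
      rw [this]
      refine mul_le_of_le_one_right zero_le (div_le_one_of_le₀ ?_ zero_le)
      exact le_self_add
    calc _ = ξm * (z ^ 2 + d / (2 * (z ^ 2 + 1)) * z ^ 2) + ξm * d / 2 := by ring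
      _ ≤ ξm * (z ^ 2 + d / 2) + ξm * d / 2 := by gcongr
      _ = (z ^ 2 + d) * ξm := by
        have : d = d / 2 + d / 2 := (add_halves d).symm
        nth_rewrite 3 [this]
        ring
      _ = r ^ 2 * ξm := by rw [hrz]
  simp_rw [efock_const_mul, mul_pow]
  calc _ = (c : ℝ≥0∞) ^ 2 * ∫⁻ ϰ, (ξm : ℝ≥0∞) ^ ϰ.card *
        N.efock (fun ϰ => (ζ.prod ϰ : ℝ≥0∞)) α ϰ ^ 2 ∂ν[N] := by
        rw [← lintegral_const_mul' _ _ (by simp)]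
        exact lintegral_congr fun ϰ => by ring
    _ ≤ (c : ℝ≥0∞) ^ 2 * (C * ∫⁻ ϰ, (ξp : ℝ≥0∞) ^ ϰ.card * α ϰ ^ 2 ∂ν[N]) := by
        refine mul_le_mul' le_rfl ((hC α hα).trans (mul_le_mul' le_rfl ?_))
        exact lintegral_mono fun ϰ => mul_le_mul' (pow_le_pow_left₀ zero_le
          (coe_le_coe.mpr h1) _) le_rfl
    _ = _ := by push_cast; ring

theorem efock_bound_exists {ζ : Weight X} (hζ : ζ.Meas) (hint : ζ.Integrable N.vol) (c : ℝ≥0)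
    {ξ : ℝ≥0} (hξ : 0 < ξ) : ∃ ξ' : ℝ≥0, 0 < ξ' ∧ ∀ α : Finset X → ℝ≥0∞, Measurable α →
      ∫⁻ ϰ, (ξ : ℝ≥0∞) ^ ϰ.card * α ϰ ^ 2 ∂ν[N] < ∞ →
      ∫⁻ ϰ, (ξ' : ℝ≥0∞) ^ ϰ.card * N.efock (fun ϰ => c * ζ.prod ϰ) α ϰ ^ 2 ∂ν[N] < ∞ := by
  obtain ⟨z, hz⟩ := hint.exists_oo_le
  have hξ' : 0 < ξ / (z + 1) ^ 2 := by positivity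
  obtain ⟨C, hC⟩ := efock_bound hζ hint hz (lt_add_one z) c hξ'
    (ξp := ξ) (by rw [mul_div_cancel₀]; positivity)
  exact ⟨_, hξ', fun α hα h => (hC α hα).trans_lt (mul_lt_top coe_lt_top h)⟩

theorem ae_lt_top_of_nsq {ξ : ℝ≥0} (hξ : 0 < ξ) {β : Finset X → ℝ≥0∞} (hβ : Measurable β)
    (h : ∫⁻ ϰ, (ξ : ℝ≥0∞) ^ ϰ.card * β ϰ ^ 2 ∂ν[N] < ∞) :
    ∀ᵐ ϰ ∂ν[N], β ϰ < ∞ := by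
  filter_upwards [ae_lt_top ((measurable_pow_card _).mul (hβ.pow_const 2)) h.ne] with ϰ hϰ
  by_contra hn
  rw [not_lt_top_iff] at hn
  have : (ξ : ℝ≥0∞) ^ ϰ.card ≠ 0 := pow_ne_zero _ (by simpa using hξ.ne')
  simp [hn, ENNReal.mul_top this] at hϰ

theorem enorm_nfock_le (T : Op[X,K]) (a : Finset X → K) (ϰ : Finset X) :
    ‖N.nfock T a ϰ‖ₑ ≤ N.efock (fun ϰ => ‖T ϰ‖ₑ) (fun A => ‖a A‖ₑ) ϰ := by
  refine (enorm_sum_le _ _).trans (sum_le_sum fun σ _ => ?_)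
  refine (enorm_integral_le_lintegral_enorm _).trans (lintegral_mono fun p => ?_)
  exact le_opENorm _ _

theorem nfock_congr {S T : Op[X,K]} {a b : Finset X → K}
    (hST : ∀ᵐ ϰ ∂τ[N], S ϰ = T ϰ) (hab : a =ᵐ[ν[N]] b) :
    N.nfock S a =ᵐ[ν[N]] N.nfock T b := by
  filter_upwards [ae_fock hST, ae_fock (ae_dom_of_ae hab)] with ϰ h1 h2
  refine sum_congr rfl fun σ hσ => integral_congr_ae ?_
  filter_upwards [h1 σ (mem_powerset.mp hσ), h2 σ (mem_powerset.mp hσ)] with p h3 h4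
  simp only [h3]
  exact congrArg _ h4

theorem nconv_congr {S T : Op[X,K]} {a b : Finset X → K}
    (hST : ∀ᵐ ϰ ∂τ[N], S ϰ = T ϰ) (hab : a =ᵐ[ν[N]] b) :
    ∀ᵐ ϰ ∂ν[N], N.NConv S a ϰ → N.NConv T b ϰ := by
  filter_upwards [ae_fock hST, ae_fock (ae_dom_of_ae hab)] with ϰ h1 h2 h σ hσ
  refine (h σ hσ).congr ?_
  filter_upwards [h1 σ hσ, h2 σ hσ] with p h3 h4
  simp only [h3]
  exact congrArg _ h4

theorem stronglyMeasurable_fockIntegrand {T : Op[X,K]}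
    (hT : ∀ v, StronglyMeasurable fun ϰ => T ϰ v) {a : Finset X → K} (ha : StronglyMeasurable a)
    (σ τ : Finset X) :
    StronglyMeasurable fun p : C²[X] => T ⟨p.1, p.2, σ, τ⟩ (a (σ ∪ p.1)) :=
  StronglyMeasurable.clm_apply_of_forall
    (fun v => (hT v).comp_measurable (Table.measurable_mk measurable_fst measurable_snd
      measurable_const measurable_const))
    (ha.comp_measurable (measurable_const.chain_union measurable_fst))

theorem nconv_of_efock {T : Op[X,K]} (hT : ∀ v, StronglyMeasurable fun ϰ => T ϰ v)
    {a : Finset X → K} (ha : StronglyMeasurable a) {w : Table X → ℝ≥0∞}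
    (hw : ∀ᵐ ϰ ∂τ[N], ‖T ϰ‖ₑ ≤ w ϰ)
    (hfin : ∀ᵐ ϰ ∂ν[N], N.efock w (fun A => ‖a A‖ₑ) ϰ < ∞) :
    ∀ᵐ ϰ ∂ν[N], N.NConv T a ϰ := by
  filter_upwards [ae_fock hw, hfin] with ϰ h1 h2 σ hσ
  refine ⟨(stronglyMeasurable_fockIntegrand hT ha σ _).aestronglyMeasurable, ?_⟩
  refine lt_of_le_of_lt (lintegral_mono_ae ?_)
    ((ENNReal.sum_lt_top.mp h2) σ (mem_powerset.mpr hσ))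
  filter_upwards [h1 σ hσ] with p hp
  exact (le_opENorm _ _).trans (mul_le_mul' hp le_rfl)

/-- Absolute convergence of the Fock representation of relatively bounded functions. -/
theorem ae_nconv {T : Op[X,K]} (hT : ∀ v, StronglyMeasurable fun ϰ => T ϰ v)
    {c : ℝ≥0} {ζ : Weight X} (hζ : ζ.Integrable N.vol) (hb : N.Bdd c ζ T) {ξ : ℝ≥0} (hξ : 0 < ξ)
    {a : Finset X → K} (ha : N.InG ξ a) : ∀ᵐ ϰ ∂ν[N], N.NConv T a ϰ := by
  obtain ⟨ζ', h1, h2, h3, -⟩ := hb.exists_meas hζ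
  obtain ⟨b, hb1, hb2, hb3⟩ := ha.exists_sm
  obtain ⟨ξ', hξ', h4⟩ := efock_bound_exists h1 h2 c hξ
  have h5 := nconv_of_efock hT hb1 h3 (ae_lt_top_of_nsq hξ'
    (measurable_efock (Weight.Meas.measurable_bound h1 c) hb1.enorm) (h4 _ hb1.enorm hb3.2))
  filter_upwards [h5, nconv_congr (S := T) (T := T) (Eventually.of_forall fun _ => rfl)
    hb2.symm] with ϰ h6 h7 using h7 h6

/-- The norm estimate of the Fock representation of relatively bounded functions. -/
theorem nfock_bound {T : Op[X,K]} {c : ℝ≥0} {ζ : Weight X}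
    (hζ : ζ.Integrable N.vol) (hb : N.Bdd c ζ T) {z r : ℝ≥0}
    (hz : ∀ᵐ x ∂N.vol, ζ.oo x ≤ z) (hr : z < r) {ξp ξm : ℝ≥0} (hξ : 0 < ξm)
    (hξp : r ^ 2 * ξm ≤ ξp) :
    ∃ C : ℝ≥0, ∀ a : Finset X → K, AEStronglyMeasurable a ν[N] →
      N.nsq ξm (N.nfock T a) ≤ C * N.nsq ξp a := by
  obtain ⟨ζ', h1, h2, h3, h4⟩ := hb.exists_meas hζ
  obtain ⟨C, hC⟩ := efock_bound h1 h2 (z := z)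
    (by filter_upwards [hz, h4] with x h5 h6 using h6.2.2.2.1.trans h5) hr c hξ hξp
  refine ⟨C, fun a ha => ?_⟩
  rw [nsq_congr (N := N) (ξ := ξp) ha.ae_eq_mk]
  refine le_trans (lintegral_mono_ae ?_) (hC _ ha.stronglyMeasurable_mk.enorm)
  filter_upwards [efock_mono_ae h3 (α := fun A => ‖a A‖ₑ) (α' := fun A => ‖ha.mk a A‖ₑ)
    (ha.ae_eq_mk.mono fun A hA => by rw [hA])] with ϰ h5
  exact mul_le_mul' le_rfl (pow_le_pow_left₀ zero_le ((enorm_nfock_le T a ϰ).trans h5) 2)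

theorem nfock_add {T : Op[X,K]} {a b : Finset X → K} {ϰ : Finset X}
    (ha : N.NConv T a ϰ) (hb : N.NConv T b ϰ) :
    N.nfock T (a + b) ϰ = N.nfock T a ϰ + N.nfock T b ϰ := by
  unfold nfock
  rw [← sum_add_distrib]
  refine sum_congr rfl fun σ hσ => ?_
  rw [← integral_add (ha σ (mem_powerset.mp hσ)) (hb σ (mem_powerset.mp hσ))]
  simp

theorem nfock_smul (T : Op[X,K]) (z : ℂ) (a : Finset X → K) (ϰ : Finset X) :
    N.nfock T (z • a) ϰ = z • N.nfock T a ϰ := by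
  unfold nfock
  rw [smul_sum]
  refine sum_congr rfl fun σ hσ => ?_
  rw [← integral_smul]
  simp

theorem nfock_op_add {S T : Op[X,K]} {a : Finset X → K} {ϰ : Finset X}
    (hS : N.NConv S a ϰ) (hT : N.NConv T a ϰ) :
    N.nfock (fun ϰ => S ϰ + T ϰ) a ϰ = N.nfock S a ϰ + N.nfock T a ϰ := by
  unfold nfock
  rw [← sum_add_distrib]
  refine sum_congr rfl fun σ hσ => ?_
  rw [← integral_add (hS σ (mem_powerset.mp hσ)) (hT σ (mem_powerset.mp hσ))]
  simp

theorem nfock_op_sub {S T : Op[X,K]} {a : Finset X → K} {ϰ : Finset X}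
    (hS : N.NConv S a ϰ) (hT : N.NConv T a ϰ) :
    N.nfock (fun ϰ => S ϰ - T ϰ) a ϰ = N.nfock S a ϰ - N.nfock T a ϰ := by
  unfold nfock
  rw [← Finset.sum_sub_distrib]
  refine sum_congr rfl fun σ hσ => ?_
  rw [← integral_sub (hS σ (mem_powerset.mp hσ)) (hT σ (mem_powerset.mp hσ))]
  simp

theorem nfock_op_smul (z : ℂ) (T : Op[X,K]) (a : Finset X → K) (ϰ : Finset X) :
    N.nfock (fun ϰ => z • T ϰ) a ϰ = z • N.nfock T a ϰ := by
  unfold nfock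
  rw [smul_sum]
  refine sum_congr rfl fun σ hσ => ?_
  rw [← integral_smul]
  simp

end Noise

end

section

variable {X : Type*} [MeasurableSpace X] [DecidableEq X] {N : Noise X} [StandardBorelSpace X]
variable {K : Type*} [NormedAddCommGroup K] [InnerProductSpace ℂ K]
variable {Y : Type*} [MeasurableSpace Y]

namespace Noise

/-! ### Joint measurability -/

theorem quasiMeasurePreserving_param_union (μ : Measure Y) [SFinite μ] :
    QuasiMeasurePreserving
      (fun z : (Y × C²[X]) × C²[X] => (z.1.1, z.1.2.1 ∪ z.2.1))
      ((μ.prod ν²[N]).prod ν²[N])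
      (μ.prod ν[N]) := by
  have h1 : QuasiMeasurePreserving
      (Prod.map (Prod.map id Prod.fst) Prod.fst :
        (Y × C²[X]) × C²[X] → (Y × Finset X) × Finset X)
      ((μ.prod ν²[N]).prod ν²[N])
      ((μ.prod ν[N]).prod ν[N]) :=
    QuasiMeasurePreserving.prodMap
      (QuasiMeasurePreserving.prodMap (QuasiMeasurePreserving.id _)
        quasiMeasurePreserving_fst) quasiMeasurePreserving_fst
  have h2 : QuasiMeasurePreserving
      (MeasurableEquiv.prodAssoc : (Y × Finset X) × Finset X ≃ᵐ Y × C²[X])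
      ((μ.prod ν[N]).prod ν[N])
      (μ.prod ν²[N]) :=
    (measurePreserving_prodAssoc _ _ _).quasiMeasurePreserving
  have h3 : QuasiMeasurePreserving
      (Prod.map id (fun q => q.1 ∪ q.2) : Y × C²[X] → Y × Finset X)
      (μ.prod ν²[N]) (μ.prod ν[N]) :=
    QuasiMeasurePreserving.prodMap (QuasiMeasurePreserving.id _)
      N.quasiMeasurePreserving_union
  exact h3.comp (h2.comp h1)

theorem aestronglyMeasurable_nfock_param (μ : Measure Y) [SFinite μ] {T : Y → Op[X,K]}
    (hT : ∀ v, StronglyMeasurable fun q : Y × Table X => T q.1 q.2 v) {a : Y → Finset X → K}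
    (ha : AEStronglyMeasurable (fun q : Y × Finset X => a q.1 q.2) (μ.prod ν[N])) :
    AEStronglyMeasurable (fun q : Y × Finset X => N.nfock (T q.1) (a q.1) q.2)
      (μ.prod ν[N]) := by
  have h1 : AEStronglyMeasurable
      (fun z : (Y × C²[X]) × C²[X] =>
        T z.1.1 ⟨z.2.1, z.2.2, z.1.2.1, z.1.2.2⟩ (a z.1.1 (z.1.2.1 ∪ z.2.1)))
      ((μ.prod ν²[N]).prod ν²[N]) := by
    refine AEStronglyMeasurable.clm_apply_of_forall
      (T := fun z : (Y × C²[X]) × C²[X] =>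
        T z.1.1 ⟨z.2.1, z.2.2, z.1.2.1, z.1.2.2⟩) (fun v => ?_)
      (ha.comp_quasiMeasurePreserving (quasiMeasurePreserving_param_union μ))
    exact (hT v).comp_measurable ((measurable_fst.comp measurable_fst).prodMk
      (Table.measurable_mk (by fun_prop) (by fun_prop) (by fun_prop) (by fun_prop)))
  have h2 := ((Unfold.id μ).prod N.unfold_splits).aestronglyMeasurable_sum h1.integral_prod_right'
  refine h2.congr (Eventually.of_forall fun q => ?_)
  simp only [singleton_product, sum_map, Function.Embedding.coeFn_mk, sum_splits]
  rfl

theorem aestronglyMeasurable_nfock {T : Op[X,K]}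
    (hT : ∀ v, StronglyMeasurable fun ϰ => T ϰ v) {a : Finset X → K}
    (ha : AEStronglyMeasurable a ν[N]) :
    AEStronglyMeasurable (N.nfock T a) ν[N] := by
  have h := aestronglyMeasurable_nfock_param (N := N) (dirac ()) (T := fun _ => T)
    (a := fun _ => a) (fun v => (hT v).comp_measurable measurable_snd)
    (ha.comp_quasiMeasurePreserving quasiMeasurePreserving_snd)
  rw [dirac_prod] at h
  exact h.comp_measurable measurable_prodMk_left

theorem InG.nfock {T : Op[X,K]} (hT : ∀ v, StronglyMeasurable fun ϰ => T ϰ v)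
    {c : ℝ≥0} {ζ : Weight X} (hζ : ζ.Integrable N.vol) (hb : N.Bdd c ζ T) {ξ : ℝ≥0} (hξ : 0 < ξ) :
    ∃ ξ' : ℝ≥0, 0 < ξ' ∧ ∀ a : Finset X → K, N.InG ξ a → N.InG ξ' (N.nfock T a) := by
  obtain ⟨z, hz⟩ := hζ.exists_oo_le
  have hξ' : 0 < ξ / (z + 1) ^ 2 := by positivity
  obtain ⟨C, hC⟩ := nfock_bound hζ hb hz (lt_add_one z) hξ'
    (ξp := ξ) (by rw [mul_div_cancel₀]; positivity)
  exact ⟨_, hξ', fun a ha => ⟨aestronglyMeasurable_nfock hT ha.1,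
    (hC a ha.1).trans_lt (mul_lt_top coe_lt_top ha.2)⟩⟩

/-! ### The unit -/

theorem chainMeasure_singleton_empty : ν[N] {∅} = 1 := by
  have := N.chainMeasure_restrict_empty
  have h := congrArg (fun μ : Measure (Finset X) => μ Set.univ) this
  simpa using h

theorem integral_of_support_empty {f : C²[X] → K} [CompleteSpace K]
    (hf : ∀ p, p ≠ (∅, ∅) → f p = 0) :
    ∫ p, f p ∂ν²[N] = f (∅, ∅) := by
  have h1 : ν²[N] {((∅ : Finset X), (∅ : Finset X))} = 1 := by
    rw [← Set.singleton_prod_singleton, Measure.prod_prod, chainMeasure_singleton_empty, mul_one]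
  rw [← setIntegral_eq_integral_of_forall_compl_eq_zero
    (s := {((∅ : Finset X), (∅ : Finset X))}) (fun p hp => hf p hp), integral_singleton]
  simp [Measure.real, h1]

theorem nfock_of_support [CompleteSpace K] {T : Op[X,K]}
    (hT : ∀ ϰ : Table X, ¬ (ϰ.m0 = ∅ ∧ ϰ.mp = ∅ ∧ ϰ.op = ∅) → T ϰ = 0) (a : Finset X → K)
    (ϰ : Finset X) : N.nfock T a ϰ = T ⟨∅, ∅, ϰ, ∅⟩ (a ϰ) := by
  unfold nfock
  rw [sum_eq_single ϰ]
  · rw [integral_of_support_empty]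
    · simp
    · rintro ⟨p1, p2⟩ hp
      rw [hT _ (fun h => hp (Prod.ext h.1 h.2.1))]
      rfl
  · intro σ hσ hne
    have : ϰ \ σ ≠ ∅ := fun h => hne
      (Finset.Subset.antisymm (mem_powerset.mp hσ) (sdiff_eq_empty_iff_subset.mp h))
    refine integral_eq_zero_of_ae (Eventually.of_forall fun p => ?_)
    simp only
    rw [hT _ (fun h => this h.2.2)]
    rfl
  · intro h
    exact absurd (Finset.mem_powerset_self ϰ) h

/-! ### The adjoint -/

theorem lintegral_mul_lt_top_of_weighted {ξ : ℝ≥0} (hξ : 0 < ξ) {f g : Finset X → ℝ≥0∞}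
    (hf : Measurable f) (hg : Measurable g)
    (h1 : ∫⁻ ϰ, ((ξ⁻¹ : ℝ≥0) : ℝ≥0∞) ^ ϰ.card * f ϰ ^ 2 ∂ν[N] < ∞)
    (h2 : ∫⁻ ϰ, (ξ : ℝ≥0∞) ^ ϰ.card * g ϰ ^ 2 ∂ν[N] < ∞) :
    ∫⁻ ϰ, f ϰ * g ϰ ∂ν[N] < ∞ := by
  set s := NNReal.sqrt ξ with hs
  have hs2 : s ^ 2 = ξ := NNReal.sq_sqrt ξ
  have hs0 : s ≠ 0 := by rw [hs, Ne, NNReal.sqrt_eq_zero]; exact hξ.ne'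
  have h3 : ∀ ϰ : Finset X, f ϰ * g ϰ =
      (((s⁻¹ : ℝ≥0) : ℝ≥0∞) ^ ϰ.card * f ϰ) * ((s : ℝ≥0∞) ^ ϰ.card * g ϰ) := by
    intro ϰ
    have : ((s⁻¹ : ℝ≥0) : ℝ≥0∞) ^ ϰ.card * (s : ℝ≥0∞) ^ ϰ.card = 1 := by
      rw [← mul_pow, ← ENNReal.coe_mul, inv_mul_cancel₀ hs0]; simp
    calc f ϰ * g ϰ = (((s⁻¹ : ℝ≥0) : ℝ≥0∞) ^ ϰ.card * (s : ℝ≥0∞) ^ ϰ.card) * (f ϰ * g ϰ) := by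
          rw [this, one_mul]
      _ = _ := by ring
  simp_rw [h3]
  have h4 := lintegral_mul_sq_le ν[N]
    (f := fun ϰ => ((s⁻¹ : ℝ≥0) : ℝ≥0∞) ^ ϰ.card * f ϰ) (g := fun ϰ => (s : ℝ≥0∞) ^ ϰ.card * g ϰ)
    ((measurable_pow_card _).mul hf).aemeasurable ((measurable_pow_card _).mul hg).aemeasurable
  have h5 : ∀ (t : ℝ≥0) (f : Finset X → ℝ≥0∞) (ϰ : Finset X),
      ((t : ℝ≥0∞) ^ ϰ.card * f ϰ) ^ 2 = ((t ^ 2 : ℝ≥0) : ℝ≥0∞) ^ ϰ.card * f ϰ ^ 2 := by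
    intro t f ϰ
    rw [mul_pow, ← pow_mul, mul_comm, mul_comm ϰ.card, pow_mul]
    push_cast
    ring
  simp_rw [h5, inv_pow, hs2] at h4
  by_contra hn
  rw [not_lt_top_iff] at hn
  rw [hn] at h4
  exact absurd (h4.trans_lt (mul_lt_top h1 h2)) (by simp)

variable (N) in
theorem measurePreserving_swapTable :
    MeasurePreserving (fun z : C⁴[X] =>
      (⟨z.2.1, z.2.2, z.1.1, z.1.2⟩ : Table X)) (ν²[N].prod ν²[N])
      τ[N] :=
  N.measurePreserving_equivProd.comp measurePreserving_swap

theorem enorm_inner_le (x y : K) : ‖inner ℂ x y‖ₑ ≤ ‖x‖ₑ * ‖y‖ₑ := by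
  rw [← ofReal_norm, ← ofReal_norm, ← ofReal_norm, ← ENNReal.ofReal_mul (norm_nonneg _)]
  exact ENNReal.ofReal_le_ofReal (norm_inner_le_norm _ _)

/-- The scalar product with `ε(T)a` as an integral over tables. -/
theorem integral_inner_nfock [CompleteSpace K] {T : Op[X,K]}
    (hT : ∀ v, StronglyMeasurable fun ϰ => T ϰ v) {a c : Finset X → K}
    (ha : StronglyMeasurable a) (hc : StronglyMeasurable c) {w : Table X → ℝ≥0∞}
    (hw : Measurable w) (hTw : ∀ᵐ ϰ ∂τ[N], ‖T ϰ‖ₑ ≤ w ϰ)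
    (hconv : ∀ᵐ ϰ ∂ν[N], N.NConv T a ϰ)
    (hfin : ∫⁻ ϰ, ‖c ϰ‖ₑ * N.efock w (fun A => ‖a A‖ₑ) ϰ ∂ν[N] < ∞) :
    Integrable (fun ϰ : Table X => inner ℂ (c ϰ.cod) (T ϰ (a ϰ.dom))) τ[N] ∧
      ∫ ϰ, inner ℂ (c ϰ) (N.nfock T a ϰ) ∂ν[N] =
        ∫ ϰ, inner ℂ (c ϰ.cod) (T ϰ (a ϰ.dom)) ∂τ[N] := by
  have hm : StronglyMeasurable fun ϰ : Table X => inner ℂ (c ϰ.cod) (T ϰ (a ϰ.dom)) :=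
    (hc.comp_measurable Table.measurable_cod).inner
      (StronglyMeasurable.clm_apply_of_forall hT (ha.comp_measurable Table.measurable_dom))
  let e := fun z : C⁴[X] =>
    (⟨z.2.1, z.2.2, z.1.1, z.1.2⟩ : Table X)
  have he := N.measurePreserving_swapTable
  have hw' : Measurable fun z : C⁴[X] =>
      ‖c (z.1.1 ∪ z.1.2)‖ₑ * (w (e z) * ‖a (z.1.1 ∪ z.2.1)‖ₑ) :=
    (hc.enorm.comp (measurable_chain_union₂.comp measurable_fst)).mul
      ((hw.comp he.measurable).mul (ha.enorm.comp measurable_dom₂))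
  have hint : Integrable (fun ϰ : Table X => inner ℂ (c ϰ.cod) (T ϰ (a ϰ.dom)))
      τ[N] := by
    refine ⟨hm.aestronglyMeasurable, ?_⟩
    unfold HasFiniteIntegral
    rw [← he.lintegral_comp hm.enorm]
    refine lt_of_le_of_lt (lintegral_mono_ae (g := fun z =>
      ‖c (z.1.1 ∪ z.1.2)‖ₑ * (w (e z) * ‖a (z.1.1 ∪ z.2.1)‖ₑ)) ?_) ?_
    · filter_upwards [he.quasiMeasurePreserving.ae hTw] with z hz
      refine (enorm_inner_le _ _).trans (mul_le_mul' le_rfl ?_)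
      exact (le_opENorm _ _).trans (mul_le_mul' hz le_rfl)
    · rw [lintegral_prod _ hw'.aemeasurable, ← N.unfold_splits.lint _ hw'.lintegral_prod_right']
      refine lt_of_le_of_lt (le_of_eq ?_) hfin
      refine lintegral_congr fun ϰ => ?_
      rw [sum_splits, efock, mul_sum]
      refine sum_congr rfl fun σ hσ => ?_
      simp only [union_sdiff_of_subset (mem_powerset.mp hσ)]
      exact lintegral_const_mul _ ((hw.comp (he.measurable.comp measurable_prodMk_left)).mul
        (ha.enorm.comp (measurable_const.chain_union measurable_fst)))
  refine ⟨hint, ?_⟩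
  have hint' : Integrable (fun z => inner ℂ (c (e z).cod) (T (e z) (a (e z).dom)))
      (ν²[N].prod ν²[N]) :=
    he.integrable_comp_of_integrable hint
  have h1 : ∫ ϰ, inner ℂ (c ϰ.cod) (T ϰ (a ϰ.dom)) ∂τ[N] =
      ∫ z, inner ℂ (c (e z).cod) (T (e z) (a (e z).dom)) ∂ν²[N].prod ν²[N] := by
    have h2 := integral_map he.measurable.aemeasurable (f := fun ϰ : Table X =>
      inner ℂ (c ϰ.cod) (T ϰ (a ϰ.dom))) (by rw [he.map_eq]; exact hint.1)
    rw [he.map_eq] at h2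
    exact h2
  rw [h1, integral_prod _ hint', ← N.unfold_splits.integral hint'.integral_prod_left]
  refine integral_congr_ae ?_
  filter_upwards [hconv] with ϰ hϰ
  rw [sum_splits, nfock, inner_sum]
  refine sum_congr rfl fun σ hσ => ?_
  rw [← integral_inner (hϰ σ (mem_powerset.mp hσ))]
  refine integral_congr_ae (Eventually.of_forall fun p => ?_)
  simp only [e, Table.cod, Table.dom,
    union_sdiff_of_subset (mem_powerset.mp hσ)]

/-- The conjugate of an operator-valued function. -/
noncomputable def nstar [CompleteSpace K] (T : Op[X,K]) : Op[X,K] :=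
  fun ϰ => adjoint (T ϰ.conj)

theorem OpMeas.nstar [CompleteSpace K] {T : Op[X,K]} (hT : OpMeas T) :
    OpMeas (nstar T) := hT.adjoint.comp_measurable Table.measurable_conj

theorem _root_.Weight.prod_conj (ζ : Weight X) (ϰ : Table X) :
    ζ.conj.prod ϰ = ζ.prod ϰ.conj := by
  simp only [Weight.prod, Weight.conj, Table.conj]; ring

theorem _root_.Weight.Integrable.conj {ζ : Weight X} {μ : Measure X} (h : ζ.Integrable μ) :
    ζ.conj.Integrable μ := ⟨h.op, h.mp, h.oo, h.m0⟩

theorem _root_.Weight.Meas.conj {ζ : Weight X} (h : ζ.Meas) :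
    ζ.conj.Meas := ⟨h.op, h.mp, h.oo, h.m0⟩

theorem Bdd.nstar [CompleteSpace K] {T : Op[X,K]} {c : ℝ≥0} {ζ : Weight X}
    (h : N.Bdd c ζ T) : N.Bdd c ζ.conj (nstar T) := by
  filter_upwards [N.measurePreserving_conj.quasiMeasurePreserving.ae h] with ϰ hϰ
  rw [Weight.prod_conj]
  refine le_trans (le_of_eq ?_) hϰ
  rw [← ofReal_norm, ← ofReal_norm]
  congr 1
  exact LinearIsometryEquiv.norm_map _ _

/-- Formal conjugation of `ε(T)` and `ε(T*)`. -/
theorem integral_inner_nfock_eq [CompleteSpace K] {T : Op[X,K]} (hT : OpMeas T)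
    {C : ℝ≥0} {ζ : Weight X} (hζ : ζ.Integrable N.vol) (hb : N.Bdd C ζ T) {z r : ℝ≥0}
    (hz : ∀ᵐ x ∂N.vol, ζ.oo x ≤ z) (hr : z < r) {ξp ξm : ℝ≥0} (hξ : 0 < ξm)
    (hξp : r ^ 2 * ξm ≤ ξp) {a c : Finset X → K} (ha : N.InG ξp a) (hc : N.InG ξm⁻¹ c) :
    ∫ ϰ, inner ℂ (c ϰ) (N.nfock T a ϰ) ∂ν[N] =
      ∫ ϰ, inner ℂ (N.nfock (nstar T) c ϰ) (a ϰ) ∂ν[N] := by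
  wlog hsm : StronglyMeasurable a ∧ StronglyMeasurable c generalizing a c
  · obtain ⟨a', ha1, ha2, ha3⟩ := ha.exists_sm
    obtain ⟨c', hc1, hc2, hc3⟩ := hc.exists_sm
    have h1 := nfock_congr (N := N) (S := T) (T := T) (Eventually.of_forall fun _ => rfl) ha2
    have h2 := nfock_congr (N := N) (S := nstar T) (T := nstar T)
      (Eventually.of_forall fun _ => rfl) hc2
    refine (integral_congr_ae ?_).trans ((this ha3 hc3 ⟨ha1, hc1⟩).trans (integral_congr_ae ?_))
    · filter_upwards [h1, hc2] with ϰ h3 h4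
      rw [h3, h4]
    · filter_upwards [h2, ha2] with ϰ h3 h4
      rw [h3, h4]
  obtain ⟨ha1, hc1⟩ := hsm
  obtain ⟨ζ', h1, h2, h3, h4⟩ := hb.exists_meas hζ
  have hz' : ∀ᵐ x ∂N.vol, ζ'.oo x ≤ z := by
    filter_upwards [hz, h4] with x h5 h6 using h6.2.2.2.1.trans h5
  have hr0 : 0 < r := lt_of_le_of_lt zero_le hr
  have hξp0 : 0 < ξp := lt_of_lt_of_le (by positivity) hξp
  have hξ' : r ^ 2 * ξp⁻¹ ≤ ξm⁻¹ := by
    rw [← div_eq_mul_inv, div_le_iff₀ hξp0, ← div_eq_inv_mul, le_div_iff₀ hξ]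
    exact hξp
  obtain ⟨C1, hC1⟩ := efock_bound h1 h2 hz' hr C hξ hξp
  obtain ⟨C2, hC2⟩ := efock_bound h1.conj h2.conj (N := N) (z := z) hz' hr C
    (inv_pos.mpr hξp0) hξ'
  have hmeas := Weight.Meas.measurable_bound h1 C
  have hmeas' := Weight.Meas.measurable_bound h1.conj C
  have e1 := integral_inner_nfock hT.app ha1 hc1 hmeas h3
    (ae_nconv hT.app hζ hb hξp0 ha)
    (lintegral_mul_lt_top_of_weighted hξ hc1.enorm (measurable_efock hmeas ha1.enorm) hc.2
      ((hC1 _ ha1.enorm).trans_lt (mul_lt_top coe_lt_top ha.2)))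
  have e2 := integral_inner_nfock (OpMeas.nstar hT).app hc1 ha1 hmeas' h3.nstar
    (ae_nconv (OpMeas.nstar hT).app hζ.conj hb.nstar (inv_pos.mpr hξ) hc)
    (lintegral_mul_lt_top_of_weighted (inv_pos.mpr hξp0) ha1.enorm
      (measurable_efock hmeas' hc1.enorm) (by rw [inv_inv]; exact ha.2)
      ((hC2 _ hc1.enorm).trans_lt (mul_lt_top coe_lt_top hc.2)))
  rw [e1.2]
  have e3 : ∫ ϰ, inner ℂ (N.nfock (nstar T) c ϰ) (a ϰ) ∂ν[N] =
      (starRingEnd ℂ) (∫ ϰ, inner ℂ (a ϰ) (N.nfock (nstar T) c ϰ) ∂ν[N]) := by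
    rw [← integral_conj]
    exact integral_congr_ae (Eventually.of_forall fun ϰ => (inner_conj_symm _ _).symm)
  rw [e3, e2.2, ← integral_conj]
  have h6 := integral_map (μ := τ[N]) (Table.measurable_conj (X := X)).aemeasurable
    (f := fun ϰ : Table X => inner ℂ (c ϰ.cod) (T ϰ (a ϰ.dom)))
    (by rw [N.measurePreserving_conj.map_eq]; exact e1.1.1)
  rw [N.measurePreserving_conj.map_eq] at h6
  rw [h6]
  refine integral_congr_ae (Eventually.of_forall fun ϰ => ?_)
  simp only [nstar]
  rw [inner_conj_symm, adjoint_inner_left]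
  rfl

end Noise

end

namespace Noise

section

variable {α β γ : Type*} [MeasurableSpace α] [MeasurableSpace β] [MeasurableSpace γ]

theorem FinRep.trans {R : α → Finset β} {R' : β → Finset γ} [DecidableEq γ] (h : FinRep R)
    (h' : FinRep R') (hd : ∀ a, (R a : Set β).PairwiseDisjoint R') :
    FinRep fun a => (R a).biUnion R' := by
  obtain ⟨φ, M, hφ, hM, h⟩ := h
  obtain ⟨φ', M', hφ', hM', h'⟩ := h'
  classical
  refine ⟨fun n a => φ' n.unpair.2 (φ n.unpair.1 a),
    fun n => M n.unpair.1 ∩ φ n.unpair.1 ⁻¹' M' n.unpair.2,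
    fun n => (hφ' _).comp (hφ _), fun n => (hM _).inter (hφ _ (hM' _)), fun a => ?_⟩
  obtain ⟨s, hs, hinj, hb⟩ := h a
  choose s' hs' hinj' hb' using h'
  refine ⟨s.biUnion fun n => (s' (φ n a)).image fun m => Nat.pair n m, fun n => ?_, ?_, fun c => ?_⟩
  · simp only [mem_biUnion, mem_image, mem_inter_iff, mem_preimage]
    constructor
    · rintro ⟨k, hk, m, hm, rfl⟩
      simp only [Nat.unpair_pair]
      exact ⟨(hs _).mp hk, (hs' _ _).mp hm⟩
    · rintro ⟨h1, h2⟩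
      exact ⟨n.unpair.1, (hs _).mpr h1, n.unpair.2, (hs' _ _).mpr h2, Nat.pair_unpair n⟩
  · intro n hn k hk hnk
    simp only [Finset.coe_biUnion, coe_image, mem_iUnion, Set.mem_image,
      mem_coe] at hn hk
    obtain ⟨n1, hn1, n2, hn2, rfl⟩ := hn
    obtain ⟨k1, hk1, k2, hk2, rfl⟩ := hk
    simp only [Nat.unpair_pair] at hnk
    have e1 : φ n1 a = φ k1 a := by
      by_contra hne
      have hdis := hd a (mem_coe.mpr ((hb _).mpr ⟨n1, hn1, rfl⟩))
        (mem_coe.mpr ((hb _).mpr ⟨k1, hk1, rfl⟩)) hne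
      refine disjoint_left.mp hdis ((hb' _ _).mpr ⟨n2, hn2, rfl⟩) ?_
      rw [hnk]
      exact (hb' _ _).mpr ⟨k2, hk2, rfl⟩
    have e2 : n1 = k1 := hinj hn1 hk1 e1
    subst e2
    rw [hinj' _ hn2 hk2 hnk]
  · simp only [mem_biUnion, mem_image]
    constructor
    · rintro ⟨b, hbR, hc⟩
      obtain ⟨n, hn, rfl⟩ := (hb b).mp hbR
      obtain ⟨m, hm, rfl⟩ := (hb' _ _).mp hc
      exact ⟨Nat.pair n m, ⟨n, hn, m, hm, rfl⟩, by simp⟩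
    · rintro ⟨_, ⟨n, hn, m, hm, rfl⟩, rfl⟩
      simp only [Nat.unpair_pair]
      exact ⟨φ n a, (hb _).mpr ⟨n, hn, rfl⟩, (hb' _ _).mpr ⟨m, hm, rfl⟩⟩

theorem Unfold.trans {μ : Measure α} {μ' : Measure β} {μ'' : Measure γ} {R : α → Finset β}
    {R' : β → Finset γ} [DecidableEq γ] (h : Unfold μ μ' R) (h' : Unfold μ' μ'' R')
    (hd : ∀ a, (R a : Set β).PairwiseDisjoint R') :
    Unfold μ μ'' fun a => (R a).biUnion R' where
  rep := h.rep.trans h'.rep hd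
  lint f hf := by
    rw [← h'.lint f hf, ← h.lint _ (h'.rep.measurable_sum hf)]
    exact lintegral_congr fun a => sum_biUnion (hd a)

end

section

variable {X : Type*} [MeasurableSpace X] [DecidableEq X] (N : Noise X)

/-- The ordered decompositions of a chain into three parts. -/
def splits₃ (A : Finset X) : Finset (Finset X × C²[X]) :=
  (splits A).biUnion fun q => {q.1} ×ˢ splits q.2

theorem splits₃_disjoint (A : Finset X) : (splits A : Set C²[X]).PairwiseDisjoint
    fun q => ({q.1} : Finset (Finset X)) ×ˢ splits q.2 := by
  intro q hq q' hq' hne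
  refine disjoint_left.mpr fun r hr hr' => hne ?_
  simp only [mem_product, mem_singleton] at hr hr'
  obtain ⟨θ, _, rfl⟩ := mem_image.mp hq
  obtain ⟨θ', _, rfl⟩ := mem_image.mp hq'
  have : θ = θ' := hr.1.symm.trans hr'.1
  rw [this]

theorem sum_splits₃ {M : Type*} [AddCommMonoid M] (A : Finset X)
    (f : Finset X × C²[X] → M) :
    ∑ q ∈ splits₃ A, f q = ∑ β ∈ A.powerset, ∑ α ∈ (A \ β).powerset, f (β, α, (A \ β) \ α) := by
  rw [splits₃, sum_biUnion (splits₃_disjoint A), sum_splits]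
  refine sum_congr rfl fun β _ => ?_
  rw [sum_product, sum_singleton, sum_splits]

theorem sum_powerset_powerset {M : Type*} [AddCommMonoid M] (A : Finset X)
    (f : Finset X → Finset X → M) :
    ∑ s ∈ A.powerset, ∑ σ ∈ s.powerset, f σ (s \ σ) =
      ∑ σ ∈ A.powerset, ∑ η ∈ (A \ σ).powerset, f σ η := by
  rw [sum_sigma', sum_sigma']
  refine sum_bij' (fun q _ => ⟨q.2, q.1 \ q.2⟩) (fun q _ => ⟨q.1 ∪ q.2, q.1⟩) ?_ ?_ ?_ ?_ ?_
  · rintro ⟨s, σ⟩ h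
    simp only [mem_sigma, mem_powerset] at h ⊢
    exact ⟨h.2.trans h.1, sdiff_subset_sdiff h.1 le_rfl⟩
  · rintro ⟨σ, η⟩ h
    simp only [mem_sigma, mem_powerset] at h ⊢
    exact ⟨union_subset h.1 (h.2.trans sdiff_subset), subset_union_left⟩
  · rintro ⟨s, σ⟩ h
    simp only [mem_sigma, mem_powerset] at h
    simp [union_sdiff_of_subset h.2]
  · rintro ⟨σ, η⟩ h
    simp only [mem_sigma, mem_powerset] at h
    have hd : Disjoint η σ := disjoint_of_subset_left h.2 Finset.sdiff_disjoint
    simp only [union_sdiff_left, Finset.sdiff_eq_self_of_disjoint hd]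
  · rintro ⟨s, σ⟩ _
    rfl

theorem sum_powerset_union {M : Type*} [AddCommMonoid M] {A B : Finset X} (h : Disjoint A B)
    (f : Finset X → M) :
    ∑ σ ∈ (A ∪ B).powerset, f σ = ∑ σ ∈ A.powerset, ∑ τ ∈ B.powerset, f (σ ∪ τ) := by
  rw [← Finset.sum_product']
  refine sum_bij' (fun σ _ => (σ ∩ A, σ ∩ B)) (fun q _ => q.1 ∪ q.2) ?_ ?_ ?_ ?_ ?_
  · intro σ _
    simp [Finset.inter_subset_right]
  · rintro ⟨σ, τ⟩ h
    simp only [mem_product, mem_powerset] at h ⊢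
    exact union_subset_union h.1 h.2
  · intro σ hσ
    rw [mem_powerset] at hσ
    rw [← Finset.inter_union_distrib_left, inter_eq_left.mpr hσ]
  · rintro ⟨σ, τ⟩ hq
    simp only [mem_product, mem_powerset] at hq
    have h1 : τ ∩ A = ∅ := Finset.disjoint_iff_inter_eq_empty.mp
      (disjoint_of_subset_left hq.2 h.symm)
    have h2 : σ ∩ B = ∅ := Finset.disjoint_iff_inter_eq_empty.mp
      (disjoint_of_subset_left hq.1 h)
    simp only [Finset.union_inter_distrib_right, inter_eq_left.mpr hq.1, h1, h2,
      inter_eq_left.mpr hq.2, union_empty, empty_union]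
  · intro σ hσ
    rw [mem_powerset] at hσ
    rw [← Finset.inter_union_distrib_left, inter_eq_left.mpr hσ]

theorem union_sdiff_union {A B σ τ : Finset X} (h : Disjoint A B) (hσ : σ ⊆ A) (hτ : τ ⊆ B) :
    (A ∪ B) \ (σ ∪ τ) = (A \ σ) ∪ (B \ τ) := by
  ext x
  have h1 : x ∈ A → x ∉ B := fun ha => disjoint_left.mp h ha
  have h2 := @hσ x
  have h3 := @hτ x
  simp only [mem_sdiff, mem_union]
  tauto

variable [StandardBorelSpace X]

theorem unfold_splits₃ : Unfold ν[N] (ν[N].prod ν²[N]) splits₃ :=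
  N.unfold_splits.trans ((Unfold.id _).prod N.unfold_splits) splits₃_disjoint

end

end Noise

section

variable {X : Type*} [MeasurableSpace X] [DecidableEq X] {N : Noise X} [StandardBorelSpace X]
variable {K : Type*} [NormedAddCommGroup K] [InnerProductSpace ℂ K]

namespace Noise

/-- The product of operator-valued functions, as a sum over partitions. -/
noncomputable def nmul (S T : Op[X,K]) (ϰ : Table X) : K →L[ℂ] K :=
  ∑ θ ∈ ϰ.m0.powerset, ∑ η ∈ ϰ.op.powerset, ∑ β ∈ ϰ.mp.powerset, ∑ α ∈ (ϰ.mp \ β).powerset,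
    (S ⟨θ ∪ β, (ϰ.mp \ β) \ α, ϰ.oo ∪ η, ϰ.op \ η⟩).comp
      (T ⟨ϰ.m0 \ θ, α, ϰ.oo ∪ θ, β ∪ η⟩)

variable (N) in
/-- The entries of a table are disjoint. -/
theorem ae_table_times_disjoint : ∀ᵐ ϰ : Table X ∂τ[N],
    Disjoint (N.times ϰ.m0) (N.times ϰ.mp) ∧ Disjoint (N.times ϰ.m0) (N.times ϰ.oo) ∧
    Disjoint (N.times ϰ.m0) (N.times ϰ.op) ∧ Disjoint (N.times ϰ.mp) (N.times ϰ.oo) ∧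
    Disjoint (N.times ϰ.mp) (N.times ϰ.op) ∧ Disjoint (N.times ϰ.oo) (N.times ϰ.op) := by
  have h := N.ae_times_disjoint
  have q11 := quasiMeasurePreserving_fst (μ := ν²[N])
    (ν := ν²[N])
  have q22 := quasiMeasurePreserving_snd (μ := ν²[N])
    (ν := ν²[N])
  have f := quasiMeasurePreserving_fst (μ := ν[N]) (ν := ν[N])
  have g := quasiMeasurePreserving_snd (μ := ν[N]) (ν := ν[N])
  rw [ae_table_iff]
  filter_upwards [q11.ae h, q22.ae h, (QuasiMeasurePreserving.prodMap f f).ae h,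
    (QuasiMeasurePreserving.prodMap f g).ae h,
    (QuasiMeasurePreserving.prodMap g f).ae h,
    (QuasiMeasurePreserving.prodMap g g).ae h] with q h1 h2 h3 h4 h5 h6
  exact ⟨h1, h3, h4, h5, h6, h2⟩

/-- The integrand of a composition of two Fock representations. -/
def compIntegrand (S T : Op[X,K]) (a : Finset X → K) (s τ σ η : Finset X)
    (z : (C²[X] × Finset X) × C²[X]) : K :=
  S ⟨z.1.1.1 ∪ z.1.1.2, z.1.2, s, τ⟩
    (T ⟨z.2.1, z.2.2, σ ∪ z.1.1.1, η ∪ z.1.1.2⟩ (a ((σ ∪ z.1.1.1) ∪ z.2.1)))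

theorem stronglyMeasurable_compIntegrand {S T : Op[X,K]}
    (hS : ∀ v, StronglyMeasurable fun ϰ => S ϰ v) (hT : ∀ v, StronglyMeasurable fun ϰ => T ϰ v)
    {a : Finset X → K} (ha : StronglyMeasurable a) (s τ σ η : Finset X) :
    StronglyMeasurable (compIntegrand S T a s τ σ η) := by
  have m1 : Measurable fun z : (C²[X] × Finset X) × C²[X] =>
      z.1.1.1 := by fun_prop
  have m2 : Measurable fun z : (C²[X] × Finset X) × C²[X] =>
      z.1.1.2 := by fun_prop
  have m3 : Measurable fun z : (C²[X] × Finset X) × C²[X] =>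
      z.1.2 := by fun_prop
  have m4 : Measurable fun z : (C²[X] × Finset X) × C²[X] =>
      z.2.1 := by fun_prop
  have m5 : Measurable fun z : (C²[X] × Finset X) × C²[X] =>
      z.2.2 := by fun_prop
  have mσ := (measurable_const (a := σ)).chain_union m1
  have mη := (measurable_const (a := η)).chain_union m2
  refine StronglyMeasurable.clm_apply_of_forall (fun v => (hS v).comp_measurable
    (Table.measurable_mk (m1.chain_union m2) m3 measurable_const measurable_const)) ?_
  exact StronglyMeasurable.clm_apply_of_forall (fun v => (hT v).comp_measurable
    (Table.measurable_mk m4 m5 mσ mη)) (ha.comp_measurable (mσ.chain_union m4))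

variable (N) in
/-- The decompositions of the chain `ϰ₀⁻` of the outer Fock representation. -/
theorem unfold_left : Unfold ν²[N] (ν²[N].prod ν[N])
    fun p => splits p.1 ×ˢ {p.2} := N.unfold_splits.prod (Unfold.id _)

variable (N) in
theorem measurePreserving_shuffle : MeasurePreserving
    (fun z : C²[X] × (Finset X × C²[X]) =>
      (((z.1.1, z.2.1), z.2.2.2), (z.1.2, z.2.2.1))) (ν²[N].prod (ν[N].prod ν²[N]))
    ((ν²[N].prod ν[N]).prod ν²[N]) := by
  let ν := ν[N]
  have h1 : MeasurePreserving (fun z : Finset X × C²[X] =>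
      ((z.1, z.2.2), z.2.1)) (ν.prod (ν.prod ν)) ((ν.prod ν).prod ν) :=
    ((measurePreserving_prodAssoc ν ν ν).symm MeasurableEquiv.prodAssoc).comp
      ((MeasurePreserving.id ν).prod measurePreserving_swap)
  have h2 := measurePreserving_prodProdProdComm ν ν (ν.prod ν) ν
  have h3 := ((measurePreserving_prodAssoc ν ν ν).symm MeasurableEquiv.prodAssoc).prod
    (MeasurePreserving.id (ν.prod ν))
  exact h3.comp (h2.comp ((MeasurePreserving.id (ν.prod ν)).prod h1))

theorem nmul_apply_sum (S T : Op[X,K]) (a : Finset X → K) {σ ϰ : Finset X}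
    (P : C²[X]) :
    nmul S T ⟨P.1, P.2, σ, ϰ \ σ⟩ (a (σ ∪ P.1)) = ∑ η ∈ (ϰ \ σ).powerset,
      ∑ b ∈ splits P.1 ×ˢ splits₃ P.2, compIntegrand S T a (σ ∪ η) (ϰ \ (σ ∪ η)) σ η
        (((b.1.1, b.2.1), b.2.2.2), (b.1.2, b.2.2.1)) := by
  unfold nmul
  rw [sum_comm, sum_apply]
  refine sum_congr rfl fun η _ => ?_
  rw [sum_apply, sum_product, sum_splits]
  refine sum_congr rfl fun θ hθ => ?_
  rw [sum_apply, sum_splits₃]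
  refine sum_congr rfl fun β _ => ?_
  rw [sum_apply]
  refine sum_congr rfl fun α _ => ?_
  simp only [compIntegrand, ContinuousLinearMap.comp_apply]
  have e : (ϰ \ σ) \ η = ϰ \ (σ ∪ η) := sdiff_sdiff_left
  rw [union_assoc, union_sdiff_of_subset (mem_powerset.mp hθ), e,
    union_comm η β]

/-- The composition of two Fock representations. -/
theorem nfock_nfock_of_efock [CompleteSpace K] {S T : Op[X,K]}
    (hS : ∀ v, StronglyMeasurable fun ϰ => S ϰ v) (hT : ∀ v, StronglyMeasurable fun ϰ => T ϰ v)
    {a : Finset X → K} (ha : StronglyMeasurable a) {wS wT : Table X → ℝ≥0∞}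
    (hwT : Measurable wT) (hSw : ∀ᵐ ϰ ∂τ[N], ‖S ϰ‖ₑ ≤ wS ϰ) (hTw : ∀ᵐ ϰ ∂τ[N], ‖T ϰ‖ₑ ≤ wT ϰ)
    (hfinT : ∀ᵐ ϰ ∂ν[N], N.efock wT (fun A => ‖a A‖ₑ) ϰ < ∞)
    (hfin : ∀ᵐ ϰ ∂ν[N], N.efock wS (N.efock wT fun A => ‖a A‖ₑ) ϰ < ∞) :
    N.nfock S (N.nfock T a) =ᵐ[ν[N]] N.nfock (nmul S T) a := by
  have hconv := nconv_of_efock hT ha hTw hfinT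
  filter_upwards [ae_fock hSw, ae_fock (ae_dom_of_ae (ae_fock hTw)), ae_fock (ae_dom_of_ae hconv),
    ae_fock N.ae_table_times_disjoint, hfin] with ϰ h1 h2 h3 h4 h5
  -- integrability of the joint integrand
  have hint : ∀ s ⊆ ϰ, ∀ σ ⊆ s, Integrable (compIntegrand S T a s (ϰ \ s) σ (s \ σ))
      ((ν²[N].prod ν[N]).prod ν²[N]) := by
    intro s hs σ hσ
    have hm := stronglyMeasurable_compIntegrand hS hT ha s (ϰ \ s) σ (s \ σ)
    refine ⟨hm.aestronglyMeasurable, ?_⟩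
    unfold HasFiniteIntegral
    rw [lintegral_prod _ hm.enorm.aemeasurable,
      ← N.unfold_left.lint _ hm.enorm.lintegral_prod_right']
    refine lt_of_le_of_lt (lintegral_mono_ae ?_)
      ((ENNReal.sum_lt_top.mp h5) s (mem_powerset.mpr hs))
    filter_upwards [h1 s hs, h2 s hs, h4 s hs] with p h6 h7 h8
    have hdisj : Disjoint s p.1 := (N.disjoint_of_times h8.2.1).symm
    rw [sum_product, sum_splits]
    simp only [sum_singleton]
    unfold efock
    rw [sum_powerset_union hdisj, mul_sum]
    refine le_trans ?_ (single_le_sum (f := fun σ => wS ⟨p.1, p.2, s, ϰ \ s⟩ * ∑ m ∈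
      p.1.powerset, ∫⁻ p', wT ⟨p'.1, p'.2, σ ∪ m, (s ∪ p.1) \ (σ ∪ m)⟩ * ‖a ((σ ∪ m) ∪ p'.1)‖ₑ
      ∂ν²[N]) (fun _ _ => zero_le) (mem_powerset.mpr hσ))
    rw [mul_sum]
    refine sum_le_sum fun m hm' => ?_
    rw [mem_powerset] at hm'
    have hmw : Measurable fun p' : C²[X] =>
        wT ⟨p'.1, p'.2, σ ∪ m, (s ∪ p.1) \ (σ ∪ m)⟩ * ‖a ((σ ∪ m) ∪ p'.1)‖ₑ :=
      (hwT.comp (Table.measurable_mk measurable_fst measurable_snd measurable_const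
        measurable_const)).mul (ha.enorm.comp (measurable_const.chain_union measurable_fst))
    rw [← lintegral_const_mul _ hmw]
    refine lintegral_mono_ae ?_
    filter_upwards [h7 (σ ∪ m) (union_subset_union hσ hm')] with p' h9
    simp only [compIntegrand, union_sdiff_of_subset hm',
      ← union_sdiff_union hdisj hσ hm']
    refine (le_opENorm _ _).trans (mul_le_mul' h6 ?_)
    exact (le_opENorm _ _).trans (mul_le_mul' h9 le_rfl)
  -- the left hand side
  have hl : ∀ s ∈ ϰ.powerset, ∫ p, S ⟨p.1, p.2, s, ϰ \ s⟩ (N.nfock T a (s ∪ p.1))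
      ∂ν²[N] = ∑ σ ∈ s.powerset,
        ∫ z, compIntegrand S T a (σ ∪ (s \ σ)) (ϰ \ (σ ∪ (s \ σ))) σ (s \ σ) z
          ∂((ν²[N].prod ν[N]).prod ν²[N]) := by
    intro s hs
    rw [mem_powerset] at hs
    have hb : ∀ σ ∈ s.powerset, ∫ z, compIntegrand S T a (σ ∪ (s \ σ)) (ϰ \ (σ ∪ (s \ σ))) σ
        (s \ σ) z ∂((ν²[N].prod ν[N]).prod ν²[N]) =
        ∫ p, ∑ b ∈ splits p.1 ×ˢ {p.2}, ∫ p', compIntegrand S T a s (ϰ \ s) σ (s \ σ) (b, p')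
          ∂ν²[N] ∂ν²[N] := by
      intro σ hσ
      rw [mem_powerset] at hσ
      rw [union_sdiff_of_subset hσ, integral_prod _ (hint s hs σ hσ),
        ← N.unfold_left.integral (hint s hs σ hσ).integral_prod_left]
    rw [sum_congr rfl hb, ← integral_finsetSum _ fun σ hσ =>
      N.unfold_left.integrable (hint s hs σ (mem_powerset.mp hσ)).integral_prod_left]
    refine integral_congr_ae ?_
    filter_upwards [h3 s hs, h4 s hs] with p h6 h8
    have hdisj : Disjoint s p.1 := (N.disjoint_of_times h8.2.1).symm
    have h6' : N.NConv T a (s ∪ p.1) := h6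
    unfold nfock
    rw [sum_powerset_union hdisj, map_sum]
    refine sum_congr rfl fun σ hσ => ?_
    rw [mem_powerset] at hσ
    rw [map_sum, sum_product, sum_splits]
    refine sum_congr rfl fun m hm => ?_
    rw [mem_powerset] at hm
    rw [sum_singleton, ← ContinuousLinearMap.integral_comp_comm _
      (h6' (σ ∪ m) (union_subset_union hσ hm))]
    simp only [compIntegrand, union_sdiff_of_subset hm, ← union_sdiff_union hdisj hσ hm]
  change ∑ s ∈ ϰ.powerset, ∫ p, S ⟨p.1, p.2, s, ϰ \ s⟩ (N.nfock T a (s ∪ p.1))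
      ∂ν²[N] = ∑ s ∈ ϰ.powerset, ∫ p,
        nmul S T ⟨p.1, p.2, s, ϰ \ s⟩ (a (s ∪ p.1)) ∂ν²[N]
  rw [sum_congr rfl hl, sum_powerset_powerset ϰ fun σ η =>
    ∫ z, compIntegrand S T a (σ ∪ η) (ϰ \ (σ ∪ η)) σ η z ∂((ν²[N].prod ν[N]).prod ν²[N])]
  refine sum_congr rfl fun σ hσ => ?_
  rw [mem_powerset] at hσ
  have hint' : ∀ η ∈ (ϰ \ σ).powerset, Integrable (fun b : C²[X] ×
      (Finset X × C²[X]) => compIntegrand S T a (σ ∪ η) (ϰ \ (σ ∪ η)) σ η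
        (((b.1.1, b.2.1), b.2.2.2), (b.1.2, b.2.2.1))) (ν²[N].prod (ν[N].prod ν²[N])) := by
    intro η hη
    rw [mem_powerset] at hη
    have hd : Disjoint η σ := disjoint_of_subset_left hη Finset.sdiff_disjoint
    have := hint (σ ∪ η) (union_subset hσ (hη.trans sdiff_subset)) σ
      subset_union_left
    rw [union_sdiff_left, Finset.sdiff_eq_self_of_disjoint hd] at this
    exact N.measurePreserving_shuffle.integrable_comp_of_integrable this
  have hu := N.unfold_splits.prod N.unfold_splits₃
  simp_rw [nmul_apply_sum]
  rw [integral_finsetSum _ fun η hη => hu.integrable (hint' η hη)]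
  refine sum_congr rfl fun η hη => ?_
  rw [hu.integral (hint' η hη)]
  exact (N.measurePreserving_shuffle.integral_comp_of_aestronglyMeasurable
    (stronglyMeasurable_compIntegrand hS hT ha _ _ _ _).aestronglyMeasurable).symm

theorem nfock_nfock [CompleteSpace K] {S T : Op[X,K]}
    (hS : ∀ v, StronglyMeasurable fun ϰ => S ϰ v) (hT : ∀ v, StronglyMeasurable fun ϰ => T ϰ v)
    {cS cT : ℝ≥0} {ζS ζT : Weight X} (hζS : ζS.Integrable N.vol) (hζT : ζT.Integrable N.vol)
    (hbS : N.Bdd cS ζS S) (hbT : N.Bdd cT ζT T) {ξ : ℝ≥0} (hξ : 0 < ξ) {a : Finset X → K}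
    (ha : N.InG ξ a) :
    N.nfock S (N.nfock T a) =ᵐ[ν[N]] N.nfock (nmul S T) a := by
  obtain ⟨b, hb1, hb2, hb3⟩ := ha.exists_sm
  obtain ⟨ζS', s1, s2, s3, -⟩ := hbS.exists_meas hζS
  obtain ⟨ζT', t1, t2, t3, -⟩ := hbT.exists_meas hζT
  have e1 := nfock_congr (N := N) (S := T) (T := T) (Eventually.of_forall fun _ => rfl) hb2
  have e2 := nfock_congr (N := N) (S := S) (T := S) (Eventually.of_forall fun _ => rfl) e1
  have e3 := nfock_congr (N := N) (S := nmul S T) (T := nmul S T)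
    (Eventually.of_forall fun _ => rfl) hb2
  refine e2.trans (EventuallyEq.trans ?_ e3.symm)
  obtain ⟨ξ', hξ', h1⟩ := efock_bound_exists t1 t2 cT hξ
  obtain ⟨ξ'', hξ'', h2⟩ := efock_bound_exists s1 s2 cS hξ'
  have m1 := measurable_efock (N := N) (Weight.Meas.measurable_bound t1 cT) hb1.enorm
  have m2 := measurable_efock (N := N) (Weight.Meas.measurable_bound s1 cS) m1
  have f1 := h1 _ hb1.enorm hb3.2
  exact nfock_nfock_of_efock hS hT hb1
    (Weight.Meas.measurable_bound t1 cT) s3 t3 (ae_lt_top_of_nsq hξ' m1 f1)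
    (ae_lt_top_of_nsq hξ'' m2 (h2 _ m1 f1))

end Noise

end

section

variable {X : Type*} [MeasurableSpace X] [DecidableEq X]
variable {K : Type*} [NormedAddCommGroup K] [InnerProductSpace ℂ K]

/-- The triangle inequality in a normed group, for extended norms. -/
theorem enorm_sum_le_of_normed {E ι : Type*} [SeminormedAddCommGroup E] (s : Finset ι)
    (f : ι → E) : ‖∑ i ∈ s, f i‖ₑ ≤ ∑ i ∈ s, ‖f i‖ₑ := by
  have h : ∀ x : E, ‖x‖ₑ = ((‖x‖₊ : ℝ≥0) : ℝ≥0∞) := fun _ => rfl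
  simp only [h]
  exact_mod_cast nnnorm_sum_le s f

namespace Table

/-- The pairs of tables as quadruples of pairs of chains. -/
def equivPairs : C⁴[X] ×
    C⁴[X] ≃ᵐ Table X × Table X where
  toFun z := (⟨z.1.1.1, z.1.2.1, z.2.1.1, z.2.2.1⟩, ⟨z.1.1.2, z.1.2.2, z.2.1.2, z.2.2.2⟩)
  invFun q := (((q.1.m0, q.2.m0), (q.1.mp, q.2.mp)), ((q.1.oo, q.2.oo), (q.1.op, q.2.op)))
  left_inv _ := rfl
  right_inv _ := rfl
  measurable_toFun := (measurable_mk (by fun_prop) (by fun_prop) (by fun_prop)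
    (by fun_prop)).prodMk (measurable_mk (by fun_prop) (by fun_prop) (by fun_prop) (by fun_prop))
  measurable_invFun :=
    (((measurable_m0.comp measurable_fst).prodMk (measurable_m0.comp measurable_snd)).prodMk
      ((measurable_mp.comp measurable_fst).prodMk (measurable_mp.comp measurable_snd))).prodMk
    (((measurable_oo.comp measurable_fst).prodMk (measurable_oo.comp measurable_snd)).prodMk
      ((measurable_op.comp measurable_fst).prodMk (measurable_op.comp measurable_snd)))

/-- The ordered decompositions of a table into two parts. -/
def splits (ϰ : Table X) : Finset (Table X × Table X) :=
  ((Noise.splits ϰ.m0 ×ˢ Noise.splits ϰ.mp) ×ˢ (Noise.splits ϰ.oo ×ˢ Noise.splits ϰ.op)).map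
    equivPairs.toEquiv.toEmbedding

theorem sum_splits {M : Type*} [AddCommMonoid M] (ϰ : Table X) (f : Table X × Table X → M) :
    ∑ q ∈ ϰ.splits, f q = ∑ m0 ∈ ϰ.m0.powerset, ∑ mp ∈ ϰ.mp.powerset, ∑ oo ∈ ϰ.oo.powerset,
      ∑ op ∈ ϰ.op.powerset, f (⟨m0, mp, oo, op⟩, ϰ.diff ⟨m0, mp, oo, op⟩) := by
  rw [splits, sum_map, sum_product, sum_product, Noise.sum_splits]
  refine sum_congr rfl fun m0 _ => ?_
  rw [Noise.sum_splits]
  refine sum_congr rfl fun mp _ => ?_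
  rw [sum_product, Noise.sum_splits]
  refine sum_congr rfl fun oo _ => ?_
  rw [Noise.sum_splits]
  rfl

end Table

namespace Noise

variable (N : Noise X) [StandardBorelSpace X]

theorem measurePreserving_equivPairs : MeasurePreserving (Table.equivPairs (X := X))
    ((ν²[N].prod ν²[N]).prod (ν²[N].prod ν²[N]))
    (τ[N].prod τ[N]) := by
  let ν := ν[N]
  have h1 := measurePreserving_prodProdProdComm ν ν ν ν
  have h2 := measurePreserving_prodProdProdComm (ν.prod ν) (ν.prod ν) (ν.prod ν) (ν.prod ν)
  exact (N.measurePreserving_equivProd.prod N.measurePreserving_equivProd).comp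
    (h2.comp (h1.prod h1))

theorem measurePreserving_toProd : MeasurePreserving (Table.toProd (X := X)) τ[N]
    (ν²[N].prod ν²[N]) :=
  N.measurePreserving_equivProd.symm Table.equivProd

theorem unfold_tableSplits :
    Unfold τ[N] (τ[N].prod τ[N]) Table.splits := by
  have h := ((N.unfold_splits.prod N.unfold_splits).prod
    (N.unfold_splits.prod N.unfold_splits)).map _ N.measurePreserving_equivPairs
  have h' := h.comp N.measurePreserving_toProd
  exact h'

theorem finRep_tableSplits : FinRep (Table.splits (X := X)) := by
  have h := ((finRep_splits (X := X)).prod (finRep_splits (X := X))).prod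
    ((finRep_splits (X := X)).prod (finRep_splits (X := X)))
  have h' := (h.map Table.equivPairs).comp (Table.measurable_toProd (X := X))
  exact h'

/-- The sum over all subtables. -/
noncomputable def nsum (L : Table X → Op[X,K]) (ϰ : Table X) : K →L[ℂ] K :=
  ∑ q ∈ ϰ.splits, L q.1 q.2

/-- The entrywise sum of weights. -/
def _root_.Weight.add (ζ ζ' : Weight X) : Weight X :=
  ⟨fun x => ζ.m0 x + ζ'.m0 x, fun x => ζ.mp x + ζ'.mp x, fun x => ζ.oo x + ζ'.oo x,
    fun x => ζ.op x + ζ'.op x⟩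

theorem _root_.Weight.Integrable.add {ζ ζ' : Weight X} {μ : Measure X} (h : ζ.Integrable μ)
    (h' : ζ'.Integrable μ) : (ζ.add ζ').Integrable μ := by
  refine ⟨?_, ?_, ?_, ?_⟩ <;> simp only [Weight.add, NNReal.coe_add]
  exacts [h.m0.add h'.m0, h.mp.add h'.mp, h.oo.add h'.oo, h.op.add h'.op]

theorem _root_.Weight.Meas.add {ζ ζ' : Weight X} (h : ζ.Meas) (h' : ζ'.Meas) :
    (ζ.add ζ').Meas := ⟨h.m0.add h'.m0, h.mp.add h'.mp, h.oo.add h'.oo, h.op.add h'.op⟩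

theorem _root_.Weight.prod_add (ζ ζ' : Weight X) (ϰ : Table X) :
    (ζ.add ζ').prod ϰ = ∑ q ∈ ϰ.splits, ζ.prod q.1 * ζ'.prod q.2 := by
  rw [Table.sum_splits]
  simp only [Weight.prod, Weight.add, Finset.prod_add, Table.diff]
  simp only [sum_mul, mul_sum]
  have e : ∀ f : Finset X → Finset X → Finset X → Finset X → ℝ≥0,
      ∑ a ∈ ϰ.m0.powerset, ∑ b ∈ ϰ.mp.powerset, ∑ c ∈ ϰ.oo.powerset, ∑ d ∈ ϰ.op.powerset,
        f a b c d = ∑ d ∈ ϰ.op.powerset, ∑ c ∈ ϰ.oo.powerset, ∑ b ∈ ϰ.mp.powerset,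
        ∑ a ∈ ϰ.m0.powerset, f a b c d := by
    intro f
    rw [sum_comm' (t' := ϰ.mp.powerset) (s' := fun _ => ϰ.m0.powerset) (by simp)]
    simp_rw [sum_comm (s := ϰ.m0.powerset) (t := ϰ.oo.powerset)]
    rw [sum_comm]
    simp_rw [sum_comm (s := ϰ.m0.powerset) (t := ϰ.op.powerset)]
    simp_rw [sum_comm (s := ϰ.mp.powerset) (t := ϰ.op.powerset)]
    rw [sum_comm]
  rw [e]
  refine sum_congr rfl fun d _ => sum_congr rfl fun c' _ =>
    sum_congr rfl fun b _ => sum_congr rfl fun a _ => ?_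
  ring

/-- `‖L(θ, ϰ)‖ ≤ c λ(θ) ζ(ϰ)` for almost all pairs of tables. -/
def Bdd₂ (c : ℝ≥0) (lam ζ : Weight X) (L : Table X → Op[X,K]) : Prop :=
  ∀ᵐ q ∂τ[N].prod τ[N], ‖L q.1 q.2‖ₑ ≤ c * lam.prod q.1 * ζ.prod q.2

variable {N}

theorem Bdd.mono {c : ℝ≥0} {ζ ζ' : Weight X} {T : Op[X,K]} (h : N.Bdd c ζ T)
    (hζ : ∀ᵐ x ∂N.vol, ζ.LeAt ζ' x) : N.Bdd c ζ' T := by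
  filter_upwards [h, N.ae_prod_le hζ] with ϰ h1 h2
  exact h1.trans (mul_le_mul' le_rfl (coe_le_coe.mpr h2))

/-! ### The structure of the product -/

/-- The decompositions of a table that enter into the product. -/
def mulSplits (ϰ : Table X) : Finset (C⁴[X] ×
    ((Finset X × C²[X]) × Finset X)) :=
  (splits ϰ.m0 ×ˢ splits ϰ.op) ×ˢ (splits₃ ϰ.mp ×ˢ {ϰ.oo})

/-- The left factor in a term of the product. -/
def mulLeft (z : C⁴[X] ×
    ((Finset X × C²[X]) × Finset X)) : Table X :=
  ⟨z.1.1.1 ∪ z.2.1.1, z.2.1.2.2, z.2.2 ∪ z.1.2.1, z.1.2.2⟩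

/-- The right factor in a term of the product. -/
def mulRight (z : C⁴[X] ×
    ((Finset X × C²[X]) × Finset X)) : Table X :=
  ⟨z.1.1.2, z.2.1.2.1, z.2.2 ∪ z.1.1.1, z.2.1.1 ∪ z.1.2.1⟩

theorem sum_mulSplits {M : Type*} [AddCommMonoid M] (ϰ : Table X) (f : _ → M) :
    ∑ z ∈ mulSplits ϰ, f z = ∑ θ ∈ ϰ.m0.powerset, ∑ η ∈ ϰ.op.powerset, ∑ β ∈ ϰ.mp.powerset,
      ∑ α ∈ (ϰ.mp \ β).powerset,
        f (((θ, ϰ.m0 \ θ), (η, ϰ.op \ η)), ((β, α, (ϰ.mp \ β) \ α), ϰ.oo)) := by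
  rw [mulSplits, sum_product, sum_product, sum_splits]
  refine sum_congr rfl fun θ _ => ?_
  rw [sum_splits]
  refine sum_congr rfl fun η _ => ?_
  rw [sum_product, sum_splits₃]
  simp only [sum_singleton]

theorem nmul_eq_sum (S T : Op[X,K]) (ϰ : Table X) :
    nmul S T ϰ = ∑ z ∈ mulSplits ϰ, (S (mulLeft z)).comp (T (mulRight z)) := by
  rw [sum_mulSplits]; rfl

theorem measurable_mulLeft : Measurable (mulLeft (X := X)) := by
  refine Table.measurable_mk (Measurable.chain_union ?_ ?_) ?_ (Measurable.chain_union ?_ ?_) ?_ <;>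
    fun_prop

theorem measurable_mulRight : Measurable (mulRight (X := X)) := by
  refine Table.measurable_mk ?_ ?_ (Measurable.chain_union ?_ ?_) (Measurable.chain_union ?_ ?_) <;>
    fun_prop

variable (N) in
theorem unfold_mulSplits : Unfold τ[N] ((ν²[N].prod ν²[N]).prod ((ν[N].prod ν²[N]).prod ν[N]))
    mulSplits := by
  let ν := ν[N]
  have h := (N.unfold_splits.prod N.unfold_splits).prod (N.unfold_splits₃.prod (Unfold.id ν))
  have h1 : MeasurePreserving (fun q : C⁴[X] =>
      ((q.1.1, q.2.2), (q.1.2, q.2.1))) ((ν.prod ν).prod (ν.prod ν)) ((ν.prod ν).prod (ν.prod ν)) :=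
    (measurePreserving_prodProdProdComm ν ν ν ν).comp
      ((MeasurePreserving.id _).prod measurePreserving_swap)
  have h2 : MeasurePreserving (fun ϰ : Table X => ((ϰ.m0, ϰ.op), (ϰ.mp, ϰ.oo))) τ[N]
      ((ν.prod ν).prod (ν.prod ν)) := h1.comp N.measurePreserving_toProd
  have h' := h.comp h2
  exact h'

variable (N) in
theorem qmp_mulLeft : QuasiMeasurePreserving (mulLeft (X := X)) ((ν²[N].prod ν²[N]).prod
      ((ν[N].prod ν²[N]).prod ν[N]))
    τ[N] := by
  let ν := ν[N]
  have sw : MeasurePreserving Prod.swap (ν.prod ν) (ν.prod ν) := measurePreserving_swap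
  -- ((θ, θ'), (η, η')), ((β, (α, γ)), oo) ↦ ((θ, β), (oo, η)), (γ, η')
  have a1 : QuasiMeasurePreserving
      (fun z : C⁴[X] ×
        ((Finset X × C²[X]) × Finset X) =>
        ((z.1.1.1, z.1.2), ((z.2.1.1, z.2.1.2.2), z.2.2)))
      (((ν.prod ν).prod (ν.prod ν)).prod ((ν.prod (ν.prod ν)).prod ν))
      ((ν.prod (ν.prod ν)).prod ((ν.prod ν).prod ν)) := by
    have f := quasiMeasurePreserving_fst (μ := ν) (ν := ν)
    have s := quasiMeasurePreserving_snd (μ := ν) (ν := ν)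
    have i := QuasiMeasurePreserving.id ν
    have i2 := QuasiMeasurePreserving.id (ν.prod ν)
    exact QuasiMeasurePreserving.prodMap
      (QuasiMeasurePreserving.prodMap f i2)
      (QuasiMeasurePreserving.prodMap
        (QuasiMeasurePreserving.prodMap i s) i)
  -- ((θ, (η, η')), ((β, γ), oo)) ↦ ((θ, (β, γ)), ((η, η'), oo))
  have a2 := measurePreserving_prodProdProdComm ν (ν.prod ν) (ν.prod ν) ν
  have a3 : QuasiMeasurePreserving
      (fun z : (Finset X × C²[X]) × (C²[X] × Finset X) =>
        ((z.1.1 ∪ z.1.2.1, z.1.2.2), (z.2.2 ∪ z.2.1.1, z.2.1.2)))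
      ((ν.prod (ν.prod ν)).prod ((ν.prod ν).prod ν)) ((ν.prod ν).prod (ν.prod ν)) := by
    have u := N.quasiMeasurePreserving_union
    have i := QuasiMeasurePreserving.id ν
    have b1 := (QuasiMeasurePreserving.prodMap u i).comp
      ((measurePreserving_prodAssoc ν ν ν).symm MeasurableEquiv.prodAssoc).quasiMeasurePreserving
    have b2 := b1.comp (measurePreserving_swap (μ := ν.prod ν) (ν := ν)).quasiMeasurePreserving
    exact QuasiMeasurePreserving.prodMap b1 b2
  exact N.measurePreserving_equivProd.quasiMeasurePreserving.comp
    (a3.comp (a2.quasiMeasurePreserving.comp a1))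

/-- The reflection of the decompositions that enter into the product. -/
def mulReflect (z : C⁴[X] ×
    ((Finset X × C²[X]) × Finset X)) :
    C⁴[X] ×
    ((Finset X × C²[X]) × Finset X) :=
  ((z.1.2, z.1.1), ((z.2.1.1, (z.2.1.2.2, z.2.1.2.1)), z.2.2))

variable (N) in
theorem measurePreserving_mulReflect : MeasurePreserving (mulReflect (X := X))
    ((ν²[N].prod ν²[N]).prod ((ν[N].prod ν²[N]).prod ν[N])) ((ν²[N].prod ν²[N]).prod
      ((ν[N].prod ν²[N]).prod ν[N])) :=
  measurePreserving_swap.prod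
    (((MeasurePreserving.id _).prod measurePreserving_swap).prod (MeasurePreserving.id _))

theorem mulRight_eq (z : C⁴[X] ×
    ((Finset X × C²[X]) × Finset X)) :
    mulRight z = (mulLeft (mulReflect z)).conj := by
  simp only [mulRight, mulLeft, mulReflect, Table.conj, union_comm]

variable (N) in
theorem qmp_mulRight : QuasiMeasurePreserving (mulRight (X := X)) ((ν²[N].prod ν²[N]).prod
      ((ν[N].prod ν²[N]).prod ν[N]))
    τ[N] := by
  have h := N.measurePreserving_conj.quasiMeasurePreserving.comp
    (N.qmp_mulLeft.comp N.measurePreserving_mulReflect.quasiMeasurePreserving)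
  have e : (Table.conj (X := X)) ∘ mulLeft ∘ mulReflect = mulRight :=
    funext fun z => (mulRight_eq z).symm
  rwa [e] at h

theorem ae_mulLeft {Q : Table X → Prop} (h : ∀ᵐ ϰ ∂τ[N], Q ϰ) :
    ∀ᵐ ϰ ∂τ[N], ∀ z ∈ mulSplits ϰ, Q (mulLeft z) :=
  N.unfold_mulSplits.ae (N.qmp_mulLeft.ae h)

theorem ae_mulRight {Q : Table X → Prop} (h : ∀ᵐ ϰ ∂τ[N], Q ϰ) :
    ∀ᵐ ϰ ∂τ[N], ∀ z ∈ mulSplits ϰ, Q (mulRight z) :=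
  N.unfold_mulSplits.ae (N.qmp_mulRight.ae h)

theorem OpMeas.nmul [CompleteSpace K] {S T : Op[X,K]} (hS : OpMeas S)
    (hT : OpMeas T) : OpMeas (nmul S T) := by
  have h := ((hS.comp_measurable measurable_mulLeft).comp
    (hT.comp_measurable measurable_mulRight)).sum_finRep (R := mulSplits) ?_
  · convert h using 1
    funext ϰ
    exact nmul_eq_sum S T ϰ
  · have h1 := ((finRep_splits (X := X)).prod (finRep_splits (X := X))).prod
      (((finRep_splits (X := X)).trans (FinRep.id.prod finRep_splits) splits₃_disjoint).prod
        (FinRep.id (α := Finset X)))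
    exact h1.comp (g := fun ϰ : Table X => ((ϰ.m0, ϰ.op), (ϰ.mp, ϰ.oo)))
      ((Table.measurable_m0.prodMk Table.measurable_op).prodMk
        (Table.measurable_mp.prodMk Table.measurable_oo))

theorem nmul_congr {S S' T T' : Op[X,K]} (hS : ∀ᵐ ϰ ∂τ[N], S ϰ = S' ϰ)
    (hT : ∀ᵐ ϰ ∂τ[N], T ϰ = T' ϰ) :
    ∀ᵐ ϰ ∂τ[N], nmul S T ϰ = nmul S' T' ϰ := by
  filter_upwards [ae_mulLeft hS, ae_mulRight hT] with ϰ h1 h2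
  rw [nmul_eq_sum, nmul_eq_sum]
  exact sum_congr rfl fun z hz => by rw [h1 z hz, h2 z hz]

end Noise

end

section

variable {X : Type*} [MeasurableSpace X] [DecidableEq X]
variable {K : Type*} [NormedAddCommGroup K] [InnerProductSpace ℂ K]

namespace Noise

theorem sum_tableSplits {M : Type*} [AddCommMonoid M] (A B σ τ : Finset X)
    (f : Table X → Table X → M) :
    ∑ q ∈ Table.splits ⟨A, B, σ, τ⟩, f q.1 q.2 =
      ∑ oo ∈ σ.powerset, ∑ op ∈ τ.powerset, ∑ b ∈ splits A ×ˢ splits B,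
        f ⟨b.1.1, b.2.1, oo, op⟩ ⟨b.1.2, b.2.2, σ \ oo, τ \ op⟩ := by
  rw [Table.splits, sum_map, Finset.sum_product_right, sum_product, sum_splits]
  refine sum_congr rfl fun oo _ => ?_
  rw [sum_splits]
  rfl

theorem sum_powerset_sdiff_comm {M : Type*} [AddCommMonoid M] (A : Finset X)
    (f : Finset X → Finset X → M) :
    ∑ σ ∈ A.powerset, ∑ η ∈ (A \ σ).powerset, f σ η =
      ∑ η ∈ A.powerset, ∑ σ ∈ (A \ η).powerset, f σ η := by
  refine sum_comm' fun σ η => ?_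
  simp only [mem_powerset, Finset.subset_sdiff]
  constructor
  · rintro ⟨h1, h2, h3⟩; exact ⟨⟨h1, h3.symm⟩, h2⟩
  · rintro ⟨⟨h1, h3⟩, h2⟩; exact ⟨h1, h2, h3.symm⟩

theorem sum_powerset_four {M : Type*} [AddCommMonoid M] (A : Finset X)
    (G : Finset X → Finset X → Finset X → Finset X → M) :
    ∑ s ∈ A.powerset, ∑ oo ∈ s.powerset, ∑ op ∈ (A \ s).powerset,
        G oo op (s \ oo) ((A \ s) \ op) =
      ∑ oo ∈ A.powerset, ∑ op ∈ (A \ oo).powerset, ∑ σ ∈ ((A \ oo) \ op).powerset,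
        G oo op σ (((A \ oo) \ op) \ σ) := by
  have h1 : ∀ s ∈ A.powerset, ∑ oo ∈ s.powerset, ∑ op ∈ (A \ s).powerset,
        G oo op (s \ oo) ((A \ s) \ op) = ∑ oo ∈ s.powerset,
      (fun oo σ => ∑ op ∈ ((A \ oo) \ σ).powerset, G oo op σ (((A \ oo) \ σ) \ op)) oo (s \ oo) := by
    intro s _
    refine sum_congr rfl fun oo ho => ?_
    have : (A \ oo) \ (s \ oo) = A \ s := by
      have : (A \ oo) \ (s \ oo) = A \ (oo ∪ (s \ oo)) := sdiff_sdiff_left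
      rw [this, union_sdiff_of_subset (mem_powerset.mp ho)]
    simp only [this]
  rw [sum_congr rfl h1, sum_powerset_powerset A fun oo σ =>
    ∑ op ∈ ((A \ oo) \ σ).powerset, G oo op σ (((A \ oo) \ σ) \ op)]
  refine sum_congr rfl fun oo _ => ?_
  rw [sum_powerset_sdiff_comm]
  refine sum_congr rfl fun op _ => sum_congr rfl fun σ _ => ?_
  rw [sdiff_right_comm]

variable (N : Noise X)

/-- The multiple integral of the Fock representations of `L(θ)`. -/
noncomputable def nmult (L : Table X → Op[X,K]) (a : Finset X → K) (ϰ : Finset X) :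
    K :=
  ∑ oo ∈ ϰ.powerset, ∑ op ∈ (ϰ \ oo).powerset,
    ∫ p, N.nfock (L ⟨p.1, p.2, oo, op⟩) (fun A => a ((oo ∪ p.1) ∪ A)) ((ϰ \ oo) \ op) ∂ν²[N]

variable [StandardBorelSpace X]

theorem ae_mult {Q : Table X → Table X → Prop}
    (h : ∀ᵐ q ∂τ[N].prod τ[N], Q q.1 q.2) :
    ∀ᵐ ϰ ∂ν[N], ∀ oo ⊆ ϰ, ∀ op ⊆ ϰ \ oo, ∀ σ ⊆ (ϰ \ oo) \ op,
      ∀ᵐ z : C⁴[X] ∂ν²[N].prod ν²[N],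
        Q ⟨z.1.1, z.1.2, oo, op⟩ ⟨z.2.1, z.2.2, σ, ((ϰ \ oo) \ op) \ σ⟩ := by
  let ν := ν[N]
  have h0 := (N.measurePreserving_swapTable.prod N.measurePreserving_swapTable).comp
    (measurePreserving_prodProdProdComm (ν.prod ν) (ν.prod ν) (ν.prod ν) (ν.prod ν))
  have h1 : ∀ᵐ z : C⁴[X] ×
      C⁴[X]
      ∂((ν.prod ν).prod (ν.prod ν)).prod ((ν.prod ν).prod (ν.prod ν)),
      Q ⟨z.2.1.1, z.2.1.2, z.1.1.1, z.1.1.2⟩ ⟨z.2.2.1, z.2.2.2, z.1.2.1, z.1.2.2⟩ :=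
    h0.quasiMeasurePreserving.ae h
  have h2 : ∀ᵐ y : C⁴[X]
      ∂(ν.prod ν).prod (ν.prod ν), ∀ᵐ z : C⁴[X]
      ∂(ν.prod ν).prod (ν.prod ν),
      Q ⟨z.1.1, z.1.2, y.1.1, y.1.2⟩ ⟨z.2.1, z.2.2, y.2.1, y.2.2⟩ := ae_ae_of_ae_prod h1
  have h3 : ∀ᵐ y : Finset X × (Finset X × C²[X])
      ∂ν.prod (ν.prod (ν.prod ν)), ∀ᵐ z : C⁴[X]
      ∂(ν.prod ν).prod (ν.prod ν),
      Q ⟨z.1.1, z.1.2, y.1, y.2.1⟩ ⟨z.2.1, z.2.2, y.2.2.1, y.2.2.2⟩ :=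
    ((measurePreserving_prodAssoc ν ν (ν.prod ν)).symm
      MeasurableEquiv.prodAssoc).quasiMeasurePreserving.ae h2
  have h4 := ((Unfold.id ν).prod N.unfold_splits₃).ae h3
  have h5 := N.unfold_splits.ae h4
  filter_upwards [h5] with ϰ hϰ oo hoo op hop σ hσ
  refine hϰ _ (mem_splits hoo) (oo, (op, (σ, ((ϰ \ oo) \ op) \ σ))) ?_
  simp only [mem_product, mem_singleton, true_and]
  refine mem_biUnion.mpr ⟨(op, (ϰ \ oo) \ op), mem_splits hop, ?_⟩
  simp only [mem_product, mem_singleton, true_and]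
  exact mem_splits hσ

/-- The joint integrand of a multiple integral. -/
def multIntegrandJoint (L : Table X → Op[X,K]) (a : Finset X → K)
    (oo op σ τ : Finset X) (z : C⁴[X]) : K :=
  L ⟨z.1.1, z.1.2, oo, op⟩ ⟨z.2.1, z.2.2, σ, τ⟩ (a ((oo ∪ z.1.1) ∪ (σ ∪ z.2.1)))

theorem measurable_multArg (oo σ : Finset X) :
    Measurable fun z : C⁴[X] =>
      (oo ∪ z.1.1) ∪ (σ ∪ z.2.1) :=
  (measurable_const.chain_union (measurable_fst.comp measurable_fst)).chain_union
    (measurable_const.chain_union (measurable_fst.comp measurable_snd))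

theorem measurable_multTables (oo op σ τ : Finset X) :
    Measurable fun z : C⁴[X] =>
      ((⟨z.1.1, z.1.2, oo, op⟩, ⟨z.2.1, z.2.2, σ, τ⟩) : Table X × Table X) :=
  (Table.measurable_mk (by fun_prop) (by fun_prop) (by fun_prop) (by fun_prop)).prodMk
    (Table.measurable_mk (by fun_prop) (by fun_prop) (by fun_prop) (by fun_prop))

theorem multArg_eq {oo s A A' P : Finset X} (hoo : oo ⊆ s) (hP : A ∪ A' = P) :
    (oo ∪ A) ∪ ((s \ oo) ∪ A') = s ∪ P := by
  rw [union_union_union_comm, union_sdiff_of_subset hoo, hP]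

variable {N}

theorem nmult_congr {L : Table X → Op[X,K]} {a b : Finset X → K}
    (hab : a =ᵐ[ν[N]] b) :
    ∀ᵐ ϰ ∂ν[N], ∀ oo ⊆ ϰ, ∀ op ⊆ ϰ \ oo, ∀ᵐ p ∂ν²[N],
      N.nfock (L ⟨p.1, p.2, oo, op⟩) (fun A => a ((oo ∪ p.1) ∪ A)) ((ϰ \ oo) \ op) =
      N.nfock (L ⟨p.1, p.2, oo, op⟩) (fun A => b ((oo ∪ p.1) ∪ A)) ((ϰ \ oo) \ op) := by
  have h1 : ∀ᵐ q : Table X × Table X ∂τ[N].prod τ[N],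
      a (q.1.dom ∪ q.2.dom) = b (q.1.dom ∪ q.2.dom) := by
    have h2 : QuasiMeasurePreserving (Table.dom (X := X)) τ[N] ν[N] := by
      refine ⟨Table.measurable_dom, Measure.AbsolutelyContinuous.mk fun s hs h0 => ?_⟩
      rw [map_apply Table.measurable_dom hs]
      have := ae_dom_of_ae (N := N) (P := fun A => A ∉ s) (measure_eq_zero_iff_ae_notMem.mp h0)
      exact measure_eq_zero_iff_ae_notMem.mpr this
    exact (N.quasiMeasurePreserving_union.comp
      (QuasiMeasurePreserving.prodMap h2 h2)).ae hab
  filter_upwards [N.ae_mult (Q := fun θ κ => a (θ.dom ∪ κ.dom) = b (θ.dom ∪ κ.dom)) h1]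
    with ϰ hϰ oo hoo op hop
  have h3 : ∀ᵐ p : C²[X] ∂ν²[N],
      ∀ σ ∈ ((ϰ \ oo) \ op).powerset,
      ∀ᵐ p' : C²[X] ∂ν²[N],
        a ((oo ∪ p.1) ∪ (σ ∪ p'.1)) = b ((oo ∪ p.1) ∪ (σ ∪ p'.1)) := by
    rw [Filter.eventually_all_finset]
    intro σ hσ
    exact ae_ae_of_ae_prod (hϰ oo hoo op hop σ (mem_powerset.mp hσ))
  filter_upwards [h3] with p hp
  refine sum_congr rfl fun σ hσ => integral_congr_ae ?_
  filter_upwards [hp σ hσ] with p' hp'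
  rw [hp']

theorem nfock_nsum_of_sm [CompleteSpace K] {L : Table X → Op[X,K]}
    (hL : ∀ v, StronglyMeasurable fun q : Table X × Table X => L q.1 q.2 v)
    {c : ℝ≥0} {lam ζ : Weight X} (hlm : lam.Meas) (hζm : ζ.Meas) (hb : N.Bdd₂ c lam ζ L)
    {a : Finset X → K} (ha : StronglyMeasurable a)
    (hfin : ∀ᵐ ϰ ∂ν[N],
      N.efock (fun ϰ => c * (lam.add ζ).prod ϰ) (fun A => ‖a A‖ₑ) ϰ < ∞) :
    ∀ᵐ ϰ ∂ν[N], N.nfock (nsum L) a ϰ = N.nmult L a ϰ ∧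
      ∀ oo ⊆ ϰ, ∀ op ⊆ ϰ \ oo, Integrable (fun p : C²[X] =>
        N.nfock (L ⟨p.1, p.2, oo, op⟩) (fun A => a ((oo ∪ p.1) ∪ A)) ((ϰ \ oo) \ op)) ν²[N] := by
  filter_upwards [N.ae_mult (Q := fun θ κ => ‖L θ κ‖ₑ ≤ c * lam.prod θ * ζ.prod κ) hb, hfin]
    with ϰ h1 h2
  have hcm := measurePreserving_prodProdProdComm ν[N] ν[N] ν[N] ν[N]
  have hu := N.unfold_splits.prod N.unfold_splits
  have hsm : ∀ oo op σ τ, StronglyMeasurable (multIntegrandJoint L a oo op σ τ) := by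
    intro oo op σ τ
    exact StronglyMeasurable.clm_apply_of_forall
      (fun v => (hL v).comp_measurable (measurable_multTables oo op σ τ))
      (ha.comp_measurable (measurable_multArg oo σ))
  have hint : ∀ oo ⊆ ϰ, ∀ op ⊆ ϰ \ oo, ∀ σ ⊆ (ϰ \ oo) \ op,
      Integrable (multIntegrandJoint L a oo op σ (((ϰ \ oo) \ op) \ σ)) (ν²[N].prod ν²[N]) := by
    intro oo hoo op hop σ hσ
    refine ⟨(hsm _ _ _ _).aestronglyMeasurable, ?_⟩
    set τ := ((ϰ \ oo) \ op) \ σ with hτ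
    let β : C⁴[X] → ℝ≥0∞ := fun z =>
      c * lam.prod ⟨z.1.1, z.1.2, oo, op⟩ * ζ.prod ⟨z.2.1, z.2.2, σ, τ⟩ *
        ‖a ((oo ∪ z.1.1) ∪ (σ ∪ z.2.1))‖ₑ
    have hβ : Measurable β := by
      have ht := measurable_multTables oo op σ τ
      exact (((hlm.measurable_prod.comp (measurable_fst.comp ht)).const_mul _).mul
        (hζm.measurable_prod.comp (measurable_snd.comp ht))).mul
        (ha.enorm.comp (measurable_multArg oo σ))
    have hle : HasFiniteIntegral (multIntegrandJoint L a oo op σ τ) (ν²[N].prod ν²[N]) ↔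
        ∫⁻ z, ‖multIntegrandJoint L a oo op σ τ z‖ₑ ∂ν²[N].prod ν²[N] < ∞ := Iff.rfl
    rw [hle]
    refine lt_of_le_of_lt (lintegral_mono_ae (g := β) ?_) ?_
    · filter_upwards [h1 oo hoo op hop σ hσ] with z hz
      exact (le_opENorm _ _).trans (mul_le_mul' hz le_rfl)
    · rw [← hcm.lintegral_comp hβ, ← hu.lint (fun b => β ((b.1.1, b.2.1), (b.1.2, b.2.2)))
        (hβ.comp hcm.measurable)]
      have hs : oo ∪ σ ⊆ ϰ := union_subset hoo
        (hσ.trans (sdiff_subset.trans sdiff_subset))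
      refine lt_of_le_of_lt (lintegral_mono fun P => ?_)
        ((ENNReal.sum_lt_top.mp h2) (oo ∪ σ) (mem_powerset.mpr hs))
      have e1 : ((lam.add ζ).prod ⟨P.1, P.2, oo ∪ σ, ϰ \ (oo ∪ σ)⟩ : ℝ≥0∞) =
          ∑ oo' ∈ (oo ∪ σ).powerset, ∑ op' ∈ (ϰ \ (oo ∪ σ)).powerset,
            ∑ b ∈ splits P.1 ×ˢ splits P.2, (lam.prod ⟨b.1.1, b.2.1, oo', op'⟩ : ℝ≥0∞) *
              ζ.prod ⟨b.1.2, b.2.2, (oo ∪ σ) \ oo', (ϰ \ (oo ∪ σ)) \ op'⟩ := by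
        rw [Weight.prod_add]
        push_cast
        exact sum_tableSplits P.1 P.2 (oo ∪ σ) (ϰ \ (oo ∪ σ)) fun θ κ =>
          (lam.prod θ : ℝ≥0∞) * ζ.prod κ
      have hdis : Disjoint oo σ := Finset.disjoint_of_subset_right
        (hσ.trans sdiff_subset) Finset.disjoint_sdiff
      have e2 : (oo ∪ σ) \ oo = σ := by
        rw [union_sdiff_left, Finset.sdiff_eq_self_of_disjoint hdis.symm]
      have hop' : op ⊆ ϰ \ (oo ∪ σ) := by
        intro x hx
        have h3 := hop hx
        simp only [mem_sdiff, mem_union] at h3 ⊢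
        refine ⟨h3.1, fun h4 => h4.elim h3.2 fun h5 => ?_⟩
        exact (mem_sdiff.mp (hσ h5)).2 hx
      have e3 : (ϰ \ (oo ∪ σ)) \ op = τ := by
        have e4 : ϰ \ (oo ∪ σ) = (ϰ \ oo) \ σ := sdiff_sdiff_left.symm
        rw [hτ, e4, sdiff_right_comm]
      beta_reduce
      rw [e1]
      calc ∑ b ∈ splits P.1 ×ˢ splits P.2, β ((b.1.1, b.2.1), (b.1.2, b.2.2))
          = c * (∑ b ∈ splits P.1 ×ˢ splits P.2, (lam.prod ⟨b.1.1, b.2.1, oo, op⟩ : ℝ≥0∞) *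
              ζ.prod ⟨b.1.2, b.2.2, (oo ∪ σ) \ oo, (ϰ \ (oo ∪ σ)) \ op⟩) *
              ‖a ((oo ∪ σ) ∪ P.1)‖ₑ := by
            rw [mul_sum, sum_mul]
            refine sum_congr rfl fun b hb => ?_
            have hb1 := union_of_mem_splits (mem_product.mp hb).1
            have e4 : (oo ∪ b.1.1) ∪ (σ ∪ b.1.2) = (oo ∪ σ) ∪ P.1 := by
              rw [union_union_union_comm, hb1]
            simp only [β, e2, e3, e4]
            ring
        _ ≤ _ := by
            refine mul_le_mul' (mul_le_mul' le_rfl ?_) le_rfl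
            refine le_trans ?_ (single_le_sum (f := fun oo' =>
              ∑ op' ∈ (ϰ \ (oo ∪ σ)).powerset,
              ∑ b ∈ splits P.1 ×ˢ splits P.2, (lam.prod ⟨b.1.1, b.2.1, oo', op'⟩ : ℝ≥0∞) *
              ζ.prod ⟨b.1.2, b.2.2, (oo ∪ σ) \ oo', (ϰ \ (oo ∪ σ)) \ op'⟩)
              (fun _ _ => zero_le) (mem_powerset.mpr subset_union_left))
            exact single_le_sum (f := fun op' =>
              ∑ b ∈ splits P.1 ×ˢ splits P.2, (lam.prod ⟨b.1.1, b.2.1, oo, op'⟩ : ℝ≥0∞) *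
              ζ.prod ⟨b.1.2, b.2.2, (oo ∪ σ) \ oo, (ϰ \ (oo ∪ σ)) \ op'⟩)
              (fun _ _ => zero_le) (mem_powerset.mpr hop')
  have hr : ∀ oo op p, N.nfock (L ⟨p.1, p.2, oo, op⟩) (fun A => a ((oo ∪ p.1) ∪ A))
      ((ϰ \ oo) \ op) = ∑ σ ∈ ((ϰ \ oo) \ op).powerset,
        ∫ p', multIntegrandJoint L a oo op σ (((ϰ \ oo) \ op) \ σ) (p, p')
          ∂ν²[N] := fun _ _ _ => rfl
  refine ⟨?_, fun oo hoo op hop => ?_⟩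
  · have e1 : N.nmult L a ϰ = ∑ oo ∈ ϰ.powerset, ∑ op ∈ (ϰ \ oo).powerset,
        ∑ σ ∈ ((ϰ \ oo) \ op).powerset,
        ∫ z, multIntegrandJoint L a oo op σ (((ϰ \ oo) \ op) \ σ) z ∂ν²[N].prod ν²[N] := by
      refine sum_congr rfl fun oo hoo => sum_congr rfl fun op hop => ?_
      simp_rw [hr]
      rw [integral_finsetSum _ fun σ hσ => (hint oo (mem_powerset.mp hoo) op
        (mem_powerset.mp hop) σ (mem_powerset.mp hσ)).integral_prod_left]
      exact sum_congr rfl fun σ hσ => (integral_prod _ (hint oo (mem_powerset.mp hoo)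
        op (mem_powerset.mp hop) σ (mem_powerset.mp hσ))).symm
    rw [e1, ← sum_powerset_four ϰ fun oo op σ τ => ∫ z, multIntegrandJoint L a oo op σ τ z
          ∂ν²[N].prod ν²[N]]
    refine sum_congr rfl fun s hs => ?_
    rw [mem_powerset] at hs
    have hint' : ∀ oo ∈ s.powerset, ∀ op ∈ (ϰ \ s).powerset, Integrable
        (fun b : C⁴[X] =>
          multIntegrandJoint L a oo op (s \ oo) ((ϰ \ s) \ op) ((b.1.1, b.2.1), (b.1.2, b.2.2)))
        (ν²[N].prod ν²[N]) := by
      intro oo hoo op hop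
      rw [mem_powerset] at hoo hop
      have e4 : ((ϰ \ oo) \ op) \ (s \ oo) = (ϰ \ s) \ op := by
        rw [sdiff_right_comm]
        congr 1
        have : (ϰ \ oo) \ (s \ oo) = ϰ \ (oo ∪ (s \ oo)) := sdiff_sdiff_left
        rw [this, union_sdiff_of_subset hoo]
      have h3 := hint oo (hoo.trans hs) op (hop.trans (sdiff_subset_sdiff le_rfl hoo))
        (s \ oo) (fun x hx => by
          simp only [mem_sdiff] at hx ⊢
          exact ⟨⟨hs hx.1, hx.2⟩, fun h => (mem_sdiff.mp (hop h)).2 hx.1⟩)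
      rw [e4] at h3
      exact hcm.integrable_comp_of_integrable h3
    have e5 : ∀ P : C²[X], nsum L ⟨P.1, P.2, s, ϰ \ s⟩ (a (s ∪ P.1)) =
        ∑ oo ∈ s.powerset, ∑ op ∈ (ϰ \ s).powerset, ∑ b ∈ splits P.1 ×ˢ splits P.2,
          multIntegrandJoint L a oo op (s \ oo) ((ϰ \ s) \ op)
            ((b.1.1, b.2.1), (b.1.2, b.2.2)) := by
      intro P
      rw [nsum, sum_tableSplits, sum_apply]
      refine sum_congr rfl fun oo hoo => ?_
      rw [sum_apply]
      refine sum_congr rfl fun op _ => ?_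
      rw [sum_apply]
      refine sum_congr rfl fun b hb => ?_
      rw [multIntegrandJoint, multArg_eq (mem_powerset.mp hoo)
        (union_of_mem_splits (mem_product.mp hb).1)]
    simp_rw [e5]
    rw [integral_finsetSum _ fun oo hoo => integrable_finsetSum _ fun op hop =>
      hu.integrable (hint' oo hoo op hop)]
    refine sum_congr rfl fun oo hoo => ?_
    rw [integral_finsetSum _ fun op hop => hu.integrable (hint' oo hoo op hop)]
    refine sum_congr rfl fun op hop => ?_
    rw [hu.integral (hint' oo hoo op hop)]
    exact hcm.integral_comp_of_aestronglyMeasurable (hsm _ _ _ _).aestronglyMeasurable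
  · simp_rw [hr]
    exact integrable_finsetSum _ fun σ hσ =>
      (hint oo hoo op hop σ (mem_powerset.mp hσ)).integral_prod_left

/-- The Fock representation of the sum over subtables is the multiple integral. -/
theorem nfock_nsum [CompleteSpace K] {L : Table X → Op[X,K]}
    (hL : ∀ v, StronglyMeasurable fun q : Table X × Table X => L q.1 q.2 v)
    {c : ℝ≥0} {lam ζ : Weight X} (hlam : lam.Integrable N.vol) (hζ : ζ.Integrable N.vol)
    (hb : N.Bdd₂ c lam ζ L) {ξ : ℝ≥0} (hξ : 0 < ξ) {a : Finset X → K} (ha : N.InG ξ a) :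
    ∀ᵐ ϰ ∂ν[N], N.nfock (nsum L) a ϰ = N.nmult L a ϰ ∧
      ∀ oo ⊆ ϰ, ∀ op ⊆ ϰ \ oo, Integrable (fun p : C²[X] =>
        N.nfock (L ⟨p.1, p.2, oo, op⟩) (fun A => a ((oo ∪ p.1) ∪ A)) ((ϰ \ oo) \ op)) ν²[N] := by
  obtain ⟨b, hb1, hb2, hb3⟩ := ha.exists_sm
  obtain ⟨lam', l1, l2, l3⟩ := hlam.exists_meas
  obtain ⟨ζ', z1, z2, z3⟩ := hζ.exists_meas
  have hb' : N.Bdd₂ c lam' ζ' L := by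
    have h1 := quasiMeasurePreserving_fst (μ := τ[N])
      (ν := τ[N]) |>.ae (N.ae_prod_le (l3.mono fun x hx => hx.1))
    have h2 := quasiMeasurePreserving_snd (μ := τ[N])
      (ν := τ[N]) |>.ae (N.ae_prod_le (z3.mono fun x hx => hx.1))
    unfold Bdd₂ at hb ⊢
    filter_upwards [hb, h1, h2] with q h3 h4 h5
    exact h3.trans (mul_le_mul' (mul_le_mul' le_rfl (coe_le_coe.mpr h4))
      (coe_le_coe.mpr h5))
  obtain ⟨ξ', hξ', h1⟩ := efock_bound_exists (l1.add z1) (l2.add z2) c hξ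
  have m1 := measurable_efock (N := N) (Weight.Meas.measurable_bound (l1.add z1) c) hb1.enorm
  have h2 := nfock_nsum_of_sm hL l1 z1 hb' hb1 (ae_lt_top_of_nsq hξ' m1 (h1 _ hb1.enorm hb3.2))
  have h3 := nfock_congr (N := N) (S := nsum L) (T := nsum L)
    (Eventually.of_forall fun _ => rfl) hb2
  filter_upwards [h2, h3, nmult_congr (L := L) hb2] with ϰ h4 h5 h6
  refine ⟨?_, fun oo hoo op hop => ?_⟩
  · rw [h5, h4.1]
    refine sum_congr rfl fun oo hoo => sum_congr rfl fun op hop => ?_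
    exact (integral_congr_ae (h6 oo (mem_powerset.mp hoo) op
      (mem_powerset.mp hop))).symm
  · refine (h4.2 oo hoo op hop).congr ?_
    filter_upwards [h6 oo hoo op hop] with p hp using hp.symm

end Noise

end

section

variable {X : Type*} [MeasurableSpace X] [DecidableEq X]
variable {K : Type*} [NormedAddCommGroup K] [InnerProductSpace ℂ K]

namespace Weight

/-- The product of weights as triangular matrices. -/
def mul (ζ ζ' : Weight X) : Weight X where
  m0 x := ζ'.m0 x + ζ.m0 x * ζ'.oo x
  mp x := ζ.m0 x * ζ'.op x + (ζ'.mp x + ζ.mp x)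
  oo x := ζ.oo x * ζ'.oo x
  op x := ζ.oo x * ζ'.op x + ζ.op x

theorem Integrable.mul {ζ ζ' : Weight X} {μ : Measure X} (h : ζ.Integrable μ)
    (h' : ζ'.Integrable μ) : (ζ.mul ζ').Integrable μ := by
  refine ⟨?_, ?_, ?_, ?_⟩ <;> simp only [Weight.mul, NNReal.coe_add, NNReal.coe_mul]
  · exact h'.m0.add (MemLp.mul (p := 2) (q := ∞) (r := 2) h'.oo h.m0)
  · exact (MemLp.mul (p := 2) (q := 2) (r := 1) h'.op h.m0).add (h'.mp.add h.mp)
  · exact MemLp.mul (p := ∞) (q := ∞) (r := ∞) h'.oo h.oo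
  · exact (MemLp.mul (p := ∞) (q := 2) (r := 2) h'.op h.oo).add h.op

theorem prod_mul_eq [StandardBorelSpace X] (ζ ζ' : Weight X) (ϰ : Table X) (h1 : Disjoint ϰ.m0 ϰ.mp)
    (h2 : Disjoint ϰ.m0 ϰ.oo) (h3 : Disjoint ϰ.op ϰ.mp) (h4 : Disjoint ϰ.op ϰ.oo) :
    (ζ.mul ζ').prod ϰ =
      ∑ z ∈ Noise.mulSplits ϰ, ζ.prod (Noise.mulLeft z) * ζ'.prod (Noise.mulRight z) := by
  rw [Noise.sum_mulSplits]
  have e1 : ∏ x ∈ ϰ.m0, (ζ.mul ζ').m0 x = ∑ θ ∈ ϰ.m0.powerset,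
      (∏ x ∈ θ, ζ.m0 x * ζ'.oo x) * ∏ x ∈ ϰ.m0 \ θ, ζ'.m0 x := by
    rw [← Finset.prod_add]
    exact prod_congr rfl fun x _ => add_comm _ _
  have e2 : ∏ x ∈ ϰ.op, (ζ.mul ζ').op x = ∑ η ∈ ϰ.op.powerset,
      (∏ x ∈ η, ζ.oo x * ζ'.op x) * ∏ x ∈ ϰ.op \ η, ζ.op x := by
    rw [← Finset.prod_add]
    rfl
  have e3 : ∏ x ∈ ϰ.mp, (ζ.mul ζ').mp x = ∑ β ∈ ϰ.mp.powerset, ∑ α ∈ (ϰ.mp \ β).powerset,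
      (∏ x ∈ β, ζ.m0 x * ζ'.op x) * ((∏ x ∈ α, ζ'.mp x) * ∏ x ∈ (ϰ.mp \ β) \ α, ζ.mp x) := by
    simp_rw [← mul_sum, ← Finset.prod_add]
    rfl
  have e0 : (ζ.mul ζ').prod ϰ = (∏ x ∈ ϰ.oo, ζ.oo x * ζ'.oo x) * ((∏ x ∈ ϰ.m0, (ζ.mul ζ').m0 x) *
      ((∏ x ∈ ϰ.op, (ζ.mul ζ').op x) * ∏ x ∈ ϰ.mp, (ζ.mul ζ').mp x)) := by
    simp only [Weight.prod, Weight.mul]; ring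
  rw [e0, e1, e2, e3, sum_mul, mul_sum]
  refine sum_congr rfl fun θ hθ => ?_
  rw [mem_powerset] at hθ
  rw [sum_mul, mul_sum, mul_sum]
  refine sum_congr rfl fun η hη => ?_
  rw [mem_powerset] at hη
  simp only [mul_sum]
  refine sum_congr rfl fun β hβ => sum_congr rfl fun α _ => ?_
  rw [mem_powerset] at hβ
  have d1 : Disjoint θ β := disjoint_of_subset_left hθ (Finset.disjoint_of_subset_right hβ h1)
  have d2 : Disjoint ϰ.oo η := (disjoint_of_subset_left hη h4).symm
  have d3 : Disjoint ϰ.oo θ := (disjoint_of_subset_left hθ h2).symm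
  have d4 : Disjoint β η := (disjoint_of_subset_left hη
    (Finset.disjoint_of_subset_right hβ h3)).symm
  simp only [Weight.prod, Noise.mulLeft, Noise.mulRight, Finset.prod_union d1,
    Finset.prod_union d2, Finset.prod_union d3, Finset.prod_union d4, prod_mul_distrib]
  ring

end Weight

namespace Noise

variable {N : Noise X} [StandardBorelSpace X]

theorem enorm_nmul_le {S T : Op[X,K]} {c c' : ℝ≥0} {ζ ζ' : Weight X} {ϰ : Table X}
    (hS : ∀ z ∈ mulSplits ϰ, ‖S (mulLeft z)‖ₑ ≤ c * ζ.prod (mulLeft z))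
    (hT : ∀ z ∈ mulSplits ϰ, ‖T (mulRight z)‖ₑ ≤ c' * ζ'.prod (mulRight z))
    (h1 : Disjoint ϰ.m0 ϰ.mp) (h2 : Disjoint ϰ.m0 ϰ.oo) (h3 : Disjoint ϰ.op ϰ.mp)
    (h4 : Disjoint ϰ.op ϰ.oo) :
    ‖nmul S T ϰ‖ₑ ≤ (c * c' : ℝ≥0) * (ζ.mul ζ').prod ϰ := by
  rw [nmul_eq_sum, Weight.prod_mul_eq _ _ _ h1 h2 h3 h4]
  refine (enorm_sum_le_of_normed _ _).trans ?_
  push_cast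
  rw [mul_sum]
  refine sum_le_sum fun z hz => ?_
  have h4 : ‖(S (mulLeft z)).comp (T (mulRight z))‖ₑ ≤ ‖S (mulLeft z)‖ₑ * ‖T (mulRight z)‖ₑ := by
    rw [← ofReal_norm, ← ofReal_norm, ← ofReal_norm, ← ENNReal.ofReal_mul (norm_nonneg _)]
    exact ENNReal.ofReal_le_ofReal (ContinuousLinearMap.opNorm_comp_le _ _)
  refine h4.trans ((mul_le_mul' (hS z hz) (hT z hz)).trans (le_of_eq ?_))
  ring

theorem Bdd.nmul {S T : Op[X,K]} {c c' : ℝ≥0} {ζ ζ' : Weight X} (hS : N.Bdd c ζ S)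
    (hT : N.Bdd c' ζ' T) : N.Bdd (c * c') (ζ.mul ζ') (nmul S T) := by
  unfold Bdd
  filter_upwards [ae_mulLeft hS, ae_mulRight hT, N.ae_table_times_disjoint] with ϰ h1 h2 h3
  exact enorm_nmul_le h1 h2 (N.disjoint_of_times h3.1)
    (N.disjoint_of_times h3.2.1) (N.disjoint_of_times h3.2.2.2.2.1).symm
    (N.disjoint_of_times h3.2.2.2.2.2).symm

end Noise

end

/-! ### The algebra of operator-valued functions -/

section

variable {X : Type*} [DecidableEq X]
variable {K : Type*} [NormedAddCommGroup K] [InnerProductSpace ℂ K]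

namespace Noise

theorem nmul_add_right (R S T : Op[X,K]) (ϰ : Table X) :
    nmul R (fun ϰ => S ϰ + T ϰ) ϰ = nmul R S ϰ + nmul R T ϰ := by
  simp only [nmul, ContinuousLinearMap.comp_add, sum_add_distrib]

theorem nmul_add_left (R S T : Op[X,K]) (ϰ : Table X) :
    nmul (fun ϰ => R ϰ + S ϰ) T ϰ = nmul R T ϰ + nmul S T ϰ := by
  simp only [nmul, ContinuousLinearMap.add_comp, sum_add_distrib]

theorem nmul_smul_left (z : ℂ) (S T : Op[X,K]) (ϰ : Table X) :
    nmul (fun ϰ => z • S ϰ) T ϰ = z • nmul S T ϰ := by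
  simp only [nmul, ContinuousLinearMap.smul_comp, smul_sum]

theorem nmul_smul_right (z : ℂ) (S T : Op[X,K]) (ϰ : Table X) :
    nmul S (fun ϰ => z • T ϰ) ϰ = z • nmul S T ϰ := by
  simp only [nmul, ContinuousLinearMap.comp_smul, smul_sum]

theorem sum_powerset_compl {M : Type*} [AddCommMonoid M] (A : Finset X)
    (f : Finset X → Finset X → M) :
    ∑ α ∈ A.powerset, f α (A \ α) = ∑ α ∈ A.powerset, f (A \ α) α := by
  refine sum_bij' (fun α _ => A \ α) (fun α _ => A \ α) ?_ ?_ ?_ ?_ ?_ <;>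
    intro α hα <;> rw [mem_powerset] at hα <;>
    simp [Finset.inter_eq_right.mpr hα]

theorem nstar_nmul [CompleteSpace K] (S T : Op[X,K]) (ϰ : Table X) :
    nstar (nmul S T) ϰ = nmul (nstar T) (nstar S) ϰ := by
  simp only [nstar, nmul, map_sum, adjoint_comp, Table.conj]
  rw [sum_comm]
  refine sum_congr rfl fun θ _ => sum_congr rfl fun η _ =>
    sum_congr rfl fun β _ => ?_
  rw [← sum_powerset_compl (ϰ.mp \ β) fun γ α => (adjoint
    (T ⟨ϰ.op \ η, γ, ϰ.oo ∪ η, θ ∪ β⟩)).comp (adjoint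
    (S ⟨β ∪ η, α, ϰ.oo ∪ θ, ϰ.m0 \ θ⟩))]
  refine sum_congr rfl fun α _ => ?_
  rw [union_comm β θ, union_comm η β]

/-- The unit with values in given projections. -/
noncomputable def none (P : Finset X → K →L[ℂ] K) (ϰ : Table X) : K →L[ℂ] K :=
  if ϰ.m0 = ∅ ∧ ϰ.mp = ∅ ∧ ϰ.op = ∅ then P ϰ.oo else 0

theorem none_nmul (P : Finset X → K →L[ℂ] K) (T : Op[X,K]) (ϰ : Table X) :
    nmul (none P) T ϰ = (P ϰ.cod).comp (T ϰ) := by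
  unfold nmul
  rw [sum_eq_single ∅, sum_eq_single ϰ.op, sum_eq_single ∅,
    sum_eq_single ϰ.mp]
  · simp [none, Table.cod]
  · intro α hα hne
    have : (ϰ.mp \ ∅) \ α ≠ ∅ := fun h => hne (Finset.Subset.antisymm
      (by simpa using hα) (sdiff_eq_empty_iff_subset.mp (by simpa using h)))
    rw [none, if_neg (fun h => this h.2.1), ContinuousLinearMap.zero_comp]
  · intro h; simp at h
  · intro β _ hne
    refine sum_eq_zero fun α _ => ?_
    rw [none, if_neg (fun h => hne (by simpa using h.1)), ContinuousLinearMap.zero_comp]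
  · intro h; simp at h
  · intro η hη hne
    refine sum_eq_zero fun β _ => sum_eq_zero fun α _ => ?_
    have : ϰ.op \ η ≠ ∅ := fun h => hne (Finset.Subset.antisymm
      (by simpa using hη) (sdiff_eq_empty_iff_subset.mp h))
    rw [none, if_neg (fun h => this h.2.2), ContinuousLinearMap.zero_comp]
  · intro h; simp at h
  · intro θ _ hne
    refine sum_eq_zero fun η _ => sum_eq_zero fun β _ =>
      sum_eq_zero fun α _ => ?_
    rw [none, if_neg (fun h => hne (union_eq_empty.mp h.1).1),
      ContinuousLinearMap.zero_comp]
  · intro h; simp at h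

theorem nmul_none (P : Finset X → K →L[ℂ] K) (T : Op[X,K]) (ϰ : Table X) :
    nmul T (none P) ϰ = (T ϰ).comp (P ϰ.dom) := by
  unfold nmul
  rw [sum_eq_single ϰ.m0, sum_eq_single ∅, sum_eq_single ∅,
    sum_eq_single ∅]
  · simp [none, Table.dom]
  · intro α _ hne
    rw [none, if_neg (fun h => hne h.2.1), ContinuousLinearMap.comp_zero]
  · intro h; simp at h
  · intro β _ hne
    refine sum_eq_zero fun α _ => ?_
    rw [none, if_neg (fun h => hne (union_eq_empty.mp h.2.2).1),
      ContinuousLinearMap.comp_zero]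
  · intro h; simp at h
  · intro η _ hne
    refine sum_eq_zero fun β _ => sum_eq_zero fun α _ => ?_
    rw [none, if_neg (fun h => hne (union_eq_empty.mp h.2.2).2),
      ContinuousLinearMap.comp_zero]
  · intro h; simp at h
  · intro θ hθ hne
    refine sum_eq_zero fun η _ => sum_eq_zero fun β _ =>
      sum_eq_zero fun α _ => ?_
    have : ϰ.m0 \ θ ≠ ∅ := fun h => hne (Finset.Subset.antisymm
      (by simpa using hθ) (sdiff_eq_empty_iff_subset.mp h))
    rw [none, if_neg (fun h => this h.1), ContinuousLinearMap.comp_zero]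
  · intro h; simp at h

/-! ### The derivative of a product -/

/-- The function `ϰ ↦ T(ϰ ⊔ x^μ_ν)`. -/
def ndot (T : Op[X,K]) (x : X) (μ ν : Ind) (ϰ : Table X) : K →L[ℂ] K :=
  T ((Table.elem x μ ν).union ϰ)

/-- The triangular matrix of the derivatives. -/
def ntri (T T' : Op[X,K]) (x : X) (μ ν : Ind) : Op[X,K] :=
  match μ, ν with
  | .minus, .minus => T'
  | .minus, .zero => ndot T x .minus .zero
  | .minus, .plus => ndot T x .minus .plus
  | .zero, .minus => 0
  | .zero, .zero => ndot T x .zero .zero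
  | .zero, .plus => ndot T x .zero .plus
  | .plus, .minus => 0
  | .plus, .zero => 0
  | .plus, .plus => T'

/-- All points of a table. -/
def _root_.Table.pts (ϰ : Table X) : Finset X := ϰ.m0 ∪ ϰ.mp ∪ ϰ.oo ∪ ϰ.op

theorem nmul_congr_on {S S' T T' : Op[X,K]} {ϰ : Table X}
    (hS : ∀ κ : Table X, κ.pts ⊆ ϰ.pts → S κ = S' κ)
    (hT : ∀ κ : Table X, κ.pts ⊆ ϰ.pts → T κ = T' κ) : nmul S T ϰ = nmul S' T' ϰ := by
  unfold nmul
  refine sum_congr rfl fun θ hθ => sum_congr rfl fun η hη =>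
    sum_congr rfl fun β hβ => sum_congr rfl fun α hα => ?_
  rw [mem_powerset] at hθ hη hβ hα
  rw [hS, hT]
  · intro x
    have h1 := @hθ x; have h2 := @hη x; have h3 := @hβ x; have h4 := @hα x
    simp only [Table.pts, mem_union, mem_sdiff] at h1 h2 h3 h4 ⊢
    tauto
  · intro x
    have h1 := @hθ x; have h2 := @hη x; have h3 := @hβ x; have h4 := @hα x
    simp only [Table.pts, mem_union, mem_sdiff] at h1 h2 h3 h4 ⊢
    tauto

theorem nmul_zero (S : Op[X,K]) (ϰ : Table X) : nmul S 0 ϰ = 0 := by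
  simp [nmul]

theorem zero_nmul (T : Op[X,K]) (ϰ : Table X) : nmul 0 T ϰ = 0 := by
  simp [nmul]

theorem ndot_minus_zero (T : Op[X,K]) (x : X) (ϰ : Table X) :
    ndot T x .minus .zero ϰ = T ⟨insert x ϰ.m0, ϰ.mp, ϰ.oo, ϰ.op⟩ := by
  simp only [ndot, Table.elem, Table.union, empty_union, singleton_union]

theorem ndot_minus_plus (T : Op[X,K]) (x : X) (ϰ : Table X) :
    ndot T x .minus .plus ϰ = T ⟨ϰ.m0, insert x ϰ.mp, ϰ.oo, ϰ.op⟩ := by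
  simp only [ndot, Table.elem, Table.union, empty_union, singleton_union]

theorem ndot_zero_zero (T : Op[X,K]) (x : X) (ϰ : Table X) :
    ndot T x .zero .zero ϰ = T ⟨ϰ.m0, ϰ.mp, insert x ϰ.oo, ϰ.op⟩ := by
  simp only [ndot, Table.elem, Table.union, empty_union, singleton_union]

theorem ndot_zero_plus (T : Op[X,K]) (x : X) (ϰ : Table X) :
    ndot T x .zero .plus ϰ = T ⟨ϰ.m0, ϰ.mp, ϰ.oo, insert x ϰ.op⟩ := by
  simp only [ndot, Table.elem, Table.union, empty_union, singleton_union]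

theorem nmul_insert_oo (S T : Op[X,K]) (x : X) (ϰ : Table X) :
    nmul S T ⟨ϰ.m0, ϰ.mp, insert x ϰ.oo, ϰ.op⟩ =
      nmul (ndot S x .zero .zero) (ndot T x .zero .zero) ϰ := by
  simp only [nmul, ndot_zero_zero, insert_union]

theorem nmul_insert_m0 (S T : Op[X,K]) {x : X} {ϰ : Table X} (hx : x ∉ ϰ.m0) :
    nmul S T ⟨insert x ϰ.m0, ϰ.mp, ϰ.oo, ϰ.op⟩ =
      nmul S (ndot T x .minus .zero) ϰ +
        nmul (ndot S x .minus .zero) (ndot T x .zero .zero) ϰ := by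
  simp only [nmul, ndot_minus_zero, ndot_zero_zero]
  rw [sum_powerset_insert hx]
  refine congrArg₂ (· + ·) ?_ ?_
  · refine sum_congr rfl fun θ hθ => ?_
    have : insert x ϰ.m0 \ θ = insert x (ϰ.m0 \ θ) := insert_sdiff_of_notMem _
      fun h => hx (mem_powerset.mp hθ h)
    simp only [this]
  · refine sum_congr rfl fun θ hθ => ?_
    have : insert x ϰ.m0 \ insert x θ = ϰ.m0 \ θ := by
      rw [insert_sdiff_insert, sdiff_insert_of_notMem hx]
    simp only [this, insert_union, union_insert]

theorem nmul_insert_op (S T : Op[X,K]) {x : X} {ϰ : Table X} (hx : x ∉ ϰ.op) :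
    nmul S T ⟨ϰ.m0, ϰ.mp, ϰ.oo, insert x ϰ.op⟩ =
      nmul (ndot S x .zero .plus) T ϰ +
        nmul (ndot S x .zero .zero) (ndot T x .zero .plus) ϰ := by
  simp only [nmul, ndot_zero_plus, ndot_zero_zero]
  rw [← sum_add_distrib]
  refine sum_congr rfl fun θ _ => ?_
  rw [sum_powerset_insert hx]
  refine congrArg₂ (· + ·) ?_ ?_
  · refine sum_congr rfl fun η hη => ?_
    have : insert x ϰ.op \ η = insert x (ϰ.op \ η) := insert_sdiff_of_notMem _
      fun h => hx (mem_powerset.mp hη h)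
    simp only [this]
  · refine sum_congr rfl fun η hη => ?_
    have : insert x ϰ.op \ insert x η = ϰ.op \ η := by
      rw [insert_sdiff_insert, sdiff_insert_of_notMem hx]
    simp only [this, union_insert]

theorem nmul_insert_mp (S T : Op[X,K]) {x : X} {ϰ : Table X} (hx : x ∉ ϰ.mp) :
    nmul S T ⟨ϰ.m0, insert x ϰ.mp, ϰ.oo, ϰ.op⟩ =
      nmul (ndot S x .minus .plus) T ϰ + nmul S (ndot T x .minus .plus) ϰ +
        nmul (ndot S x .minus .zero) (ndot T x .zero .plus) ϰ := by
  simp only [nmul, ndot_minus_plus, ndot_minus_zero, ndot_zero_plus]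
  simp only [← sum_add_distrib]
  refine sum_congr rfl fun θ _ => sum_congr rfl fun η _ => ?_
  rw [sum_powerset_insert hx, ← sum_add_distrib]
  refine sum_congr rfl fun β hβ => ?_
  have h1 : insert x ϰ.mp \ β = insert x (ϰ.mp \ β) := insert_sdiff_of_notMem _
    fun h => hx (mem_powerset.mp hβ h)
  have h2 : insert x ϰ.mp \ insert x β = ϰ.mp \ β := by
    rw [insert_sdiff_insert, sdiff_insert_of_notMem hx]
  have h3 : x ∉ ϰ.mp \ β := fun h => hx (mem_sdiff.mp h).1
  rw [h1, h2, sum_powerset_insert h3]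
  simp only [sum_add_distrib, insert_union, union_insert]
  refine congrArg₂ (· + ·) (congrArg₂ (· + ·) ?_ ?_) rfl
  · refine sum_congr rfl fun α hα => ?_
    have : insert x (ϰ.mp \ β) \ α = insert x ((ϰ.mp \ β) \ α) := insert_sdiff_of_notMem _
      fun h => h3 (mem_powerset.mp hα h)
    rw [this]
  · refine sum_congr rfl fun α hα => ?_
    have : insert x (ϰ.mp \ β) \ insert x α = (ϰ.mp \ β) \ α := by
      rw [insert_sdiff_insert, sdiff_insert_of_notMem h3]
    rw [this]

/-- The product of triangular matrices of operator-valued functions. -/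
noncomputable def ntriMul (S T : Ind → Ind → Op[X,K]) (μ ν : Ind) (ϰ : Table X) :
    K →L[ℂ] K :=
  nmul (S μ .minus) (T .minus ν) ϰ + nmul (S μ .zero) (T .zero ν) ϰ +
    nmul (S μ .plus) (T .plus ν) ϰ

/-- The triangular matrix of the derivatives of a product is the product of the matrices. -/
theorem ntri_nmul (S T : Op[X,K]) {x : X} {ϰ : Table X} (hx : x ∉ ϰ.pts)
    (μ ν : Ind) :
    ntri (nmul S T) (nmul S T) x μ ν ϰ = ntriMul (ntri S S x) (ntri T T x) μ ν ϰ := by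
  simp only [Table.pts, mem_union, not_or] at hx
  obtain ⟨⟨⟨h1, h2⟩, h3⟩, h4⟩ := hx
  cases μ <;> cases ν <;>
    simp only [ntri, ntriMul, nmul_zero, zero_nmul, add_zero, zero_add, Pi.zero_apply]
  · rw [ndot_minus_zero, nmul_insert_m0 S T h1]
  · rw [ndot_minus_plus, nmul_insert_mp S T h2]
    abel
  · rw [ndot_zero_zero, nmul_insert_oo]
  · rw [ndot_zero_plus, nmul_insert_op S T h4]
    abel

/-! ### Associativity -/

theorem ntriMul_assoc (R S T : Ind → Ind → Op[X,K]) {ϰ : Table X}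
    (h : ∀ R S T : Op[X,K], nmul (nmul R S) T ϰ = nmul R (nmul S T) ϰ) (μ ν : Ind) :
    ntriMul (ntriMul R S) T μ ν ϰ = ntriMul R (ntriMul S T) μ ν ϰ := by
  have e1 : ∀ μ κ, ntriMul R S μ κ = fun ϰ => nmul (R μ .minus) (S .minus κ) ϰ +
    nmul (R μ .zero) (S .zero κ) ϰ + nmul (R μ .plus) (S .plus κ) ϰ := fun _ _ => rfl
  have e2 : ∀ κ ν, ntriMul S T κ ν = fun ϰ => nmul (S κ .minus) (T .minus ν) ϰ +
    nmul (S κ .zero) (T .zero ν) ϰ + nmul (S κ .plus) (T .plus ν) ϰ := fun _ _ => rfl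
  rw [ntriMul, ntriMul]
  simp only [e1, e2, nmul_add_left, nmul_add_right]
  have h' : ∀ R S T : Op[X,K],
    nmul (fun ϰ => nmul R S ϰ) T ϰ = nmul R (fun ϰ => nmul S T ϰ) ϰ := h
  simp only [h']
  abel

theorem ntri_nmul_assoc (R S T : Op[X,K]) {x : X} {ϰ : Table X} (hx : x ∉ ϰ.pts)
    (h : ∀ R S T : Op[X,K], nmul (nmul R S) T ϰ = nmul R (nmul S T) ϰ) (μ ν : Ind) :
    ntri (nmul (nmul R S) T) (nmul (nmul R S) T) x μ ν ϰ =
      ntri (nmul R (nmul S T)) (nmul R (nmul S T)) x μ ν ϰ := by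
  rw [ntri_nmul _ _ hx, ntri_nmul _ _ hx]
  have e1 : ntriMul (ntri (nmul R S) (nmul R S) x) (ntri T T x) μ ν ϰ =
      ntriMul (ntriMul (ntri R R x) (ntri S S x)) (ntri T T x) μ ν ϰ := by
    have h1 : ∀ μ (κ : Table X), κ.pts ⊆ ϰ.pts → ∀ ν, ntri (nmul R S) (nmul R S) x μ ν κ =
        ntriMul (ntri R R x) (ntri S S x) μ ν κ := fun μ κ hκ ν =>
      ntri_nmul R S (fun hx' => hx (hκ hx')) μ ν
    rw [ntriMul, ntriMul]
    rw [nmul_congr_on (fun κ hκ => h1 μ κ hκ .minus) fun _ _ => rfl,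
      nmul_congr_on (fun κ hκ => h1 μ κ hκ .zero) fun _ _ => rfl,
      nmul_congr_on (fun κ hκ => h1 μ κ hκ .plus) fun _ _ => rfl]
  have e2 : ntriMul (ntri R R x) (ntri (nmul S T) (nmul S T) x) μ ν ϰ =
      ntriMul (ntri R R x) (ntriMul (ntri S S x) (ntri T T x)) μ ν ϰ := by
    have h1 : ∀ μ (κ : Table X), κ.pts ⊆ ϰ.pts → ∀ ν, ntri (nmul S T) (nmul S T) x μ ν κ =
        ntriMul (ntri S S x) (ntri T T x) μ ν κ := fun μ κ hκ ν =>
      ntri_nmul S T (fun hx' => hx (hκ hx')) μ ν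
    rw [ntriMul, ntriMul]
    rw [nmul_congr_on (fun _ _ => rfl) fun κ hκ => h1 .minus κ hκ ν,
      nmul_congr_on (fun _ _ => rfl) fun κ hκ => h1 .zero κ hκ ν,
      nmul_congr_on (fun _ _ => rfl) fun κ hκ => h1 .plus κ hκ ν]
  rw [e1, e2, ntriMul_assoc _ _ _ h]

/-- The product is associative on the tables with disjoint entries. -/
theorem nmul_assoc (R S T : Op[X,K]) (ϰ : Table X) (h1 : Disjoint ϰ.m0 ϰ.mp)
    (h2 : Disjoint ϰ.m0 ϰ.oo) (h3 : Disjoint ϰ.m0 ϰ.op) (h4 : Disjoint ϰ.mp ϰ.oo)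
    (h5 : Disjoint ϰ.mp ϰ.op) (h6 : Disjoint ϰ.oo ϰ.op) :
    nmul (nmul R S) T ϰ = nmul R (nmul S T) ϰ := by
  obtain ⟨n, hn⟩ : ∃ n, n = ϰ.m0.card + ϰ.mp.card + ϰ.oo.card + ϰ.op.card := ⟨_, rfl⟩
  induction n generalizing ϰ R S T with
  | zero =>
    obtain ⟨m0, mp, oo, op⟩ := ϰ
    dsimp only at hn
    obtain rfl : m0 = ∅ := card_eq_zero.mp (by omega)
    obtain rfl : mp = ∅ := card_eq_zero.mp (by omega)
    obtain rfl : oo = ∅ := card_eq_zero.mp (by omega)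
    obtain rfl : op = ∅ := card_eq_zero.mp (by omega)
    simp [nmul, ContinuousLinearMap.comp_assoc]
  | succ n ih =>
    obtain ⟨m0, mp, oo, op⟩ := ϰ
    dsimp only at hn h1 h2 h3 h4 h5 h6
    have key : ∀ (x : X) (μ ν : Ind) (κ : Table X), x ∉ κ.pts →
        n = κ.m0.card + κ.mp.card + κ.oo.card + κ.op.card → Disjoint κ.m0 κ.mp →
        Disjoint κ.m0 κ.oo → Disjoint κ.m0 κ.op → Disjoint κ.mp κ.oo → Disjoint κ.mp κ.op →
        Disjoint κ.oo κ.op → ntri (nmul (nmul R S) T) (nmul (nmul R S) T) x μ ν κ =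
          ntri (nmul R (nmul S T)) (nmul R (nmul S T)) x μ ν κ :=
      fun x μ ν κ hx hn d1 d2 d3 d4 d5 d6 => ntri_nmul_assoc R S T hx
        (fun R S T => ih R S T κ d1 d2 d3 d4 d5 d6 hn) μ ν
    rcases m0.eq_empty_or_nonempty with rfl | ⟨x, hx⟩
    · rcases mp.eq_empty_or_nonempty with rfl | ⟨x, hx⟩
      · rcases oo.eq_empty_or_nonempty with rfl | ⟨x, hx⟩
        · rcases op.eq_empty_or_nonempty with rfl | ⟨x, hx⟩
          · simp at hn
          · obtain ⟨op', hop, rfl⟩ : ∃ op', x ∉ op' ∧ insert x op' = op :=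
              ⟨op.erase x, notMem_erase _ _, insert_erase hx⟩
            have := key x .zero .plus ⟨∅, ∅, ∅, op'⟩ (by simpa [Table.pts] using hop)
              (by simp [hop] at hn ⊢; omega) (by simp) (by simp) (by simp) (by simp) (by simp)
              (by simp)
            simpa only [ntri, ndot_zero_plus] using this
        · obtain ⟨oo', hoo, rfl⟩ : ∃ oo', x ∉ oo' ∧ insert x oo' = oo :=
            ⟨oo.erase x, notMem_erase _ _, insert_erase hx⟩
          rw [Finset.disjoint_insert_left] at h6
          have := key x .zero .zero ⟨∅, ∅, oo', op⟩ (by simpa [Table.pts] using ⟨hoo, h6.1⟩)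
            (by simp [hoo] at hn ⊢; omega) (by simp) (by simp) (by simp) (by simp) (by simp) h6.2
          simpa only [ntri, ndot_zero_zero] using this
      · obtain ⟨mp', hmp, rfl⟩ : ∃ mp', x ∉ mp' ∧ insert x mp' = mp :=
          ⟨mp.erase x, notMem_erase _ _, insert_erase hx⟩
        rw [Finset.disjoint_insert_left] at h4 h5
        have := key x .minus .plus ⟨∅, mp', oo, op⟩
          (by simpa [Table.pts] using ⟨hmp, h4.1, h5.1⟩)
          (by simp [hmp] at hn ⊢; omega) (by simp) (by simp) (by simp) h4.2 h5.2 h6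
        simpa only [ntri, ndot_minus_plus] using this
    · obtain ⟨m0', hm0, rfl⟩ : ∃ m0', x ∉ m0' ∧ insert x m0' = m0 :=
        ⟨m0.erase x, notMem_erase _ _, insert_erase hx⟩
      rw [Finset.disjoint_insert_left] at h1 h2 h3
      have := key x .minus .zero ⟨m0', mp, oo, op⟩
        (by simpa [Table.pts] using ⟨hm0, h1.1, h2.1, h3.1⟩)
        (by simp [hm0] at hn ⊢; omega) h1.2 h2.2 h3.2 h4 h5 h6
      simpa only [ntri, ndot_minus_zero] using this

/-! ### Sums with at most one point -/

theorem sum_powerset_of_card_le_one {M : Type*} [AddCommMonoid M] (A : Finset X)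
    {g : Finset X → M} (h : ∀ a ⊆ A, 1 < a.card → g a = 0) :
    ∑ a ∈ A.powerset, g a = g ∅ + ∑ x ∈ A, g {x} := by
  induction A using Finset.induction_on with
  | empty => simp
  | insert x A hx ih =>
    rw [sum_powerset_insert hx, ih fun a ha => h a (ha.trans (Finset.subset_insert _ _)),
      sum_insert hx, Finset.sum_eq_single_of_mem ∅ (Finset.empty_mem_powerset _)]
    · rw [insert_empty_eq]
      abel
    · intro a ha hne
      rw [mem_powerset] at ha
      refine h _ (Finset.insert_subset_insert _ ha) ?_
      rw [Finset.card_insert_of_notMem fun h => hx (ha h)]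
      have := card_pos.mpr (Finset.nonempty_iff_ne_empty.mpr hne)
      omega

theorem sum_powerset_of_empty {M : Type*} [AddCommMonoid M] (A : Finset X)
    {g : Finset X → M} (h : ∀ a ⊆ A, a ≠ ∅ → g a = 0) : ∑ a ∈ A.powerset, g a = g ∅ :=
  Finset.sum_eq_single_of_mem ∅ (Finset.empty_mem_powerset _)
    fun a ha hne => h a (mem_powerset.mp ha) hne

/-- The number of points of a table. -/
def _root_.Table.size (ϰ : Table X) : ℕ := ϰ.m0.card + ϰ.mp.card + ϰ.oo.card + ϰ.op.card

theorem sum_splits_of_size_one [MeasurableSpace X] {M : Type*} [AddCommMonoid M] (ϰ : Table X)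
    {f : Table X × Table X → M} (h : ∀ q : Table X × Table X, q.1.size ≠ 1 → f q = 0) :
    ∑ q ∈ ϰ.splits, f q =
      ∑ x ∈ ϰ.m0, f (Table.elem x .minus .zero, ϰ.diff (Table.elem x .minus .zero)) +
      ∑ x ∈ ϰ.mp, f (Table.elem x .minus .plus, ϰ.diff (Table.elem x .minus .plus)) +
      ∑ x ∈ ϰ.oo, f (Table.elem x .zero .zero, ϰ.diff (Table.elem x .zero .zero)) +
      ∑ x ∈ ϰ.op, f (Table.elem x .zero .plus, ϰ.diff (Table.elem x .zero .plus)) := by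
  have hc : ∀ a : Finset X, a ≠ ∅ → 0 < a.card := fun a ha =>
    card_pos.mpr (Finset.nonempty_iff_ne_empty.mpr ha)
  have h' : ∀ a b c d : Finset X, a.card + b.card + c.card + d.card ≠ 1 →
      f (⟨a, b, c, d⟩, ϰ.diff ⟨a, b, c, d⟩) = 0 := fun a b c d hq => h _ hq
  rw [Table.sum_splits, sum_powerset_of_card_le_one]
  · have e1 : ∀ x : X, ∑ mp ∈ ϰ.mp.powerset, ∑ oo ∈ ϰ.oo.powerset, ∑ op ∈ ϰ.op.powerset,
        f (⟨{x}, mp, oo, op⟩, ϰ.diff ⟨{x}, mp, oo, op⟩) =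
        f (Table.elem x .minus .zero, ϰ.diff (Table.elem x .minus .zero)) := by
      intro x
      rw [sum_powerset_of_empty, sum_powerset_of_empty, sum_powerset_of_empty]
      · rfl
      · intro d _ hd
        exact h' _ _ _ _ (by have := hc d hd; simp; omega)
      · intro c _ hc'
        exact sum_eq_zero fun d _ => h' _ _ _ _ (by have := hc c hc'; simp; omega)
      · intro b _ hb
        exact sum_eq_zero fun c _ => sum_eq_zero fun d _ => h' _ _ _ _
          (by have := hc b hb; simp; omega)
    simp only [e1]
    rw [sum_powerset_of_card_le_one (A := ϰ.mp)]
    · have e2 : ∀ x : X, ∑ oo ∈ ϰ.oo.powerset, ∑ op ∈ ϰ.op.powerset,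
          f (⟨∅, {x}, oo, op⟩, ϰ.diff ⟨∅, {x}, oo, op⟩) =
          f (Table.elem x .minus .plus, ϰ.diff (Table.elem x .minus .plus)) := by
        intro x
        rw [sum_powerset_of_empty, sum_powerset_of_empty]
        · rfl
        · intro d _ hd
          exact h' _ _ _ _ (by have := hc d hd; simp; omega)
        · intro c _ hc'
          exact sum_eq_zero fun d _ => h' _ _ _ _ (by have := hc c hc'; simp; omega)
      simp only [e2]
      rw [sum_powerset_of_card_le_one (A := ϰ.oo)]
      · have e3 : ∀ x : X, ∑ op ∈ ϰ.op.powerset,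
            f (⟨∅, ∅, {x}, op⟩, ϰ.diff ⟨∅, ∅, {x}, op⟩) =
            f (Table.elem x .zero .zero, ϰ.diff (Table.elem x .zero .zero)) := by
          intro x
          rw [sum_powerset_of_empty]
          · rfl
          · intro d _ hd
            exact h' _ _ _ _ (by have := hc d hd; simp; omega)
        simp only [e3]
        rw [sum_powerset_of_card_le_one (A := ϰ.op)]
        · rw [h' ∅ ∅ ∅ ∅ (by simp), zero_add]
          simp only [Table.elem]
          abel
        · intro d _ hd
          exact h' _ _ _ _ (by simp; omega)
      · intro c _ hc'
        exact sum_eq_zero fun d _ => h' _ _ _ _ (by simp; omega)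
    · intro b _ hb
      exact sum_eq_zero fun c _ => sum_eq_zero fun d _ => h' _ _ _ _
        (by simp; omega)
  · intro a _ ha
    exact sum_eq_zero fun b _ => sum_eq_zero fun c _ =>
      sum_eq_zero fun d _ => h' _ _ _ _ (by omega)

/-- The increments of a function of initial segments that only depends on a finite set. -/
theorem sum_increments {M : Type*} [AddCommGroup M] (S : Finset ℝ≥0) (G : Set ℝ≥0 → M)
    (hG : ∀ I J : Set ℝ≥0, (∀ s ∈ S, s ∈ I ↔ s ∈ J) → G I = G J) (t : ℝ≥0) :
    ∑ s ∈ S, (if s < t then G (Iic s) - G (Iio s) else 0) = G (Iio t) - G ∅ := by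
  rw [← sum_filter]
  obtain ⟨S', hS'⟩ : ∃ S', S' = S.filter (· < t) := ⟨_, rfl⟩
  rw [← hS']
  induction S' using Finset.induction_on_max generalizing t with
  | empty =>
    rw [Finset.sum_empty, eq_comm, sub_eq_zero]
    refine hG _ _ fun s hs => ?_
    have : s ∉ S.filter (· < t) := hS' ▸ Finset.notMem_empty s
    simp only [mem_filter, not_and] at this
    simpa using this hs
  | insert m S' hm ih =>
    have hmem : ∀ s, (s = m ∨ s ∈ S') ↔ s ∈ S ∧ s < t := fun s => by
      rw [← mem_insert, hS', mem_filter]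
    rw [sum_insert fun h => lt_irrefl _ (hm m h), ih m]
    · have : G (Iic m) = G (Iio t) := by
        refine hG _ _ fun s hs => ?_
        simp only [mem_Iic, mem_Iio]
        refine ⟨fun h => lt_of_le_of_lt h ((hmem m).mp (Or.inl rfl)).2, fun h => ?_⟩
        rcases (hmem s).mpr ⟨hs, h⟩ with rfl | h'
        · exact le_rfl
        · exact (hm s h').le
      rw [this]
      abel
    · ext s
      rw [mem_filter]
      constructor
      · exact fun h => ⟨((hmem s).mp (Or.inr h)).1, hm s h⟩
      · rintro ⟨h, h'⟩
        rcases (hmem s).mpr ⟨h, h'.trans ((hmem m).mp (Or.inl rfl)).2⟩ with rfl | h''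
        · exact absurd h' (lt_irrefl _)
        · exact h''

end Noise

end

/-! ### Chains with one point -/

section

variable {X : Type*} [MeasurableSpace X] [DecidableEq X]

namespace Noise

/-- The point of a chain with one point. -/
noncomputable def point (x₀ : X) (A : Finset X) : X :=
  if h : A.card = 1 then (card_eq_one.mp h).choose else x₀

theorem point_singleton (x₀ x : X) : point x₀ {x} = x := by
  have h : ({x} : Finset X).card = 1 := card_singleton x
  rw [point, dif_pos h]
  exact (Finset.singleton_injective (card_eq_one.mp h).choose_spec).symm

variable (N : Noise X) [StandardBorelSpace X]

theorem measurable_point (x₀ : X) : Measurable (point x₀) := by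
  rw [measurable_chain_iff]
  intro n
  rcases n with - | n
  · exact Subsingleton.measurable
  · have hs : MeasurableSet {v : Fin (n + 1) → X | ∀ i, v i = v 0} := by
      rw [Set.ofPred_forall]
      exact MeasurableSet.iInter fun i => measurableSet_eq_fun (measurable_pi_apply i)
        (measurable_pi_apply 0)
    have e : (fun v : Fin (n + 1) → X => point x₀ (univ.image v)) =
        Set.piecewise {v : Fin (n + 1) → X | ∀ i, v i = v 0} (fun v => v 0) fun _ => x₀ := by
      funext v
      by_cases hv : ∀ i, v i = v 0
      · have hmem : v ∈ {v : Fin (n + 1) → X | ∀ i, v i = v 0} := hv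
        rw [Set.piecewise_eq_of_mem _ _ _ hmem]
        have : univ.image v = {v 0} := by
          ext x
          simp only [mem_image, mem_univ, true_and, mem_singleton]
          exact ⟨fun ⟨i, hi⟩ => hi ▸ hv i, fun h => ⟨0, h.symm⟩⟩
        rw [this, point_singleton]
      · have hmem : v ∉ {v : Fin (n + 1) → X | ∀ i, v i = v 0} := hv
        rw [Set.piecewise_eq_of_notMem _ _ _ hmem, point, dif_neg]
        intro h
        obtain ⟨y, hy⟩ := card_eq_one.mp h
        refine hv fun i => ?_
        have h1 : ∀ j, v j = y := fun j => by
          have : v j ∈ univ.image v := mem_image_of_mem _ (mem_univ j)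
          rwa [hy, mem_singleton] at this
        rw [h1, h1]
    rw [e]
    exact (measurable_pi_apply 0).piecewise hs measurable_const

theorem measurePreserving_point (x₀ : X) : MeasurePreserving (point x₀)
    (ν[N].restrict {A | A.card = 1}) N.vol := by
  refine ⟨measurable_point x₀, ?_⟩
  rw [N.chainMeasure_restrict_card_one, Measure.map_map (measurable_point x₀)
    measurable_chain_singleton]
  have : (point x₀ ∘ fun x : X => ({x} : Finset X)) = id := funext fun x => point_singleton x₀ x
  rw [this, Measure.map_id]

instance : SFinite N.vol := haveI := N.sigmaFinite; inferInstance

/-- Almost every point of almost every chain, together with the remaining chain. -/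
theorem ae_erase {P : X → Finset X → Prop}
    (h : ∀ᵐ q ∂N.vol.prod ν[N], P q.1 q.2) :
    ∀ᵐ ϰ ∂ν[N], ∀ x ∈ ϰ, P x (ϰ.erase x) := by
  rcases isEmpty_or_nonempty X with hX | ⟨⟨x₀⟩⟩
  · exact Eventually.of_forall fun ϰ x => (hX.false x).elim
  have h1 : QuasiMeasurePreserving
      (Prod.map (point x₀) id : C²[X] → X × Finset X) ((ν[N].restrict {A | A.card = 1}).prod ν[N])
      (N.vol.prod ν[N]) :=
    QuasiMeasurePreserving.prodMap
      (N.measurePreserving_point x₀).quasiMeasurePreserving (QuasiMeasurePreserving.id _)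
  have h2 : ∀ᵐ q ∂(ν[N].restrict {A | A.card = 1}).prod ν[N],
    P (point x₀ q.1) q.2 := h1.ae h
  have h3 : (ν[N].restrict {A : Finset X | A.card = 1}).prod ν[N] =
      ν²[N].restrict ({A | A.card = 1} ×ˢ Set.univ) := by
    rw [← prod_restrict, Measure.restrict_univ]
  rw [h3, ae_restrict_iff' ((measurable_card_eq 1).prod MeasurableSet.univ)] at h2
  filter_upwards [N.unfold_splits.ae h2] with ϰ hϰ x hx
  have h4 := hϰ _ (mem_splits (Finset.singleton_subset_iff.mpr hx))
    ⟨card_singleton x, Set.mem_univ _⟩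
  rw [point_singleton] at h4
  rwa [erase_eq]

/-! ### Unions of tables -/

theorem qmp_table_union : QuasiMeasurePreserving
    (fun q : Table X × Table X => q.1.union q.2) (τ[N].prod τ[N])
    τ[N] := by
  have u := N.quasiMeasurePreserving_union
  have h1 := QuasiMeasurePreserving.prodMap
    (QuasiMeasurePreserving.prodMap u u)
    (QuasiMeasurePreserving.prodMap u u)
  have h2 := N.measurePreserving_equivPairs.symm Table.equivPairs
  exact N.measurePreserving_equivProd.quasiMeasurePreserving.comp
    (h1.comp h2.quasiMeasurePreserving)

/-- The corresponding entries of almost all pairs of tables are disjoint. -/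
theorem ae_tables_disjoint : ∀ᵐ q : Table X × Table X ∂τ[N].prod τ[N],
    Disjoint q.1.m0 q.2.m0 ∧ Disjoint q.1.mp q.2.mp ∧ Disjoint q.1.oo q.2.oo ∧
      Disjoint q.1.op q.2.op := by
  have h := N.ae_times_disjoint
  have h1 := (QuasiMeasurePreserving.prodMap N.qmp_m0 N.qmp_m0).ae h
  have h2 := (QuasiMeasurePreserving.prodMap N.qmp_mp N.qmp_mp).ae h
  have h3 := (QuasiMeasurePreserving.prodMap N.qmp_oo N.qmp_oo).ae h
  have h4 := (QuasiMeasurePreserving.prodMap N.qmp_op N.qmp_op).ae h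
  filter_upwards [h1, h2, h3, h4] with q d1 d2 d3 d4
  exact ⟨N.disjoint_of_times d1, N.disjoint_of_times d2, N.disjoint_of_times d3,
    N.disjoint_of_times d4⟩

theorem _root_.Weight.prod_union (ζ : Weight X) {θ κ : Table X} (h1 : Disjoint θ.m0 κ.m0)
    (h2 : Disjoint θ.mp κ.mp) (h3 : Disjoint θ.oo κ.oo) (h4 : Disjoint θ.op κ.op) :
    ζ.prod (θ.union κ) = ζ.prod θ * ζ.prod κ := by
  simp only [Weight.prod, Table.union, Finset.prod_union h1, Finset.prod_union h2,
    Finset.prod_union h3, Finset.prod_union h4]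
  ring

theorem _root_.MeasureTheory.Measure.quasiMeasurePreserving_prodMk_right {α β : Type*}
    [MeasurableSpace α] [MeasurableSpace β] (μ : Measure α) {ν : Measure β} [SFinite μ]
    [SFinite ν] {c : β} (h : dirac c ≪ ν) :
    QuasiMeasurePreserving (fun a => (a, c)) μ (μ.prod ν) := by
  refine ⟨measurable_prodMk_right, ?_⟩
  rw [← Measure.prod_dirac]
  exact Measure.AbsolutelyContinuous.rfl.prod h

theorem _root_.MeasureTheory.Measure.quasiMeasurePreserving_prodMk_left {α β : Type*}
    [MeasurableSpace α] [MeasurableSpace β] {μ : Measure α} (ν : Measure β) [SFinite μ]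
    [SFinite ν] {c : α} (h : dirac c ≪ μ) :
    QuasiMeasurePreserving (fun b => (c, b)) ν (μ.prod ν) := by
  refine ⟨measurable_prodMk_left, ?_⟩
  rw [← dirac_prod]
  exact h.prod Measure.AbsolutelyContinuous.rfl

theorem dirac_empty_absolutelyContinuous : dirac ∅ ≪ ν[N] := by
  rw [← N.chainMeasure_restrict_empty]
  exact Measure.absolutelyContinuous_of_le restrict_le_self

theorem qmp_singleton : QuasiMeasurePreserving (fun x : X => ({x} : Finset X)) N.vol ν[N] :=
  ⟨measurable_chain_singleton, by
    rw [← N.chainMeasure_restrict_card_one]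
    exact Measure.absolutelyContinuous_of_le restrict_le_self⟩

theorem qmp_elem {μ ν : Ind} (hμ : μ ≠ .plus) (hν : ν ≠ .minus) :
    QuasiMeasurePreserving (fun x : X => Table.elem x μ ν) N.vol τ[N] := by
  have d := N.dirac_empty_absolutelyContinuous
  have d2 : dirac ((∅, ∅) : C²[X]) ≪ ν²[N] := by
    rw [← Measure.dirac_prod_dirac]
    exact d.prod d
  have e := N.measurePreserving_equivProd.quasiMeasurePreserving
  have s := N.qmp_singleton
  have r := Measure.quasiMeasurePreserving_prodMk_right ν[N] d
  have l := Measure.quasiMeasurePreserving_prodMk_left ν[N] d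
  have r2 := Measure.quasiMeasurePreserving_prodMk_right ν²[N] d2
  have l2 := Measure.quasiMeasurePreserving_prodMk_left ν²[N] d2
  cases μ <;> cases ν <;> first | exact absurd rfl hμ | exact absurd rfl hν | skip
  · exact e.comp (r2.comp (r.comp s))
  · exact e.comp (r2.comp (l.comp s))
  · exact e.comp (l2.comp (r.comp s))
  · exact e.comp (l2.comp (l.comp s))

theorem qmp_elem_union {μ ν : Ind} (hμ : μ ≠ .plus) (hν : ν ≠ .minus) :
    QuasiMeasurePreserving (fun q : X × Table X => (Table.elem q.1 μ ν).union q.2)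
      (N.vol.prod τ[N]) τ[N] :=
  N.qmp_table_union.comp (QuasiMeasurePreserving.prodMap (N.qmp_elem hμ hν)
    (QuasiMeasurePreserving.id _))

end Noise

end

section

variable {X : Type*} [MeasurableSpace X] [DecidableEq X]
variable {K : Type*} [NormedAddCommGroup K] [InnerProductSpace ℂ K]

namespace Noise

/-! ### Joint measurability of the multiple integral -/

theorem aestronglyMeasurable_nmult_param [StandardBorelSpace X] {N : Noise X} {Y : Type*}
    [MeasurableSpace Y] (μ : Measure Y) [SFinite μ] {L : Y → Table X → Op[X,K]}
    (hL : ∀ v, StronglyMeasurable fun q : Y × (Table X × Table X) => L q.1 q.2.1 q.2.2 v)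
    {a : Y → Finset X → K}
    (ha : AEStronglyMeasurable (fun q : Y × Finset X => a q.1 q.2) (μ.prod ν[N])) :
    AEStronglyMeasurable (fun q : Y × Finset X => N.nmult (L q.1) (a q.1) q.2)
      (μ.prod ν[N]) := by
  let C := ν[N]
  have q1 : QuasiMeasurePreserving
      (fun z : ((Y × C²[X]) × C²[X]) × Finset X =>
        (z.1.1.1, (z.1.1.2.1 ∪ z.1.2.1) ∪ z.2))
      (((μ.prod (C.prod C)).prod (C.prod C)).prod C) (μ.prod C) := by
    have h1 := quasiMeasurePreserving_param_union (N := N) μ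
    have h2 := QuasiMeasurePreserving.prodMap h1 (QuasiMeasurePreserving.id C)
    have h3 : QuasiMeasurePreserving
      (MeasurableEquiv.prodAssoc : (Y × Finset X) × Finset X ≃ᵐ Y × C²[X])
      ((μ.prod C).prod C) (μ.prod (C.prod C)) :=
      (measurePreserving_prodAssoc _ _ _).quasiMeasurePreserving
    have h4 := QuasiMeasurePreserving.prodMap (QuasiMeasurePreserving.id μ)
      N.quasiMeasurePreserving_union
    exact h4.comp (h3.comp h2)
  have h1 := aestronglyMeasurable_nfock_param (N := N) ((μ.prod (C.prod C)).prod (C.prod C))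
    (T := fun z κ => L z.1.1 ⟨z.2.1, z.2.2, z.1.2.1, z.1.2.2⟩ κ)
    (a := fun z A => a z.1.1 ((z.1.2.1 ∪ z.2.1) ∪ A))
    (fun v => (hL v).comp_measurable (g := fun q : ((Y × C²[X]) ×
      C²[X]) × Table X =>
      (q.1.1.1, ((⟨q.1.2.1, q.1.2.2, q.1.1.2.1, q.1.1.2.2⟩ : Table X), q.2)))
      ((by fun_prop : Measurable fun q : ((Y × C²[X]) ×
        C²[X]) × Table X => q.1.1.1).prodMk
        ((Table.measurable_mk (by fun_prop) (by fun_prop) (by fun_prop) (by fun_prop)).prodMk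
          measurable_snd)))
    (ha.comp_quasiMeasurePreserving q1)
  have q2 : MeasurePreserving
      (fun z : (Y × (Finset X × C²[X])) × C²[X] =>
        (((z.1.1, (z.1.2.1, z.1.2.2.1)), z.2), z.1.2.2.2))
      ((μ.prod (C.prod (C.prod C))).prod (C.prod C))
      (((μ.prod (C.prod C)).prod (C.prod C)).prod C) := by
    have a1 := (MeasurePreserving.id μ).prod
      ((measurePreserving_prodAssoc C C C).symm MeasurableEquiv.prodAssoc)
    have a2 := ((measurePreserving_prodAssoc μ (C.prod C) C).symm
      MeasurableEquiv.prodAssoc).comp a1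
    have a3 := a2.prod (MeasurePreserving.id (C.prod C))
    have a4 := (measurePreserving_prodAssoc (μ.prod (C.prod C)) C (C.prod C)).comp a3
    have a5 := ((MeasurePreserving.id (μ.prod (C.prod C))).prod
      (measurePreserving_swap (μ := C) (ν := C.prod C))).comp a4
    exact ((measurePreserving_prodAssoc (μ.prod (C.prod C)) (C.prod C) C).symm
      MeasurableEquiv.prodAssoc).comp a5
  have h2 := (h1.comp_quasiMeasurePreserving q2.quasiMeasurePreserving).integral_prod_right'
  have h3 := ((Unfold.id μ).prod N.unfold_splits₃).aestronglyMeasurable_sum h2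
  refine h3.congr (Eventually.of_forall fun q => ?_)
  simp only [singleton_product, sum_map, Function.Embedding.coeFn_mk, sum_splits₃]
  rfl

/-! ### Integrals over one point -/

theorem integral_of_size_one [StandardBorelSpace X] {N : Noise X}
    {f : C²[X] → K} (hf : ∀ p, p.1.card + p.2.card ≠ 1 → f p = 0)
    (hi : Integrable f ν²[N]) :
    Integrable (fun x => f ({x}, ∅)) N.vol ∧ Integrable (fun x => f (∅, {x})) N.vol ∧
      ∫ p, f p ∂ν²[N] =
        ∫ x, f ({x}, ∅) ∂N.vol + ∫ x, f (∅, {x}) ∂N.vol := by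
  let C := ν[N]
  let s : Set (Finset X) := {A | A.card = 1}
  have hs : MeasurableSet s := measurable_card_eq 1
  have he : MeasurableSet ({∅} : Set (Finset X)) := by
    have : ({∅} : Set (Finset X)) = {A | A.card = 0} := by
      ext A
      simp
    rw [this]
    exact measurable_card_eq 0
  have r1 : MeasurePreserving (fun x : X => (({x}, ∅) : C²[X])) N.vol
      ((C.prod C).restrict (s ×ˢ {∅})) := by
    refine ⟨measurable_chain_singleton.prodMk measurable_const, ?_⟩
    rw [← prod_restrict, N.chainMeasure_restrict_empty, Measure.prod_dirac,
      N.chainMeasure_restrict_card_one,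
      Measure.map_map measurable_prodMk_right measurable_chain_singleton]
    rfl
  have r2 : MeasurePreserving (fun x : X => ((∅, {x}) : C²[X])) N.vol
      ((C.prod C).restrict ({∅} ×ˢ s)) := by
    refine ⟨measurable_const.prodMk measurable_chain_singleton, ?_⟩
    rw [← prod_restrict, N.chainMeasure_restrict_empty, dirac_prod,
      N.chainMeasure_restrict_card_one,
      Measure.map_map measurable_prodMk_left measurable_chain_singleton]
    rfl
  have hd : Disjoint (s ×ˢ ({∅} : Set (Finset X))) ({∅} ×ˢ s) := by
    rw [Set.disjoint_left]
    rintro ⟨A, B⟩ ⟨h1, -⟩ ⟨h2, -⟩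
    have h1' : A.card = 1 := h1
    have h2' : A = ∅ := h2
    rw [h2'] at h1'
    simp at h1'
  refine ⟨r1.integrable_comp_of_integrable hi.integrableOn,
    r2.integrable_comp_of_integrable hi.integrableOn, ?_⟩
  rw [r1.integral_comp_of_aestronglyMeasurable hi.1.restrict,
    r2.integral_comp_of_aestronglyMeasurable hi.1.restrict,
    ← setIntegral_union hd (he.prod hs) hi.integrableOn hi.integrableOn]
  refine (setIntegral_eq_integral_of_forall_compl_eq_zero fun p hp => hf p fun h => hp ?_).symm
  obtain ⟨A, B⟩ := p
  have h' : A.card + B.card = 1 := h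
  rcases Nat.eq_zero_or_pos A.card with h0 | h0
  · exact Or.inr ⟨card_eq_zero.mp h0, show B.card = 1 by omega⟩
  · exact Or.inl ⟨show A.card = 1 by omega, card_eq_zero.mp (show B.card = 0 by omega)⟩

/-! ### Step families -/

variable (N : Noise X)

/-- Families of operator-valued functions `F(I)`, where `F(I)(ϰ)` depends on the times of `ϰ` that
are in `I`, that are bounded for the sets `I` of times before `t`. -/
structure StepFamily [CompleteSpace K] (t c : ℝ≥0) (ζ : Weight X)
    (F : Set ℝ≥0 → Op[X,K]) : Prop where
  lt : OpMeas fun q : ℝ≥0 × Table X => F (Iio q.1) q.2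
  le : OpMeas fun q : ℝ≥0 × Table X => F (Iic q.1) q.2
  congr : ∀ (I J : Set ℝ≥0) (ϰ : Table X),
    (∀ x ∈ ϰ.pts, N.time x ∈ I ↔ N.time x ∈ J) → F I ϰ = F J ϰ
  bdd : ∀ᵐ ϰ ∂τ[N], ∀ I ⊆ Iio t, ‖F I ϰ‖ₑ ≤ c * ζ.prod ϰ

/-- The latest time of a table. -/
noncomputable def last (θ : Table X) : ℝ≥0 := θ.pts.sup N.time

/-- The increments of a step family, as a function of tables with one point. -/
noncomputable def increments (t : ℝ≥0) (F : Set ℝ≥0 → Op[X,K]) (θ κ : Table X) :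
    K →L[ℂ] K :=
  letI := Classical.dec (θ.size = 1 ∧ N.last θ < t)
  if θ.size = 1 ∧ N.last θ < t then
    F (Iic (N.last θ)) (θ.union κ) - F (Iio (N.last θ)) (θ.union κ) else 0

theorem size_elem {μ ν : Ind} (hμ : μ ≠ .plus) (hν : ν ≠ .minus) (x : X) :
    (Table.elem x μ ν).size = 1 := by
  cases μ <;> cases ν <;> first | exact absurd rfl hμ | exact absurd rfl hν | rfl

theorem pts_elem {μ ν : Ind} (hμ : μ ≠ .plus) (hν : ν ≠ .minus) (x : X) :
    (Table.elem x μ ν).pts = {x} := by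
  cases μ <;> cases ν <;> first | exact absurd rfl hμ | exact absurd rfl hν | rfl

theorem last_elem {μ ν : Ind} (hμ : μ ≠ .plus) (hν : ν ≠ .minus) (x : X) :
    N.last (Table.elem x μ ν) = N.time x := by
  rw [last, pts_elem hμ hν, Finset.sup_singleton]

theorem increments_elem (t : ℝ≥0) (F : Set ℝ≥0 → Op[X,K]) {μ ν : Ind}
    (hμ : μ ≠ .plus) (hν : ν ≠ .minus) (x : X) (κ : Table X) :
    N.increments t F (Table.elem x μ ν) κ = if N.time x < t then
      F (Iic (N.time x)) ((Table.elem x μ ν).union κ) -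
        F (Iio (N.time x)) ((Table.elem x μ ν).union κ) else 0 := by
  rw [increments, last_elem N hμ hν, size_elem hμ hν]
  simp only [true_and]

theorem increments_of_size_ne (t : ℝ≥0) (F : Set ℝ≥0 → Op[X,K]) {θ : Table X}
    (h : θ.size ≠ 1) : N.increments t F θ = 0 := by
  funext κ
  rw [increments, if_neg fun h' => h h'.1]
  rfl

variable {N} [StandardBorelSpace X]

theorem measurable_sup_time : Measurable fun A : Finset X => A.sup N.time := by
  refine measurable_of_Iic fun c => ?_
  have : (fun A : Finset X => A.sup N.time) ⁻¹' Iic c =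
      {A | ∀ x ∈ A, x ∉ {x | c < N.time x}} := by
    ext A
    simp only [mem_preimage, mem_Iic, Finset.sup_le_iff]
    exact forall₂_congr fun x _ => (not_lt (a := c)).symm
  rw [this]
  exact measurableSet_avoid (measurableSet_lt measurable_const N.measurable_time)

theorem measurable_pts : Measurable fun θ : Table X => θ.pts :=
  ((Table.measurable_m0.chain_union Table.measurable_mp).chain_union
    Table.measurable_oo).chain_union Table.measurable_op

theorem measurable_last : Measurable N.last := measurable_sup_time.comp measurable_pts

theorem measurable_card : Measurable fun A : Finset X => A.card :=
  measurable_to_countable' fun n => measurable_card_eq n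

theorem measurable_size : Measurable fun θ : Table X => θ.size :=
  (((measurable_card.comp Table.measurable_m0).add (measurable_card.comp Table.measurable_mp)).add
    (measurable_card.comp Table.measurable_oo)).add (measurable_card.comp Table.measurable_op)

variable [CompleteSpace K] {t c : ℝ≥0} {ζ : Weight X} {F : Set ℝ≥0 → Op[X,K]}

theorem StepFamily.opMeas_increments (h : N.StepFamily t c ζ F) :
    OpMeas₂ (N.increments t F) := by
  have g : Measurable fun q : Table X × Table X => (N.last q.1, q.1.union q.2) :=
    (measurable_last.comp measurable_fst).prodMk
      (Table.measurable_union measurable_fst measurable_snd)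
  have hs : MeasurableSet {q : Table X × Table X | q.1.size = 1 ∧ N.last q.1 < t} :=
    ((measurable_size.comp measurable_fst) (measurableSet_singleton 1)).inter
      ((measurable_last (N := N)).comp measurable_fst measurableSet_Iio)
  have h1 := ((h.le.comp_measurable g).sub (h.lt.comp_measurable g)).indicator hs
  have e : (fun q : Table X × Table X => N.increments t F q.1 q.2) =
      {q : Table X × Table X | q.1.size = 1 ∧ N.last q.1 < t}.indicator
        fun q => F (Iic (N.last q.1)) (q.1.union q.2) -
          F (Iio (N.last q.1)) (q.1.union q.2) := by
    funext q
    rw [increments, Set.indicator]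
    congr
  rw [e]
  exact h1

theorem StepFamily.bdd₂_increments (h : N.StepFamily t c ζ F) :
    N.Bdd₂ (2 * c) ζ ζ (N.increments t F) := by
  unfold Bdd₂
  filter_upwards [N.qmp_table_union.ae h.bdd, N.ae_tables_disjoint] with q h1 h2
  rw [increments]
  split_ifs with hq
  · have h3 := h1 (Iic (N.last q.1)) fun s hs => lt_of_le_of_lt hs hq.2
    have h4 := h1 (Iio (N.last q.1)) fun s hs => lt_trans hs hq.2
    rw [Weight.prod_union ζ h2.1 h2.2.1 h2.2.2.1 h2.2.2.2] at h3 h4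
    refine (enorm_sub_le).trans ((add_le_add h3 h4).trans (le_of_eq ?_))
    push_cast
    ring
  · rw [enorm_zero]
    exact zero_le

theorem table_elem_union_diff {ϰ : Table X} {x : X} :
    (x ∈ ϰ.m0 → (Table.elem x .minus .zero).union (ϰ.diff (Table.elem x .minus .zero)) = ϰ) ∧
    (x ∈ ϰ.mp → (Table.elem x .minus .plus).union (ϰ.diff (Table.elem x .minus .plus)) = ϰ) ∧
    (x ∈ ϰ.oo → (Table.elem x .zero .zero).union (ϰ.diff (Table.elem x .zero .zero)) = ϰ) ∧
    (x ∈ ϰ.op → (Table.elem x .zero .plus).union (ϰ.diff (Table.elem x .zero .plus)) = ϰ) := by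
  refine ⟨fun h => ?_, fun h => ?_, fun h => ?_, fun h => ?_⟩ <;> ext y <;>
    simp only [Table.elem, Table.union, Table.diff, empty_union, sdiff_empty,
      mem_union, mem_sdiff, mem_singleton] <;>
    (by_cases hy : y = x <;> simp [hy, h])

theorem StepFamily.nsum_increments (h : N.StepFamily t c ζ F) :
    ∀ᵐ ϰ ∂τ[N], nsum (N.increments t F) ϰ = F (Iio t) ϰ - F ∅ ϰ := by
  filter_upwards [N.ae_table_times_disjoint, N.qmp_m0.ae N.ae_time_injOn,
    N.qmp_mp.ae N.ae_time_injOn, N.qmp_oo.ae N.ae_time_injOn, N.qmp_op.ae N.ae_time_injOn]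
    with ϰ hd i1 i2 i3 i4
  have e : ∀ x, ∀ μ ν : Ind, μ ≠ .plus → ν ≠ .minus →
      (Table.elem x μ ν).union (ϰ.diff (Table.elem x μ ν)) = ϰ →
      N.increments t F (Table.elem x μ ν) (ϰ.diff (Table.elem x μ ν)) =
        if N.time x < t then F (Iic (N.time x)) ϰ - F (Iio (N.time x)) ϰ else 0 := by
    intro x μ ν hμ hν hx
    rw [increments_elem N t F hμ hν, hx]
  rw [nsum, sum_splits_of_size_one ϰ fun q hq => by rw [N.increments_of_size_ne t F hq]; rfl]
  have hS := sum_increments (N.times ϰ.pts) (fun I => F I ϰ) (fun I J hIJ => h.congr I J ϰ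
    fun x hx => hIJ _ (mem_image_of_mem _ hx)) t
  rw [← hS]
  have hp : N.times ϰ.pts =
      ((N.times ϰ.m0 ∪ N.times ϰ.mp) ∪ N.times ϰ.oo) ∪ N.times ϰ.op := by
    simp only [times, Table.pts, Finset.image_union]
  rw [hp, sum_union, sum_union, sum_union hd.1]
  · simp only [times]
    rw [sum_image i1, sum_image i2, sum_image i3, sum_image i4]
    refine congrArg₂ (· + ·) (congrArg₂ (· + ·) (congrArg₂ (· + ·) ?_ ?_) ?_) ?_
    · exact sum_congr rfl fun x hx => e x _ _ (by simp) (by simp)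
        (table_elem_union_diff.1 hx)
    · exact sum_congr rfl fun x hx => e x _ _ (by simp) (by simp)
        (table_elem_union_diff.2.1 hx)
    · exact sum_congr rfl fun x hx => e x _ _ (by simp) (by simp)
        (table_elem_union_diff.2.2.1 hx)
    · exact sum_congr rfl fun x hx => e x _ _ (by simp) (by simp)
        (table_elem_union_diff.2.2.2 hx)
  · exact disjoint_union_left.mpr ⟨hd.2.1, hd.2.2.2.1⟩
  · exact disjoint_union_left.mpr ⟨disjoint_union_left.mpr
      ⟨hd.2.2.1, hd.2.2.2.2.1⟩, hd.2.2.2.2.2⟩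

/-! ### Single integrals -/

/-- The argument of the entries of a single integral. -/
def nderiv (a : Finset X → K) (ν : Ind) (x : X) (A : Finset X) : K := a (ν.pts x ∪ A)

variable (N) in
/-- The single integral of the vectors `e^μ_ν(x)`. -/
noncomputable def nsingle (t : ℝ≥0) (e : Ind → Ind → X → Finset X → K) (ϰ : Finset X) : K :=
  (∑ x ∈ N.cut (Iio t) ϰ, e .zero .zero x (ϰ.erase x)) +
  (∑ x ∈ N.cut (Iio t) ϰ, e .zero .plus x (ϰ.erase x)) +
  (∫ x in N.before t, e .minus .zero x ϰ ∂N.vol) + (∫ x in N.before t, e .minus .plus x ϰ ∂N.vol)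

variable (N) in
/-- The vectors whose single integral is the increment of a step family. -/
noncomputable def nincr (F : Set ℝ≥0 → Op[X,K]) (a : Finset X → K) (μ ν : Ind) (x : X) :
    Finset X → K :=
  N.nfock (fun κ => F (Iic (N.time x)) ((Table.elem x μ ν).union κ) -
    F (Iio (N.time x)) ((Table.elem x μ ν).union κ)) (nderiv a ν x)

theorem measurableSet_before (t : ℝ≥0) : MeasurableSet (N.before t) :=
  measurableSet_lt N.measurable_time measurable_const

theorem nfock_zero_op (a : Finset X → K) (ϰ : Finset X) : N.nfock 0 a ϰ = 0 := by
  simp [nfock]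

theorem sum_cut {M : Type*} [AddCommMonoid M] (t : ℝ≥0) (ϰ : Finset X) (f : X → M) :
    ∑ x ∈ N.cut (Iio t) ϰ, f x = ∑ x ∈ ϰ, if N.time x < t then f x else 0 := by
  rw [cut, sum_filter]
  refine sum_congr rfl fun x _ => ?_
  simp only [mem_Iio]

theorem nfock_increments_elem (t : ℝ≥0) (F : Set ℝ≥0 → Op[X,K]) {μ ν : Ind}
    (hμ : μ ≠ .plus) (hν : ν ≠ .minus) (x : X) (a : Finset X → K) (ϰ : Finset X) :
    N.nfock (N.increments t F (Table.elem x μ ν)) (nderiv a ν x) ϰ =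
      if N.time x < t then N.nincr F a μ ν x ϰ else 0 := by
  have : N.increments t F (Table.elem x μ ν) = fun κ => if N.time x < t then
      F (Iic (N.time x)) ((Table.elem x μ ν).union κ) -
        F (Iio (N.time x)) ((Table.elem x μ ν).union κ) else 0 :=
    funext fun κ => N.increments_elem t F hμ hν x κ
  rw [this]
  split_ifs with h
  · rfl
  · exact nfock_zero_op _ _

/-- The increment of a step family is a single integral. -/
theorem StepFamily.nfock_sub (h : N.StepFamily t c ζ F) (hζ : ζ.Integrable N.vol) {ξ : ℝ≥0}
    (hξ : 0 < ξ) {a : Finset X → K} (ha : N.InG ξ a) :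
    ∀ᵐ ϰ ∂ν[N],
      (IntegrableOn (fun x => N.nincr F a .minus .zero x ϰ) (N.before t) N.vol ∧
        IntegrableOn (fun x => N.nincr F a .minus .plus x ϰ) (N.before t) N.vol) ∧
      N.nfock (fun κ => F (Iio t) κ - F ∅ κ) a ϰ = N.nsingle t (N.nincr F a) ϰ := by
  have h1 := nfock_nsum (fun v => h.opMeas_increments.app v) hζ hζ h.bdd₂_increments hξ ha
  have h2 := nfock_congr h.nsum_increments (EventuallyEq.refl _ a)
  filter_upwards [h1, h2] with ϰ ⟨h3, h4⟩ h5
  rw [← h5, h3]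
  let g : Finset X → Finset X → C²[X] → K := fun oo op p =>
    N.nfock (N.increments t F ⟨p.1, p.2, oo, op⟩) (fun A => a ((oo ∪ p.1) ∪ A)) ((ϰ \ oo) \ op)
  have g0 : ∀ oo op p, p.1.card + p.2.card + oo.card + op.card ≠ 1 → g oo op p = 0 := by
    intro oo op p hp
    have : N.increments t F ⟨p.1, p.2, oo, op⟩ = 0 := N.increments_of_size_ne t F hp
    simp only [g, this, nfock_zero_op]
  have hc : ∀ a : Finset X, a ≠ ∅ → 0 < a.card := fun a ha =>
    card_pos.mpr (Finset.nonempty_iff_ne_empty.mpr ha)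
  have hI : ∀ oo op : Finset X, 1 < oo.card + op.card →
      ∫ p, g oo op p ∂ν²[N] = 0 := fun oo op hcard => by
    have : g oo op = 0 := funext fun p => g0 oo op p (by omega)
    rw [this]
    simp
  have hE : ∀ oo op : Finset X, oo.card + op.card = 1 →
      ∫ p, g oo op p ∂ν²[N] = g oo op (∅, ∅) := fun oo op hcard => by
    refine integral_of_support_empty fun p hp => g0 oo op p fun hs => hp ?_
    have h1 : p.1 = ∅ := card_eq_zero.mp (by omega)
    have h2 : p.2 = ∅ := card_eq_zero.mp (by omega)
    exact Prod.ext h1 h2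
  have hpl : ∀ x, nderiv a .plus x = a := fun x => funext fun A => by
    rw [nderiv, Ind.pts, empty_union]
  have k1 : ∀ x, g ∅ ∅ ({x}, ∅) = (N.before t).indicator
      (fun x => N.nincr F a .minus .zero x ϰ) x := by
    intro x
    have := nfock_increments_elem (N := N) t F (μ := .minus) (ν := .zero) (by simp) (by simp) x a ϰ
    simp only [g, sdiff_empty, empty_union]
    exact this
  have k2 : ∀ x, g ∅ ∅ (∅, {x}) = (N.before t).indicator
      (fun x => N.nincr F a .minus .plus x ϰ) x := by
    intro x
    have := nfock_increments_elem (N := N) t F (μ := .minus) (ν := .plus) (by simp) (by simp) x a ϰ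
    rw [hpl] at this
    simp only [g, sdiff_empty, empty_union]
    exact this
  have k3 : ∀ x, g {x} ∅ (∅, ∅) = if N.time x < t then
      N.nincr F a .zero .zero x (ϰ.erase x) else 0 := by
    intro x
    have := nfock_increments_elem (N := N) t F (μ := .zero) (ν := .zero) (by simp) (by simp) x a
      (ϰ.erase x)
    simp only [g, sdiff_empty, union_empty, ← erase_eq]
    exact this
  have k4 : ∀ x, g ∅ {x} (∅, ∅) = if N.time x < t then
      N.nincr F a .zero .plus x (ϰ.erase x) else 0 := by
    intro x
    have := nfock_increments_elem (N := N) t F (μ := .zero) (ν := .plus) (by simp) (by simp) x a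
      (ϰ.erase x)
    simp only [g, sdiff_empty, empty_union, ← erase_eq]
    rw [hpl] at this
    exact this
  have i1 : Integrable (g ∅ ∅) ν²[N] :=
    h4 ∅ (empty_subset _) ∅ (empty_subset _)
  obtain ⟨j1, j2, j3⟩ := integral_of_size_one (f := g ∅ ∅)
    (fun p hp => g0 ∅ ∅ p (by simpa using hp)) i1
  simp only [k1, k2] at j1 j2 j3
  rw [integrable_indicator_iff (measurableSet_before t)] at j1 j2
  rw [integral_indicator (measurableSet_before t), integral_indicator (measurableSet_before t)]
    at j3
  refine ⟨⟨j1, j2⟩, ?_⟩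
  have e0 : N.nmult (N.increments t F) a ϰ = ∑ oo ∈ ϰ.powerset, ∑ op ∈ (ϰ \ oo).powerset,
      ∫ p, g oo op p ∂ν²[N] := rfl
  rw [e0, sum_powerset_of_card_le_one]
  · rw [sum_powerset_of_card_le_one]
    · rw [j3, nsingle, sum_cut, sum_cut]
      have e1 : ∑ x ∈ ϰ, ∑ op ∈ (ϰ \ {x}).powerset,
          ∫ p, g {x} op p ∂ν²[N] =
          ∑ x ∈ ϰ, if N.time x < t then N.nincr F a .zero .zero x (ϰ.erase x) else 0 := by
        refine sum_congr rfl fun x _ => ?_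
        rw [sum_powerset_of_empty, hE _ _ (by simp), k3]
        intro op _ hop
        exact hI _ _ (by have := hc op hop; rw [card_singleton]; omega)
      have e2 : ∑ x ∈ ϰ \ ∅, ∫ p, g ∅ {x} p ∂ν²[N] =
          ∑ x ∈ ϰ, if N.time x < t then N.nincr F a .zero .plus x (ϰ.erase x) else 0 := by
        rw [sdiff_empty]
        refine sum_congr rfl fun x _ => ?_
        rw [hE _ _ (by simp), k4]
      rw [e1, e2]
      abel
    · intro op _ hop
      exact hI _ _ (by simpa using hop)
  · intro oo _ hoo
    exact sum_eq_zero fun op _ => hI _ _ (by omega)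

end Noise

end

section

variable {X : Type*} [MeasurableSpace X] [DecidableEq X]
variable {K : Type*} [NormedAddCommGroup K] [InnerProductSpace ℂ K]

namespace Noise

variable (N : Noise X)

/-- The restriction of `L(θ, ϰ)` to the tables `θ` with times in `I`. -/
noncomputable def ncut (I : Set ℝ≥0) (L : Table X → Op[X,K]) (θ κ : Table X) :
    K →L[ℂ] K :=
  letI := Classical.dec (∀ x ∈ θ.pts, N.time x ∈ I)
  if ∀ x ∈ θ.pts, N.time x ∈ I then L θ κ else 0

/-- The weight, set to zero from the time `t` on. -/
noncomputable def cutWeight (t : ℝ≥0) (ζ : Weight X) : Weight X :=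
  ⟨(N.before t).indicator ζ.m0, (N.before t).indicator ζ.mp, (N.before t).indicator ζ.oo,
    (N.before t).indicator ζ.op⟩

variable {N}

theorem ncut_of_pos {I : Set ℝ≥0} {L : Table X → Op[X,K]} {θ : Table X}
    (h : ∀ x ∈ θ.pts, N.time x ∈ I) : N.ncut I L θ = L θ := by
  funext κ
  rw [ncut, if_pos h]

theorem ncut_of_neg {I : Set ℝ≥0} {L : Table X → Op[X,K]} {θ : Table X}
    (h : ¬ ∀ x ∈ θ.pts, N.time x ∈ I) : N.ncut I L θ = 0 := by
  funext κ
  rw [ncut, if_neg h]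
  rfl

theorem ncut_congr {I J : Set ℝ≥0} {L : Table X → Op[X,K]} {θ : Table X}
    (h : ∀ x ∈ θ.pts, N.time x ∈ I ↔ N.time x ∈ J) : N.ncut I L θ = N.ncut J L θ := by
  by_cases hI : ∀ x ∈ θ.pts, N.time x ∈ I
  · rw [ncut_of_pos hI, ncut_of_pos fun x hx => (h x hx).mp (hI x hx)]
  · rw [ncut_of_neg hI, ncut_of_neg fun hJ => hI fun x hx => (h x hx).mpr (hJ x hx)]

theorem pts_subset_of_mem_splits {ϰ : Table X} {q : Table X × Table X} (h : q ∈ ϰ.splits) :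
    q.1.pts ⊆ ϰ.pts := by
  simp only [Table.splits, mem_map, mem_product] at h
  obtain ⟨z, ⟨⟨h1, h2⟩, h3, h4⟩, rfl⟩ := h
  have e1 := union_of_mem_splits h1
  have e2 := union_of_mem_splits h2
  have e3 := union_of_mem_splits h3
  have e4 := union_of_mem_splits h4
  have : ∀ x, x ∈ (⟨z.1.1.1, z.1.2.1, z.2.1.1, z.2.2.1⟩ : Table X).pts → x ∈ ϰ.pts := by
    intro x
    simp only [Table.pts, ← e1, ← e2, ← e3, ← e4, mem_union]
    tauto
  exact this

theorem nsum_congr_on {L L' : Table X → Op[X,K]} {ϰ : Table X}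
    (h : ∀ θ : Table X, θ.pts ⊆ ϰ.pts → L θ = L' θ) : nsum L ϰ = nsum L' ϰ :=
  sum_congr rfl fun _ hq => by rw [h _ (pts_subset_of_mem_splits hq)]

theorem _root_.Weight.Integrable.cutWeight {lam : Weight X} {t : ℝ≥0}
    (h : lam.Integrable (N.vol.restrict (N.before t))) :
    (N.cutWeight t lam).Integrable N.vol := by
  have hm : MeasurableSet (N.before t) := measurableSet_lt N.measurable_time measurable_const
  have e : ∀ f : X → ℝ≥0, (fun x => (((N.before t).indicator f x : ℝ≥0) : ℝ)) =
      (N.before t).indicator fun x => (f x : ℝ) := fun f => by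
    funext x
    by_cases hx : x ∈ N.before t <;> simp [hx]
  refine ⟨?_, ?_, ?_, ?_⟩ <;> simp only [Noise.cutWeight, e] <;>
    rw [memLp_indicator_iff_restrict hm]
  exacts [h.m0, h.mp, h.oo, h.op]

theorem prod_cutWeight {lam : Weight X} {t : ℝ≥0} {θ : Table X}
    (h : ∀ x ∈ θ.pts, N.time x < t) : (N.cutWeight t lam).prod θ = lam.prod θ := by
  have e : ∀ (f : X → ℝ≥0) (A : Finset X), A ⊆ θ.pts →
      ∏ x ∈ A, (N.before t).indicator f x = ∏ x ∈ A, f x := fun f A hA =>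
    prod_congr rfl fun x hx => indicator_of_mem (show x ∈ N.before t from h x (hA hx)) _
  rw [Weight.prod, Weight.prod, cutWeight]
  rw [e _ θ.m0 (by intro x hx; simp [Table.pts, hx]), e _ θ.mp (by intro x hx; simp [Table.pts, hx]),
    e _ θ.oo (by intro x hx; simp [Table.pts, hx]), e _ θ.op (by intro x hx; simp [Table.pts, hx])]

variable [StandardBorelSpace X]

theorem measurableSet_times_lt : MeasurableSet
    {q : ℝ≥0 × Table X | ∀ x ∈ q.2.pts, N.time x ∈ Iio q.1} := by
  have e : {q : ℝ≥0 × Table X | ∀ x ∈ q.2.pts, N.time x ∈ Iio q.1} =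
      {q | q.2.size = 0} ∪ {q | N.last q.2 < q.1} := by
    ext ⟨s, θ⟩
    have h0 : θ.size = 0 ↔ θ.pts = ∅ := by
      simp only [Table.size, Nat.add_eq_zero_iff, card_eq_zero, Table.pts,
        union_eq_empty]
    change (∀ x ∈ θ.pts, N.time x < s) ↔ θ.size = 0 ∨ N.last θ < s
    rw [h0]
    rcases θ.pts.eq_empty_or_nonempty with he | ⟨y, hy⟩
    · simp [he]
    · have hne : θ.pts ≠ ∅ := Finset.ne_empty_of_mem hy
      simp only [hne, false_or]
      exact ⟨fun h => (Finset.sup_lt_iff (bot_le.trans_lt (h y hy))).mpr h,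
        fun h x hx => (Finset.le_sup (f := N.time) hx).trans_lt h⟩
  rw [e]
  exact ((measurable_size.comp measurable_snd) (measurableSet_singleton 0)).union
    (measurableSet_lt ((measurable_last (N := N)).comp measurable_snd) measurable_fst)

theorem measurableSet_times_le : MeasurableSet
    {q : ℝ≥0 × Table X | ∀ x ∈ q.2.pts, N.time x ∈ Iic q.1} := by
  have e : {q : ℝ≥0 × Table X | ∀ x ∈ q.2.pts, N.time x ∈ Iic q.1} =
      {q | N.last q.2 ≤ q.1} := by
    ext ⟨s, θ⟩
    exact (Finset.sup_le_iff (s := θ.pts) (f := N.time)).symm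
  rw [e]
  exact measurableSet_le ((measurable_last (N := N)).comp measurable_snd) measurable_fst

variable [CompleteSpace K]

theorem OpMeas.ncut {Y : Type*} [MeasurableSpace Y] {L : Y → Table X → Op[X,K]}
    (hL : OpMeas fun q : Y × (Table X × Table X) => L q.1 q.2.1 q.2.2) {I : Y → Set ℝ≥0}
    (hI : MeasurableSet {q : Y × Table X | ∀ x ∈ q.2.pts, N.time x ∈ I q.1}) :
    OpMeas fun q : Y × (Table X × Table X) => N.ncut (I q.1) (L q.1) q.2.1 q.2.2 := by
  have hg : Measurable fun q : Y × (Table X × Table X) => (q.1, q.2.1) := by fun_prop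
  have h1 := hL.indicator (hg hI)
  have e : (fun q : Y × (Table X × Table X) => N.ncut (I q.1) (L q.1) q.2.1 q.2.2) =
      ((fun q : Y × (Table X × Table X) => (q.1, q.2.1)) ⁻¹'
        {q : Y × Table X | ∀ x ∈ q.2.pts, N.time x ∈ I q.1}).indicator
        fun q => L q.1 q.2.1 q.2.2 := by
    funext q
    rw [Noise.ncut, Set.indicator]
    congr
  rw [e]
  exact h1

theorem OpMeas.nsum_param {Y : Type*} [MeasurableSpace Y] {L : Y → Table X → Op[X,K]}
    (hL : OpMeas fun q : Y × (Table X × Table X) => L q.1 q.2.1 q.2.2) :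
    OpMeas fun q : Y × Table X => Noise.nsum (L q.1) q.2 := by
  have h := OpMeas.sum_finRep (FinRep.id.prod finRep_tableSplits) hL
  simp only [singleton_product, sum_map, Function.Embedding.coeFn_mk] at h
  exact h

theorem ncut_bound {L : Table X → Op[X,K]} {c t : ℝ≥0} {lam ζ : Weight X}
    {I : Set ℝ≥0} (hI : I ⊆ Iio t) {θ κ : Table X}
    (h : ‖L θ κ‖ₑ ≤ c * lam.prod θ * ζ.prod κ) :
    ‖N.ncut I L θ κ‖ₑ ≤ c * (N.cutWeight t lam).prod θ * ζ.prod κ := by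
  by_cases hθ : ∀ x ∈ θ.pts, N.time x ∈ I
  · rwa [ncut_of_pos hθ, prod_cutWeight fun x hx => hI (hθ x hx)]
  · rw [ncut_of_neg hθ, Pi.zero_apply, enorm_zero]
    exact zero_le

variable (N) in
/-- The functions `N_I(L)`. -/
noncomputable def nstep (L : Table X → Op[X,K]) (I : Set ℝ≥0) :
    Op[X,K] := nsum (N.ncut I L)

theorem stepFamily_nstep {L : Table X → Op[X,K]}
    (hL : OpMeas₂ L) {c : ℝ≥0} {lam ζ : Weight X}
    (hb : N.Bdd₂ c lam ζ L) (t : ℝ≥0) :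
    N.StepFamily t c ((N.cutWeight t lam).add ζ) (N.nstep L) where
  lt := OpMeas.nsum_param (L := fun s => N.ncut (Iio s) L) (OpMeas.ncut (N := N) (L := fun _ => L)
    (I := fun s => Iio s)
    (hL.comp_measurable measurable_snd) measurableSet_times_lt)
  le := OpMeas.nsum_param (L := fun s => N.ncut (Iic s) L) (OpMeas.ncut (N := N) (L := fun _ => L)
    (I := fun s => Iic s)
    (hL.comp_measurable measurable_snd) measurableSet_times_le)
  congr I J ϰ h := nsum_congr_on fun θ hθ => ncut_congr fun x hx => h x (hθ hx)
  bdd := by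
    unfold Bdd₂ at hb
    filter_upwards [N.unfold_tableSplits.ae hb] with ϰ h I hI
    rw [nstep, nsum, Weight.prod_add]
    refine (enorm_sum_le_of_normed _ _).trans ?_
    push_cast
    rw [mul_sum]
    refine sum_le_sum fun q hq => (ncut_bound hI (h q hq)).trans (le_of_eq ?_)
    ring

namespace StepFamily

variable {t c c' : ℝ≥0} {ζ ζ' : Weight X} {F G : Set ℝ≥0 → Op[X,K]}

theorem mono (h : N.StepFamily t c ζ F) (hζ : ∀ᵐ x ∂N.vol, ζ.LeAt ζ' x) :
    N.StepFamily t c ζ' F :=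
  { h with
    bdd := by
      filter_upwards [h.bdd, N.ae_prod_le hζ] with ϰ h1 h2 I hI
      exact (h1 I hI).trans (mul_le_mul' le_rfl (coe_le_coe.mpr h2)) }

theorem star (h : N.StepFamily t c ζ F) :
    N.StepFamily t c ζ.conj fun I => nstar (F I) where
  lt := h.lt.adjoint.comp_measurable (g := fun q : ℝ≥0 × Table X => (q.1, q.2.conj))
    (measurable_fst.prodMk (Table.measurable_conj.comp measurable_snd))
  le := h.le.adjoint.comp_measurable (g := fun q : ℝ≥0 × Table X => (q.1, q.2.conj))
    (measurable_fst.prodMk (Table.measurable_conj.comp measurable_snd))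
  congr I J ϰ hϰ := by
    rw [nstar, nstar, h.congr I J ϰ.conj]
    intro x hx
    refine hϰ x ?_
    simp only [Table.pts, Table.conj, mem_union] at hx ⊢
    tauto
  bdd := by
    filter_upwards [N.measurePreserving_conj.quasiMeasurePreserving.ae h.bdd] with ϰ h1 I hI
    rw [Weight.prod_conj, nstar]
    have h2 : ‖adjoint (F I ϰ.conj)‖ₑ = ‖F I ϰ.conj‖ₑ := by
      rw [← ofReal_norm, ← ofReal_norm, LinearIsometryEquiv.norm_map]
    rw [h2]
    exact h1 I hI

theorem nmul (h : N.StepFamily t c ζ F) (h' : N.StepFamily t c' ζ' G) :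
    N.StepFamily t (c * c') (ζ.mul ζ') fun I => nmul (F I) (G I) where
  lt := by
    have h1 := OpMeas.sum_finRep (FinRep.id.prod (unfold_mulSplits N).rep)
      ((h.lt.comp_measurable (measurable_fst.prodMk (measurable_mulLeft.comp measurable_snd))).comp
      (h'.lt.comp_measurable (measurable_fst.prodMk (measurable_mulRight.comp measurable_snd))))
    simpa only [singleton_product, sum_map, Function.Embedding.coeFn_mk,
      Function.comp_apply, ← nmul_eq_sum] using h1
  le := by
    have h1 := OpMeas.sum_finRep (FinRep.id.prod (unfold_mulSplits N).rep)
      ((h.le.comp_measurable (measurable_fst.prodMk (measurable_mulLeft.comp measurable_snd))).comp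
      (h'.le.comp_measurable (measurable_fst.prodMk (measurable_mulRight.comp measurable_snd))))
    simpa only [singleton_product, sum_map, Function.Embedding.coeFn_mk,
      Function.comp_apply, ← nmul_eq_sum] using h1
  congr I J ϰ hϰ := nmul_congr_on (fun κ hκ => h.congr I J κ fun x hx => hϰ x (hκ hx))
    fun κ hκ => h'.congr I J κ fun x hx => hϰ x (hκ hx)
  bdd := by
    filter_upwards [ae_mulLeft h.bdd, ae_mulRight h'.bdd, N.ae_table_times_disjoint]
      with ϰ h1 h2 h3 I hI
    exact enorm_nmul_le (fun z hz => h1 z hz I hI) (fun z hz => h2 z hz I hI)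
      (N.disjoint_of_times h3.1) (N.disjoint_of_times h3.2.1)
      (N.disjoint_of_times h3.2.2.2.2.1).symm (N.disjoint_of_times h3.2.2.2.2.2).symm

theorem opMeas (h : N.StepFamily t c ζ F) (s : ℝ≥0) : OpMeas (F (Iio s)) :=
  h.lt.comp_measurable (measurable_const.prodMk measurable_id)

theorem bdd_of_subset (h : N.StepFamily t c ζ F) {I : Set ℝ≥0} (hI : I ⊆ Iio t) :
    N.Bdd c ζ (F I) := by
  unfold Bdd
  filter_upwards [h.bdd] with ϰ hϰ using hϰ I hI

end StepFamily

/-! ### The sum over subtables of a table with an additional point -/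

theorem nsum_elem_union (L : Table X → Op[X,K]) {x : X} {ϰ : Table X}
    (hx : x ∉ ϰ.pts) {μ ν : Ind} (hμ : μ ≠ .plus) (hν : ν ≠ .minus) :
    nsum L ((Table.elem x μ ν).union ϰ) =
      nsum (fun θ κ => L θ ((Table.elem x μ ν).union κ)) ϰ +
        nsum (fun θ κ => L ((Table.elem x μ ν).union θ) κ) ϰ := by
  simp only [Table.pts, mem_union, not_or] at hx
  obtain ⟨⟨⟨h1, h2⟩, h3⟩, h4⟩ := hx
  have s1 : ∀ {A θ : Finset X}, x ∉ A → θ ∈ A.powerset → insert x A \ θ = insert x (A \ θ) :=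
    fun hA hθ => insert_sdiff_of_notMem _ fun h => hA (mem_powerset.mp hθ h)
  have s2 : ∀ {A : Finset X} (θ : Finset X), x ∉ A → insert x A \ insert x θ = A \ θ :=
    fun θ hA => by rw [insert_sdiff_insert, sdiff_insert_of_notMem hA]
  unfold nsum
  simp only [Table.sum_splits]
  cases μ <;> cases ν <;> first | exact absurd rfl hμ | exact absurd rfl hν | skip
  all_goals simp only [Table.elem, Table.union, Table.diff, empty_union,
    singleton_union]
  · rw [sum_powerset_insert h1]
    refine congrArg₂ (· + ·) (sum_congr rfl fun θ hθ => ?_)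
      (sum_congr rfl fun θ hθ => ?_)
    · simp only [s1 h1 hθ]
    · simp only [s2 θ h1]
  · simp only [← sum_add_distrib]
    refine sum_congr rfl fun _ _ => ?_
    rw [sum_powerset_insert h2]
    simp only [sum_add_distrib]
    refine congrArg₂ (· + ·) (sum_congr rfl fun θ hθ => ?_)
      (sum_congr rfl fun θ hθ => ?_)
    · simp only [s1 h2 hθ]
    · simp only [s2 θ h2]
  · simp only [← sum_add_distrib]
    refine sum_congr rfl fun _ _ => sum_congr rfl fun _ _ => ?_
    rw [sum_powerset_insert h3]
    simp only [sum_add_distrib]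
    refine congrArg₂ (· + ·) (sum_congr rfl fun θ hθ => ?_)
      (sum_congr rfl fun θ hθ => ?_)
    · simp only [s1 h3 hθ]
    · simp only [s2 θ h3]
  · simp only [← sum_add_distrib]
    refine sum_congr rfl fun _ _ => sum_congr rfl fun _ _ =>
      sum_congr rfl fun _ _ => ?_
    rw [sum_powerset_insert h4]
    simp only [sum_add_distrib]
    refine congrArg₂ (· + ·) (sum_congr rfl fun θ hθ => ?_)
      (sum_congr rfl fun θ hθ => ?_)
    · simp only [s1 h4 hθ]
    · simp only [s2 θ h4]

variable (N) in
/-- The integrand of the multiple integral for the derivative at `x`. -/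
noncomputable def nderivL (L : Table X → Op[X,K]) (μ ν : Ind) (x : X) :
    Table X → Op[X,K] :=
  N.ncut (Iio (N.time x)) fun θ κ => L ((Table.elem x μ ν).union θ) κ

theorem nsum_nderivL (L : Table X → Op[X,K]) {x : X} {ϰ : Table X}
    (hx : ∀ y ∈ ϰ.pts, N.time y ≠ N.time x) {μ ν : Ind} (hμ : μ ≠ .plus) (hν : ν ≠ .minus) :
    nsum (N.nderivL L μ ν x) ϰ = N.nstep L (Iic (N.time x)) ((Table.elem x μ ν).union ϰ) -
      N.nstep L (Iio (N.time x)) ((Table.elem x μ ν).union ϰ) := by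
  have hx' : x ∉ ϰ.pts := fun h => hx x h rfl
  have hp : ∀ θ : Table X, ((Table.elem x μ ν).union θ).pts = insert x θ.pts := by
    intro θ
    have h := pts_elem hμ hν x
    ext y
    have h' := congrArg (y ∈ ·) h
    simp only [Table.pts, Table.union, mem_union, mem_insert,
      mem_singleton] at h' ⊢
    rw [← h']
    tauto
  rw [nstep, nstep, nsum_elem_union _ hx' hμ hν, nsum_elem_union _ hx' hμ hν]
  have hI : ∀ θ : Table X, θ.pts ⊆ ϰ.pts → ∀ y ∈ θ.pts,
      N.time y ∈ Iic (N.time x) ↔ N.time y ∈ Iio (N.time x) := fun θ hθ y hy =>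
    ⟨fun h => lt_of_le_of_ne h (hx y (hθ hy)), fun h => le_of_lt (mem_Iio.mp h)⟩
  have e1 : nsum (fun θ κ => N.ncut (Iic (N.time x)) L θ ((Table.elem x μ ν).union κ)) ϰ =
      nsum (fun θ κ => N.ncut (Iio (N.time x)) L θ ((Table.elem x μ ν).union κ)) ϰ :=
    nsum_congr_on fun θ hθ => by rw [ncut_congr (hI θ hθ)]
  have e2 : nsum (fun θ κ => N.ncut (Iio (N.time x)) L ((Table.elem x μ ν).union θ) κ) ϰ =
      0 := sum_eq_zero fun q _ => by
    beta_reduce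
    rw [ncut_of_neg (I := Iio (N.time x)) fun h => lt_irrefl (N.time x) (h x (by rw [hp]; exact Finset.mem_insert_self _ _))]
    rfl
  have e3 : nsum (fun θ κ => N.ncut (Iic (N.time x)) L ((Table.elem x μ ν).union θ) κ) ϰ =
      nsum (N.nderivL L μ ν x) ϰ := nsum_congr_on fun θ hθ => by
    rw [nderivL, ← ncut_congr (hI θ hθ)]
    by_cases h : ∀ y ∈ θ.pts, N.time y ∈ Iic (N.time x)
    · rw [ncut_of_pos h, ncut_of_pos]
      intro y hy
      rw [hp, mem_insert] at hy
      rcases hy with rfl | hy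
      exacts [mem_Iic.mpr le_rfl, h y hy]
    · rw [ncut_of_neg h, ncut_of_neg]
      exact fun h' => h fun y hy => h' y (by rw [hp]; exact Finset.mem_insert_of_mem hy)
  rw [e1, e2, e3]
  abel

end Noise

end

section

variable {X : Type*} [MeasurableSpace X] [DecidableEq X] {N : Noise X} [StandardBorelSpace X]
variable {K : Type*} [NormedAddCommGroup K] [InnerProductSpace ℂ K]

theorem MeasureTheory.ae_prod_eq_of_ae_ae {α β E : Type*} [MeasurableSpace α] [MeasurableSpace β]
    [TopologicalSpace E] [TopologicalSpace.MetrizableSpace E] {μ : Measure α} {ν : Measure β}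
    [SFinite μ] [SFinite ν] {f g : α × β → E} (hf : AEStronglyMeasurable f (μ.prod ν))
    (hg : AEStronglyMeasurable g (μ.prod ν)) (h : ∀ᵐ x ∂μ, ∀ᵐ y ∂ν, f (x, y) = g (x, y)) :
    f =ᵐ[μ.prod ν] g := by
  have h1 : ∀ᵐ z ∂μ.prod ν, z ∈ {z | hf.mk f z = hg.mk g z} := by
    refine (Measure.ae_prod_mem_iff_ae_ae_mem
      (hf.stronglyMeasurable_mk.measurableSet_eq_fun hg.stronglyMeasurable_mk)).mpr ?_
    filter_upwards [h, ae_ae_of_ae_prod hf.ae_eq_mk, ae_ae_of_ae_prod hg.ae_eq_mk]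
      with x h1 h2 h3
    filter_upwards [h1, h2, h3] with y e1 e2 e3
    exact e2.symm.trans (e1.trans e3)
  filter_upwards [h1, hf.ae_eq_mk, hg.ae_eq_mk] with z e1 e2 e3
  exact e2.trans (Eq.trans e1 e3.symm)

namespace Noise

theorem ae_erase_before {t : ℝ≥0} {P : X → Finset X → Prop}
    (h : ∀ᵐ q ∂(N.vol.restrict (N.before t)).prod ν[N], P q.1 q.2) :
    ∀ᵐ ϰ ∂ν[N], ∀ x ∈ ϰ, N.time x < t → P x (ϰ.erase x) := by
  have h3 : (N.vol.restrict (N.before t)).prod ν[N] =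
      (N.vol.prod ν[N]).restrict (N.before t ×ˢ Set.univ) := by
    rw [← prod_restrict, Measure.restrict_univ]
  rw [h3, ae_restrict_iff' ((measurableSet_before t).prod MeasurableSet.univ)] at h
  have h' := N.ae_erase (P := fun x A => N.time x < t → P x A)
    (h.mono fun q hq hx => hq ⟨hx, Set.mem_univ _⟩)
  exact h'

/-! ### The argument of a single integral -/

theorem aestronglyMeasurable_nderiv {a : Finset X → K}
    (ha : AEStronglyMeasurable a ν[N]) (ν : Ind) :
    AEStronglyMeasurable (fun q : X × Finset X => nderiv a ν q.1 q.2)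
      (N.vol.prod ν[N]) := by
  have h0 : AEStronglyMeasurable (fun q : X × Finset X => a (∅ ∪ q.2))
      (N.vol.prod ν[N]) := by
    simp only [empty_union]
    exact ha.comp_quasiMeasurePreserving quasiMeasurePreserving_snd
  cases ν
  · exact h0
  · exact ha.comp_quasiMeasurePreserving (N.quasiMeasurePreserving_union.comp
      (QuasiMeasurePreserving.prodMap N.qmp_singleton
        (QuasiMeasurePreserving.id _)))
  · exact h0

variable (N) in
/-- The functions in one of the spaces of the Fock scale. -/
def InScale (a : Finset X → K) : Prop := ∃ ξ : ℝ≥0, 0 < ξ ∧ N.InG ξ a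

theorem InG.add {ξ : ℝ≥0} {a b : Finset X → K} (ha : N.InG ξ a) (hb : N.InG ξ b) :
    N.InG ξ (a + b) := by
  refine ⟨ha.1.add hb.1, ?_⟩
  have hm : AEMeasurable (fun ϰ : Finset X => 2 * ((ξ : ℝ≥0∞) ^ ϰ.card * ‖a ϰ‖ₑ ^ 2))
      ν[N] := ((measurable_pow_card _).aemeasurable.mul (ha.1.enorm.pow_const 2)).const_mul 2
  refine lt_of_le_of_lt (lintegral_mono (g := fun ϰ => 2 * ((ξ : ℝ≥0∞) ^ ϰ.card * ‖a ϰ‖ₑ ^ 2) +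
    2 * ((ξ : ℝ≥0∞) ^ ϰ.card * ‖b ϰ‖ₑ ^ 2)) fun ϰ => ?_) ?_
  · have h1 : ‖a ϰ + b ϰ‖ₑ ^ 2 ≤ 2 * ‖a ϰ‖ₑ ^ 2 + 2 * ‖b ϰ‖ₑ ^ 2 := by
      refine (pow_le_pow_left' (enorm_add_le _ _) 2).trans ?_
      rw [← mul_add]
      have := ENNReal.sum_mul_sq_le (univ : Finset (Fin 2)) (fun _ => 1) ![‖a ϰ‖ₑ, ‖b ϰ‖ₑ]
      simpa [Fin.sum_univ_two, one_add_one_eq_two] using this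
    calc (ξ : ℝ≥0∞) ^ ϰ.card * ‖(a + b) ϰ‖ₑ ^ 2
        ≤ (ξ : ℝ≥0∞) ^ ϰ.card * (2 * ‖a ϰ‖ₑ ^ 2 + 2 * ‖b ϰ‖ₑ ^ 2) := mul_le_mul' le_rfl h1
      _ = _ := by ring
  · rw [lintegral_add_left' hm, lintegral_const_mul' _ _ (by simp), lintegral_const_mul' _ _ (by simp)]
    exact ENNReal.add_lt_top.mpr ⟨mul_lt_top (by simp) ha.2,
      mul_lt_top (by simp) hb.2⟩

theorem InG.smul {ξ : ℝ≥0} {a : Finset X → K} (ha : N.InG ξ a) (z : ℂ) : N.InG ξ (z • a) := by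
  refine ⟨ha.1.const_smul z, ?_⟩
  have : N.nsq ξ (z • a) = ‖z‖ₑ ^ 2 * N.nsq ξ a := by
    rw [nsq, nsq, ← lintegral_const_mul' _ _ (by simp)]
    refine lintegral_congr fun ϰ => ?_
    rw [Pi.smul_apply, enorm_smul, mul_pow]
    ring
  rw [this]
  exact mul_lt_top (by simp) ha.2

theorem InG.neg {ξ : ℝ≥0} {a : Finset X → K} (ha : N.InG ξ a) : N.InG ξ (-a) :=
  ⟨ha.1.neg, by simpa [nsq] using ha.2⟩

theorem ae_inScale_nderiv {ξ : ℝ≥0} (hξ : 0 < ξ) {a : Finset X → K} (ha : N.InG ξ a) :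
    ∀ᵐ x ∂N.vol, ∀ ν, N.InScale (nderiv a ν x) := by
  have h0 : ∀ x : X, ∀ ν : Ind, ν ≠ .zero → nderiv a ν x = a := fun x ν hν => by
    funext A
    cases ν <;> first | exact absurd rfl hν | rw [nderiv, Ind.pts, empty_union]
  obtain ⟨b, hb1, hb2, hb3⟩ := ha.exists_sm
  have h2 : (ξ / 2 + ξ / 2 : ℝ≥0∞) = ξ := ENNReal.add_halves _
  have h3 := N.lintegral_chain_union_pow (ξ / 2) (ξ / 2) (hb1.enorm.pow_const 2)
  have hm : Measurable fun σ : Finset X => (ξ / 2 : ℝ≥0∞) ^ σ.card *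
      ∫⁻ ρ, (ξ / 2 : ℝ≥0∞) ^ ρ.card * ‖b (σ ∪ ρ)‖ₑ ^ 2 ∂ν[N] :=
    (measurable_pow_card _).mul (Measurable.lintegral_prod_right'
      (f := fun q : C²[X] => (ξ / 2 : ℝ≥0∞) ^ q.2.card * ‖b (q.1 ∪ q.2)‖ₑ ^ 2)
      (((measurable_pow_card _).comp measurable_snd).mul
        ((hb1.enorm.pow_const 2).comp measurable_chain_union₂)))
  have h4 := ae_lt_top hm (by rw [h3, h2]; exact hb3.2.ne)
  have h5 := N.qmp_singleton.ae h4
  have h6 := ae_ae_of_ae_prod (N.quasiMeasurePreserving_union.ae hb2)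
  have h7 := N.qmp_singleton.ae h6
  filter_upwards [h5, h7] with x h8 h9 ν
  by_cases hν : ν = .zero
  · subst hν
    refine ⟨ξ / 2, by positivity, InG.congr (a := fun A => b ({x} ∪ A)) ⟨?_, ?_⟩ ?_⟩
    · exact (hb1.comp_measurable
        (measurable_chain_union₂.comp measurable_prodMk_left)).aestronglyMeasurable
    · by_contra h
      rw [not_lt, top_le_iff, nsq, ENNReal.coe_div (by norm_num)] at h
      have h' : ∫⁻ ρ, (ξ / 2 : ℝ≥0∞) ^ ρ.card * ‖b ({x} ∪ ρ)‖ₑ ^ 2 ∂ν[N] = ∞ := h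
      rw [h', card_singleton, pow_one, ENNReal.mul_top] at h8
      · exact lt_irrefl _ h8
      · simpa using hξ.ne'
    · exact h9.mono fun A hA => hA.symm
  · exact ⟨ξ, hξ, by rwa [h0 x ν hν]⟩

/-! ### Operators in the Fock scale -/

variable [CompleteSpace K]

theorem InScale.neg {a : Finset X → K} (ha : N.InScale a) : N.InScale (-a) := by
  obtain ⟨ξ, h1, h2⟩ := ha
  exact ⟨ξ, h1, h2.neg⟩

variable (N) in
/-- Operator-valued functions that are measurable and relatively bounded. -/
def NRel (T : Op[X,K]) : Prop :=
  OpMeas T ∧ ∃ (c : ℝ≥0) (ζ : Weight X), ζ.Integrable N.vol ∧ N.Bdd c ζ T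

namespace NRel

variable {S T : Op[X,K]} {a b : Finset X → K}

theorem inScale (hT : N.NRel T) (ha : N.InScale a) : N.InScale (N.nfock T a) := by
  obtain ⟨h1, c, ζ, hζ, hb⟩ := hT
  obtain ⟨ξ, hξ, ha⟩ := ha
  obtain ⟨ξ', h2, h3⟩ := InG.nfock (fun v => h1.app v) hζ hb hξ
  exact ⟨ξ', h2, h3 a ha⟩

theorem nconv (hT : N.NRel T) (ha : N.InScale a) : ∀ᵐ ϰ ∂ν[N], N.NConv T a ϰ := by
  obtain ⟨h1, c, ζ, hζ, hb⟩ := hT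
  obtain ⟨ξ, hξ, ha⟩ := ha
  exact ae_nconv (fun v => h1.app v) hζ hb hξ ha

theorem nfock_sub (hT : N.NRel T) (ha : N.InScale a) (hb : N.InScale b) :
    N.nfock T (a - b) =ᵐ[ν[N]] N.nfock T a - N.nfock T b := by
  filter_upwards [hT.nconv ha, hT.nconv hb.neg] with ϰ h1 h2
  have h3 : N.nfock T (-b) ϰ = - N.nfock T b ϰ := by
    have := nfock_smul (N := N) T (-1) b ϰ
    simpa only [neg_smul, one_smul] using this
  rw [sub_eq_add_neg, nfock_add h1 h2, h3, Pi.sub_apply, sub_eq_add_neg]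

theorem nfock_op_sub (hS : N.NRel S) (hT : N.NRel T) (ha : N.InScale a) :
    N.nfock (fun ϰ => S ϰ - T ϰ) a =ᵐ[ν[N]] N.nfock S a - N.nfock T a := by
  filter_upwards [hS.nconv ha, hT.nconv ha] with ϰ h1 h2
  exact Noise.nfock_op_sub h1 h2

theorem nfock_op_add (hS : N.NRel S) (hT : N.NRel T) (ha : N.InScale a) :
    N.nfock (fun ϰ => S ϰ + T ϰ) a =ᵐ[ν[N]] N.nfock S a + N.nfock T a := by
  filter_upwards [hS.nconv ha, hT.nconv ha] with ϰ h1 h2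
  exact Noise.nfock_op_add h1 h2

theorem nfock_nfock (hS : N.NRel S) (hT : N.NRel T) (ha : N.InScale a) :
    N.nfock S (N.nfock T a) =ᵐ[ν[N]] N.nfock (Noise.nmul S T) a := by
  obtain ⟨h1, c, ζ, hζ, hb⟩ := hT
  obtain ⟨h1', c', ζ', hζ', hb'⟩ := hS
  obtain ⟨ξ, hξ, ha⟩ := ha
  exact Noise.nfock_nfock (fun v => h1'.app v) (fun v => h1.app v) hζ' hζ hb' hb hξ ha

theorem nmul (hS : N.NRel S) (hT : N.NRel T) : N.NRel (Noise.nmul S T) := by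
  obtain ⟨h1, c, ζ, hζ, hb⟩ := hT
  obtain ⟨h1', c', ζ', hζ', hb'⟩ := hS
  exact ⟨OpMeas.nmul h1' h1, c' * c, ζ'.mul ζ, hζ'.mul hζ, hb'.nmul hb⟩

theorem add (hS : N.NRel S) (hT : N.NRel T) : N.NRel fun ϰ => S ϰ + T ϰ := by
  obtain ⟨h1, c, ζ, hζ, hb⟩ := hT
  obtain ⟨h1', c', ζ', hζ', hb'⟩ := hS
  refine ⟨h1'.add h1, c' + c, ζ'.add ζ, hζ'.add hζ, ?_⟩
  have m1 : N.Bdd c' (ζ'.add ζ) S := hb'.mono (Eventually.of_forall fun x =>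
    ⟨le_self_add, le_self_add, le_self_add, le_self_add⟩)
  have m2 : N.Bdd c (ζ'.add ζ) T := hb.mono (Eventually.of_forall fun x =>
    ⟨le_add_self, le_add_self, le_add_self, le_add_self⟩)
  unfold Bdd at m1 m2 ⊢
  filter_upwards [m1, m2] with ϰ h2 h3
  rw [ENNReal.coe_add, add_mul]
  exact (enorm_add_le _ _).trans (add_le_add h2 h3)

end NRel

/-! ### Matrices of operators -/

/-- The product of matrices of maps. -/
def nmatMul (P Q : Ind → Ind → (Finset X → K) → Finset X → K) :
    Ind → Ind → (Finset X → K) → Finset X → K := fun μ ν a =>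
  P μ .minus (Q .minus ν a) + P μ .zero (Q .zero ν a) + P μ .plus (Q .plus ν a)

variable (N) in
/-- The matrix of the operators `U` at the point `x`. -/
noncomputable def nU (F : Set ℝ≥0 → Op[X,K]) (x : X) :
    Ind → Ind → (Finset X → K) → Finset X → K := fun μ ν =>
  N.nfock (ntri (F (Iio (N.time x))) (F (Iio (N.time x))) x μ ν)

variable (N) in
/-- The matrix of the operators `G` at the point `x`. -/
noncomputable def nG (F : Set ℝ≥0 → Op[X,K]) (x : X) :
    Ind → Ind → (Finset X → K) → Finset X → K := fun μ ν =>
  N.nfock (ntri (F (Iic (N.time x))) (F (Iio (N.time x))) x μ ν)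

theorem nfock_ntriMul {A B : Ind → Ind → Op[X,K]} (hA : ∀ μ ν, N.NRel (A μ ν))
    (hB : ∀ μ ν, N.NRel (B μ ν)) {a : Finset X → K} (ha : N.InScale a) (μ ν : Ind) :
    N.nfock (ntriMul A B μ ν) a =ᵐ[ν[N]]
      nmatMul (fun μ ν => N.nfock (A μ ν)) (fun μ ν => N.nfock (B μ ν)) μ ν a := by
  have h := fun κ => (hA μ κ).nmul (hB κ ν)
  have e : ntriMul A B μ ν = fun ϰ => (fun ϰ => nmul (A μ .minus) (B .minus ν) ϰ +
    nmul (A μ .zero) (B .zero ν) ϰ) ϰ + nmul (A μ .plus) (B .plus ν) ϰ := rfl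
  rw [e]
  filter_upwards [((h .minus).add (h .zero)).nfock_op_add (h .plus) ha,
    (h .minus).nfock_op_add (h .zero) ha, (hA μ .minus).nfock_nfock (hB .minus ν) ha,
    (hA μ .zero).nfock_nfock (hB .zero ν) ha, (hA μ .plus).nfock_nfock (hB .plus ν) ha]
    with ϰ h1 h2 h3 h4 h5
  rw [h1, Pi.add_apply, h2, Pi.add_apply, ← h3, ← h4, ← h5]
  rfl

theorem nstar_ntri (T T' : Op[X,K]) (x : X) (μ ν : Ind) :
    nstar (ntri T T' x ν.refl μ.refl) = ntri (nstar T) (nstar T') x μ ν := by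
  cases μ <;> cases ν <;> funext ϰ <;> simp [ntri, Ind.refl, nstar] <;> rfl

namespace StepFamily

variable {t c c' : ℝ≥0} {ζ ζ' : Weight X} {F G : Set ℝ≥0 → Op[X,K]}

theorem opMeas_ntri_Iio (h : N.StepFamily t c ζ F) (μ ν : Ind) :
    OpMeas fun q : X × Table X => ntri (F (Iio (N.time q.1))) (F (Iio (N.time q.1)))
      q.1 μ ν q.2 := by
  have m : ∀ {g : X × Table X → Table X}, Measurable g → OpMeas fun q : X × Table X =>
      F (Iio (N.time q.1)) (g q) := fun hg =>
    h.lt.comp_measurable ((N.measurable_time.comp measurable_fst).prodMk hg)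
  have z : OpMeas fun _ : X × Table X => (0 : K →L[ℂ] K) := OpMeas.const 0
  have s : Measurable fun q : X × Table X => ({q.1} : Finset X) :=
    measurable_chain_singleton.comp measurable_fst
  have o : Measurable fun _ : X × Table X => (∅ : Finset X) := measurable_const
  cases μ <;> cases ν <;> first
    | exact z
    | exact m measurable_snd
    | exact m (Table.measurable_union (Table.measurable_mk s o o o) measurable_snd)
    | exact m (Table.measurable_union (Table.measurable_mk o s o o) measurable_snd)
    | exact m (Table.measurable_union (Table.measurable_mk o o s o) measurable_snd)
    | exact m (Table.measurable_union (Table.measurable_mk o o o s) measurable_snd)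

theorem opMeas_ntri_Iic (h : N.StepFamily t c ζ F) (μ ν : Ind) :
    OpMeas fun q : X × Table X => ntri (F (Iic (N.time q.1))) (F (Iio (N.time q.1)))
      q.1 μ ν q.2 := by
  have m : ∀ {g : X × Table X → Table X}, Measurable g → OpMeas fun q : X × Table X =>
      F (Iic (N.time q.1)) (g q) := fun hg =>
    h.le.comp_measurable ((N.measurable_time.comp measurable_fst).prodMk hg)
  have m' : OpMeas fun q : X × Table X => F (Iio (N.time q.1)) q.2 :=
    h.lt.comp_measurable ((N.measurable_time.comp measurable_fst).prodMk measurable_snd)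
  have z : OpMeas fun _ : X × Table X => (0 : K →L[ℂ] K) := OpMeas.const 0
  have s : Measurable fun q : X × Table X => ({q.1} : Finset X) :=
    measurable_chain_singleton.comp measurable_fst
  have o : Measurable fun _ : X × Table X => (∅ : Finset X) := measurable_const
  cases μ <;> cases ν <;> first
    | exact z
    | exact m'
    | exact m (Table.measurable_union (Table.measurable_mk s o o o) measurable_snd)
    | exact m (Table.measurable_union (Table.measurable_mk o s o o) measurable_snd)
    | exact m (Table.measurable_union (Table.measurable_mk o o s o) measurable_snd)
    | exact m (Table.measurable_union (Table.measurable_mk o o o s) measurable_snd)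

theorem ae_bdd_ntri (h : N.StepFamily t c ζ F) : ∀ᵐ x ∂N.vol, N.time x < t → ∃ C : ℝ≥0,
    ∀ μ ν : Ind, N.Bdd C ζ (ntri (F (Iio (N.time x))) (F (Iio (N.time x))) x μ ν) ∧
      N.Bdd C ζ (ntri (F (Iic (N.time x))) (F (Iio (N.time x))) x μ ν) := by
  have key : ∀ μ ν : Ind, μ ≠ .plus → ν ≠ .minus → ∀ᵐ x ∂N.vol, ∀ᵐ ϰ ∂τ[N],
      ∀ I ⊆ Iio t, ‖ndot (F I) x μ ν ϰ‖ₑ ≤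
        c * (ζ.prod (Table.elem x μ ν) * ζ.prod ϰ : ℝ≥0) := by
    intro μ ν hμ hν
    have q := QuasiMeasurePreserving.prodMap (N.qmp_elem hμ hν)
      (QuasiMeasurePreserving.id τ[N])
    have h1 := ae_ae_of_ae_prod (q.ae N.ae_tables_disjoint)
    have h2 := ae_ae_of_ae_prod ((N.qmp_elem_union hμ hν).ae h.bdd)
    filter_upwards [h1, h2] with x h3 h4
    filter_upwards [h3, h4] with ϰ h5 h6 I hI
    have h5 : Disjoint (Table.elem x μ ν).m0 ϰ.m0 ∧ Disjoint (Table.elem x μ ν).mp ϰ.mp ∧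
      Disjoint (Table.elem x μ ν).oo ϰ.oo ∧ Disjoint (Table.elem x μ ν).op ϰ.op := h5
    rw [← Weight.prod_union ζ h5.1 h5.2.1 h5.2.2.1 h5.2.2.2]
    exact h6 I hI
  filter_upwards [key .minus .zero (by simp) (by simp), key .minus .plus (by simp) (by simp),
    key .zero .zero (by simp) (by simp), key .zero .plus (by simp) (by simp)]
    with x k1 k2 k3 k4 hx
  have s1 : Iio (N.time x) ⊆ Iio t := Set.Iio_subset_Iio hx.le
  have s2 : Iic (N.time x) ⊆ Iio t := fun s hs => lt_of_le_of_lt hs hx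
  let C : ℝ≥0 := c * (1 + ζ.m0 x + ζ.mp x + ζ.oo x + ζ.op x)
  have hz : N.Bdd C ζ (0 : Op[X,K]) := Eventually.of_forall fun ϰ => by simp
  have hd : N.Bdd C ζ (F (Iio (N.time x))) := by
    have h1 := h.bdd_of_subset s1
    unfold Bdd at h1 ⊢
    filter_upwards [h1] with ϰ hϰ
    refine hϰ.trans (mul_le_mul' (coe_le_coe.mpr ?_) le_rfl)
    refine le_mul_of_one_le_right' ?_
    rw [add_assoc, add_assoc, add_assoc]
    exact le_self_add
  have hk : ∀ (μ ν : Ind), ζ.prod (Table.elem x μ ν) ≤ 1 + ζ.m0 x + ζ.mp x + ζ.oo x + ζ.op x →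
      (∀ᵐ ϰ ∂τ[N], ∀ I ⊆ Iio t, ‖ndot (F I) x μ ν ϰ‖ₑ ≤
        c * (ζ.prod (Table.elem x μ ν) * ζ.prod ϰ : ℝ≥0)) → ∀ I ⊆ Iio t,
      N.Bdd C ζ (ndot (F I) x μ ν) := by
    intro μ ν hle k I hI
    unfold Bdd
    filter_upwards [k] with ϰ hϰ
    refine (hϰ I hI).trans ?_
    rw [← ENNReal.coe_mul, ← ENNReal.coe_mul, ← mul_assoc]
    exact coe_le_coe.mpr (mul_le_mul' (mul_le_mul' le_rfl hle) le_rfl)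
  have l1 := hk .minus .zero (by
    simp only [Weight.prod, Table.elem, prod_singleton, prod_empty, mul_one]
    calc ζ.m0 x ≤ 1 + ζ.m0 x := le_add_self
      _ ≤ _ := (le_self_add.trans le_self_add).trans le_self_add) k1
  have l2 := hk .minus .plus (by
    simp only [Weight.prod, Table.elem, prod_singleton, prod_empty, mul_one, one_mul]
    calc ζ.mp x ≤ 1 + ζ.m0 x + ζ.mp x := le_add_self
      _ ≤ _ := le_self_add.trans le_self_add) k2
  have l3 := hk .zero .zero (by
    simp only [Weight.prod, Table.elem, prod_singleton, prod_empty, mul_one, one_mul]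
    exact le_add_self.trans le_self_add) k3
  have l4 := hk .zero .plus (by
    simp only [Weight.prod, Table.elem, prod_singleton, prod_empty, mul_one, one_mul]
    exact le_add_self) k4
  refine ⟨C, fun μ ν => ?_⟩
  cases μ <;> cases ν
  exacts [⟨hd, hd⟩, ⟨l1 _ s1, l1 _ s2⟩, ⟨l2 _ s1, l2 _ s2⟩, ⟨hz, hz⟩, ⟨l3 _ s1, l3 _ s2⟩,
    ⟨l4 _ s1, l4 _ s2⟩, ⟨hz, hz⟩, ⟨hz, hz⟩, ⟨hd, hd⟩]

theorem ae_nrel_ntri (h : N.StepFamily t c ζ F) (hζ : ζ.Integrable N.vol) :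
    ∀ᵐ x ∂N.vol, N.time x < t → ∀ μ ν : Ind,
      N.NRel (ntri (F (Iio (N.time x))) (F (Iio (N.time x))) x μ ν) ∧
      N.NRel (ntri (F (Iic (N.time x))) (F (Iio (N.time x))) x μ ν) := by
  filter_upwards [h.ae_bdd_ntri] with x hx ht μ ν
  obtain ⟨C, hC⟩ := hx ht
  exact ⟨⟨(h.opMeas_ntri_Iio μ ν).comp_measurable measurable_prodMk_left, C, ζ, hζ, (hC μ ν).1⟩,
    ⟨(h.opMeas_ntri_Iic μ ν).comp_measurable measurable_prodMk_left, C, ζ, hζ, (hC μ ν).2⟩⟩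

theorem aestronglyMeasurable_nU (h : N.StepFamily t c ζ F) (μ ν : Ind) {b : X → Finset X → K}
    (hb : AEStronglyMeasurable (fun q : X × Finset X => b q.1 q.2) (N.vol.prod ν[N])) :
    AEStronglyMeasurable (fun q : X × Finset X => N.nU F q.1 μ ν (b q.1) q.2)
      (N.vol.prod ν[N]) := by
  have h1 := (h.opMeas_ntri_Iio μ ν).app
  exact aestronglyMeasurable_nfock_param N.vol
    (T := fun x => ntri (F (Iio (N.time x))) (F (Iio (N.time x))) x μ ν) h1 hb

theorem aestronglyMeasurable_nG (h : N.StepFamily t c ζ F) (μ ν : Ind) {b : X → Finset X → K}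
    (hb : AEStronglyMeasurable (fun q : X × Finset X => b q.1 q.2) (N.vol.prod ν[N])) :
    AEStronglyMeasurable (fun q : X × Finset X => N.nG F q.1 μ ν (b q.1) q.2)
      (N.vol.prod ν[N]) := by
  have h1 := (h.opMeas_ntri_Iic μ ν).app
  exact aestronglyMeasurable_nfock_param N.vol
    (T := fun x => ntri (F (Iic (N.time x))) (F (Iio (N.time x))) x μ ν) h1 hb

theorem nincr_ae_eq (h : N.StepFamily t c ζ F) (hζ : ζ.Integrable N.vol) {ξ : ℝ≥0} (hξ : 0 < ξ)
    {a : Finset X → K} (ha : N.InG ξ a) {μ ν : Ind} (hμ : μ ≠ .plus) (hν : ν ≠ .minus) :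
    ∀ᵐ x ∂N.vol, N.time x < t → N.nincr F a μ ν x =ᵐ[ν[N]]
      N.nG F x μ ν (nderiv a ν x) - N.nU F x μ ν (nderiv a ν x) := by
  filter_upwards [h.ae_nrel_ntri hζ, ae_inScale_nderiv hξ ha] with x h1 h2 hx
  have h3 := ((h1 hx μ ν).2.nfock_op_sub (h1 hx μ ν).1 (h2 ν))
  cases μ <;> cases ν <;> first | exact absurd rfl hμ | exact absurd rfl hν | exact h3

/-- The increment of a step family as a single integral of given vectors. -/
theorem nfock_eq (h : N.StepFamily t c ζ F) (hζ : ζ.Integrable N.vol) {ξ : ℝ≥0} (hξ : 0 < ξ)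
    {a : Finset X → K} (ha : N.InG ξ a) {e : Ind → Ind → X → Finset X → K}
    (hm : ∀ μ ν : Ind, μ ≠ .plus → ν ≠ .minus →
      AEStronglyMeasurable (fun q : X × Finset X => e μ ν q.1 q.2) (N.vol.prod ν[N]))
    (he : ∀ μ ν : Ind, μ ≠ .plus → ν ≠ .minus → ∀ᵐ x ∂N.vol, N.time x < t →
      N.nG F x μ ν (nderiv a ν x) - N.nU F x μ ν (nderiv a ν x) =ᵐ[ν[N]] e μ ν x) :
    ∀ᵐ ϰ ∂ν[N],
      (IntegrableOn (fun x => e .minus .zero x ϰ) (N.before t) N.vol ∧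
        IntegrableOn (fun x => e .minus .plus x ϰ) (N.before t) N.vol) ∧
      N.nfock (F (Iio t)) a ϰ = N.nfock (F ∅) a ϰ + N.nsingle t e ϰ := by
  have key : ∀ μ ν : Ind, μ ≠ .plus → ν ≠ .minus →
      ∀ᵐ q : X × Finset X ∂(N.vol.restrict (N.before t)).prod ν[N],
        N.nincr F a μ ν q.1 q.2 = e μ ν q.1 q.2 := by
    intro μ ν hμ hν
    have hd := aestronglyMeasurable_nderiv ha.1 ν
    have hle : (N.vol.restrict (N.before t)).prod ν[N] ≪ N.vol.prod ν[N] :=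
      (Measure.absolutelyContinuous_of_le restrict_le_self).prod
        Measure.AbsolutelyContinuous.rfl
    have m1 : AEStronglyMeasurable (fun q : X × Finset X => N.nincr F a μ ν q.1 q.2)
        (N.vol.prod ν[N]) := by
      have h1 := (h.opMeas_ntri_Iic μ ν).sub (h.opMeas_ntri_Iio μ ν)
      have h2 := aestronglyMeasurable_nfock_param N.vol (T := fun x κ =>
        ntri (F (Iic (N.time x))) (F (Iio (N.time x))) x μ ν κ -
        ntri (F (Iio (N.time x))) (F (Iio (N.time x))) x μ ν κ) (fun v => h1.app v) hd
      cases μ <;> cases ν <;> first | exact absurd rfl hμ | exact absurd rfl hν | exact h2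
    refine ae_prod_eq_of_ae_ae (f := fun q : X × Finset X => N.nincr F a μ ν q.1 q.2)
      (g := fun q : X × Finset X => e μ ν q.1 q.2) (m1.mono_ac hle) ((hm μ ν hμ hν).mono_ac hle) ?_
    rw [ae_restrict_iff' (measurableSet_before t)]
    filter_upwards [h.nincr_ae_eq hζ hξ ha hμ hν, he μ ν hμ hν] with x h1 h2 hx
    exact (h1 hx).trans (h2 hx)
  have sw : ∀ ν : Ind, ν ≠ .minus → ∀ᵐ ϰ ∂ν[N], ∀ᵐ x ∂N.vol.restrict (N.before t),
      N.nincr F a .minus ν x ϰ = e .minus ν x ϰ := fun ν hν => ae_ae_of_ae_prod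
    (measurePreserving_swap.quasiMeasurePreserving.ae (key .minus ν (by simp) hν))
  have r1 : N.NRel (F (Iio t)) := ⟨h.opMeas t, c, ζ, hζ, h.bdd_of_subset le_rfl⟩
  have hempty : (∅ : Set ℝ≥0) = Iio 0 := by
    ext s
    simp
  have r2 : N.NRel (F ∅) := ⟨hempty ▸ h.opMeas 0, c, ζ, hζ, h.bdd_of_subset (Set.empty_subset _)⟩
  filter_upwards [h.nfock_sub hζ hξ ha, sw .zero (by simp), sw .plus (by simp),
    ae_erase_before (P := fun x A => N.nincr F a .zero .zero x A = e .zero .zero x A)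
      (key .zero .zero (by simp) (by simp)),
    ae_erase_before (P := fun x A => N.nincr F a .zero .plus x A = e .zero .plus x A)
      (key .zero .plus (by simp) (by simp)), r1.nfock_op_sub r2 ⟨ξ, hξ, ha⟩]
    with ϰ ⟨⟨i1, i2⟩, i3⟩ j1 j2 j3 j4 j5
  refine ⟨⟨i1.congr j1, i2.congr j2⟩, ?_⟩
  rw [i3, Pi.sub_apply] at j5
  rw [eq_add_of_sub_eq' j5.symm]
  congr 1
  rw [nsingle, nsingle, sum_cut, sum_cut, sum_cut, sum_cut, integral_congr_ae j1,
    integral_congr_ae j2]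
  congr 3
  · refine sum_congr rfl fun x hx => ?_
    split_ifs with h
    exacts [j3 x hx h, rfl]
  · refine sum_congr rfl fun x hx => ?_
    split_ifs with h
    exacts [j4 x hx h, rfl]

end StepFamily

end Noise

end

section

variable {X : Type*} [MeasurableSpace X] [DecidableEq X] {N : Noise X} [StandardBorelSpace X]
variable {K : Type*} [NormedAddCommGroup K] [InnerProductSpace ℂ K] [CompleteSpace K]

namespace Noise

/-! ### Jointly measurable matrices -/

variable (N) in
/-- Matrices of maps that preserve joint measurability. -/
def JointMeas (P : X → Ind → Ind → (Finset X → K) → Finset X → K) : Prop :=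
  ∀ (μ ν : Ind) (b : X → Finset X → K),
    AEStronglyMeasurable (fun q : X × Finset X => b q.1 q.2) (N.vol.prod ν[N]) →
    AEStronglyMeasurable (fun q : X × Finset X => P q.1 μ ν (b q.1) q.2)
      (N.vol.prod ν[N])

namespace JointMeas

variable {P Q : X → Ind → Ind → (Finset X → K) → Finset X → K}

theorem add (hP : N.JointMeas P) (hQ : N.JointMeas Q) : N.JointMeas fun x => P x + Q x :=
  fun μ ν b hb => (hP μ ν b hb).add (hQ μ ν b hb)

theorem sub (hP : N.JointMeas P) (hQ : N.JointMeas Q) : N.JointMeas fun x => P x - Q x :=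
  fun μ ν b hb => (hP μ ν b hb).sub (hQ μ ν b hb)

theorem matMul (hP : N.JointMeas P) (hQ : N.JointMeas Q) :
    N.JointMeas fun x => nmatMul (P x) (Q x) := fun μ ν b hb =>
  have h := fun κ => hP μ κ (fun x => Q x κ ν (b x)) (hQ κ ν b hb)
  ((h .minus).add (h .zero)).add (h .plus)

end JointMeas

variable {t c c' : ℝ≥0} {ζ ζ' lam : Weight X} {F G : Set ℝ≥0 → Op[X,K]}

theorem StepFamily.jointMeas_nU (h : N.StepFamily t c ζ F) : N.JointMeas (N.nU F) :=
  fun μ ν _ hb => h.aestronglyMeasurable_nU μ ν hb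

theorem StepFamily.jointMeas_nG (h : N.StepFamily t c ζ F) : N.JointMeas (N.nG F) :=
  fun μ ν _ hb => h.aestronglyMeasurable_nG μ ν hb

/-! ### The derivatives of a product -/

variable (N) in
theorem ae_time_ne (s : ℝ≥0) : ∀ᵐ ϰ ∂τ[N], ∀ y ∈ ϰ.pts, N.time y ≠ s :=
  N.ae_table_of_ae (N.vol_time_eq s)

theorem StepFamily.congr_Iic (h : N.StepFamily t c ζ F) {s : ℝ≥0} {ϰ : Table X}
    (hϰ : ∀ y ∈ ϰ.pts, N.time y ≠ s) : F (Iic s) ϰ = F (Iio s) ϰ :=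
  h.congr _ _ ϰ fun y hy => ⟨fun h' => lt_of_le_of_ne h' (hϰ y hy), fun h' =>
    le_of_lt (mem_Iio.mp h')⟩

theorem ntri_congr_diag {T T' T'' : Op[X,K]} {ϰ : Table X} (h : T' ϰ = T'' ϰ) (x : X)
    (μ ν : Ind) : ntri T T' x μ ν ϰ = ntri T T'' x μ ν ϰ := by
  cases μ <;> cases ν <;> first | rfl | exact h

theorem nU_nmul_ae_eq (h : N.StepFamily t c ζ F) (h' : N.StepFamily t c' ζ' G)
    (hζ : ζ.Integrable N.vol) (hζ' : ζ'.Integrable N.vol) :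
    ∀ᵐ x ∂N.vol, N.time x < t → ∀ (μ ν : Ind) (b : Finset X → K), N.InScale b →
      N.nU (fun I => nmul (F I) (G I)) x μ ν b =ᵐ[ν[N]]
        nmatMul (N.nU F x) (N.nU G x) μ ν b := by
  filter_upwards [h.ae_nrel_ntri hζ, h'.ae_nrel_ntri hζ'] with x h1 h2 hx μ ν b hb
  refine EventuallyEq.trans (nfock_congr ?_ EventuallyEq.rfl)
    (nfock_ntriMul (fun μ ν => (h1 hx μ ν).1) (fun μ ν => (h2 hx μ ν).1) hb μ ν)
  filter_upwards [N.ae_time_ne (N.time x)] with ϰ hϰ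
  exact ntri_nmul _ _ (fun h => hϰ x h rfl) μ ν

theorem nG_nmul_ae_eq (h : N.StepFamily t c ζ F) (h' : N.StepFamily t c' ζ' G)
    (hζ : ζ.Integrable N.vol) (hζ' : ζ'.Integrable N.vol) :
    ∀ᵐ x ∂N.vol, N.time x < t → ∀ (μ ν : Ind) (b : Finset X → K), N.InScale b →
      N.nG (fun I => nmul (F I) (G I)) x μ ν b =ᵐ[ν[N]]
        nmatMul (N.nG F x) (N.nG G x) μ ν b := by
  filter_upwards [h.ae_nrel_ntri hζ, h'.ae_nrel_ntri hζ'] with x h1 h2 hx μ ν b hb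
  refine EventuallyEq.trans (nfock_congr ?_ EventuallyEq.rfl)
    (nfock_ntriMul (fun μ ν => (h1 hx μ ν).2) (fun μ ν => (h2 hx μ ν).2) hb μ ν)
  filter_upwards [N.ae_time_ne (N.time x)] with ϰ hϰ
  rw [ntri_congr_diag ((h.nmul h').congr_Iic hϰ).symm, ntri_nmul _ _ (fun h => hϰ x h rfl) μ ν,
    ntriMul, ntriMul]
  have e : ∀ κ : Table X, κ.pts ⊆ ϰ.pts → ∀ μ ν,
      ntri (F (Iic (N.time x))) (F (Iic (N.time x))) x μ ν κ =
        ntri (F (Iic (N.time x))) (F (Iio (N.time x))) x μ ν κ := fun κ hκ μ ν =>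
    ntri_congr_diag (h.congr_Iic fun y hy => hϰ y (hκ hy)) x μ ν
  have e' : ∀ κ : Table X, κ.pts ⊆ ϰ.pts → ∀ μ ν,
      ntri (G (Iic (N.time x))) (G (Iic (N.time x))) x μ ν κ =
        ntri (G (Iic (N.time x))) (G (Iio (N.time x))) x μ ν κ := fun κ hκ μ ν =>
    ntri_congr_diag (h'.congr_Iic fun y hy => hϰ y (hκ hy)) x μ ν
  rw [nmul_congr_on (fun κ hκ => e κ hκ μ .minus) fun κ hκ => e' κ hκ .minus ν,
    nmul_congr_on (fun κ hκ => e κ hκ μ .zero) fun κ hκ => e' κ hκ .zero ν,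
    nmul_congr_on (fun κ hκ => e κ hκ μ .plus) fun κ hκ => e' κ hκ .plus ν]

/-! ### The derivatives of the multiple integral -/

variable (N) in
/-- The matrix of the derivatives of the multiple integral. -/
noncomputable def nD (L : Table X → Op[X,K]) (x : X) :
    Ind → Ind → (Finset X → K) → Finset X → K := fun μ ν =>
  match μ, ν with
  | .minus, .zero => N.nmult (N.nderivL L .minus .zero x)
  | .minus, .plus => N.nmult (N.nderivL L .minus .plus x)
  | .zero, .zero => N.nmult (N.nderivL L .zero .zero x)
  | .zero, .plus => N.nmult (N.nderivL L .zero .plus x)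
  | _, _ => 0

theorem opMeas_nderivL {L : Table X → Op[X,K]}
    (hL : OpMeas₂ L) (μ ν : Ind) :
    OpMeas fun q : X × (Table X × Table X) => N.nderivL L μ ν q.1 q.2.1 q.2.2 := by
  refine OpMeas.ncut (N := N) (L := fun x θ κ => L ((Table.elem x μ ν).union θ) κ)
    (I := fun x => Iio (N.time x)) ?_ ?_
  · have s : Measurable fun q : X × (Table X × Table X) => ({q.1} : Finset X) :=
      measurable_chain_singleton.comp measurable_fst
    have o : Measurable fun _ : X × (Table X × Table X) => (∅ : Finset X) := measurable_const
    have u : ∀ {g : X × (Table X × Table X) → Table X}, Measurable g → OpMeas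
        fun q : X × (Table X × Table X) => L ((g q).union q.2.1) q.2.2 := fun hg =>
      hL.comp_measurable ((Table.measurable_union hg (measurable_fst.comp measurable_snd)).prodMk
        (measurable_snd.comp measurable_snd))
    cases μ <;> cases ν <;> first
      | exact u (Table.measurable_mk s o o o)
      | exact u (Table.measurable_mk o s o o)
      | exact u (Table.measurable_mk o o s o)
      | exact u (Table.measurable_mk o o o s)
      | exact u (Table.measurable_mk o o o o)
  · exact ((N.measurable_time.comp measurable_fst).prodMk measurable_snd :
      Measurable fun q : X × Table X => (N.time q.1, q.2)) measurableSet_times_lt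

theorem jointMeas_nD {L : Table X → Op[X,K]}
    (hL : OpMeas₂ L) : N.JointMeas (N.nD L) := by
  intro μ ν b hb
  have h1 := aestronglyMeasurable_nmult_param N.vol (L := fun x => N.nderivL L μ ν x)
    (opMeas_nderivL hL μ ν).app hb
  have z : AEStronglyMeasurable (fun _ : X × Finset X => (0 : K)) (N.vol.prod ν[N]) :=
    aestronglyMeasurable_const
  cases μ <;> cases ν <;> first | exact z | exact h1

/-- The entries of the matrices of a step family `N_I(L)`, for almost all `x`. -/
theorem ae_nrel_nstep {L : Table X → Op[X,K]}
    (hL : OpMeas₂ L)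
    (hlam : ∀ t, lam.Integrable (N.vol.restrict (N.before t))) (hζ : ζ.Integrable N.vol)
    (hb : N.Bdd₂ c lam ζ L) : ∀ᵐ x ∂N.vol, ∀ μ ν : Ind,
      N.NRel (ntri (N.nstep L (Iio (N.time x))) (N.nstep L (Iio (N.time x))) x μ ν) ∧
      N.NRel (ntri (N.nstep L (Iic (N.time x))) (N.nstep L (Iio (N.time x))) x μ ν) := by
  have h : ∀ n : ℕ, _ := fun n => (stepFamily_nstep hL hb (n : ℝ≥0)).ae_nrel_ntri
    ((hlam n).cutWeight.add hζ)
  filter_upwards [ae_all_iff.mpr h] with x hx μ ν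
  obtain ⟨n, hn⟩ := exists_nat_gt (N.time x)
  exact hx n hn μ ν

theorem Bdd₂.ae_nderivL {L : Table X → Op[X,K]} (hb : N.Bdd₂ c lam ζ L) {μ ν : Ind}
    (hμ : μ ≠ .plus) (hν : ν ≠ .minus) : ∀ᵐ x ∂N.vol,
      N.Bdd₂ (c * lam.prod (Table.elem x μ ν)) (N.cutWeight (N.time x) lam) ζ
        (N.nderivL L μ ν x) := by
  have q1 := (QuasiMeasurePreserving.prodMap (N.qmp_elem_union hμ hν)
    (QuasiMeasurePreserving.id τ[N])).comp
    ((measurePreserving_prodAssoc N.vol τ[N] τ[N]).symm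
      MeasurableEquiv.prodAssoc).quasiMeasurePreserving
  have q2 := (QuasiMeasurePreserving.prodMap (N.qmp_elem hμ hν)
    (quasiMeasurePreserving_fst (μ := τ[N]) (ν := τ[N])))
  filter_upwards [ae_ae_of_ae_prod (q1.ae hb),
    ae_ae_of_ae_prod (q2.ae N.ae_tables_disjoint)] with x h1 h2
  unfold Bdd₂
  filter_upwards [h1, h2] with p h3 h4
  have h4 : Disjoint (Table.elem x μ ν).m0 p.1.m0 ∧ Disjoint (Table.elem x μ ν).mp p.1.mp ∧
      Disjoint (Table.elem x μ ν).oo p.1.oo ∧ Disjoint (Table.elem x μ ν).op p.1.op := h4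
  have h3 : ‖L ((Table.elem x μ ν).union p.1) p.2‖ₑ ≤
    c * lam.prod ((Table.elem x μ ν).union p.1) * ζ.prod p.2 := h3
  rw [Weight.prod_union lam h4.1 h4.2.1 h4.2.2.1 h4.2.2.2, ENNReal.coe_mul, ← mul_assoc,
    ← ENNReal.coe_mul] at h3
  exact ncut_bound le_rfl (L := fun θ κ => L ((Table.elem x μ ν).union θ) κ) h3

theorem ae_nmult_nderivL {L : Table X → Op[X,K]}
    (hL : OpMeas₂ L)
    (hlam : ∀ t, lam.Integrable (N.vol.restrict (N.before t))) (hζ : ζ.Integrable N.vol)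
    (hb : N.Bdd₂ c lam ζ L) {μ ν : Ind} (hμ : μ ≠ .plus) (hν : ν ≠ .minus) :
    ∀ᵐ x ∂N.vol, ∀ b : Finset X → K, N.InScale b → ∀ᵐ ϰ ∂ν[N],
      N.nmult (N.nderivL L μ ν x) b ϰ = (N.nG (N.nstep L) x - N.nU (N.nstep L) x) μ ν b ϰ ∧
      ∀ oo ⊆ ϰ, ∀ op ⊆ ϰ \ oo, Integrable (fun p : C²[X] =>
        N.nfock (N.nderivL L μ ν x ⟨p.1, p.2, oo, op⟩) (fun A => b ((oo ∪ p.1) ∪ A))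
          ((ϰ \ oo) \ op)) ν²[N] := by
  filter_upwards [ae_nrel_nstep hL hlam hζ hb, hb.ae_nderivL hμ hν] with x h1 h2 b ⟨ξ, hξ, hb⟩
  have h3 := nfock_nsum (fun v => ((opMeas_nderivL (N := N) hL μ ν).comp_measurable
    (measurable_prodMk_left (x := x))).app v) (hlam (N.time x)).cutWeight hζ h2 hξ hb
  have h4 := (h1 μ ν).2.nfock_op_sub (h1 μ ν).1 ⟨ξ, hξ, hb⟩
  have h5 : N.nfock (nsum (N.nderivL L μ ν x)) b =ᵐ[ν[N]] N.nfock (fun ϰ =>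
      ntri (N.nstep L (Iic (N.time x))) (N.nstep L (Iio (N.time x))) x μ ν ϰ -
      ntri (N.nstep L (Iio (N.time x))) (N.nstep L (Iio (N.time x))) x μ ν ϰ) b := by
    refine nfock_congr ?_ EventuallyEq.rfl
    filter_upwards [N.ae_time_ne (N.time x)] with ϰ hϰ
    rw [nsum_nderivL L hϰ hμ hν]
    cases μ <;> cases ν <;> first | exact absurd rfl hμ | exact absurd rfl hν | rfl
  filter_upwards [h3, h4, h5] with ϰ h6 h7 h8
  exact ⟨by rw [← h6.1, h8, h7]; rfl, h6.2⟩

theorem ae_nD_eq {L : Table X → Op[X,K]}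
    (hL : OpMeas₂ L)
    (hlam : ∀ t, lam.Integrable (N.vol.restrict (N.before t))) (hζ : ζ.Integrable N.vol)
    (hb : N.Bdd₂ c lam ζ L) : ∀ᵐ x ∂N.vol, ∀ (μ ν : Ind) (b : Finset X → K), N.InScale b →
      N.nD L x μ ν b =ᵐ[ν[N]] (N.nG (N.nstep L) x - N.nU (N.nstep L) x) μ ν b := by
  have h : ∀ {μ ν : Ind}, μ ≠ .plus → ν ≠ .minus → _ := fun hμ hν =>
    ae_nmult_nderivL hL hlam hζ hb hμ hν
  filter_upwards [h (μ := .minus) (ν := .zero) (by simp) (by simp),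
    h (μ := .minus) (ν := .plus) (by simp) (by simp),
    h (μ := .zero) (ν := .zero) (by simp) (by simp),
    h (μ := .zero) (ν := .plus) (by simp) (by simp)] with x h1 h2 h3 h4 μ ν b hb
  have z : ∀ v : Finset X → K, (0 : Finset X → K) =ᵐ[ν[N]] v - v := fun v => by
    rw [sub_self]
  cases μ <;> cases ν
  exacts [z _, (h1 b hb).mono fun _ h => h.1, (h2 b hb).mono fun _ h => h.1, z _,
    (h3 b hb).mono fun _ h => h.1, (h4 b hb).mono fun _ h => h.1, z _, z _, z _]

/-! ### The differentials -/

/-- The conclusion on the increment of `F` as a single integral of the matrices `P(x)`. -/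
def HasDifferential (N : Noise X) (t : ℝ≥0) (F : Set ℝ≥0 → Op[X,K])
    (P : X → Ind → Ind → (Finset X → K) → Finset X → K) (a : Finset X → K) : Prop :=
  ∀ᵐ ϰ ∂ν[N],
    (IntegrableOn (fun x => P x .minus .zero (nderiv a .zero x) ϰ) (N.before t) N.vol ∧
      IntegrableOn (fun x => P x .minus .plus (nderiv a .plus x) ϰ) (N.before t) N.vol) ∧
    N.nfock (F (Iio t)) a ϰ =
      N.nfock (F ∅) a ϰ + N.nsingle t (fun μ ν x => P x μ ν (nderiv a ν x)) ϰ

theorem StepFamily.hasDifferential (h : N.StepFamily t c ζ F) (hζ : ζ.Integrable N.vol)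
    {P : X → Ind → Ind → (Finset X → K) → Finset X → K} (hP : N.JointMeas P)
    (he : ∀ᵐ x ∂N.vol, N.time x < t → ∀ (μ ν : Ind) (b : Finset X → K), N.InScale b →
      (N.nG F x - N.nU F x) μ ν b =ᵐ[ν[N]] P x μ ν b) {a : Finset X → K}
    (ha : N.InScale a) : HasDifferential N t F P a := by
  obtain ⟨ξ, hξ, ha⟩ := ha
  have hm : ∀ μ ν : Ind, AEStronglyMeasurable
      (fun q : X × Finset X => P q.1 μ ν (nderiv a ν q.1) q.2) (N.vol.prod ν[N]) :=
    fun μ ν => hP μ ν (nderiv a ν) (aestronglyMeasurable_nderiv ha.1 ν)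
  have he' : ∀ μ ν : Ind, ∀ᵐ x ∂N.vol, N.time x < t →
      N.nG F x μ ν (nderiv a ν x) - N.nU F x μ ν (nderiv a ν x) =ᵐ[ν[N]]
        P x μ ν (nderiv a ν x) := fun μ ν => by
    filter_upwards [he, ae_inScale_nderiv hξ ha] with x h1 h2 hx using h1 hx μ ν _ (h2 ν)
  have r := h.nfock_eq hζ hξ ha (e := fun μ ν x => P x μ ν (nderiv a ν x))
    (fun μ ν _ _ => hm μ ν) (fun μ ν _ _ => he' μ ν)
  exact r

variable {L : Table X → Op[X,K]}

theorem hasDifferential_nD (hL : OpMeas₂ L)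
    (hlam : ∀ t, lam.Integrable (N.vol.restrict (N.before t))) (hζ : ζ.Integrable N.vol)
    (hb : N.Bdd₂ c lam ζ L) (t : ℝ≥0) {a : Finset X → K} (ha : N.InScale a) :
    HasDifferential N t (N.nstep L) (N.nD L) a := by
  refine (stepFamily_nstep hL hb t).hasDifferential ((hlam t).cutWeight.add hζ) (jointMeas_nD hL)
    ?_ ha
  filter_upwards [ae_nD_eq hL hlam hζ hb] with x h1 _ μ ν b hb
  exact (h1 μ ν b hb).symm

theorem StepFamily.hasDifferential_sub (h : N.StepFamily t c ζ F) (hζ : ζ.Integrable N.vol)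
    {a : Finset X → K} (ha : N.InScale a) :
    HasDifferential N t F (fun x => N.nG F x - N.nU F x) a :=
  h.hasDifferential hζ (h.jointMeas_nG.sub h.jointMeas_nU)
    (Eventually.of_forall fun _ _ _ _ _ _ => EventuallyEq.rfl) ha

theorem StepFamily.hasDifferential_nmul (h : N.StepFamily t c ζ F) (h' : N.StepFamily t c' ζ' G)
    (hζ : ζ.Integrable N.vol) (hζ' : ζ'.Integrable N.vol) {a : Finset X → K}
    (ha : N.InScale a) : HasDifferential N t (fun I => Noise.nmul (F I) (G I))
      (fun x => nmatMul (N.nG F x) (N.nG G x) - nmatMul (N.nU F x) (N.nU G x)) a := by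
  refine (h.nmul h').hasDifferential (hζ.mul hζ')
    ((h.jointMeas_nG.matMul h'.jointMeas_nG).sub (h.jointMeas_nU.matMul h'.jointMeas_nU)) ?_ ha
  filter_upwards [nU_nmul_ae_eq h h' hζ hζ', nG_nmul_ae_eq h h' hζ hζ'] with x h1 h2 hx μ ν b hb
  exact (h2 hx μ ν b hb).sub (h1 hx μ ν b hb)

/-- The Ito formula for a product. -/
theorem StepFamily.hasDifferential_ito (h : N.StepFamily t c' ζ' F) (hζ' : ζ'.Integrable N.vol)
    (hL : OpMeas₂ L)
    (hlam : ∀ t, lam.Integrable (N.vol.restrict (N.before t))) (hζ : ζ.Integrable N.vol)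
    (hb : N.Bdd₂ c lam ζ L) {a : Finset X → K} (ha : N.InScale a) :
    HasDifferential N t (fun I => Noise.nmul (F I) (N.nstep L I))
      (fun x => nmatMul (N.nU F x) (N.nD L x) +
        nmatMul (N.nG F x - N.nU F x) (N.nU (N.nstep L) x) +
        nmatMul (N.nG F x - N.nU F x) (N.nD L x)) a := by
  have h' := stepFamily_nstep hL hb t
  have hw := (hlam t).cutWeight.add hζ
  have hD := jointMeas_nD (N := N) hL
  refine (h.nmul h').hasDifferential (hζ'.mul hw)
    (((h.jointMeas_nU.matMul hD).add ((h.jointMeas_nG.sub h.jointMeas_nU).matMul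
      h'.jointMeas_nU)).add ((h.jointMeas_nG.sub h.jointMeas_nU).matMul hD)) ?_ ha
  filter_upwards [nU_nmul_ae_eq h h' hζ' hw, nG_nmul_ae_eq h h' hζ' hw,
    ae_nD_eq hL hlam hζ hb, h.ae_nrel_ntri hζ', h'.ae_nrel_ntri hw] with x h1 h2 h3 h4 h5 hx μ ν b hb
  have key : ∀ κ : Ind, N.nG F x μ κ (N.nD L x κ ν b) =ᵐ[ν[N]]
      N.nG F x μ κ (N.nG (N.nstep L) x κ ν b) - N.nG F x μ κ (N.nU (N.nstep L) x κ ν b) :=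
    fun κ => (nfock_congr (Eventually.of_forall fun _ => rfl) (h3 κ ν b hb)).trans
      ((h4 hx μ κ).2.nfock_sub ((h5 hx κ ν).2.inScale hb) ((h5 hx κ ν).1.inScale hb))
  filter_upwards [h1 hx μ ν b hb, h2 hx μ ν b hb, key .minus, key .zero, key .plus]
    with ϰ k1 k2 k3 k4 k5
  simp only [Pi.sub_apply, Pi.add_apply, nmatMul] at k1 k2 k3 k4 k5 ⊢
  rw [k1, k2, k3, k4, k5]
  abel

end Noise

end

theorem MeasureTheory.StronglyMeasurable.eval_nat {Y E : Type*} [MeasurableSpace Y]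
    [TopologicalSpace E] [TopologicalSpace.PseudoMetrizableSpace E] {F : ℕ → Y → E}
    (hF : ∀ n, StronglyMeasurable (F n)) {i : Y → ℕ} (hi : Measurable i) :
    StronglyMeasurable fun y => F (i y) y := by
  borelize E
  refine stronglyMeasurable_iff_measurable_separable.mpr ⟨?_, ?_⟩
  · have h : Measurable fun q : ℕ × Y => F q.1 q.2 :=
      measurable_from_prod_countable_right fun n => (hF n).measurable
    exact h.comp (hi.prodMk measurable_id)
  · refine (TopologicalSpace.IsSeparable.iUnion fun n => (hF n).isSeparable_range).mono ?_
    rintro _ ⟨y, rfl⟩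
    exact mem_iUnion.mpr ⟨i y, y, rfl⟩

section Coordinates

/-- The sequences in `H` with summable squares of norms. -/
abbrev Ell2 (H : Type*) [NormedAddCommGroup H] : Type _ := lp (fun _ : ℕ => H) 2

variable {H : Type*} [NormedAddCommGroup H]

/-- The sequence with a single term. -/
noncomputable def ellSingle (n : ℕ) (h : H) : Ell2 H := lp.single 2 n h

theorem ellSingle_self (n : ℕ) (h : H) : (ellSingle n h : ℕ → H) n = h :=
  lp.single_apply_self (E := fun _ : ℕ => H) 2 n h

theorem ellSingle_ne {n m : ℕ} (hm : m ≠ n) (h : H) : (ellSingle n h : ℕ → H) m = 0 :=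
  lp.single_apply_ne (E := fun _ : ℕ => H) 2 n h hm

theorem continuous_ellSingle (n : ℕ) : Continuous (ellSingle (H := H) n) :=
  (lp.isometry_single (E := fun _ : ℕ => H) (p := 2) n).continuous

theorem tendsto_sum_ellSingle (v : Ell2 H) :
    Filter.Tendsto (fun M => ∑ n ∈ Finset.range M, ellSingle n (v n))
      atTop (nhds v) :=
  (lp.hasSum_single (by norm_num) v).tendsto_sum_nat

theorem continuous_lp_eval (n : ℕ) : Continuous fun v : Ell2 H => v n := by
  refine (LipschitzWith.of_dist_le_mul (K := 1) fun v w => ?_).continuous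
  rw [dist_eq_norm, dist_eq_norm, NNReal.coe_one, one_mul]
  exact lp.norm_apply_le_norm (by norm_num) (v - w) n

theorem aestronglyMeasurable_lp {Y : Type*} [MeasurableSpace Y] {μ : Measure Y}
    {w : Y → Ell2 H} (h : ∀ n, AEStronglyMeasurable (fun y => w y n) μ) :
    AEStronglyMeasurable w μ :=
  aestronglyMeasurable_of_tendsto_ae atTop
    (fun _ => Finset.aestronglyMeasurable_fun_sum _ fun n _ =>
      (continuous_ellSingle n).comp_aestronglyMeasurable (h n))
    (Eventually.of_forall fun y => tendsto_sum_ellSingle (w y))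

theorem stronglyMeasurable_lp {Y : Type*} [MeasurableSpace Y]
    {w : Y → Ell2 H} (h : ∀ n, StronglyMeasurable fun y => w y n) :
    StronglyMeasurable w :=
  stronglyMeasurable_of_tendsto atTop
    (fun _ => stronglyMeasurable_fun_sum _ fun n _ =>
      (continuous_ellSingle n).comp_stronglyMeasurable (h n))
    (tendsto_pi_nhds.mpr fun y => tendsto_sum_ellSingle (w y))

end Coordinates

namespace Noise

variable {X : Type*} [MeasurableSpace X] [StandardBorelSpace X] [DecidableEq X] {N : Noise X}
variable {H : Type*} [NormedAddCommGroup H] [InnerProductSpace ℂ H] [CompleteSpace H]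

/-- The first function of the sequence `interp` that agrees with `f` on `A`. -/
noncomputable def index (f : X → ℕ) (A : Finset X) : ℕ :=
  letI : DecidablePred fun n => ∀ x ∈ A, interp n x = f x := Classical.decPred _
  Nat.find (exists_interp_eq A f)

theorem interp_index (f : X → ℕ) (A : Finset X) : ∀ x ∈ A, interp (index f A) x = f x := by
  let _ : DecidablePred fun n => ∀ x ∈ A, interp n x = f x := Classical.decPred _
  exact Nat.find_spec (exists_interp_eq A f)

theorem index_congr {f g : X → ℕ} {A : Finset X} (h : ∀ x ∈ A, f x = g x) :
    index f A = index g A := by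
  have : (fun n => ∀ x ∈ A, interp n x = f x) = fun n => ∀ x ∈ A, interp n x = g x :=
    funext fun n => propext (forall₂_congr fun x hx => by rw [h x hx])
  unfold index
  congr 1

theorem measurable_index {f : X → ℕ} (hf : Measurable f) : Measurable (index f) := by
  let _ : ∀ A : Finset X, DecidablePred fun n => ∀ x ∈ A, interp n x = f x :=
    fun _ => Classical.decPred _
  exact measurable_find (fun A => exists_interp_eq A f)
    fun n => measurableSet_agree (measurable_interp n) hf

/-- The number of a label. -/
noncomputable def code (A : Finset X) (l : N.Lab A) : ℕ :=
  index (fun x => if h : x ∈ A then (l ⟨x, h⟩ : ℕ) else 0) A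

theorem interp_code {A : Finset X} (l : N.Lab A) (x : A) : interp (code A l) (x : X) = l x := by
  have := interp_index (fun x => if h : x ∈ A then (l ⟨x, h⟩ : ℕ) else 0) A x x.2
  rw [dif_pos x.2] at this
  exact this

theorem code_injective (A : Finset X) : Function.Injective (code (N := N) A) := fun l l' h => by
  funext x
  exact Subtype.ext (by rw [← interp_code l x, ← interp_code l' x, h])

theorem code_eq_index {A : Finset X} {f : X → ℕ} {l : N.Lab A} (h : ∀ x : A, (l x : ℕ) = f x) :
    code A l = index f A := index_congr fun x hx => by rw [dif_pos hx]; exact h ⟨x, hx⟩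

/-- The components of the embedding. -/
noncomputable def ellSingleₗᵢ (n : ℕ) : H →ₗᵢ[ℂ] Ell2 H where
  toFun := ellSingle n
  map_add' := lp.single_add (E := fun _ : ℕ => H) 2 n
  map_smul' := lp.single_smul (E := fun _ : ℕ => H) 2 n
  norm_map' := lp.norm_single (E := fun _ : ℕ => H) (p := 2) (by norm_num) n

theorem inner_ellSingle (n : ℕ) (h : H) (v : Ell2 H) : inner ℂ (ellSingle n h) v = inner ℂ h (v n) :=
  lp.inner_single_left (G := fun _ : ℕ => H) n h v

theorem orthogonalFamily_ellSingle (A : Finset X) :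
    OrthogonalFamily ℂ (fun _ : N.Lab A => H) fun l => ellSingleₗᵢ (code A l) := by
  intro l l' h v w
  have e := inner_ellSingle (code A l) v (ellSingle (code A l') w)
  rw [ellSingle_ne (fun h' => h (code_injective A h')), inner_zero_right] at e
  exact e

/-- The embedding of `H ⊗ E^⊗(A)` into a fixed Hilbert space. -/
noncomputable def emb (A : Finset X) : N.Ten H A →ₗᵢ[ℂ] Ell2 H :=
  (orthogonalFamily_ellSingle A).linearIsometry

theorem hasSum_emb (A : Finset X) (v : N.Ten H A) (n : ℕ) :
    HasSum (fun l => (ellSingle (code A l) (v l) : ℕ → H) n) (emb A v n) :=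
  ((orthogonalFamily_ellSingle A).hasSum_linearIsometry v).map
    (AddMonoidHom.mk' (fun v : Ell2 H => v n) fun _ _ => rfl) (continuous_lp_eval n)

theorem emb_code (A : Finset X) (v : N.Ten H A) (l : N.Lab A) : emb A v (code A l) = v l := by
  have h := hasSum_single (f := fun l' : N.Lab A =>
    (ellSingle (code A l') (v l') : ℕ → H) (code A l)) l fun l' h =>
    ellSingle_ne (fun h' => h (code_injective A h'.symm)) _
  rw [ellSingle_self] at h
  exact (hasSum_emb A v _).unique h

theorem emb_of_notMem (A : Finset X) (v : N.Ten H A) {n : ℕ} (h : ∀ l : N.Lab A, code A l ≠ n) :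
    emb A v n = 0 := by
  refine (hasSum_emb A v _).unique ?_
  convert hasSum_zero with l
  exact ellSingle_ne (h l).symm _

theorem coord_eq (f : X → ℕ) (A : Finset X) (v : N.Ten H A) :
    coord f A v = emb A v (index f A) := by
  unfold coord
  split_ifs with h
  · have e := emb_code A v (fun x => ⟨f x, h x⟩ : N.Lab A)
    have e' : code A (fun x => ⟨f x, h x⟩ : N.Lab A) = index f A := code_eq_index fun _ => rfl
    exact (e' ▸ e).symm
  · refine (emb_of_notMem A v fun l hl => h fun x => ?_).symm
    rw [← interp_index f A x x.2, ← hl, interp_code]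
    exact (l x).2

theorem emb_apply (A : Finset X) (v : N.Ten H A) (n : ℕ) [Decidable (index (interp n) A = n)] :
    emb A v n = if index (interp n) A = n then coord (interp n) A v else 0 := by
  split_ifs with h
  · rw [coord_eq, h]
  · refine emb_of_notMem A v fun l hl => h ?_
    rw [← hl]
    exact (code_eq_index fun x => (interp_code l x).symm).symm

/-- The adjoint of the embedding. -/
noncomputable def embAdj (A : Finset X) : Ell2 H →L[ℂ] N.Ten H A :=
  adjoint (emb A).toContinuousLinearMap

theorem basisVec_eq (f : X → ℕ) (A : Finset X) (h : H) :
    basisVec (N := N) f A h = embAdj A (ellSingle (index f A) h) := by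
  classical
  refine ext_inner_right ℂ fun v => ?_
  rw [embAdj, adjoint_inner_left]
  show _ = inner ℂ (ellSingle (index f A) h) (emb A v)
  rw [inner_ellSingle, ← coord_eq]
  unfold coord basisVec
  split_ifs with hf
  · exact lp.inner_single_left (G := fun _ : N.Lab A => H) _ h v
  · rw [inner_zero_left, inner_zero_right]

theorem embAdj_single (A : Finset X) (n : ℕ) (h : H) [Decidable (index (interp n) A = n)] :
    embAdj (N := N) A (ellSingle n h) =
      if index (interp n) A = n then basisVec (interp n) A h else 0 := by
  classical
  refine ext_inner_right ℂ fun v => ?_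
  rw [embAdj, adjoint_inner_left]
  show inner ℂ (ellSingle n h) (emb A v) = _
  rw [inner_ellSingle, emb_apply]
  split_ifs with hn
  · rw [basisVec_eq, embAdj, adjoint_inner_left]
    show _ = inner ℂ (ellSingle _ h) (emb A v)
    rw [inner_ellSingle, ← coord_eq]
  · rw [inner_zero_left, inner_zero_right]

theorem embAdj_emb (A : Finset X) (v : N.Ten H A) : embAdj A (emb A v) = v := by
  refine ext_inner_right ℂ fun w => ?_
  rw [embAdj, adjoint_inner_left]
  exact (emb A).inner_map_map v w

/-- The action of an operator in the fixed Hilbert space. -/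
noncomputable def hatO {A B : Finset X} : (N.Ten H A →L[ℂ] N.Ten H B) →ₗ[ℂ]
    (Ell2 H →L[ℂ] Ell2 H) where
  toFun T := (emb B).toContinuousLinearMap.comp (T.comp (embAdj A))
  map_add' S T := by ext1 v; exact map_add (emb B) _ _
  map_smul' z T := by ext1 v; exact map_smul (emb B) _ _

theorem hatO_apply {A B : Finset X} (T : N.Ten H A →L[ℂ] N.Ten H B) (v : Ell2 H) :
    hatO T v = emb B (T (embAdj A v)) := rfl

theorem hatO_emb {A B : Finset X} (T : N.Ten H A →L[ℂ] N.Ten H B) (v : N.Ten H A) :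
    hatO T (emb A v) = emb B (T v) := by rw [hatO_apply, embAdj_emb]

theorem norm_hatO {A B : Finset X} (T : N.Ten H A →L[ℂ] N.Ten H B) : ‖hatO T‖ = ‖T‖ := by
  refine le_antisymm (opNorm_le_bound _ (norm_nonneg T) fun v => ?_)
    (opNorm_le_bound _ (norm_nonneg _) fun v => ?_)
  · rw [hatO_apply, (emb B).norm_map]
    refine (T.le_opNorm _).trans (mul_le_mul_of_nonneg_left ?_ (norm_nonneg T))
    refine ((embAdj A).le_opNorm v).trans (mul_le_of_le_one_left (norm_nonneg v) ?_)
    rw [embAdj, LinearIsometryEquiv.norm_map]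
    exact opNorm_le_bound _ zero_le_one fun w => by
      rw [one_mul]; exact ((emb A).norm_map w).le
  · rw [← (emb B).norm_map, ← hatO_emb, ← (emb A).norm_map v]
    exact (hatO T).le_opNorm _

theorem enorm_hatO {A B : Finset X} (T : N.Ten H A →L[ℂ] N.Ten H B) : ‖hatO T‖ₑ = ‖T‖ₑ := by
  simp only [← ofReal_norm, norm_hatO]

theorem hatO_inj {A B : Finset X} {S T : N.Ten H A →L[ℂ] N.Ten H B} :
    hatO S = hatO T ↔ S = T := by
  refine ⟨fun h => ?_, congrArg _⟩
  refine sub_eq_zero.mp (norm_eq_zero.mp ?_)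
  rw [← norm_hatO, map_sub, h, sub_self, norm_zero]

theorem hatO_comp {A B C : Finset X} (S : N.Ten H B →L[ℂ] N.Ten H C)
    (T : N.Ten H A →L[ℂ] N.Ten H B) : hatO (S.comp T) = (hatO S).comp (hatO T) := by
  ext1 v
  rw [ContinuousLinearMap.comp_apply, hatO_apply T, hatO_emb]; rfl

theorem hatO_adjoint {A B : Finset X} (T : N.Ten H A →L[ℂ] N.Ten H B) :
    hatO (adjoint T) = adjoint (hatO T) := by
  show _ = adjoint ((emb B).toContinuousLinearMap.comp (T.comp (embAdj A)))
  rw [adjoint_comp, adjoint_comp, embAdj,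
    adjoint_adjoint]
  rfl

theorem emb_tenCast {A B : Finset X} (h : A = B) (v : N.Ten H A) :
    emb B (tenCast A B v) = emb A v := by
  subst h; simp [tenCast]

theorem tenCast_comp {A B C : Finset X} (h : B = C) (T : N.Ten H A →L[ℂ] N.Ten H B) :
    hatO ((tenCast B C).comp T) = hatO T := by
  subst h; ext1 v; simp [tenCast, hatO_apply]

theorem hatO_opCast {A B A' B' : Finset X} (hA : A = A') (hB : B = B')
    (T : N.Ten H A →L[ℂ] N.Ten H B) : hatO (opCast A' B' T) = hatO T := by
  subst hA hB; ext1 v; simp [opCast, tenCast, hatO_apply]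

theorem opMeas_hatO_iff {Y : Type*} [MeasurableSpace Y] {D R : Y → Finset X} (hD : Measurable D)
    (hR : Measurable R) (T : ∀ y, N.Ten H (D y) →L[ℂ] N.Ten H (R y)) :
    (OpMeas fun y => hatO (T y)) ↔ ∀ f g : X → ℕ, Measurable f → Measurable g → ∀ h : H,
      StronglyMeasurable (fun y => coord g (R y) (T y (basisVec f (D y) h))) ∧
      StronglyMeasurable (fun y => coord f (D y)
        (adjoint (T y) (basisVec g (R y) h))) := by
  classical
  have key : ∀ {D R : Y → Finset X} (hD : Measurable D) (hR : Measurable R)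
      (T : ∀ y, N.Ten H (D y) →L[ℂ] N.Ten H (R y)),
      (∀ v, StronglyMeasurable fun y => hatO (T y) v) ↔
        ∀ f g : X → ℕ, Measurable f → Measurable g → ∀ h : H,
          StronglyMeasurable fun y => coord g (R y) (T y (basisVec f (D y) h)) := by
    intro D R hD hR T
    constructor
    · intro hT f g hf hg h
      simp only [coord_eq, basisVec_eq]
      exact StronglyMeasurable.eval_nat (fun n => (continuous_lp_eval n).comp_stronglyMeasurable
        (StronglyMeasurable.eval_nat (F := fun m y => hatO (T y) (ellSingle m h)) (fun m => hT _)
          ((measurable_index hf).comp hD))) ((measurable_index hg).comp hR)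
    · intro hT v
      have hs : ∀ m n (h : H), StronglyMeasurable fun y => hatO (T y) (ellSingle m h) n := by
        intro m n h
        have e : (fun y => hatO (T y) (ellSingle m h) n) =
            {y | index (interp m) (D y) = m ∧ index (interp n) (R y) = n}.indicator fun y =>
              coord (interp n) (R y) (T y (basisVec (interp m) (D y) h)) := by
          funext y
          rw [hatO_apply, emb_apply, embAdj_single]
          by_cases h1 : index (interp m) (D y) = m <;> by_cases h2 : index (interp n) (R y) = n <;>
            simp [h1, h2, coord_eq]
        rw [e]
        refine (hT _ _ (measurable_interp m) (measurable_interp n) h).indicator ?_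
        exact (((measurable_index (measurable_interp m)).comp hD) (measurableSet_singleton m)).inter
          (((measurable_index (measurable_interp n)).comp hR) (measurableSet_singleton n))
      refine stronglyMeasurable_of_tendsto atTop (f := fun M y =>
        hatO (T y) (∑ n ∈ Finset.range M, ellSingle n (v n))) (fun M => ?_)
        (tendsto_pi_nhds.mpr fun y =>
          ((hatO (T y)).continuous.tendsto v).comp (tendsto_sum_ellSingle v))
      simp only [map_sum]
      exact stronglyMeasurable_fun_sum _ fun m _ => stronglyMeasurable_lp fun n => hs m n _
  constructor
  · intro h f g hf hg e
    exact ⟨(key hD hR T).mp h.app f g hf hg e,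
      (key hR hD fun y => adjoint (T y)).mp
        (by simpa only [hatO_adjoint] using h.adj) g f hg hf e⟩
  · intro h
    refine ⟨(key hD hR T).mpr fun f g hf hg e => (h f g hf hg e).1, ?_⟩
    have := (key hR hD fun y => adjoint (T y)).mpr
      fun f g hf hg e => (h g f hg hf e).2
    simpa only [hatO_adjoint] using this

/-- The action of an operator-valued function in the fixed Hilbert space. -/
noncomputable def hatF {A B : Finset X} (T : N.OpFn H A B) (ϰ : Table X) :
    Ell2 H →L[ℂ] Ell2 H := hatO (T ϰ)

/-- A section as a function with values in the fixed Hilbert space. -/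
noncomputable def hatV {A : Finset X} (a : N.Vec H A) (ϰ : Finset X) : Ell2 H :=
  emb (A ∪ ϰ) (a ϰ)

/-- The action of the values of a family in the fixed Hilbert space. -/
noncomputable def hatL (L : N.OpFamily H) (θ κ : Table X) :
    Ell2 H →L[ℂ] Ell2 H := hatO (L θ κ)

variable {A B C : Finset X}

theorem measOp_iff {T : N.OpFn H A B} : MeasOp T ↔ OpMeas (hatF T) :=
  (opMeas_hatO_iff (measurable_const.chain_union Table.measurable_dom)
    (measurable_const.chain_union Table.measurable_cod) T).symm

theorem measFamily_iff {L : N.OpFamily H} :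
    MeasFamily L ↔ OpMeas₂ (hatL L) :=
  (opMeas_hatO_iff ((Table.measurable_dom.comp measurable_fst).chain_union
      (Table.measurable_dom.comp measurable_snd))
    ((Table.measurable_cod.comp measurable_fst).chain_union
      (Table.measurable_cod.comp measurable_snd)) fun q : Table X × Table X => L q.1 q.2).symm

theorem measVec_iff {a : N.Vec H A} :
    MeasVec a ↔ AEStronglyMeasurable (hatV a) ν[N] := by
  classical
  have hu : Measurable fun ϰ : Finset X => A ∪ ϰ := measurable_const.chain_union measurable_id
  constructor
  · intro h
    refine aestronglyMeasurable_lp fun n => ?_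
    have e : (fun ϰ => hatV a ϰ n) = {ϰ | index (interp n) (A ∪ ϰ) = n}.indicator
        fun ϰ => coord (interp n) (A ∪ ϰ) (a ϰ) := by
      funext ϰ
      rw [hatV, emb_apply, Set.indicator_apply]; rfl
    rw [e]
    exact (h _ (measurable_interp n)).indicator
      (((measurable_index (measurable_interp n)).comp hu) (measurableSet_singleton n))
  · intro h f hf
    simp only [coord_eq]
    refine ⟨fun ϰ => h.mk _ ϰ (index f (A ∪ ϰ)), StronglyMeasurable.eval_nat
      (F := fun n ϰ => h.mk _ ϰ n) (fun n =>
      (continuous_lp_eval n).comp_stronglyMeasurable h.stronglyMeasurable_mk)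
      ((measurable_index hf).comp hu), h.ae_eq_mk.mono fun ϰ hϰ => ?_⟩
    show hatV a ϰ _ = _
    rw [hϰ]

theorem nsq_hatV (ξ : ℝ≥0) (a : N.Vec H A) : N.nsq ξ (hatV a) = sqNorm ξ a := by
  simp only [nsq, sqNorm, hatV, LinearIsometry.enorm_map]

theorem memG_iff {ξ : ℝ≥0} {a : N.Vec H A} : MemG ξ a ↔ N.InG ξ (hatV a) := by
  rw [MemG, InG, measVec_iff, nsq_hatV]

theorem aeq_iff {a b : N.Vec H A} : AEq a b ↔ hatV a =ᵐ[ν[N]] hatV b :=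
  eventually_congr (Eventually.of_forall fun _ => (emb _).injective.eq_iff.symm)

theorem opAEq_iff {S T : N.OpFn H A B} :
    OpAEq S T ↔ ∀ᵐ ϰ ∂τ[N], hatF S ϰ = hatF T ϰ :=
  eventually_congr (Eventually.of_forall fun _ => hatO_inj.symm)

theorem pairing_eq (c a : N.Vec H A) :
    pairing c a = ∫ ϰ, inner ℂ (hatV c ϰ) (hatV a ϰ) ∂ν[N] := by
  simp only [pairing, hatV, LinearIsometry.inner_map_map]

theorem hatV_add (a b : N.Vec H A) : hatV (a + b) = hatV a + hatV b :=
  funext fun ϰ => map_add (emb _) (a ϰ) (b ϰ)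

theorem hatV_sub (a b : N.Vec H A) : hatV (a - b) = hatV a - hatV b :=
  funext fun ϰ => map_sub (emb _) (a ϰ) (b ϰ)

theorem hatV_smul (z : ℂ) (a : N.Vec H A) : hatV (z • a) = z • hatV a :=
  funext fun ϰ => map_smul (emb _) z (a ϰ)

theorem hatF_add (S T : N.OpFn H A B) : hatF (S + T) = fun ϰ => hatF S ϰ + hatF T ϰ :=
  funext fun ϰ => map_add hatO (S ϰ) (T ϰ)

theorem hatF_smul (z : ℂ) (T : N.OpFn H A B) : hatF (z • T) = fun ϰ => z • hatF T ϰ :=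
  funext fun ϰ => map_smul hatO z (T ϰ)

theorem hatF_star (T : N.OpFn H A B) : hatF (star T) = nstar (hatF T) :=
  funext fun ϰ => hatO_adjoint (T ϰ.conj)

theorem integrable_emb {α : Type*} [MeasurableSpace α] {μ : Measure α} (A : Finset X)
    {f : α → N.Ten H A} : Integrable (fun x => emb A (f x)) μ ↔ Integrable f μ :=
  (emb A).lipschitz.integrable_comp_iff_of_antilipschitz (emb A).antilipschitz (map_zero (emb A))

theorem emb_integral {α : Type*} [MeasurableSpace α] {μ : Measure α} (A : Finset X)
    (f : α → N.Ten H A) : emb A (∫ x, f x ∂μ) = ∫ x, emb A (f x) ∂μ :=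
  ((emb A).integral_comp_comm f).symm

theorem emb_fockIntegrand (T : N.OpFn H A B) (a : N.Vec H A) {ϰ σ : Finset X} (hσ : σ ⊆ ϰ)
    (p : C²[X]) : emb (B ∪ ϰ) (fockIntegrand T a ϰ σ p) =
      hatF T ⟨p.1, p.2, σ, ϰ \ σ⟩ (hatV a (σ ∪ p.1)) := by
  unfold fockIntegrand
  rw [emb_tenCast]
  · exact (hatO_emb _ _).symm
  · rw [Table.cod, union_sdiff_of_subset hσ]

theorem hatV_fock (T : N.OpFn H A B) (a : N.Vec H A) :
    hatV (fock T a) = N.nfock (hatF T) (hatV a) := by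
  funext ϰ
  show emb _ (∑ σ ∈ ϰ.powerset, _) = ∑ σ ∈ ϰ.powerset, _
  rw [map_sum]
  refine sum_congr rfl fun σ hσ => ?_
  rw [emb_integral]
  exact integral_congr_ae (Eventually.of_forall fun p =>
    emb_fockIntegrand T a (mem_powerset.mp hσ) p)

theorem fockConverges_iff {T : N.OpFn H A B} {a : N.Vec H A} :
    FockConverges T a ↔ ∀ᵐ ϰ ∂ν[N], N.NConv (hatF T) (hatV a) ϰ := by
  refine eventually_congr (Eventually.of_forall fun ϰ => forall_congr' fun σ => ?_)
  rw [mem_powerset]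
  refine imp_congr_right fun hσ => ?_
  rw [← integrable_emb]
  simp only [emb_fockIntegrand T a hσ]

/-- The sum over the pairs of sets with a given union, by the intersection and the complement of the
second set. -/
theorem sum_union_pairs {M : Type*} [AddCommMonoid M] (A : Finset X)
    (f : Finset X → Finset X → Finset X → M) :
    ∑ p ∈ (A.powerset ×ˢ A.powerset).filter (fun p => p.1 ∪ p.2 = A),
      f (p.1 ∩ p.2) (A \ p.1) (A \ p.2) =
    ∑ β ∈ A.powerset, ∑ α ∈ (A \ β).powerset, f β ((A \ β) \ α) α := by
  rw [sum_sigma']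
  refine sum_bij' (fun p _ => ⟨p.1 ∩ p.2, A \ p.2⟩) (fun q _ => (q.1 ∪ q.2, A \ q.2))
    ?_ ?_ ?_ ?_ ?_
  · rintro ⟨σ, ρ⟩ h
    simp only [mem_filter, mem_product, mem_powerset, mem_sigma] at h ⊢
    grind
  · rintro ⟨β, α⟩ h
    simp only [mem_filter, mem_product, mem_powerset, mem_sigma] at h ⊢
    grind
  · rintro ⟨σ, ρ⟩ h
    simp only [mem_filter, mem_product, mem_powerset] at h
    ext x <;> grind
  · rintro ⟨β, α⟩ h
    simp only [mem_powerset, mem_sigma] at h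
    have e1 : (β ∪ α) ∩ (A \ α) = β := by ext x; grind
    have e2 : A \ (A \ α) = α := by ext x; grind
    simp only [e1, e2]
  · rintro ⟨σ, ρ⟩ h
    simp only [mem_filter, mem_product, mem_powerset] at h
    have e : (A \ (σ ∩ ρ)) \ (A \ ρ) = A \ σ := by ext x; grind
    simp only [e]

theorem hatF_mul (S : N.OpFn H B C) (T : N.OpFn H A B) :
    hatF (mul S T) = nmul (hatF S) (hatF T) := by
  funext ϰ
  unfold hatF mul nmul
  simp only [map_sum]
  refine sum_congr rfl fun θ hθ => sum_congr rfl fun η hη => ?_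
  rw [← sum_union_pairs ϰ.mp fun β γ α => (hatO (S ⟨θ ∪ β, γ, ϰ.oo ∪ η, ϰ.op \ η⟩)).comp
    (hatO (T ⟨ϰ.m0 \ θ, α, ϰ.oo ∪ θ, β ∪ η⟩))]
  refine sum_congr rfl fun p _ => ?_
  rw [mem_powerset] at hθ hη
  rw [tenCast_comp, hatO_comp, hatO_opCast]
  all_goals ext x; simp only [Table.dom, Table.cod]; grind

theorem mem_cut {I : Set ℝ≥0} {A : Finset X} {x : X} :
    x ∈ N.cut I A ↔ x ∈ A ∧ N.time x ∈ I := by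
  simp only [cut, mem_filter]

theorem cut_subset (I : Set ℝ≥0) (A : Finset X) : N.cut I A ⊆ A := fun _ h => (mem_cut.mp h).1

theorem hatF_multSum (I : Set ℝ≥0) (L : N.OpFamily H) :
    hatF (multSum I L) = N.nstep (hatL L) I := by
  funext ϰ
  unfold hatF multSum nstep nsum
  rw [Table.sum_splits (f := fun q => N.ncut I (hatL L) q.1 q.2)]
  simp only [map_sum]
  have hsub : ∀ A : Finset X, (N.cut I A).powerset ⊆ A.powerset := fun A =>
    powerset_mono.mpr (cut_subset _ _)
  have hcut : ∀ {A α : Finset X}, α ∈ A.powerset → α ∉ (N.cut I A).powerset →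
      ∃ x ∈ α, N.time x ∉ I := by
    intro A α h h'
    by_contra! hc
    refine h' (mem_powerset.mpr fun x hx => ?_)
    exact mem_cut.mpr ⟨mem_powerset.mp h hx, hc x hx⟩
  have hneg : ∀ {θ : Table X} (κ : Table X), (∃ x ∈ θ.pts, N.time x ∉ I) →
      N.ncut I (hatL L) θ κ = 0 := by
    rintro θ κ ⟨x, hx, hI⟩
    rw [ncut_of_neg fun h => hI (h x hx)]; rfl
  rw [← sum_subset (hsub ϰ.m0) fun m0 h h' => ?_]
  · refine sum_congr rfl fun m0 h0 => ?_
    rw [← sum_subset (hsub ϰ.mp) fun mp h h' => ?_]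
    · refine sum_congr rfl fun mp h1 => ?_
      rw [← sum_subset (hsub ϰ.oo) fun oo h h' => ?_]
      · refine sum_congr rfl fun oo h2 => ?_
        rw [← sum_subset (hsub ϰ.op) fun op h h' => ?_]
        · refine sum_congr rfl fun op h3 => ?_
          rw [mem_powerset] at h0 h1 h2 h3
          rw [ncut_of_pos]
          · have e := fun {A α : Finset X} (h : α ⊆ N.cut I A) =>
              union_sdiff_of_subset (h.trans (cut_subset _ _))
            rw [hatO_opCast]
            · rfl
            · simp only [Table.dom, Table.diff, empty_union]
              rw [union_union_union_comm, e h2, e h0]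
            · simp only [Table.cod, Table.diff, empty_union]
              rw [union_union_union_comm, e h2, e h3]
          · intro x hx
            simp only [Table.pts, mem_union] at hx
            rcases hx with ((hx | hx) | hx) | hx
            exacts [(mem_cut.mp (h0 hx)).2, (mem_cut.mp (h1 hx)).2,
              (mem_cut.mp (h2 hx)).2, (mem_cut.mp (h3 hx)).2]
        · obtain ⟨x, hx, hI⟩ := hcut h h'
          exact hneg _ ⟨x, by simp [Table.pts, hx], hI⟩
      · obtain ⟨x, hx, hI⟩ := hcut h h'
        exact sum_eq_zero fun _ _ => hneg _ ⟨x, by simp [Table.pts, hx], hI⟩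
    · obtain ⟨x, hx, hI⟩ := hcut h h'
      exact sum_eq_zero fun _ _ => sum_eq_zero fun _ _ =>
        hneg _ ⟨x, by simp [Table.pts, hx], hI⟩
  · obtain ⟨x, hx, hI⟩ := hcut h h'
    exact sum_eq_zero fun _ _ => sum_eq_zero fun _ _ => sum_eq_zero
      fun _ _ => hneg _ ⟨x, by simp [Table.pts, hx], hI⟩

theorem dom_elem_union {x : X} {μ ν : Ind} (hμ : μ ≠ .plus) (hν : ν ≠ .minus) (ϰ : Table X) :
    ((Table.elem x μ ν).union ϰ).dom = ν.pts x ∪ ϰ.dom ∧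
      ((Table.elem x μ ν).union ϰ).cod = μ.pts x ∪ ϰ.cod := by
  cases μ <;> cases ν <;> first | exact absurd rfl hμ | exact absurd rfl hν |
    (constructor <;> ext y <;>
      simp only [Table.dom, Table.cod, Table.union, Table.elem, Ind.pts] <;> grind)

theorem hatF_dotOp (T : N.OpFn H ∅ ∅) {x : X} {μ ν : Ind} (hμ : μ ≠ .plus) (hν : ν ≠ .minus) :
    hatF (dotOp T x μ ν) = ndot (hatF T) x μ ν := by
  funext ϰ
  obtain ⟨h1, h2⟩ := dom_elem_union (x := x) hμ hν ϰ
  exact hatO_opCast (by rw [h1, empty_union]) (by rw [h2, empty_union]) _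

theorem hatF_triMatrix (T T' : N.OpFn H ∅ ∅) (x : X) (μ ν : Ind) :
    hatF (triMatrix T T' x μ ν) = ntri (hatF T) (hatF T') x μ ν :=
  match μ, ν with
  | .minus, .minus | .plus, .plus => rfl
  | .zero, .minus | .plus, .minus | .plus, .zero => funext fun _ => map_zero hatO
  | .minus, .zero | .minus, .plus | .zero, .zero | .zero, .plus => hatF_dotOp T nofun nofun

variable (N H) in
/-- The projection onto the image of `H ⊗ E^⊗(A)`. -/
noncomputable def proj (A : Finset X) : Ell2 H →L[ℂ] Ell2 H :=
  hatO (ContinuousLinearMap.id ℂ (N.Ten H A))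

theorem hatF_one : hatF (one : N.OpFn H A A) = none fun oo => proj N H (A ∪ oo) := by
  funext ϰ
  unfold hatF one none
  split_ifs with h
  · have e : A ∪ ϰ.oo = A ∪ ϰ.dom := by simp [Table.dom, h.1]
    have e' : A ∪ ϰ.dom = A ∪ ϰ.cod := by simp [Table.dom, Table.cod, h]
    have := tenCast_comp e' (ContinuousLinearMap.id ℂ (N.Ten H (A ∪ ϰ.dom)))
    rw [ContinuousLinearMap.comp_id] at this
    rw [this]
    show proj N H _ = proj N H _
    rw [e]
  · exact map_zero hatO

theorem proj_comp (T : N.Ten H A →L[ℂ] N.Ten H B) : (proj N H B).comp (hatO T) = hatO T := by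
  rw [proj, ← hatO_comp, ContinuousLinearMap.id_comp]

theorem comp_proj (T : N.Ten H A →L[ℂ] N.Ten H B) : (hatO T).comp (proj N H A) = hatO T := by
  rw [proj, ← hatO_comp, ContinuousLinearMap.comp_id]

theorem hatV_pointDeriv (a : N.Vec H A) {θ D : Finset X} (h : A ∪ θ = D) :
    hatV (pointDeriv a θ D) = fun κ => hatV a (θ ∪ κ) := by
  funext κ
  unfold hatV pointDeriv
  exact emb_tenCast (by rw [← h, union_assoc]) _

theorem emb_multIntegrand (L : N.OpFamily H) {σ : Table X} (hA : A = σ.dom) (hB : B = σ.cod)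
    (a : N.Vec H A) {ϰ oo op : Finset X} (hoo : oo ⊆ ϰ) (hop : op ⊆ ϰ \ oo)
    (p : C²[X]) :
    emb (B ∪ ϰ) (multIntegrand (fun θ => fock (L θ)) σ a ϰ oo op p) =
      N.nfock (hatL L (σ.union ⟨p.1, p.2, oo, op⟩)) (fun A => hatV a ((oo ∪ p.1) ∪ A))
        ((ϰ \ oo) \ op) := by
  subst hA hB
  unfold multIntegrand
  rw [emb_tenCast]
  · have := congrFun (hatV_fock (L (σ.union ⟨p.1, p.2, oo, op⟩)) (pointDeriv a (oo ∪ p.1) _))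
      ((ϰ \ oo) \ op)
    rw [hatV_pointDeriv] at this
    · exact this
    · ext x; simp only [Table.dom, Table.union]; grind
  · ext x; simp only [Table.cod, Table.union]; grind

theorem measurableSet_chainsBefore (t : ℝ≥0) : MeasurableSet (N.chainsBefore t) := by
  have := measurableSet_avoid (X := X) (measurableSet_before (N := N) t).compl
  convert this using 1
  ext A
  show (∀ x ∈ A, N.time x < t) ↔ ∀ x ∈ A, ¬ ¬ (N.time x < t)
  simp

theorem nfock_ncut (L : Table X → Table X → Ell2 H →L[ℂ] Ell2 H) (t : ℝ≥0) (a : Finset X → Ell2 H)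
    {ϰ oo op : Finset X} (hoo : oo ⊆ N.cut (Iio t) ϰ) (hop : op ⊆ N.cut (Iio t) ϰ) :
    (fun p : C²[X] => N.nfock (N.ncut (Iio t) L ⟨p.1, p.2, oo, op⟩)
        (fun A => a ((oo ∪ p.1) ∪ A)) ((ϰ \ oo) \ op)) =
      (N.chainsBefore t ×ˢ N.chainsBefore t).indicator fun p => N.nfock (L ⟨p.1, p.2, oo, op⟩)
        (fun A => a ((oo ∪ p.1) ∪ A)) ((ϰ \ oo) \ op) := by
  funext p
  by_cases h : p ∈ N.chainsBefore t ×ˢ N.chainsBefore t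
  · rw [indicator_of_mem h, ncut_of_pos]
    intro x hx
    simp only [Table.pts, mem_union] at hx
    rcases hx with ((hx | hx) | hx) | hx
    exacts [h.1 x hx, h.2 x hx, (mem_cut.mp (hoo hx)).2, (mem_cut.mp (hop hx)).2]
  · rw [indicator_of_notMem h, ncut_of_neg, nfock_zero_op]
    exact fun hc => h ⟨fun x hx => hc x (by simp [Table.pts, hx]),
      fun x hx => hc x (by simp [Table.pts, hx])⟩

theorem nfock_ncut_eq_zero (L : Table X → Table X → Ell2 H →L[ℂ] Ell2 H) (t : ℝ≥0)
    (a : Finset X → Ell2 H) {ϰ θ : Finset X} (hθ : θ ⊆ ϰ) (h : ¬ θ ⊆ N.cut (Iio t) ϰ)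
    {κ : Table X} (hκ : θ ⊆ κ.pts) (A : Finset X) : N.nfock (N.ncut (Iio t) L κ) a A = 0 := by
  rw [ncut_of_neg, nfock_zero_op]
  exact fun hc => h fun x hx => mem_cut.mpr ⟨hθ hx, hc x (hκ hx)⟩

theorem hatV_multInt (L : N.OpFamily H) {σ : Table X} (hA : A = σ.dom) (hB : B = σ.cod) (t : ℝ≥0)
    (a : N.Vec H A) : hatV (multInt (B := B) t (fun θ => fock (L θ)) σ a) =
      N.nmult (N.ncut (Iio t) fun θ κ => hatL L (σ.union θ) κ) (hatV a) := by
  funext ϰ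
  unfold nmult
  rw [← sum_subset (powerset_mono.mpr (cut_subset _ ϰ)) fun oo h h' => ?_]
  · show emb _ (∑ oo ∈ _, ∑ op ∈ _, _) = _
    rw [map_sum]
    refine sum_congr rfl fun oo hoo => ?_
    rw [mem_powerset] at hoo
    have hoo' := hoo.trans (cut_subset _ _)
    rw [map_sum, ← sum_subset (powerset_mono.mpr (sdiff_subset_sdiff
      (cut_subset _ ϰ) le_rfl)) fun op h h' => ?_]
    · refine sum_congr rfl fun op hop => ?_
      rw [mem_powerset] at hop
      rw [nfock_ncut _ _ _ hoo (hop.trans sdiff_subset), integral_indicator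
        ((measurableSet_chainsBefore t).prod (measurableSet_chainsBefore t)), emb_integral]
      exact integral_congr_ae (Eventually.of_forall fun p =>
        emb_multIntegrand L hA hB a hoo' (hop.trans (sdiff_subset_sdiff
          (cut_subset _ _) le_rfl)) p)
    · rw [mem_powerset] at h h'
      refine integral_eq_zero_of_ae (Eventually.of_forall fun p => ?_)
      exact nfock_ncut_eq_zero _ _ _ (h.trans sdiff_subset) (fun hc => h' fun x hx =>
        mem_sdiff.mpr ⟨hc hx, (mem_sdiff.mp (h hx)).2⟩)
        (fun x hx => by simp [Table.pts, hx]) _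
  · rw [mem_powerset] at h h'
    refine sum_eq_zero fun op _ => integral_eq_zero_of_ae
      (Eventually.of_forall fun p => ?_)
    exact nfock_ncut_eq_zero _ _ _ h h' (fun x hx => by simp [Table.pts, hx]) _

theorem multConverges_of (L : N.OpFamily H) {σ : Table X} (hA : A = σ.dom) (hB : B = σ.cod)
    {t : ℝ≥0} {a : N.Vec H A} (h : ∀ᵐ ϰ ∂ν[N], ∀ oo ⊆ ϰ, ∀ op ⊆ ϰ \ oo,
      Integrable (fun p : C²[X] => N.nfock
        (N.ncut (Iio t) (fun θ κ => hatL L (σ.union θ) κ) ⟨p.1, p.2, oo, op⟩)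
        (fun A => hatV a ((oo ∪ p.1) ∪ A)) ((ϰ \ oo) \ op)) ν²[N]) :
    MultConverges B t (fun θ => fock (L θ)) σ a := by
  filter_upwards [h] with ϰ hϰ oo hoo op hop
  rw [mem_powerset] at hoo hop
  have hoo' := hoo.trans (cut_subset _ _)
  have hop' := hop.trans (sdiff_subset_sdiff (cut_subset _ ϰ) le_rfl)
  have := hϰ oo hoo' op hop'
  rw [nfock_ncut _ _ _ hoo (hop.trans sdiff_subset), integrable_indicator_iff
    ((measurableSet_chainsBefore t).prod (measurableSet_chainsBefore t))] at this
  refine (integrable_emb (B ∪ ϰ)).mp ?_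
  simp only [emb_multIntegrand L hA hB a hoo' hop']
  exact this

/-- The matrix of operators acts as the given matrix in the fixed Hilbert space. -/
def Represents {x : X} (P : N.OpMatrix H x)
    (P' : Ind → Ind → (Finset X → Ell2 H) → Finset X → Ell2 H) : Prop :=
  ∀ μ ν a, hatV (P μ ν a) = P' μ ν (hatV a)

namespace Represents

variable {x : X} {P Q : N.OpMatrix H x}
  {P' Q' : Ind → Ind → (Finset X → Ell2 H) → Finset X → Ell2 H}

theorem add (hP : Represents P P') (hQ : Represents Q Q') : Represents (P + Q) (P' + Q') :=
  fun μ ν a => (hatV_add _ _).trans (by rw [hP, hQ]; rfl)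

theorem sub (hP : Represents P P') (hQ : Represents Q Q') : Represents (P - Q) (P' - Q') :=
  fun μ ν a => (hatV_sub _ _).trans (by rw [hP, hQ]; rfl)

theorem matMul (hP : Represents P P') (hQ : Represents Q Q') :
    Represents (matMul P Q) (nmatMul P' Q') := fun μ ν a => by
  unfold Noise.matMul nmatMul
  rw [hatV_add, hatV_add]
  simp only [hP μ _ _, hQ _ ν a]

theorem gConj (hP : Represents P P') : Represents (gConj P) fun μ ν => P' μ.refl ν.refl := by
  have e : ∀ μ : Ind, μ.refl.pts x = μ.pts x := fun μ => by cases μ <;> rfl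
  intro μ ν a
  have h := hP μ.refl ν.refl fun ϰ => tenCast _ _ (a ϰ)
  have h' : hatV (fun ϰ => tenCast (ν.pts x ∪ ϰ) (ν.refl.pts x ∪ ϰ) (a ϰ)) = hatV a :=
    funext fun ϰ => emb_tenCast (by rw [e]) _
  rw [h'] at h
  exact (funext fun ϰ => emb_tenCast (by rw [e]) _ : hatV (Noise.gConj P μ ν a) = _).trans h

end Represents

theorem represents_matU (L : N.OpFamily H) (x : X) :
    Represents (matU L x) (N.nU (N.nstep (hatL L)) x) := fun μ ν a => by
  unfold matU nU
  rw [hatV_fock, hatF_triMatrix, hatF_multSum]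

theorem represents_matG (L : N.OpFamily H) (x : X) :
    Represents (matG L x) (N.nG (N.nstep (hatL L)) x) := fun μ ν a => by
  unfold matG nG
  rw [hatV_fock, hatF_triMatrix, hatF_multSum, hatF_multSum]

theorem represents_matUstar (L : N.OpFamily H) (x : X) :
    Represents (matUstar L x) (N.nU (fun I => nstar (N.nstep (hatL L) I)) x) := by
  have h : Represents (matUadj L x) fun μ ν => N.nfock (nstar (ntri
      (N.nstep (hatL L) (Iio (N.time x))) (N.nstep (hatL L) (Iio (N.time x))) x ν μ)) :=
    fun μ ν a => by unfold matUadj; rw [hatV_fock, hatF_star, hatF_triMatrix, hatF_multSum]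
  have h' := h.gConj
  simp only [nstar_ntri] at h'
  exact h'

theorem represents_matGstar (L : N.OpFamily H) (x : X) :
    Represents (matGstar L x) (N.nG (fun I => nstar (N.nstep (hatL L) I)) x) := by
  have h : Represents (matGadj L x) fun μ ν => N.nfock (nstar (ntri
      (N.nstep (hatL L) (Iic (N.time x))) (N.nstep (hatL L) (Iio (N.time x))) x ν μ)) :=
    fun μ ν a => by
      unfold matGadj; rw [hatV_fock, hatF_star, hatF_triMatrix, hatF_multSum, hatF_multSum]
  have h' := h.gConj
  simp only [nstar_ntri] at h'
  exact h'

theorem elem_dom_cod {x : X} {μ ν : Ind} (hμ : μ ≠ .plus) (hν : ν ≠ .minus) :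
    ν.pts x = (Table.elem x μ ν).dom ∧ μ.pts x = (Table.elem x μ ν).cod := by
  cases μ <;> cases ν <;> first | exact absurd rfl hμ | exact absurd rfl hν |
    simp [Table.dom, Table.cod, Table.elem, Ind.pts]

theorem hatV_multInt_elem (L : N.OpFamily H) {x : X} {μ ν : Ind} (hμ : μ ≠ .plus)
    (hν : ν ≠ .minus) (a : N.Vec H (ν.pts x)) :
    hatV (multInt (B := μ.pts x) (N.time x) (fun θ => fock (L θ)) (Table.elem x μ ν) a) =
      N.nmult (N.nderivL (hatL L) μ ν x) (hatV a) :=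
  hatV_multInt L (elem_dom_cod hμ hν).1 (elem_dom_cod hμ hν).2 _ a

theorem represents_matD (L : N.OpFamily H) (x : X) :
    Represents (matD (fun θ => fock (L θ)) x) (N.nD (hatL L) x)
  | .minus, .zero, a => hatV_multInt_elem (μ := .minus) (ν := .zero) L nofun nofun a
  | .minus, .plus, a => hatV_multInt_elem (μ := .minus) (ν := .plus) L nofun nofun a
  | .zero, .zero, a => hatV_multInt_elem (μ := .zero) (ν := .zero) L nofun nofun a
  | .zero, .plus, a => hatV_multInt_elem (μ := .zero) (ν := .plus) L nofun nofun a
  | .minus, .minus, _ => funext fun _ => map_zero (emb _)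
  | .zero, .minus, _ => funext fun _ => map_zero (emb _)
  | .plus, .minus, _ => funext fun _ => map_zero (emb _)
  | .plus, .zero, _ => funext fun _ => map_zero (emb _)
  | .plus, .plus, _ => funext fun _ => map_zero (emb _)

theorem hatV_deriv (D : N.OpMatrix H x) {D' : Ind → Ind → (Finset X → Ell2 H) → Finset X → Ell2 H}
    (hD : Represents D D') (μ : Ind) (a : N.Vec H ∅) :
    hatV (D μ .zero (pointDeriv a {x} {x})) = D' μ .zero (nderiv (hatV a) .zero x) ∧
      hatV (D μ .plus a) = D' μ .plus (nderiv (hatV a) .plus x) := by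
  refine ⟨(hD μ .zero (pointDeriv a {x} {x})).trans ?_, (hD μ .plus a).trans ?_⟩
  · exact congrArg _ (hatV_pointDeriv a (empty_union _))
  · exact congrArg _ (funext fun κ => congrArg (hatV a) (empty_union κ).symm)

theorem hatV_singleInt (t : ℝ≥0) {D : ∀ x, N.OpMatrix H x}
    {D' : X → Ind → Ind → (Finset X → Ell2 H) → Finset X → Ell2 H}
    (hD : ∀ x, Represents (D x) (D' x)) (a : N.Vec H ∅) :
    hatV (singleInt t D a) = N.nsingle t fun μ ν x => D' x μ ν (nderiv (hatV a) ν x) := by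
  funext ϰ
  have hx : ∀ x ∈ N.cut (Iio t) ϰ, {x} ∪ ϰ.erase x = ∅ ∪ ϰ := fun x hx => by
    rw [empty_union, ← Finset.insert_eq,
      insert_erase (mem_cut.mp hx).1]
  have h := fun x μ => hatV_deriv (D x) (hD x) μ a
  have e1 := emb_integral (∅ ∪ ϰ) (μ := N.vol.restrict (N.before t))
    fun x => D x .minus .zero (pointDeriv a {x} {x}) ϰ
  have e2 := emb_integral (∅ ∪ ϰ) (μ := N.vol.restrict (N.before t)) fun x => D x .minus .plus a ϰ
  show emb (∅ ∪ ϰ) (_ + _ + _ + _) = _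
  rw [map_add, map_add, map_add, map_sum, map_sum]
  refine congrArg₂ _ (congrArg₂ _ (congrArg₂ _ (sum_congr rfl fun x hx' =>
    (emb_tenCast (hx x hx') _).trans (congrFun (h x .zero).1 _)) (sum_congr rfl fun x hx' =>
    (emb_tenCast (hx x hx') _).trans (congrFun (h x .zero).2 _))) (e1.trans ?_)) (e2.trans ?_)
  · exact congrArg _ (funext fun x => congrFun (h x .minus).1 ϰ)
  · exact congrArg _ (funext fun x => congrFun (h x .minus).2 ϰ)

/-- A differential in the fixed Hilbert space is a differential of the original operators. -/
theorem HasDifferential.transfer {t : ℝ≥0} {F : Set ℝ≥0 → Table X → Ell2 H →L[ℂ] Ell2 H}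
    {D : ∀ x, N.OpMatrix H x} {D' : X → Ind → Ind → (Finset X → Ell2 H) → Finset X → Ell2 H}
    {a : N.Vec H ∅} (h : HasDifferential N t F D' (hatV a)) (hD : ∀ x, Represents (D x) (D' x))
    {b b₀ : N.Vec H ∅} (hb : hatV b =ᵐ[ν[N]] N.nfock (F (Iio t)) (hatV a))
    (hb₀ : hatV b₀ =ᵐ[ν[N]] N.nfock (F (Iio 0)) (hatV a)) :
    SingleConverges t D a ∧ AEq b (b₀ + singleInt t D a) := by
  rw [show Iio (0 : ℝ≥0) = ∅ from Set.Iio_bot] at hb₀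
  have hd := fun x μ => hatV_deriv (D x) (hD x) μ a
  constructor
  · filter_upwards [h] with ϰ hϰ
    refine ⟨(integrable_emb (∅ ∪ ϰ)).mp (hϰ.1.1.congr (Eventually.of_forall fun x => ?_)),
      (integrable_emb (∅ ∪ ϰ)).mp (hϰ.1.2.congr (Eventually.of_forall fun x => ?_))⟩
    · exact (congrFun (hd x .minus).1 ϰ).symm
    · exact (congrFun (hd x .minus).2 ϰ).symm
  · rw [aeq_iff, hatV_add, hatV_singleInt t hD]
    filter_upwards [h, hb, hb₀] with ϰ h1 h2 h3
    rw [h2, h1.2, Pi.add_apply, h3]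

theorem relNorm_le_iff {T : N.OpFn H A B} {ζ : Weight X} {c : ℝ≥0} :
    relNorm ζ T ≤ c ↔ N.Bdd c ζ (hatF T) := by
  have key : ∀ ϰ, ‖T ϰ‖ₑ / (ζ.prod ϰ : ℝ≥0∞) ≤ c ↔ ‖hatF T ϰ‖ₑ ≤ c * ζ.prod ϰ := by
    intro ϰ
    rw [hatF, enorm_hatO]
    refine ⟨fun h => ?_, ENNReal.div_le_of_le_mul⟩
    by_cases hp : (ζ.prod ϰ : ℝ≥0∞) = 0
    · by_contra hT
      rw [hp, mul_zero, nonpos_iff_eq_zero] at hT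
      rw [hp, ENNReal.div_zero hT] at h
      exact absurd h (by simp)
    · exact (ENNReal.div_le_iff hp ENNReal.coe_ne_top).mp h
  refine ⟨fun h => ?_, fun h => essSup_le_of_ae_le _ (Eventually.mono h fun ϰ => (key ϰ).mpr)⟩
  filter_upwards [ENNReal.ae_le_essSup fun ϰ => ‖T ϰ‖ₑ / (ζ.prod ϰ : ℝ≥0∞)] with ϰ hϰ
  exact (key ϰ).mp (hϰ.trans h)

theorem bdd_of_relNorm {T : N.OpFn H A B} {ζ : Weight X} (h : relNorm ζ T < ∞) :
    N.Bdd (relNorm ζ T).toNNReal ζ (hatF T) :=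
  relNorm_le_iff.mp (coe_toNNReal h.ne).ge

theorem relBounded_iff {T : N.OpFn H A B} : RelBounded T ↔ N.NRel (hatF T) := by
  rw [RelBounded, NRel, measOp_iff]
  refine and_congr_right fun _ => ⟨fun ⟨ζ, h, h'⟩ => ⟨_, ζ, h, bdd_of_relNorm h'⟩,
    fun ⟨c, ζ, h, h'⟩ => ⟨ζ, h, (relNorm_le_iff.mpr h').trans_lt coe_lt_top⟩⟩

theorem exists_lt_of_essSup_lt {ζ : Weight X} {r : ℝ≥0}
    (h : essSup (fun x => (ζ.oo x : ℝ≥0∞)) N.vol < r) : ∃ z < r, ∀ᵐ x ∂N.vol, ζ.oo x ≤ z := by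
  lift essSup (fun x => (ζ.oo x : ℝ≥0∞)) N.vol to ℝ≥0 using h.ne_top with z hz
  refine ⟨z, ENNReal.coe_lt_coe.mp h, ?_⟩
  filter_upwards [ENNReal.ae_le_essSup (μ := N.vol) fun x => (ζ.oo x : ℝ≥0∞)] with x hx
  exact coe_le_coe.mp (hx.trans hz.ge)

theorem scaleBounded_fock {T : N.OpFn H A B} (hT : OpMeas (hatF T)) {c : ℝ≥0} {ζ : Weight X}
    (hζ : ζ.Integrable N.vol) (hb : N.Bdd c ζ (hatF T)) {z r : ℝ≥0}
    (hz : ∀ᵐ x ∂N.vol, ζ.oo x ≤ z) (hr : z < r) : ScaleBounded r (fock T) := by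
  intro ξp ξm hξ hξp
  have hp : 0 < ξp := (mul_pos (pow_pos (pos_of_gt hr) 2) hξ).trans_le hξp
  obtain ⟨C, hC⟩ := nfock_bound hζ hb hz hr hξ hξp
  have hC' : ∀ a : N.Vec H A, MemG ξp a → sqNorm ξm (fock T a) ≤ C * sqNorm ξp a := fun a ha => by
    rw [← nsq_hatV, ← nsq_hatV, hatV_fock]
    exact hC _ (memG_iff.mp ha).1
  refine ⟨fun a ha => ⟨?_, (hC' a ha).trans_lt (mul_lt_top coe_lt_top ha.2)⟩,
    fun a b ha hb' => ?_, fun z a ha => ?_, NNReal.sqrt C, fun a ha => ?_⟩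
  · rw [measVec_iff, hatV_fock]
    exact aestronglyMeasurable_nfock hT.app (memG_iff.mp ha).1
  · rw [aeq_iff, hatV_add, hatV_fock, hatV_fock, hatV_fock, hatV_add]
    filter_upwards [ae_nconv hT.app hζ hb hp (memG_iff.mp ha),
      ae_nconv hT.app hζ hb hp (memG_iff.mp hb')] with ϰ h1 h2 using nfock_add h1 h2
  · rw [aeq_iff, hatV_smul, hatV_fock, hatV_fock, hatV_smul]
    exact Eventually.of_forall (nfock_smul _ z _)
  · refine (ENNReal.rpow_le_rpow (hC' a ha) (by norm_num)).trans_eq ?_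
    rw [ENNReal.mul_rpow_of_nonneg _ _ (by norm_num), NNReal.sqrt_eq_rpow,
      ENNReal.coe_rpow_of_nonneg _ (by norm_num)]
    rfl

theorem formalAdjoint_fock {T : N.OpFn H A B} (hT : OpMeas (hatF T)) {c : ℝ≥0} {ζ : Weight X}
    (hζ : ζ.Integrable N.vol) (hb : N.Bdd c ζ (hatF T)) {z r : ℝ≥0}
    (hz : ∀ᵐ x ∂N.vol, ζ.oo x ≤ z) (hr : z < r) : FormalAdjoint r (fock T) (fock (star T)) := by
  intro ξp ξm hξ hξp a c ha hc
  rw [pairing_eq, pairing_eq, hatV_fock, hatV_fock, hatF_star]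
  exact integral_inner_nfock_eq hT hζ hb hz hr hξ hξp (memG_iff.mp ha) (memG_iff.mp hc)

theorem inScale_of_memG {ξ : ℝ≥0} (hξ : 0 < ξ) {a : N.Vec H A} (ha : MemG ξ a) :
    N.InScale (hatV a) := ⟨ξ, hξ, memG_iff.mp ha⟩

theorem fock_fock {S : N.OpFn H B C} {T : N.OpFn H A B} (hS : N.NRel (hatF S))
    (hT : N.NRel (hatF T)) {a : N.Vec H A} (ha : N.InScale (hatV a)) :
    AEq (fock S (fock T a)) (fock (mul S T) a) := by
  rw [aeq_iff, hatV_fock, hatV_fock, hatV_fock, hatF_mul]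
  exact hS.nfock_nfock hT ha

theorem AEq.memG {ξ : ℝ≥0} {a b : N.Vec H A} (h : AEq a b) (ha : MemG ξ a) : MemG ξ b :=
  memG_iff.mpr ((memG_iff.mp ha).congr (aeq_iff.mp h))

theorem AEq.scaleNorm_eq {ξ : ℝ≥0} {a b : N.Vec H A} (h : AEq a b) :
    scaleNorm ξ a = scaleNorm ξ b := by
  rw [scaleNorm, scaleNorm, ← nsq_hatV, ← nsq_hatV, nsq_congr (aeq_iff.mp h)]

theorem OpMeas.none {P : Finset X → Ell2 H →L[ℂ] Ell2 H}
    (hP : OpMeas P) : OpMeas (Noise.none P) := by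
  classical
  have hs : ∀ {f : Table X → Finset X}, Measurable f → MeasurableSet {ϰ | f ϰ = ∅} := by
    intro f hf
    have := (measurable_card.comp hf) (measurableSet_singleton 0)
    convert this using 1
    ext ϰ
    exact card_eq_zero.symm
  have e : Noise.none P = {ϰ : Table X | ϰ.m0 = ∅ ∧ ϰ.mp = ∅ ∧ ϰ.op = ∅}.indicator fun ϰ => P ϰ.oo := by
    funext ϰ
    rw [Noise.none, Set.indicator_apply]; rfl
  rw [e]
  exact (hP.comp_measurable Table.measurable_oo).indicator
    ((hs Table.measurable_m0).inter ((hs Table.measurable_mp).inter (hs Table.measurable_op)))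

theorem opMeas_proj : OpMeas (N.proj H) := by
  classical
  have key : ∀ f g : X → ℕ, Measurable f → Measurable g → ∀ h : H,
      StronglyMeasurable fun A : Finset X => coord (N := N) g A (basisVec f A h) := by
    intro f g hf hg h
    have e : (fun A : Finset X => coord (N := N) g A (basisVec f A h)) =
        ({A | ∀ x ∈ A, f x = g x} ∩ {A | ∀ x ∈ A, x ∉ {x | (f x : ℕ∞) < N.dim x}ᶜ}).indicator
          fun _ => h := by
      funext A
      by_cases hfg : ∀ x ∈ A, f x = g x
      · by_cases hd : ∀ x : A, (f x : ℕ∞) < N.dim x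
        · have hd' : ∀ x : A, (g x : ℕ∞) < N.dim x := fun x => by rw [← hfg x x.2]; exact hd x
          rw [indicator_of_mem, coord, basisVec, dif_pos hd, dif_pos hd']
          swap
          · exact ⟨hfg, fun x hx => not_not.mpr (hd ⟨x, hx⟩)⟩
          have : (fun x => ⟨g x, hd' x⟩ : N.Lab A) = fun x => ⟨f x, hd x⟩ :=
            funext fun x => Subtype.ext (hfg x x.2).symm
          rw [this]
          exact lp.single_apply_self (E := fun _ : N.Lab A => H) 2 _ h
        · rw [indicator_of_notMem fun hc => hd fun x => not_not.mp (hc.2 x x.2), coord,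
            basisVec, dif_neg hd]
          split_ifs <;> rfl
      · rw [indicator_of_notMem fun hc => hfg hc.1, coord, basisVec]
        split_ifs with h1 h2
        · refine lp.single_apply_ne (E := fun _ : N.Lab A => H) 2 _ h fun hl => hfg fun x hx => ?_
          exact (congrArg Subtype.val (congrFun hl ⟨x, hx⟩)).symm
        · rfl
        · rfl
    rw [e]
    refine stronglyMeasurable_const.indicator ((measurableSet_agree hf hg).inter
      (measurableSet_avoid (MeasurableSet.compl ?_)))
    exact (hf.prodMk N.measurable_dim)
      (MeasurableSet.of_discrete (s := {p : ℕ × ℕ∞ | (p.1 : ℕ∞) < p.2}))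
  refine (opMeas_hatO_iff measurable_id measurable_id fun A : Finset X =>
    ContinuousLinearMap.id ℂ (N.Ten H A)).mpr fun f g hf hg h => ⟨key f g hf hg h, ?_⟩
  have e : (fun A : Finset X => coord (N := N) f A (adjoint
      (ContinuousLinearMap.id ℂ (N.Ten H A)) (basisVec g A h))) = fun A => coord f A (basisVec g A h) :=
    funext fun A => congrArg (coord f A) (DFunLike.congr_fun ContinuousLinearMap.adjoint_id _)
  exact e ▸ key g f hg hf h

theorem ScaleBounded.congr {r : ℝ≥0} (hr : 0 < r) {U V : N.Vec H A → N.Vec H B}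
    (hU : ScaleBounded r U) (h : ∀ ξ : ℝ≥0, 0 < ξ → ∀ a, MemG ξ a → AEq (U a) (V a)) :
    ScaleBounded r V := by
  intro ξp ξm hξ hξp
  obtain ⟨h1, h2, h3, K, h4⟩ := hU ξp ξm hξ hξp
  have h' := h ξp ((mul_pos (pow_pos hr 2) hξ).trans_le hξp)
  refine ⟨fun a ha => (h' a ha).memG (h1 a ha), fun a b ha hb => ?_, fun z a ha => ?_, K,
    fun a ha => (h' a ha).scaleNorm_eq ▸ h4 a ha⟩
  · have hab : MemG ξp (a + b) :=
      memG_iff.mpr (hatV_add a b ▸ (memG_iff.mp ha).add (memG_iff.mp hb))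
    filter_upwards [h' _ hab, h' _ ha, h' _ hb, h2 a b ha hb] with ϰ e1 e2 e3 e4
    rw [← e1, e4, Pi.add_apply, Pi.add_apply, e2, e3]
  · have hza : MemG ξp (z • a) := memG_iff.mpr (hatV_smul z a ▸ (memG_iff.mp ha).smul z)
    filter_upwards [h' _ hza, h' _ ha, h3 z a ha] with ϰ e1 e2 e3
    rw [← e1, e3, Pi.smul_apply, Pi.smul_apply, e2]

theorem nrel_star {T : N.OpFn H A B} (h : N.NRel (hatF T)) : N.NRel (hatF (star T)) := by
  obtain ⟨h1, c, ζ, h2, h3⟩ := h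
  rw [hatF_star]
  exact ⟨OpMeas.nstar h1, c, ζ.conj, h2.conj, h3.nstar⟩

theorem nrel_one : N.NRel (hatF (one : N.OpFn H A A)) := by
  have hm : OpMeas (hatF (one : N.OpFn H A A)) := by
    rw [hatF_one]
    exact OpMeas.none (opMeas_proj.comp_measurable (measurable_const.chain_union measurable_id))
  refine ⟨hm, 1, ⟨0, 0, 1, 0⟩, ⟨MemLp.zero, MemLp.zero, memLp_top_const 1, MemLp.zero⟩,
    Eventually.of_forall fun ϰ => ?_⟩
  rw [hatF_one, none]
  split_ifs with h
  · have e : (⟨0, 0, 1, 0⟩ : Weight X).prod ϰ = 1 := by simp [Weight.prod, h]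
    rw [e, proj, enorm_hatO, ENNReal.coe_one, mul_one, ← ofReal_norm]
    exact (ENNReal.ofReal_le_ofReal ContinuousLinearMap.norm_id_le).trans_eq (by simp)
  · simp

theorem unitalStarAlgebra : UnitalStarAlgebra {T : N.OpFn H ∅ ∅ | RelBounded T} := by
  have mem : ∀ {T : N.OpFn H ∅ ∅}, T ∈ {T : N.OpFn H ∅ ∅ | RelBounded T} ↔ N.NRel (hatF T) :=
    relBounded_iff
  have all : ∀ {S T : N.OpFn H ∅ ∅}, hatF S = hatF T → OpAEq S T := fun h =>
    opAEq_iff.mpr (Eventually.of_forall (congrFun h))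
  refine
    { one_mem := mem.mpr nrel_one
      zero_mem := mem.mpr ?_
      add_mem := fun S hS T hT => mem.mpr (hatF_add S T ▸ (mem.mp hS).add (mem.mp hT))
      smul_mem := fun z T hT => mem.mpr ?_
      mul_mem := fun S hS T hT => mem.mpr (hatF_mul S T ▸ (mem.mp hS).nmul (mem.mp hT))
      star_mem := fun T hT => mem.mpr (nrel_star (mem.mp hT))
      mul_congr := fun S _ S' _ T _ T' _ h h' => ?_
      star_congr := fun T _ T' _ h => ?_
      mul_assoc := fun R _ S _ T _ => ?_
      one_mul := fun T _ => all (funext fun ϰ => ?_)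
      mul_one := fun T _ => all (funext fun ϰ => ?_)
      mul_add := fun R _ S _ T _ => all ?_
      add_mul := fun R _ S _ T _ => all ?_
      smul_mul := fun z S _ T _ => all ?_
      mul_smul := fun z S _ T _ => all ?_
      star_star := fun T _ => all (funext fun ϰ => ?_)
      star_add := fun S _ T _ => all (funext fun ϰ => ?_)
      star_smul := fun z T _ => all (funext fun ϰ => ?_)
      star_mul := fun S _ T _ => all (funext fun ϰ => ?_) }
  · have e : hatF (0 : N.OpFn H ∅ ∅) = fun _ => 0 := funext fun ϰ => map_zero hatO
    rw [e]
    exact ⟨OpMeas.const 0, 0, ⟨0, 0, 0, 0⟩, ⟨MemLp.zero, MemLp.zero, MemLp.zero, MemLp.zero⟩,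
      Eventually.of_forall fun ϰ => by simp⟩
  · obtain ⟨h1, c, ζ, h2, h3⟩ := mem.mp hT
    rw [hatF_smul]
    refine ⟨h1.smul z, ‖z‖₊ * c, ζ, h2, Eventually.mono h3 fun ϰ hϰ => ?_⟩
    rw [enorm_smul, ENNReal.coe_mul, mul_assoc]
    exact mul_le_mul' le_rfl hϰ
  · rw [opAEq_iff, hatF_mul, hatF_mul]
    exact nmul_congr (opAEq_iff.mp h) (opAEq_iff.mp h')
  · rw [opAEq_iff, hatF_star, hatF_star]
    filter_upwards [(measurePreserving_conj N).quasiMeasurePreserving.ae (opAEq_iff.mp h)] with ϰ hϰ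
    rw [nstar, nstar, hϰ]
  · rw [opAEq_iff, hatF_mul, hatF_mul, hatF_mul, hatF_mul]
    filter_upwards [N.ae_table_times_disjoint] with ϰ h
    have d : ∀ {A B : Finset X}, Disjoint (N.times A) (N.times B) → Disjoint A B :=
      fun h => Disjoint.of_image_finset h
    exact Noise.nmul_assoc _ _ _ ϰ (d h.1) (d h.2.1) (d h.2.2.1) (d h.2.2.2.1) (d h.2.2.2.2.1)
      (d h.2.2.2.2.2)
  · rw [hatF_mul, hatF_one, none_nmul]
    exact proj_comp _
  · rw [hatF_mul, hatF_one, nmul_none]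
    exact comp_proj _
  · rw [hatF_mul, hatF_add, hatF_add, hatF_mul, hatF_mul]
    exact funext (nmul_add_right _ _ _)
  · rw [hatF_mul, hatF_add, hatF_add, hatF_mul, hatF_mul]
    exact funext (nmul_add_left _ _ _)
  · rw [hatF_mul, hatF_smul, hatF_smul, hatF_mul]
    exact funext (nmul_smul_left z _ _)
  · rw [hatF_mul, hatF_smul, hatF_smul, hatF_mul]
    exact funext (nmul_smul_right z _ _)
  · rw [hatF_star, hatF_star]
    exact adjoint_adjoint _
  · rw [hatF_add, hatF_star, hatF_star, hatF_star, hatF_add]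
    exact map_add adjoint _ _
  · rw [hatF_smul, hatF_star, hatF_star, hatF_smul]
    exact map_smulₛₗ adjoint z _
  · rw [hatF_star, hatF_mul, hatF_mul, hatF_star, hatF_star]
    exact nstar_nmul _ _ ϰ

theorem relNorm_antitone {ζ ζ' : Weight X} (h : ∀ x, ζ.LeAt ζ' x) (T : N.OpFn H A B) :
    relNorm ζ' T ≤ relNorm ζ T :=
  essSup_mono_ae ((N.ae_prod_le (Eventually.of_forall h)).mono fun _ hϰ =>
    ENNReal.div_le_div_left (coe_le_coe.mpr hϰ) _)

theorem relNorm_eq_essSup_hatF (ζ : Weight X) (T : N.OpFn H A B) :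
    relNorm ζ T = essSup (fun ϰ => ‖hatF T ϰ‖ₑ / (ζ.prod ϰ : ℝ≥0∞)) τ[N] := by
  simp only [relNorm, hatF, enorm_hatO]

theorem relNorm_add_le (ζ : Weight X) (S T : N.OpFn H A B) :
    relNorm ζ (S + T) ≤ relNorm ζ S + relNorm ζ T := by
  simp only [relNorm_eq_essSup_hatF, hatF_add]
  refine (essSup_mono_ae (Eventually.of_forall fun ϰ => ?_)).trans (ENNReal.essSup_add_le _ _)
  show _ ≤ ‖hatF S ϰ‖ₑ / _ + ‖hatF T ϰ‖ₑ / _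
  rw [← ENNReal.add_div]
  exact ENNReal.div_le_div_right (enorm_add_le (hatF S ϰ) (hatF T ϰ)) _

theorem relNorm_smul (ζ : Weight X) (z : ℂ) (T : N.OpFn H A B) :
    relNorm ζ (z • T) = ‖z‖ₑ * relNorm ζ T := by
  simp only [relNorm_eq_essSup_hatF, hatF_smul, ← ENNReal.essSup_const_mul, enorm_smul,
    mul_div_assoc]

theorem relNorm_eq_zero_iff {ζ : Weight X} {T : N.OpFn H A B} : relNorm ζ T = 0 ↔ OpAEq T 0 := by
  rw [relNorm_eq_essSup_hatF, ENNReal.essSup_eq_zero_iff]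
  refine eventually_congr (Eventually.of_forall fun ϰ => ?_)
  rw [Pi.zero_apply, ENNReal.div_eq_zero_iff, or_iff_left ENNReal.coe_ne_top, enorm_eq_zero, hatF,
    ← map_zero (hatO (N := N) (H := H) (A := A ∪ ϰ.dom) (B := B ∪ ϰ.cod)), hatO_inj]
  rfl

theorem relNorm_star_le (ζ : Weight X) (T : N.OpFn H A B) :
    relNorm ζ (star T) ≤ relNorm ζ.conj T := by
  rcases eq_or_ne (relNorm ζ.conj T) ∞ with h | h
  · exact h ▸ le_top
  · have := (bdd_of_relNorm (lt_top_iff_ne_top.mpr h)).nstar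
    rw [← hatF_star] at this
    exact (relNorm_le_iff.mpr this).trans_eq (coe_toNNReal h)

theorem relNorm_star_mul_le {ζ ξ : Weight X} (T : N.OpFn H A B)
    (h : ∀ᵐ x ∂N.vol, ∀ i j, (ζ.conj.matrix x * ζ.matrix x) i j ≤ ξ.matrix x i j) :
    relNorm ξ (mul (star T) T) ≤ relNorm ζ T ^ 2 := by
  rcases eq_or_ne (relNorm ζ T) ∞ with hT | hT
  · simp [hT]
  · have hb := bdd_of_relNorm (lt_top_iff_ne_top.mpr hT)
    have hle : ∀ᵐ x ∂N.vol, (ζ.conj.mul ζ).LeAt ξ x := by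
      filter_upwards [h] with x hx
      have h1 := hx 0 1; have h2 := hx 0 2; have h3 := hx 1 1; have h4 := hx 1 2
      simp only [Matrix.mul_apply, Fin.sum_univ_three, Weight.matrix, Weight.conj, Matrix.of_apply,
        Matrix.cons_val', Matrix.cons_val_zero, Matrix.cons_val_one, Matrix.cons_val] at h1 h2 h3 h4
      simp only [Weight.LeAt, Weight.mul, Weight.conj]
      refine ⟨?_, ?_, ?_, ?_⟩
      · simpa using h1
      · refine le_trans (le_of_eq ?_) h2; ring
      · simpa using h3
      · simpa using h4
    have := (hb.nstar.nmul hb).mono hle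
    rw [← hatF_star, ← hatF_mul] at this
    refine (relNorm_le_iff.mpr this).trans_eq ?_
    rw [ENNReal.coe_mul, coe_toNNReal hT, sq]

theorem fock_facts {T : N.OpFn H ∅ ∅} {ζ : Weight X} (hm : MeasOp T) (hζ : ζ.Integrable N.vol)
    (hT : relNorm ζ T < ∞) {r : ℝ≥0} (hr : essSup (fun x => (ζ.oo x : ℝ≥0∞)) N.vol < r) :
    (∀ ξ : ℝ≥0, 0 < ξ → ∀ a : N.Vec H ∅, MemG ξ a →
      FockConverges T a ∧ FockConverges (star T) a) ∧
    ScaleBounded r (fock T) ∧ ScaleBounded r (fock (star T)) ∧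
    FormalAdjoint r (fock T) (fock (star T)) ∧
    ScaleBounded (r ^ 2) (fun a => fock (star T) (fock T a)) ∧
    ScaleBounded (r ^ 2) (fock (mul (star T) T)) ∧
    ∀ ξ : ℝ≥0, 0 < ξ → ∀ a : N.Vec H ∅, MemG ξ a →
      AEq (fock (star T) (fock T a)) (fock (mul (star T) T) a) := by
  obtain ⟨z, hz, hzo⟩ := exists_lt_of_essSup_lt hr
  have hm := measOp_iff.mp hm
  have hb := bdd_of_relNorm hT
  have hm' : OpMeas (hatF (star T)) := hatF_star T ▸ OpMeas.nstar hm
  have hb' : N.Bdd _ ζ.conj (hatF (star T)) := hatF_star T ▸ hb.nstar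
  have hr0 : 0 < r := pos_of_gt hz
  have hc : ∀ ξ : ℝ≥0, 0 < ξ → ∀ a : N.Vec H ∅, MemG ξ a →
      AEq (fock (star T) (fock T a)) (fock (mul (star T) T) a) := fun ξ hξ a ha =>
    fock_fock ⟨hm', _, _, hζ.conj, hb'⟩ ⟨hm, _, _, hζ, hb⟩ (inScale_of_memG hξ ha)
  have h2 : ScaleBounded (r ^ 2) (fock (mul (star T) T)) :=
    scaleBounded_fock (hatF_mul (star T) T ▸ OpMeas.nmul hm' hm) (hζ.conj.mul hζ)
      (hatF_mul (star T) T ▸ hb'.nmul hb) (z := z ^ 2)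
      (hzo.mono fun x hx => (mul_le_mul' hx hx).trans_eq (sq z).symm)
      (pow_lt_pow_left₀ hz (zero_le) two_ne_zero)
  exact ⟨fun ξ hξ a ha => ⟨fockConverges_iff.mpr (ae_nconv hm.app hζ hb hξ (memG_iff.mp ha)),
      fockConverges_iff.mpr (ae_nconv hm'.app hζ.conj hb' hξ (memG_iff.mp ha))⟩,
    scaleBounded_fock hm hζ hb hzo hz, scaleBounded_fock hm' hζ.conj hb' hzo hz,
    formalAdjoint_fock hm hζ hb hzo hz,
    h2.congr (pow_pos hr0 2) fun ξ hξ a ha => (hc ξ hξ a ha).mono fun _ h => h.symm, h2, hc⟩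

theorem fock_one (a : N.Vec H ∅) : AEq (fock one a) a := by
  rw [aeq_iff, hatV_fock, hatF_one]
  refine Eventually.of_forall fun ϰ => ?_
  have h := nfock_of_support (N := N) (T := none fun oo => proj N H (∅ ∪ oo))
    (fun κ hκ => if_neg hκ) (hatV a) ϰ
  rw [h, none, if_pos ⟨rfl, rfl, rfl⟩]
  exact hatO_emb (ContinuousLinearMap.id ℂ _) (a ϰ)

theorem fock_representation {S T : N.OpFn H ∅ ∅} (hS : RelBounded S) (hT : RelBounded T) {ξ : ℝ≥0}
    (hξ : 0 < ξ) {a : N.Vec H ∅} (ha : MemG ξ a) :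
    (OpAEq S T → AEq (fock S a) (fock T a)) ∧ AEq (fock (S + T) a) (fock S a + fock T a) ∧
    (∀ z : ℂ, AEq (fock (z • T) a) (z • fock T a)) ∧ AEq (fock one a) a ∧
    AEq (fock S (fock T a)) (fock (mul S T) a) := by
  rw [relBounded_iff] at hS hT
  have hi := inScale_of_memG hξ ha
  refine ⟨fun h => ?_, ?_, fun z => ?_, fock_one a, fock_fock hS hT hi⟩
  · rw [aeq_iff, hatV_fock, hatV_fock]
    exact nfock_congr (opAEq_iff.mp h) (EventuallyEq.refl _ _)
  · rw [aeq_iff, hatV_add, hatV_fock, hatV_fock, hatV_fock, hatF_add]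
    exact hS.nfock_op_add hT hi
  · rw [aeq_iff, hatV_smul, hatV_fock, hatV_fock, hatF_smul]
    exact Eventually.of_forall (nfock_op_smul z _ _)

section Integrals

variable {L : N.OpFamily H} {ξ lam ζ : Weight X} {c r t : ℝ≥0}

theorem bdd₂_hatL (h : ∀ᵐ p ∂(τ[N].prod τ[N]),
    ‖L p.1 p.2‖₊ ≤ c * lam.prod p.1 * ξ.prod p.2) : N.Bdd₂ c lam ξ (hatL L) := by
  unfold Bdd₂
  filter_upwards [h] with p hp
  rw [hatL, enorm_hatO]
  have h := coe_le_coe.mpr hp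
  rw [ENNReal.coe_mul, ENNReal.coe_mul] at h
  exact h

theorem scaleBounded_family (hL : OpMeas₂ (hatL L))
    (hξ : ξ.Integrable N.vol) (hb : N.Bdd₂ c lam ξ (hatL L))
    (hr : essSup (fun x => (ξ.oo x : ℝ≥0∞)) N.vol < r) :
    ∀ᵐ θ ∂τ[N], ScaleBounded r (fock (L θ)) := by
  obtain ⟨z, hz, hzo⟩ := exists_lt_of_essSup_lt hr
  have h := ae_ae_of_ae_prod hb
  filter_upwards [h] with θ hθ
  have hm : OpMeas (hatF (L θ)) :=
    hL.comp_measurable (g := fun κ : Table X => (θ, κ)) measurable_prodMk_left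
  have hb' : N.Bdd (c * lam.prod θ) ξ (hatF (L θ)) := by
    unfold Bdd
    rw [ENNReal.coe_mul]
    exact hθ
  exact scaleBounded_fock (T := L θ) hm hξ hb' hzo hz

theorem leAt_of_le (h : ∀ᵐ x ∂N.vol,
    (N.time x < t → ξ.m0 x + lam.m0 x ≤ ζ.m0 x ∧ ξ.mp x + lam.mp x ≤ ζ.mp x ∧
      ξ.oo x + lam.oo x ≤ ζ.oo x ∧ ξ.op x + lam.op x ≤ ζ.op x) ∧
    (t ≤ N.time x → ξ.m0 x ≤ ζ.m0 x ∧ ξ.mp x ≤ ζ.mp x ∧ ξ.oo x ≤ ζ.oo x ∧ ξ.op x ≤ ζ.op x)) :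
    ∀ᵐ x ∂N.vol, ((N.cutWeight t lam).add ξ).LeAt ζ x := by
  filter_upwards [h] with x hx
  simp only [Weight.LeAt, Weight.add, cutWeight]
  rcases lt_or_ge (N.time x) t with ht | ht
  · have hm : x ∈ N.before t := ht
    simpa only [indicator_of_mem hm, add_comm] using hx.1 ht
  · have hm : x ∉ N.before t := not_lt.mpr ht
    simpa only [indicator_of_notMem hm, zero_add] using hx.2 ht

theorem multInt_eq_fock (hL : OpMeas₂ (hatL L))
    (hξ : ξ.Integrable N.vol) (hlam : ∀ t, lam.Integrable (N.vol.restrict (N.before t)))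
    (hb : N.Bdd₂ c lam ξ (hatL L)) (t : ℝ≥0) {ξ' : ℝ≥0} (hξ' : 0 < ξ') {a : N.Vec H ∅}
    (ha : MemG ξ' a) : MultConverges ∅ t (fun θ => fock (L θ)) Table.empty a ∧
      AEq (multInt t (fun θ => fock (L θ)) Table.empty a) (fock (multSum (Iio t) L) a) := by
  have e : (fun θ κ => hatL L (Table.empty.union θ) κ) = hatL L := by
    funext θ κ
    congr 1
    exact Table.ext (empty_union _) (empty_union _) (empty_union _)
      (empty_union _)
  have hm : OpMeas₂ (N.ncut (Iio t) (hatL L)) :=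
    (OpMeas.ncut (N := N) (L := fun _ : ℝ≥0 => hatL L) (I := fun s => Iio s)
      (hL.comp_measurable measurable_snd) measurableSet_times_lt).comp_measurable
      (g := fun q => (t, q)) measurable_prodMk_left
  have hb' : N.Bdd₂ c (N.cutWeight t lam) ξ (N.ncut (Iio t) (hatL L)) :=
    Eventually.mono hb fun _ h => ncut_bound le_rfl h
  have h := nfock_nsum (L := N.ncut (Iio t) (hatL L)) hm.app (hlam t).cutWeight hξ hb' hξ'
    (memG_iff.mp ha)
  refine ⟨multConverges_of L rfl rfl ?_, ?_⟩
  · rw [e]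
    exact h.mono fun ϰ hϰ => hϰ.2
  · have hv := hatV_multInt L (σ := Table.empty) rfl rfl t a
    rw [e] at hv
    rw [aeq_iff, hatV_fock, hatF_multSum]
    refine (EventuallyEq.of_eq hv).trans ?_
    exact h.mono fun ϰ hϰ => hϰ.1.symm

theorem multSum_Iic_eq (L : N.OpFamily H) {s : ℝ≥0} {ϰ : Table X} (hst : s < t)
    (h : ∀ x ∈ ϰ.m0 ∪ ϰ.mp ∪ ϰ.oo ∪ ϰ.op, s < N.time x → t ≤ N.time x) :
    multSum (Iic s) L ϰ = multSum (Iio t) L ϰ := by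
  refine hatO_inj.mp ?_
  show hatF (multSum _ L) ϰ = hatF (multSum _ L) ϰ
  rw [hatF_multSum, hatF_multSum]
  refine nsum_congr_on fun θ hθ => ncut_congr fun x hx => ⟨fun hs => ?_, fun ht => ?_⟩
  · exact mem_Iio.mpr ((mem_Iic.mp hs).trans_lt hst)
  · exact mem_Iic.mpr (not_lt.mp fun hs =>
      (h x (hθ hx) hs).not_gt (mem_Iio.mp ht))

theorem ae_matrices (hL : OpMeas₂ (hatL L))
    (hb : N.Bdd₂ c lam ξ (hatL L)) (hζ : ζ.Integrable N.vol)
    (hle : ∀ᵐ x ∂N.vol, ((N.cutWeight t lam).add ξ).LeAt ζ x)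
    (hr : essSup (fun x => (ζ.oo x : ℝ≥0∞)) N.vol < r) :
    ∀ᵐ x ∂N.vol, N.time x < t → ∀ μ ν : Ind, ScaleBounded r (matU L x μ ν) ∧
      ScaleBounded r (matG L x μ ν) ∧ FormalAdjoint r (matU L x μ ν) (matUadj L x ν μ) ∧
      FormalAdjoint r (matG L x μ ν) (matGadj L x ν μ) := by
  obtain ⟨z, hz, hzo⟩ := exists_lt_of_essSup_lt hr
  have hF := (stepFamily_nstep hL hb t).mono hle
  filter_upwards [hF.ae_bdd_ntri] with x hx ht μ ν
  obtain ⟨C, hC⟩ := hx ht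
  have m1 : OpMeas (hatF (triMatrix (multSum (Iio (N.time x)) L)
      (multSum (Iio (N.time x)) L) x μ ν)) := by
    rw [hatF_triMatrix, hatF_multSum]
    exact (hF.opMeas_ntri_Iio μ ν).comp_measurable (g := fun κ => (x, κ)) measurable_prodMk_left
  have m2 : OpMeas (hatF (triMatrix (multSum (Iic (N.time x)) L)
      (multSum (Iio (N.time x)) L) x μ ν)) := by
    rw [hatF_triMatrix, hatF_multSum, hatF_multSum]
    exact (hF.opMeas_ntri_Iic μ ν).comp_measurable (g := fun κ => (x, κ)) measurable_prodMk_left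
  have b1 : N.Bdd C ζ (hatF (triMatrix (multSum (Iio (N.time x)) L)
      (multSum (Iio (N.time x)) L) x μ ν)) := by
    rw [hatF_triMatrix, hatF_multSum]; exact (hC μ ν).1
  have b2 : N.Bdd C ζ (hatF (triMatrix (multSum (Iic (N.time x)) L)
      (multSum (Iio (N.time x)) L) x μ ν)) := by
    rw [hatF_triMatrix, hatF_multSum, hatF_multSum]; exact (hC μ ν).2
  exact ⟨scaleBounded_fock m1 hζ b1 hzo hz, scaleBounded_fock m2 hζ b2 hzo hz,
    formalAdjoint_fock m1 hζ b1 hzo hz, formalAdjoint_fock m2 hζ b2 hzo hz⟩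

theorem ae_matD_eq (hL : OpMeas₂ (hatL L))
    (hξ : ξ.Integrable N.vol) (hlam : ∀ t, lam.Integrable (N.vol.restrict (N.before t)))
    (hb : N.Bdd₂ c lam ξ (hatL L)) :
    ∀ᵐ x ∂N.vol, ∀ (μ ν : Ind) (ξ' : ℝ≥0), 0 < ξ' → ∀ b : N.Vec H (ν.pts x), MemG ξ' b →
      (μ ≠ .plus → ν ≠ .minus →
        MultConverges (μ.pts x) (N.time x) (fun θ => fock (L θ)) (Table.elem x μ ν) b) ∧
      AEq (matD (fun θ => fock (L θ)) x μ ν b) ((matG L x - matU L x) μ ν b) := by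
  have h : ∀ {μ ν : Ind}, μ ≠ .plus → ν ≠ .minus → ∀ᵐ x ∂N.vol, ∀ (ξ' : ℝ≥0), 0 < ξ' →
      ∀ b : N.Vec H (ν.pts x), MemG ξ' b →
        MultConverges (μ.pts x) (N.time x) (fun θ => fock (L θ)) (Table.elem x μ ν) b := by
    intro μ ν hμ hν
    filter_upwards [ae_nmult_nderivL hL hlam hξ hb hμ hν] with x hx ξ' hξ' b hb'
    exact multConverges_of L (elem_dom_cod hμ hν).1 (elem_dom_cod hμ hν).2
      ((hx _ (inScale_of_memG hξ' hb')).mono fun ϰ hϰ => hϰ.2)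
  filter_upwards [ae_nD_eq hL hlam hξ hb, h (μ := .minus) (ν := .zero) nofun nofun,
    h (μ := .minus) (ν := .plus) nofun nofun, h (μ := .zero) (ν := .zero) nofun nofun,
    h (μ := .zero) (ν := .plus) nofun nofun] with x hx h1 h2 h3 h4 μ ν ξ' hξ' b hb'
  refine ⟨fun hμ hν => ?_, ?_⟩
  · exact match μ, ν, b, hb' with
    | .minus, .zero, b, hb' => h1 ξ' hξ' b hb'
    | .minus, .plus, b, hb' => h2 ξ' hξ' b hb'
    | .zero, .zero, b, hb' => h3 ξ' hξ' b hb'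
    | .zero, .plus, b, hb' => h4 ξ' hξ' b hb'
    | .plus, _, _, _ => absurd rfl hμ
    | _, .minus, _, _ => absurd rfl hν
  · rw [aeq_iff, represents_matD, ((represents_matG L x).sub (represents_matU L x)) μ ν b]
    exact hx μ ν _ (inScale_of_memG hξ' hb')

end Integrals

end Noise

theorem theorem2 {X : Type*} [MeasurableSpace X] [StandardBorelSpace X] [DecidableEq X]
    {H : Type*} [NormedAddCommGroup H] [InnerProductSpace ℂ H] [CompleteSpace H]
    (N : Noise X) :
    -- boundedness of `ε(T)` and `ε(T*)`, and the operator `ε(T)* ε(T) = ε(T* · T)`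
    (∀ (T : N.OpFn H ∅ ∅) (ζ : Weight X), Noise.MeasOp T → ζ.Integrable N.vol →
      Noise.relNorm ζ T < ∞ → ∀ r : ℝ≥0, essSup (fun x => (ζ.oo x : ℝ≥0∞)) N.vol < r →
        (∀ ξ : ℝ≥0, 0 < ξ → ∀ a : N.Vec H ∅, Noise.MemG ξ a →
          Noise.FockConverges T a ∧ Noise.FockConverges (Noise.star T) a) ∧
        Noise.ScaleBounded r (Noise.fock T) ∧
        Noise.ScaleBounded r (Noise.fock (Noise.star T)) ∧
        Noise.FormalAdjoint r (Noise.fock T) (Noise.fock (Noise.star T)) ∧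
        Noise.ScaleBounded (r ^ 2) (fun a => Noise.fock (Noise.star T) (Noise.fock T a)) ∧
        Noise.ScaleBounded (r ^ 2) (Noise.fock (Noise.mul (Noise.star T) T)) ∧
        (∀ ξ : ℝ≥0, 0 < ξ → ∀ a : N.Vec H ∅, Noise.MemG ξ a →
          Noise.AEq (Noise.fock (Noise.star T) (Noise.fock T a))
            (Noise.fock (Noise.mul (Noise.star T) T) a))) ∧
    -- the unital inductive `*`-algebra of relatively bounded functions, and its norms
    Noise.UnitalStarAlgebra {T : N.OpFn H ∅ ∅ | Noise.RelBounded T} ∧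
    (∀ ζ ζ' : Weight X, ζ.Integrable N.vol → ζ'.Integrable N.vol →
      ∃ ξ : Weight X, ξ.Integrable N.vol ∧ ∀ T : N.OpFn H ∅ ∅,
        Noise.relNorm ξ T ≤ Noise.relNorm ζ T ∧ Noise.relNorm ξ T ≤ Noise.relNorm ζ' T) ∧
    (∀ (ζ : Weight X) (S T : N.OpFn H ∅ ∅) (z : ℂ), ζ.Integrable N.vol →
      Noise.relNorm ζ (S + T) ≤ Noise.relNorm ζ S + Noise.relNorm ζ T ∧
      Noise.relNorm ζ (z • T) = ‖z‖ₑ * Noise.relNorm ζ T ∧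
      (Noise.relNorm ζ T = 0 ↔ Noise.OpAEq T 0)) ∧
    (∀ (ζ : Weight X) (T : N.OpFn H ∅ ∅), ζ.Integrable N.vol → Noise.MeasOp T →
      Noise.relNorm ζ (Noise.star T) = Noise.relNorm ζ.conj T) ∧
    (∀ (ζ ξ : Weight X) (T : N.OpFn H ∅ ∅), ζ.Integrable N.vol → Noise.MeasOp T →
      (∀ᵐ x ∂N.vol, ∀ i j, (ζ.conj.matrix x * ζ.matrix x) i j ≤ ξ.matrix x i j) →
      Noise.relNorm ξ (Noise.mul (Noise.star T) T) ≤ Noise.relNorm ζ T ^ 2) ∧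
    -- `ε` is a representation of this algebra
    (∀ S T : N.OpFn H ∅ ∅, Noise.RelBounded S → Noise.RelBounded T →
      ∀ ξ : ℝ≥0, 0 < ξ → ∀ a : N.Vec H ∅, Noise.MemG ξ a →
        (Noise.OpAEq S T → Noise.AEq (Noise.fock S a) (Noise.fock T a)) ∧
        Noise.AEq (Noise.fock (S + T) a) (Noise.fock S a + Noise.fock T a) ∧
        (∀ z : ℂ, Noise.AEq (Noise.fock (z • T) a) (z • Noise.fock T a)) ∧
        Noise.AEq (Noise.fock Noise.one a) a ∧
        Noise.AEq (Noise.fock S (Noise.fock T a)) (Noise.fock (Noise.mul S T) a)) ∧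
    -- multiple integrals `U^t = Λ_{[0,t)}(B)` of `B(θ) = ε(L(θ))`
    (∀ (L : N.OpFamily H) (ξ lam : Weight X) (c : ℝ≥0), Noise.MeasFamily L →
      ξ.Integrable N.vol → (∀ t, lam.Integrable (N.vol.restrict (N.before t))) →
      (∀ᵐ p ∂(N.tableMeasure.prod N.tableMeasure),
        ‖L p.1 p.2‖₊ ≤ c * lam.prod p.1 * ξ.prod p.2) →
      ∀ (B : N.OpIntegrand H), (B = fun θ => Noise.fock (L θ)) →
      ∀ (T : ℝ≥0 → N.OpFn H ∅ ∅), (T = fun t => Noise.multSum (Set.Iio t) L) →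
        -- the operators `B(θ)` are bounded in the Fock scale
        (∀ r : ℝ≥0, essSup (fun x => (ξ.oo x : ℝ≥0∞)) N.vol < r →
          ∀ᵐ θ ∂N.tableMeasure, Noise.ScaleBounded r (B θ)) ∧
        -- the functions `T^t = N_{[0,t)}(L)` are relatively bounded
        (∀ t, Noise.RelBounded (T t)) ∧
        (∀ (t : ℝ≥0) (ζ : Weight X),
          (∀ᵐ x ∂N.vol,
            (N.time x < t → ξ.m0 x + lam.m0 x ≤ ζ.m0 x ∧ ξ.mp x + lam.mp x ≤ ζ.mp x ∧
              ξ.oo x + lam.oo x ≤ ζ.oo x ∧ ξ.op x + lam.op x ≤ ζ.op x) ∧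
            (t ≤ N.time x → ξ.m0 x ≤ ζ.m0 x ∧ ξ.mp x ≤ ζ.mp x ∧
              ξ.oo x ≤ ζ.oo x ∧ ξ.op x ≤ ζ.op x)) →
          Noise.relNorm ζ (T t) ≤ c) ∧
        -- `Λ_{[0,t)} ∘ ε = ε ∘ N_{[0,t)}`
        (∀ (t ξ' : ℝ≥0), 0 < ξ' → ∀ a : N.Vec H ∅, Noise.MemG ξ' a →
          Noise.MultConverges ∅ t B Table.empty a ∧
          Noise.AEq (Noise.multInt t B Table.empty a) (Noise.fock (T t) a)) ∧
        -- `T^{s]} = T^t` if no point of the table has its time in `(s, t)`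
        (∀ (s t : ℝ≥0) (ϰ : Table X), s < t →
          (∀ x ∈ ϰ.m0 ∪ ϰ.mp ∪ ϰ.oo ∪ ϰ.op, s < N.time x → t ≤ N.time x) →
          Noise.multSum (Set.Iic s) L ϰ = T t ϰ) ∧
        -- the derivatives: `𝐔(x)`, `𝐆(x)`, their conjugates, and `𝐃 = 𝐆 - 𝐔`
        (∀ (t : ℝ≥0) (ζ : Weight X), ζ.Integrable N.vol →
          (∀ᵐ x ∂N.vol,
            (N.time x < t → ξ.m0 x + lam.m0 x ≤ ζ.m0 x ∧ ξ.mp x + lam.mp x ≤ ζ.mp x ∧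
              ξ.oo x + lam.oo x ≤ ζ.oo x ∧ ξ.op x + lam.op x ≤ ζ.op x) ∧
            (t ≤ N.time x → ξ.m0 x ≤ ζ.m0 x ∧ ξ.mp x ≤ ζ.mp x ∧
              ξ.oo x ≤ ζ.oo x ∧ ξ.op x ≤ ζ.op x)) →
          ∀ r : ℝ≥0, essSup (fun x => (ζ.oo x : ℝ≥0∞)) N.vol < r →
          ∀ᵐ x ∂N.vol, N.time x < t → ∀ μ ν : Ind,
            Noise.ScaleBounded r (Noise.matU L x μ ν) ∧
            Noise.ScaleBounded r (Noise.matG L x μ ν) ∧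
            Noise.FormalAdjoint r (Noise.matU L x μ ν) (Noise.matUadj L x ν μ) ∧
            Noise.FormalAdjoint r (Noise.matG L x μ ν) (Noise.matGadj L x ν μ)) ∧
        (∀ᵐ x ∂N.vol, ∀ (μ ν : Ind) (ξ' : ℝ≥0), 0 < ξ' →
          ∀ b : N.Vec H (ν.pts x), Noise.MemG ξ' b →
            (μ ≠ .plus → ν ≠ .minus →
              Noise.MultConverges (μ.pts x) (N.time x) B (Table.elem x μ ν) b) ∧
            Noise.AEq (Noise.matD B x μ ν b)
              ((Noise.matG L x - Noise.matU L x) μ ν b)) ∧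
        -- the differentials of `U`, `U*` and `U* U`
        (∀ (t ξ' : ℝ≥0), 0 < ξ' → ∀ a : N.Vec H ∅, Noise.MemG ξ' a →
          (Noise.SingleConverges t (fun x => Noise.matD B x) a ∧
            Noise.AEq (Noise.fock (T t) a)
              (Noise.fock (T 0) a + Noise.singleInt t (fun x => Noise.matD B x) a)) ∧
          (Noise.SingleConverges t (fun x => Noise.matGstar L x - Noise.matUstar L x) a ∧
            Noise.AEq (Noise.fock (Noise.star (T t)) a)
              (Noise.fock (Noise.star (T 0)) a +
                Noise.singleInt t (fun x => Noise.matGstar L x - Noise.matUstar L x) a)) ∧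
          (Noise.SingleConverges t
              (fun x => Noise.matMul (Noise.matUstar L x) (Noise.matD B x) +
                Noise.matMul (Noise.matGstar L x - Noise.matUstar L x) (Noise.matU L x) +
                Noise.matMul (Noise.matGstar L x - Noise.matUstar L x) (Noise.matD B x)) a ∧
            Noise.AEq (Noise.fock (Noise.star (T t)) (Noise.fock (T t) a))
              (Noise.fock (Noise.star (T 0)) (Noise.fock (T 0) a) +
                Noise.singleInt t
                  (fun x => Noise.matMul (Noise.matUstar L x) (Noise.matD B x) +
                    Noise.matMul (Noise.matGstar L x - Noise.matUstar L x) (Noise.matU L x) +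
                    Noise.matMul (Noise.matGstar L x - Noise.matUstar L x) (Noise.matD B x))
                  a)) ∧
          (Noise.SingleConverges t
              (fun x => Noise.matMul (Noise.matGstar L x) (Noise.matG L x) -
                Noise.matMul (Noise.matUstar L x) (Noise.matU L x)) a ∧
            Noise.AEq (Noise.fock (Noise.star (T t)) (Noise.fock (T t) a))
              (Noise.fock (Noise.star (T 0)) (Noise.fock (T 0) a) +
                Noise.singleInt t
                  (fun x => Noise.matMul (Noise.matGstar L x) (Noise.matG L x) -
                    Noise.matMul (Noise.matUstar L x) (Noise.matU L x)) a)))) := by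
  open Noise in
  refine ⟨fun T ζ hm hζ hT r hr => fock_facts hm hζ hT hr, unitalStarAlgebra,
    fun ζ ζ' hζ hζ' => ⟨ζ.add ζ', hζ.add hζ', fun T =>
      ⟨relNorm_antitone (fun x => ?_) T, relNorm_antitone (fun x => ?_) T⟩⟩,
    fun ζ S T z _ => ⟨relNorm_add_le ζ S T, relNorm_smul ζ z T,
      relNorm_eq_zero_iff⟩, fun ζ T _ _ => le_antisymm (relNorm_star_le ζ T) ?_,
    fun ζ ξ T _ _ h => relNorm_star_mul_le T h,
    fun S T hS hT ξ hξ a ha => fock_representation hS hT hξ ha, ?_⟩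
  · exact ⟨le_self_add, le_self_add, le_self_add, le_self_add⟩
  · exact ⟨le_add_self, le_add_self, le_add_self, le_add_self⟩
  · have e : star (star T) = T :=
      funext fun ϰ => adjoint_adjoint (T ϰ)
    have h := relNorm_star_le ζ.conj (star T)
    rwa [e] at h
  intro L ξ lam c hL hξ hlam hb B hB T hT
  subst hB hT
  have hm := measFamily_iff.mp hL
  have hb := bdd₂_hatL hb
  have hF := fun t => stepFamily_nstep hm hb t
  have hw := fun t => (hlam t).cutWeight.add hξ
  have hbt : ∀ t, N.Bdd c ((N.cutWeight t lam).add ξ) (hatF (multSum (Iio t) L)) :=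
    fun t => hatF_multSum (Iio t) L ▸ (hF t).bdd_of_subset le_rfl
  have hrel : ∀ t, N.NRel (hatF (multSum (Iio t) L)) := fun t =>
    ⟨hatF_multSum (Iio t) L ▸ (hF t).opMeas t, c, _, hw t, hbt t⟩
  refine ⟨fun r hr => scaleBounded_family hm hξ hb hr,
    fun t => relBounded_iff.mpr (hrel t),
    fun t ζ h => relNorm_le_iff.mpr ((hbt t).mono (leAt_of_le h)),
    fun t ξ' hξ' a ha => multInt_eq_fock hm hξ hlam hb t hξ' ha,
    fun s t ϰ hst h => multSum_Iic_eq L hst h,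
    fun t ζ hζ h r hr => ae_matrices hm hb hζ (leAt_of_le h) hr,
    ae_matD_eq hm hξ hlam hb, fun t ξ' hξ' a ha => ?_⟩
  have hi := inScale_of_memG hξ' ha
  have v : ∀ s, hatV (fock (multSum (Iio s) L) a) =
      N.nfock (N.nstep (hatL L) (Iio s)) (hatV a) := fun s => by
    rw [hatV_fock, hatF_multSum]
  have vs : ∀ s, hatV (fock (star (multSum (Iio s) L)) a) =
      N.nfock (nstar (N.nstep (hatL L) (Iio s))) (hatV a) := fun s => by
    rw [hatV_fock, hatF_star, hatF_multSum]
  have vm : ∀ s, hatV (fock (star (multSum (Iio s) L))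
      (fock (multSum (Iio s) L) a)) =ᵐ[N.chainMeasure]
      N.nfock (nmul (nstar (N.nstep (hatL L) (Iio s)))
        (N.nstep (hatL L) (Iio s))) (hatV a) := fun s => by
    have h := (nrel_star (hrel s)).nfock_nfock (hrel s) hi
    rwa [← hatV_fock, ← hatV_fock, hatF_star, hatF_multSum] at h
  refine ⟨?_, ?_, ?_, ?_⟩
  · exact (hasDifferential_nD hm hlam hξ hb t hi).transfer (represents_matD L)
      (v t).eventuallyEq (v 0).eventuallyEq
  · exact ((hF t).star.hasDifferential_sub (hw t).conj hi).transfer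
      (fun x => (represents_matGstar L x).sub (represents_matUstar L x))
      (vs t).eventuallyEq (vs 0).eventuallyEq
  · exact ((hF t).star.hasDifferential_ito (hw t).conj hm hlam hξ hb hi).transfer
      (fun x => (((represents_matUstar L x).matMul (represents_matD L x)).add
        (((represents_matGstar L x).sub (represents_matUstar L x)).matMul
          (represents_matU L x))).add
        (((represents_matGstar L x).sub (represents_matUstar L x)).matMul
          (represents_matD L x))) (vm t) (vm 0)
  · exact ((hF t).star.hasDifferential_nmul (hF t) (hw t).conj (hw t) hi).transfer
      (fun x => ((represents_matGstar L x).matMul (represents_matG L x)).sub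
        ((represents_matUstar L x).matMul (represents_matU L x))) (vm t) (vm 0)
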